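/- All vector spaces, coalgebras and tensor products are over $\mathbb{C}$; $\Delta(c)=c_{1}\otimes c_{2}$ and $\varepsilon$ denote comultiplication and counit. For a right $C$-comodule $X$, with coaction $x\mapsto x_0\otimes x_1$, and a left $C$-comodule $Y$, with coaction $y\mapsto y_{-1}\otimes y_0$, let $X\square_C Y\subseteq X\otimes Y$ be the kernel of $x\otimes y\mapsto x_0\otimes x_1\otimes y-x\otimes y_{-1}\otimes y_0$. Elements of cotensor products are written as if they were simple tensors. **Bicoalgebroids.** Let $C,\mathcal K$ be coalgebras and let $\alpha:\mathcal K\to C$, $\beta:\mathcal K\to C_{\rm cop}$ be coalgebra maps with $\alpha(h_1)\otimes\beta(h_2)=\alpha(h_2)\otimes\beta(h_1)$. * A *left bicoalgebroid* structure on $\mathcal K$ over $C$ consists of $C$-bicolinear maps $\mu:\mathcal K\square_C\mathcal K\to\mathcal K$ (written $gh$) and $\eta:C\to\mathcal K$, where $\mathcal K$ is a $C$-bicomodule by $h\mapsto\alpha(h_1)\otimes h_2$ and $h\mapsto h_2\otimes\beta(h_1)$, such that $\mu$ is associative, $\eta(\alpha(h_1))h_2=h=h_2\,\eta(\beta(h_1))$,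 $gh_1\otimes\alpha(h_2)=g_1h\otimes\beta(g_2)$, $\Delta(gh)=g_1h_1\otimes g_2h_2$, $\varepsilon(gh)=\varepsilon(g)\varepsilon(h)$, $\Delta(\eta(c))=\eta(c)_1\otimes\eta(\alpha(\eta(c)_2))=\eta(c)_1\otimes\eta(\beta(\eta(c)_2))$ and $\varepsilon(\eta(c))=\varepsilon(c)$. It is a *left $\times_C$-Hopf coalgebra* if $\nu:\mathcal K\square_C\mathcal K\to\mathcal K\square_{C_{\rm cop}}\mathcal K$, $k\otimes k'\mapsto kk'_1\otimes k'_2$, is bijective; in the codomain the coactions are $k\mapsto k_1\otimes\beta(k_2)$ and $k\mapsto\beta(k_1)\otimes k_2$. Write $\nu^{-1}(k\otimes k')=\nu^-(k,k')\otimes\nu^+(k,k')$. * A *right bicoalgebroid* $\mathcal B$ over $C$ is defined likewise, with the $C$-bicomodule structure $b\mapsto\beta(b_2)\otimes b_1$, $b\mapsto b_1\otimes\alpha(b_2)$ on $\mathcal B$, and with $\eta(\beta(b_2))b_1=b=b_1\eta(\alpha(b_2))$, $bb'_2\otimes\beta(b'_1)=b_2b'\otimes\alpha(b_1)$ and $\Delta(\eta(c))=\eta(\alpha(\eta(c)_1))\otimes\eta(c)_2=\eta(\beta(\eta(c)_1))\otimes\eta(c)_2$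 in place of the corresponding axioms. It is a *right $\times_C$-Hopf coalgebra* if $\nu:\mathcal B\square_C\mathcal B\to\mathcal B\square_{C_{\rm cop}}\mathcal B$, $b\otimes b'\mapsto b_1\otimes b_2b'$, is bijective (same $C_{\rm cop}$-coactions); again $\nu^{-1}(b\otimes b')=\nu^-(b,b')\otimes\nu^+(b,b')$. **Modules.** A left module over a left bicoalgebroid $\mathcal K$ is a left $C$-comodule $M$ with an associative and unital left $C$-colinear action $\mathcal K\square_C M\to M$, $k\otimes m\mapsto k\triangleright m$ (so $(k\triangleright m)_{-1}\otimes(k\triangleright m)_0=\alpha(k_1)\otimes k_2\triangleright m$); it carries the canonical right $C$-coaction $m\mapsto\eta(m_{-1})_1\triangleright m_0\otimes\alpha(\eta(m_{-1})_2)$. A right module over a right bicoalgebroid $\mathcal B$ is a right $C$-comodule $M$ with an associative and unital right $C$-colinear action $M\square_C\mathcal B\to M$; it carries the canonical left $C$-coaction $m\mapsto\alpha(\eta(m_1)_1)\otimes m_0\triangleleft\eta(m_1)_2$. **SAYD modules.** A *left-right SAYD module* over a left $\times_C$-Hopf coalgebra $\mathcal K$ is a left $\mathcal K$-module and right $\mathcal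 K$-comodule $M$, $m\mapsto m_{\langle0\rangle}\otimes m_{\langle1\rangle}$, such that the left $C$-coaction of the module $M$ is $m\mapsto\beta(m_{\langle1\rangle})\otimes m_{\langle0\rangle}$, the canonical right $C$-coaction is $m\mapsto m_{\langle0\rangle}\otimes\alpha(m_{\langle1\rangle})$, $$(k\triangleright m)_{\langle0\rangle}\otimes(k\triangleright m)_{\langle1\rangle}=\nu^+(m_{\langle1\rangle},k_1)\triangleright m_{\langle0\rangle}\otimes k_2\,\nu^-(m_{\langle1\rangle},k_1)\qquad(k\otimes m\in\mathcal K\square_CM),$$ and $m_{\langle1\rangle}\triangleright m_{\langle0\rangle}=m$. A *right-left SAYD module* over a right $\times_C$-Hopf coalgebra $\mathcal B$ is a right $\mathcal B$-module and left $\mathcal B$-comodule $M$ such that the right $C$-coaction of the module $M$ is $m\mapsto m_{\langle0\rangle}\otimes\beta(m_{\langle-1\rangle})$, the canonical left $C$-coaction is $m\mapsto\alpha(m_{\langle-1\rangle})\otimes m_{\langle0\rangle}$, $$(m\triangleleft b)_{\langle-1\rangle}\otimes(m\triangleleft b)_{\langle0\rangle}=\nu^+(b_2,m_{\langle-1\rangle})\,b_1\otimes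 m_{\langle0\rangle}\triangleleft\nu^-(b_2,m_{\langle-1\rangle})\qquad(m\otimes b\in M\square_C\mathcal B),$$ and $m_{\langle0\rangle}\triangleleft m_{\langle-1\rangle}=m$. Morphisms in the categories ${}_{\mathcal K}SAYD^{\mathcal K}$ and ${}^{\mathcal B}SAYD_{\mathcal B}$ are the linear maps that are linear and colinear over $\mathcal K$, respectively over $\mathcal B$ (in particular colinear over the base coalgebra). **Equivariant Galois coextensions.** Let $\mathcal B$ be a right $\times_C$-Hopf coalgebra and let $T$ be a right $\mathcal B$-module coalgebra: a coalgebra and right $\mathcal B$-module with $(t_1)_0\otimes(t_1)_1\otimes t_2=t_1\otimes(t_2)_{-1}\otimes(t_2)_0$ (the right and the canonical left $C$-coaction), $\varepsilon(t\triangleleft b)=\varepsilon(t)\varepsilon(b)$ and $\Delta(t\triangleleft b)=t_1\triangleleft b_1\otimes t_2\triangleleft b_2$ for $t\otimes b\in T\square_C\mathcal B$. Let $I=\{t\triangleleft b-\varepsilon(b)t : t\otimes b\in T\square_C\mathcal B\}$, a coideal, and $\pi:T\to S=T/I$. Then $T$ is an $S$-bicomodule by $t\mapsto\pi(t_1)\otimes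 t_2$ and $t\mapsto t_1\otimes\pi(t_2)$. Let $\mathcal K$ be a left $\times_S$-Hopf coalgebra and let $T$ be a left $\mathcal K$-comodule coalgebra, $t\mapsto t_{\langle-1\rangle}\otimes t_{\langle0\rangle}$: a left $\mathcal K$-comodule with $t_{\langle-1\rangle}\varepsilon(t_{\langle0\rangle})=\eta(\alpha(t_{\langle-1\rangle}))\varepsilon(t_{\langle0\rangle})$, $t_{\langle-1\rangle}\otimes\Delta(t_{\langle0\rangle})=(t_1)_{\langle-1\rangle}(t_2)_{\langle-1\rangle}\otimes(t_1)_{\langle0\rangle}\otimes(t_2)_{\langle0\rangle}$ and $\beta((t_1)_{\langle-1\rangle})\otimes(t_1)_{\langle0\rangle}\otimes t_2=\alpha((t_2)_{\langle-1\rangle})\otimes t_1\otimes(t_2)_{\langle0\rangle}$. Then $T$ is a *$\mathcal K$-equivariant $\mathcal B$-Galois coextension* of $S$ if the $S$-bicomodule structure $t\mapsto\alpha(t_{\langle-1\rangle})\otimes t_{\langle0\rangle}$, $t\mapsto t_{\langle0\rangle}\otimes\beta(t_{\langle-1\rangle})$ of the $\mathcal K$-comodule $T$ is the above one, the $\mathcal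 K$-coaction is right $C$-colinear, $(t\triangleleft b)_{\langle-1\rangle}\otimes(t\triangleleft b)_{\langle0\rangle}=t_{\langle-1\rangle}\otimes t_{\langle0\rangle}\triangleleft b$ on $T\square_C\mathcal B$, and $$can:T\square_C\mathcal B\to T\square_ST,\qquad t\otimes b\mapsto t_1\otimes t_2\triangleleft b,$$ is bijective. Put $\kappa=(\varepsilon\otimes{\rm Id})\circ can^{-1}:T\square_ST\to\mathcal B$. **Proposition.** Let $T$ be a $\mathcal K$-equivariant $\mathcal B$-Galois coextension of $S$. For every left-right SAYD module $M$ over $\mathcal K$, the vector space $\widetilde M=M\square_{\mathcal K}T$ is a right-left SAYD module over $\mathcal B$ with the right $C$-coaction $m\otimes t\mapsto m\otimes t_0\otimes t_1$, the right action $$(m\otimes t)\triangleleft b=m\otimes t\triangleleft b,$$ and the left coaction $$m\otimes t\mapsto\kappa\big(((t_2)_{\langle0\rangle})_2\otimes t_1\big)\otimes\big((t_2)_{\langle-1\rangle}\triangleright m\otimes((t_2)_{\langle0\rangle})_1\big).$$ For every morphism $\varphi:M\to N$ of left-right SAYD modules over $\mathcal K$, the map $\varphi\otimes{\rm Id}_T$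 restricts to a morphism $\varphi\,\square_{\mathcal K}{\rm Id}_T:\widetilde M\to\widetilde N$ of right-left SAYD modules over $\mathcal B$. The assignment $M\mapsto M\square_{\mathcal K}T$, $\varphi\mapsto\varphi\,\square_{\mathcal K}{\rm Id}_T$ is a covariant functor ${}_{\mathcal K}SAYD^{\mathcal K}\to{}^{\mathcal B}SAYD_{\mathcal B}$. -/

import Mathlib

open scoped TensorProduct
open CategoryTheory

universe u₁ u₂ u₃ u₄ v

noncomputable section

/-! ### Partially defined linear maps -/

section Extension

variable {V W : Type*} [AddCommGroup V] [Module ℂ V] [AddCommGroup W] [Module ℂ W]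

/-- A linear extension to the whole space of a linear map `f` that is defined on a subspace.
It serves to write formulas such as `(f ⊗ id)(z)` for a map `f` defined on a cotensor product.
Below it is only evaluated (one factor after the other, if several extensions are tensored) on
elements of `domain ⊗ anything`, where the value does not depend on the choice of the extension. -/
def linExt {p : Submodule ℂ V} (f : p →ₗ[ℂ] W) : V →ₗ[ℂ] W :=
  (LinearMap.exists_extend f).choose

theorem linExt_comp_subtype {p : Submodule ℂ V} (f : p →ₗ[ℂ] W) :
    linExt f ∘ₗ p.subtype = f :=
  (LinearMap.exists_extend f).choose_spec

theorem linExt_apply {p : Submodule ℂ V} (f : p →ₗ[ℂ] W) (x : p) : linExt f (x : V) = f x :=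
  LinearMap.congr_fun (linExt_comp_subtype f) x

/-- The inverse `q → p` of a linear map that restricts to a bijection of the subspace `p` onto the
subspace `q`, written as a map on the whole space through `linExt`. -/
def invOn {p : Submodule ℂ V} {q : Submodule ℂ W} (f : V →ₗ[ℂ] W) (h : Set.BijOn f p q) :
    W →ₗ[ℂ] V :=
  linExt (p.subtype ∘ₗ
    (LinearEquiv.ofBijective (f.restrict (p := p) (q := q) (fun _ hx => h.mapsTo hx))
      ⟨fun x y hxy => Subtype.ext (h.injOn x.2 y.2 (congrArg Subtype.val hxy)),
        fun y => by
          obtain ⟨x, hx, hxy⟩ := h.surjOn y.2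
          exact ⟨⟨x, hx⟩, Subtype.ext hxy⟩⟩).symm.toLinearMap)

theorem invOn_apply {p : Submodule ℂ V} {q : Submodule ℂ W} (f : V →ₗ[ℂ] W)
    (h : Set.BijOn f p q) {x : V} (hx : x ∈ p) : invOn f h (f x) = x := by
  have hq : f x ∈ q := h.mapsTo hx
  refine (linExt_apply _ ⟨f x, hq⟩).trans ?_
  rw [LinearMap.comp_apply, LinearEquiv.coe_coe]
  refine congrArg Subtype.val (a₂ := (⟨x, hx⟩ : p)) ?_
  rw [LinearEquiv.symm_apply_eq]
  rfl

end Extension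

/-! ### Comodules and cotensor products -/

section Cotensor

variable {C D X Y Z : Type*}
  [AddCommGroup C] [Module ℂ C] [AddCommGroup D] [Module ℂ D] [AddCommGroup X] [Module ℂ X]
  [AddCommGroup Y] [Module ℂ Y] [AddCommGroup Z] [Module ℂ Z]

/-- `x ↦ x₀ ⊗ x₁` is a coassociative and counital right coaction. -/
structure IsRightCoaction [Coalgebra ℂ C] (r : X →ₗ[ℂ] X ⊗[ℂ] C) : Prop where
  coassoc : ∀ x, TensorProduct.assoc ℂ X C C (r.rTensor C (r x)) =
    (Coalgebra.comul (R := ℂ) (A := C)).lTensor X (r x)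
  counit : ∀ x, (Coalgebra.counit (R := ℂ) (A := C)).lTensor X (r x) = x ⊗ₜ 1

/-- `x ↦ x₋₁ ⊗ x₀` is a coassociative and counital left coaction. -/
structure IsLeftCoaction [Coalgebra ℂ C] (l : X →ₗ[ℂ] C ⊗[ℂ] X) : Prop where
  coassoc : ∀ x, TensorProduct.assoc ℂ C C X
    ((Coalgebra.comul (R := ℂ) (A := C)).rTensor X (l x)) = l.lTensor C (l x)
  counit : ∀ x, (Coalgebra.counit (R := ℂ) (A := C)).rTensor X (l x) = 1 ⊗ₜ x

/-- `x ⊗ y ↦ x₀ ⊗ x₁ ⊗ y - x ⊗ y₋₁ ⊗ y₀`. -/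
def cotensorDiff (r : X →ₗ[ℂ] X ⊗[ℂ] C) (l : Y →ₗ[ℂ] C ⊗[ℂ] Y) :
    X ⊗[ℂ] Y →ₗ[ℂ] X ⊗[ℂ] (C ⊗[ℂ] Y) :=
  (TensorProduct.assoc ℂ X C Y).toLinearMap ∘ₗ r.rTensor Y - l.lTensor X

/-- The cotensor product `X □_C Y` of a right and a left comodule, as a subspace of `X ⊗ Y`. -/
def cotensor (r : X →ₗ[ℂ] X ⊗[ℂ] C) (l : Y →ₗ[ℂ] C ⊗[ℂ] Y) : Submodule ℂ (X ⊗[ℂ] Y) :=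
  LinearMap.ker (cotensorDiff r l)

/-- The cotensor product `X □_C Y □_D Z`, as a subspace of `(X ⊗ Y) ⊗ Z`. -/
def cotensor₃ (rX : X →ₗ[ℂ] X ⊗[ℂ] C) (lY : Y →ₗ[ℂ] C ⊗[ℂ] Y)
    (rY : Y →ₗ[ℂ] Y ⊗[ℂ] D) (lZ : Z →ₗ[ℂ] D ⊗[ℂ] Z) : Submodule ℂ ((X ⊗[ℂ] Y) ⊗[ℂ] Z) :=
  LinearMap.ker ((cotensorDiff rX lY).rTensor Z) ⊓
    LinearMap.ker ((cotensorDiff rY lZ).lTensor X ∘ₗ (TensorProduct.assoc ℂ X Y Z).toLinearMap)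

end Cotensor

/-! ### Bicoalgebroids and `×`-Hopf coalgebras -/

section Bicoalgebroid

/-- The source and target maps of a bicoalgebroid: a coalgebra map `α : B → C` and a coalgebra map
`β : B → C_cop` (that is, an anti-coalgebra map `B → C`), whose images cocommute. -/
structure SourceTarget (C : Type u₁) (B : Type u₂) [AddCommGroup C] [Module ℂ C] [Coalgebra ℂ C]
    [AddCommGroup B] [Module ℂ B] [Coalgebra ℂ B] where
  α : B →ₗ[ℂ] C
  β : B →ₗ[ℂ] C
  counit_α : ∀ b, Coalgebra.counit (R := ℂ) (α b) = Coalgebra.counit (R := ℂ) b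
  comul_α : ∀ b, Coalgebra.comul (R := ℂ) (α b) =
    TensorProduct.map α α (Coalgebra.comul (R := ℂ) b)
  counit_β : ∀ b, Coalgebra.counit (R := ℂ) (β b) = Coalgebra.counit (R := ℂ) b
  comul_β : ∀ b, Coalgebra.comul (R := ℂ) (β b) =
    TensorProduct.map β β (TensorProduct.comm ℂ B B (Coalgebra.comul (R := ℂ) b))
  /-- `α(b₁) ⊗ β(b₂) = α(b₂) ⊗ β(b₁)` -/
  cocommute : ∀ b, TensorProduct.map α β (Coalgebra.comul (R := ℂ) b) =
    TensorProduct.map α β (TensorProduct.comm ℂ B B (Coalgebra.comul (R := ℂ) b))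

variable {C : Type u₁} {B : Type u₂} [AddCommGroup C] [Module ℂ C] [Coalgebra ℂ C]
  [AddCommGroup B] [Module ℂ B] [Coalgebra ℂ B]

namespace SourceTarget

variable (s : SourceTarget C B)

/-- `b ↦ α(b₁) ⊗ b₂` -/
def αL : B →ₗ[ℂ] C ⊗[ℂ] B := s.α.rTensor B ∘ₗ Coalgebra.comul

/-- `b ↦ b₁ ⊗ α(b₂)` -/
def αR : B →ₗ[ℂ] B ⊗[ℂ] C := s.α.lTensor B ∘ₗ Coalgebra.comul

/-- `b ↦ β(b₂) ⊗ b₁` -/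
def βL : B →ₗ[ℂ] C ⊗[ℂ] B :=
  s.β.rTensor B ∘ₗ (TensorProduct.comm ℂ B B).toLinearMap ∘ₗ Coalgebra.comul

/-- `b ↦ b₂ ⊗ β(b₁)` -/
def βR : B →ₗ[ℂ] B ⊗[ℂ] C :=
  s.β.lTensor B ∘ₗ (TensorProduct.comm ℂ B B).toLinearMap ∘ₗ Coalgebra.comul

/-- The left `C_cop`-coaction `b ↦ β(b₁) ⊗ b₂`. -/
def copL : B →ₗ[ℂ] C ⊗[ℂ] B := s.β.rTensor B ∘ₗ Coalgebra.comul

/-- The right `C_cop`-coaction `b ↦ b₁ ⊗ β(b₂)`. -/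
def copR : B →ₗ[ℂ] B ⊗[ℂ] C := s.β.lTensor B ∘ₗ Coalgebra.comul

/-- `B □_{C_cop} B`, the codomain of the Galois map of a left or right `×_C`-Hopf coalgebra. -/
def copCotensor : Submodule ℂ (B ⊗[ℂ] B) := cotensor s.copR s.copL

end SourceTarget

/-- A left bicoalgebroid `K` over the coalgebra `C`. Here `K` is a `C`-bicomodule through
`h ↦ α(h₁) ⊗ h₂` and `h ↦ h₂ ⊗ β(h₁)`. -/
structure LeftBicoalgebroid (C : Type u₁) (K : Type u₂) [AddCommGroup C] [Module ℂ C]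
    [Coalgebra ℂ C] [AddCommGroup K] [Module ℂ K] [Coalgebra ℂ K] extends SourceTarget C K where
  /-- the multiplication `K □_C K → K` -/
  μ : cotensor toSourceTarget.βR toSourceTarget.αL →ₗ[ℂ] K
  /-- the unit map -/
  η : C →ₗ[ℂ] K
  /-- `μ` is a map of `C`-bicomodules -/
  μ_colinear_left : ∀ w, toSourceTarget.αL (μ w) =
    (linExt μ).lTensor C (TensorProduct.assoc ℂ C K K (toSourceTarget.αL.rTensor K (w : K ⊗[ℂ] K)))
  μ_colinear_right : ∀ w, toSourceTarget.βR (μ w) =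
    (linExt μ).rTensor C
      ((TensorProduct.assoc ℂ K K C).symm (toSourceTarget.βR.lTensor K (w : K ⊗[ℂ] K)))
  /-- `η` is a map of `C`-bicomodules -/
  η_colinear_left : ∀ c, toSourceTarget.αL (η c) = η.lTensor C (Coalgebra.comul (R := ℂ) c)
  η_colinear_right : ∀ c, toSourceTarget.βR (η c) = η.rTensor C (Coalgebra.comul (R := ℂ) c)
  μ_assoc : ∀ w ∈ cotensor₃ toSourceTarget.βR toSourceTarget.αL
      toSourceTarget.βR toSourceTarget.αL,
    linExt μ ((linExt μ).rTensor K w) =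
      linExt μ ((linExt μ).lTensor K (TensorProduct.assoc ℂ K K K w))
  /-- `(g h₁) ⊗ α(h₂) = (g₁ h) ⊗ β(g₂)` -/
  takeuchi : ∀ w : cotensor toSourceTarget.βR toSourceTarget.αL,
    TensorProduct.map (linExt μ) toSourceTarget.α ((TensorProduct.assoc ℂ K K K).symm
        ((Coalgebra.comul (R := ℂ) (A := K)).lTensor K (w : K ⊗[ℂ] K))) =
      TensorProduct.map (linExt μ) toSourceTarget.β (TensorProduct.rightComm ℂ K K K
        ((Coalgebra.comul (R := ℂ) (A := K)).rTensor K (w : K ⊗[ℂ] K)))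
  /-- `Δ(g h) = g₁ h₁ ⊗ g₂ h₂` -/
  comul_μ : ∀ w, Coalgebra.comul (R := ℂ) (μ w) =
    TensorProduct.map (linExt μ) (linExt μ) (TensorProduct.tensorTensorTensorComm ℂ K K K K
      (TensorProduct.map (Coalgebra.comul (R := ℂ) (A := K)) (Coalgebra.comul (R := ℂ) (A := K))
        (w : K ⊗[ℂ] K)))
  /-- `ε(g h) = ε(g) ε(h)` -/
  counit_μ : ∀ w, Coalgebra.counit (R := ℂ) (μ w) =
    TensorProduct.lid ℂ ℂ (TensorProduct.map (Coalgebra.counit (R := ℂ) (A := K))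
      (Coalgebra.counit (R := ℂ) (A := K)) (w : K ⊗[ℂ] K))
  η_μ : ∀ h, linExt μ (η.rTensor K (toSourceTarget.αL h)) = h
  μ_η : ∀ h, linExt μ (η.lTensor K (toSourceTarget.βR h)) = h
  /-- `Δ(η(c)) = η(c)₁ ⊗ η(α(η(c)₂))` -/
  comul_η_α : ∀ c, Coalgebra.comul (R := ℂ) (η c) =
    (η ∘ₗ toSourceTarget.α).lTensor K (Coalgebra.comul (R := ℂ) (η c))
  /-- `Δ(η(c)) = η(c)₁ ⊗ η(β(η(c)₂))` -/
  comul_η_β : ∀ c, Coalgebra.comul (R := ℂ) (η c) =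
    (η ∘ₗ toSourceTarget.β).lTensor K (Coalgebra.comul (R := ℂ) (η c))
  counit_η : ∀ c, Coalgebra.counit (R := ℂ) (η c) = Coalgebra.counit (R := ℂ) c

/-- `K □_C K` -/
def LeftBicoalgebroid.square (k : LeftBicoalgebroid C B) : Submodule ℂ (B ⊗[ℂ] B) :=
  cotensor k.βR k.αL

/-- The Galois map `k ⊗ k' ↦ k k'₁ ⊗ k'₂` of a left bicoalgebroid. -/
def LeftBicoalgebroid.galois (k : LeftBicoalgebroid C B) : B ⊗[ℂ] B →ₗ[ℂ] B ⊗[ℂ] B :=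
  (linExt k.μ).rTensor B ∘ₗ (TensorProduct.assoc ℂ B B B).symm.toLinearMap ∘ₗ
    (Coalgebra.comul (R := ℂ) (A := B)).lTensor B

/-- A left `×_C`-Hopf coalgebra: a left bicoalgebroid whose Galois map
`K □_C K → K □_{C_cop} K` is bijective. -/
structure LeftHopfCoalgebra (C : Type u₁) (K : Type u₂) [AddCommGroup C] [Module ℂ C]
    [Coalgebra ℂ C] [AddCommGroup K] [Module ℂ K] [Coalgebra ℂ K]
    extends LeftBicoalgebroid C K where
  galois_bijOn : Set.BijOn toLeftBicoalgebroid.galois toLeftBicoalgebroid.square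
    toLeftBicoalgebroid.copCotensor

/-- The inverse `k ⊗ k' ↦ ν⁻(k, k') ⊗ ν⁺(k, k')` of the Galois map. -/
def LeftHopfCoalgebra.νInv (k : LeftHopfCoalgebra C B) : B ⊗[ℂ] B →ₗ[ℂ] B ⊗[ℂ] B :=
  invOn k.galois k.galois_bijOn

/-- A right bicoalgebroid `B` over the coalgebra `C`. Here `B` is a `C`-bicomodule through
`b ↦ β(b₂) ⊗ b₁` and `b ↦ b₁ ⊗ α(b₂)`. -/
structure RightBicoalgebroid (C : Type u₁) (B : Type u₂) [AddCommGroup C] [Module ℂ C]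
    [Coalgebra ℂ C] [AddCommGroup B] [Module ℂ B] [Coalgebra ℂ B] extends SourceTarget C B where
  /-- the multiplication `B □_C B → B` -/
  μ : cotensor toSourceTarget.αR toSourceTarget.βL →ₗ[ℂ] B
  /-- the unit map -/
  η : C →ₗ[ℂ] B
  /-- `μ` is a map of `C`-bicomodules -/
  μ_colinear_left : ∀ w, toSourceTarget.βL (μ w) =
    (linExt μ).lTensor C (TensorProduct.assoc ℂ C B B (toSourceTarget.βL.rTensor B (w : B ⊗[ℂ] B)))
  μ_colinear_right : ∀ w, toSourceTarget.αR (μ w) =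
    (linExt μ).rTensor C
      ((TensorProduct.assoc ℂ B B C).symm (toSourceTarget.αR.lTensor B (w : B ⊗[ℂ] B)))
  /-- `η` is a map of `C`-bicomodules -/
  η_colinear_left : ∀ c, toSourceTarget.βL (η c) = η.lTensor C (Coalgebra.comul (R := ℂ) c)
  η_colinear_right : ∀ c, toSourceTarget.αR (η c) = η.rTensor C (Coalgebra.comul (R := ℂ) c)
  μ_assoc : ∀ w ∈ cotensor₃ toSourceTarget.αR toSourceTarget.βL
      toSourceTarget.αR toSourceTarget.βL,
    linExt μ ((linExt μ).rTensor B w) =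
      linExt μ ((linExt μ).lTensor B (TensorProduct.assoc ℂ B B B w))
  /-- `(b b'₂) ⊗ β(b'₁) = (b₂ b') ⊗ α(b₁)` -/
  takeuchi : ∀ w : cotensor toSourceTarget.αR toSourceTarget.βL,
    TensorProduct.map (linExt μ) toSourceTarget.β ((TensorProduct.assoc ℂ B B B).symm
        (((TensorProduct.comm ℂ B B).toLinearMap ∘ₗ Coalgebra.comul).lTensor B
          (w : B ⊗[ℂ] B))) =
      TensorProduct.map (linExt μ) toSourceTarget.α (TensorProduct.rightComm ℂ B B B
        (((TensorProduct.comm ℂ B B).toLinearMap ∘ₗ Coalgebra.comul).rTensor B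
          (w : B ⊗[ℂ] B)))
  /-- `Δ(b b') = b₁ b'₁ ⊗ b₂ b'₂` -/
  comul_μ : ∀ w, Coalgebra.comul (R := ℂ) (μ w) =
    TensorProduct.map (linExt μ) (linExt μ) (TensorProduct.tensorTensorTensorComm ℂ B B B B
      (TensorProduct.map (Coalgebra.comul (R := ℂ) (A := B)) (Coalgebra.comul (R := ℂ) (A := B))
        (w : B ⊗[ℂ] B)))
  /-- `ε(b b') = ε(b) ε(b')` -/
  counit_μ : ∀ w, Coalgebra.counit (R := ℂ) (μ w) =
    TensorProduct.lid ℂ ℂ (TensorProduct.map (Coalgebra.counit (R := ℂ) (A := B))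
      (Coalgebra.counit (R := ℂ) (A := B)) (w : B ⊗[ℂ] B))
  η_μ : ∀ b, linExt μ (η.rTensor B (toSourceTarget.βL b)) = b
  μ_η : ∀ b, linExt μ (η.lTensor B (toSourceTarget.αR b)) = b
  /-- `Δ(η(c)) = η(α(η(c)₁)) ⊗ η(c)₂` -/
  comul_η_α : ∀ c, Coalgebra.comul (R := ℂ) (η c) =
    (η ∘ₗ toSourceTarget.α).rTensor B (Coalgebra.comul (R := ℂ) (η c))
  /-- `Δ(η(c)) = η(β(η(c)₁)) ⊗ η(c)₂` -/
  comul_η_β : ∀ c, Coalgebra.comul (R := ℂ) (η c) =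
    (η ∘ₗ toSourceTarget.β).rTensor B (Coalgebra.comul (R := ℂ) (η c))
  counit_η : ∀ c, Coalgebra.counit (R := ℂ) (η c) = Coalgebra.counit (R := ℂ) c

/-- `B □_C B` -/
def RightBicoalgebroid.square (b : RightBicoalgebroid C B) : Submodule ℂ (B ⊗[ℂ] B) :=
  cotensor b.αR b.βL

/-- The Galois map `b ⊗ b' ↦ b₁ ⊗ b₂ b'` of a right bicoalgebroid. -/
def RightBicoalgebroid.galois (b : RightBicoalgebroid C B) : B ⊗[ℂ] B →ₗ[ℂ] B ⊗[ℂ] B :=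
  (linExt b.μ).lTensor B ∘ₗ (TensorProduct.assoc ℂ B B B).toLinearMap ∘ₗ
    (Coalgebra.comul (R := ℂ) (A := B)).rTensor B

/-- A right `×_C`-Hopf coalgebra: a right bicoalgebroid whose Galois map
`B □_C B → B □_{C_cop} B` is bijective. -/
structure RightHopfCoalgebra (C : Type u₁) (B : Type u₂) [AddCommGroup C] [Module ℂ C]
    [Coalgebra ℂ C] [AddCommGroup B] [Module ℂ B] [Coalgebra ℂ B]
    extends RightBicoalgebroid C B where
  galois_bijOn : Set.BijOn toRightBicoalgebroid.galois toRightBicoalgebroid.square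
    toRightBicoalgebroid.copCotensor

/-- The inverse `b ⊗ b' ↦ ν⁻(b, b') ⊗ ν⁺(b, b')` of the Galois map. -/
def RightHopfCoalgebra.νInv (b : RightHopfCoalgebra C B) : B ⊗[ℂ] B →ₗ[ℂ] B ⊗[ℂ] B :=
  invOn b.galois b.galois_bijOn

end Bicoalgebroid

/-! ### Left-right stable anti-Yetter-Drinfeld modules -/

section LeftRight

variable {C : Type u₁} {K : Type u₂} [AddCommGroup C] [Module ℂ C] [Coalgebra ℂ C]
  [AddCommGroup K] [Module ℂ K] [Coalgebra ℂ K]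

/-- A left module over a left bicoalgebroid `K`: a left `C`-comodule `M` with an associative and
unital left `C`-colinear action `K □_C M → M`. -/
structure LeftModuleStr (k : LeftBicoalgebroid C K) (M : Type v) [AddCommGroup M]
    [Module ℂ M] where
  baseCoact : M →ₗ[ℂ] C ⊗[ℂ] M
  isLeftCoaction_baseCoact : IsLeftCoaction baseCoact
  act : cotensor k.βR baseCoact →ₗ[ℂ] M
  /-- `(k ▷ m)₋₁ ⊗ (k ▷ m)₀ = α(k₁) ⊗ k₂ ▷ m` -/
  act_colinear : ∀ w, baseCoact (act w) =
    (linExt act).lTensor C (TensorProduct.assoc ℂ C K M (k.αL.rTensor M (w : K ⊗[ℂ] M)))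
  act_assoc : ∀ w ∈ cotensor₃ k.βR k.αL k.βR baseCoact,
    linExt act ((linExt k.μ).rTensor M w) =
      linExt act ((linExt act).lTensor K (TensorProduct.assoc ℂ K K M w))
  act_unit : ∀ m, linExt act (k.η.rTensor M (baseCoact m)) = m

/-- The canonical right `C`-coaction `m ↦ η(m₋₁)₁ ▷ m₀ ⊗ α(η(m₋₁)₂)` of a left module over a left
bicoalgebroid. -/
def LeftModuleStr.canonicalCoact {k : LeftBicoalgebroid C K} {M : Type v} [AddCommGroup M]
    [Module ℂ M] (s : LeftModuleStr k M) : M →ₗ[ℂ] M ⊗[ℂ] C :=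
  TensorProduct.map (linExt s.act) k.α ∘ₗ (TensorProduct.rightComm ℂ K K M).toLinearMap ∘ₗ
    (Coalgebra.comul ∘ₗ k.η).rTensor M ∘ₗ s.baseCoact

/-- A left-right stable anti-Yetter-Drinfeld structure over a left `×_C`-Hopf coalgebra on the
vector space `M`: a left `K`-module and right `K`-comodule structure such that the two underlying
`C`-bicomodule structures agree, with the anti-Yetter-Drinfeld and the stability condition. -/
structure LeftRightSAYDStr (k : LeftHopfCoalgebra C K) (M : Type v) [AddCommGroup M]
    [Module ℂ M] extends LeftModuleStr k.toLeftBicoalgebroid M where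
  coact : M →ₗ[ℂ] M ⊗[ℂ] K
  isRightCoaction_coact : IsRightCoaction coact
  /-- the left `C`-coaction is `m ↦ β(m₁) ⊗ m₀` -/
  baseCoact_eq : ∀ m, baseCoact m = k.β.rTensor M (TensorProduct.comm ℂ M K (coact m))
  /-- the right `C`-coaction `m ↦ m₀ ⊗ α(m₁)` is the canonical one -/
  canonicalCoact_eq : ∀ m, k.α.lTensor M (coact m) = toLeftModuleStr.canonicalCoact m
  /-- `(k ▷ m)₀ ⊗ (k ▷ m)₁ = ν⁺(m₁, k₁) ▷ m₀ ⊗ k₂ ν⁻(m₁, k₁)`. The permutations turn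
  `(k₁ ⊗ k₂) ⊗ (m₀ ⊗ m₁)` into `(m₁ ⊗ k₁) ⊗ (m₀ ⊗ k₂)`, and then `(ν⁻ ⊗ ν⁺) ⊗ (m₀ ⊗ k₂)` into
  `(ν⁺ ⊗ m₀) ⊗ (ν⁻ ⊗ k₂)`. -/
  ayd : ∀ w, coact (act w) =
    TensorProduct.map (linExt act) (linExt k.μ ∘ₗ (TensorProduct.comm ℂ K K).toLinearMap)
      (TensorProduct.tensorTensorTensorComm ℂ K K M K
        (((TensorProduct.comm ℂ K K).toLinearMap ∘ₗ k.νInv).rTensor (M ⊗[ℂ] K)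
          (TensorProduct.map (TensorProduct.comm ℂ K K).toLinearMap
              (TensorProduct.comm ℂ K M).toLinearMap
            (TensorProduct.tensorTensorTensorComm ℂ K K K M
              (TensorProduct.map (Coalgebra.comul (R := ℂ) (A := K))
                ((TensorProduct.comm ℂ M K).toLinearMap ∘ₗ coact) (w : K ⊗[ℂ] M))))))
  /-- `m₁ ▷ m₀ = m` -/
  stable : ∀ m, linExt act (TensorProduct.comm ℂ M K (coact m)) = m

/-- A left-right stable anti-Yetter-Drinfeld module. -/
structure LeftRightSAYD (k : LeftHopfCoalgebra C K) where
  carrier : Type v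
  [addCommGroup : AddCommGroup carrier]
  [module : Module ℂ carrier]
  str : LeftRightSAYDStr k carrier

namespace LeftRightSAYD

attribute [instance] LeftRightSAYD.addCommGroup LeftRightSAYD.module

variable {k : LeftHopfCoalgebra C K}

/-- A `K`-linear and `K`-colinear map. -/
@[ext]
structure Hom (M N : LeftRightSAYD.{u₁, u₂, v} k) where
  toLinearMap : M.carrier →ₗ[ℂ] N.carrier
  map_baseCoact : ∀ m, N.str.baseCoact (toLinearMap m) = toLinearMap.lTensor C (M.str.baseCoact m)
  map_act : ∀ w, toLinearMap (M.str.act w) =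
    linExt N.str.act (toLinearMap.lTensor K (w : K ⊗[ℂ] M.carrier))
  map_coact : ∀ m, N.str.coact (toLinearMap m) = toLinearMap.rTensor K (M.str.coact m)

theorem map_act_lTensor {M N : LeftRightSAYD.{u₁, u₂, v} k} (f : Hom M N)
    (w : K ⊗[ℂ] M.carrier) (hw : w ∈ cotensor k.βR M.str.baseCoact) :
    f.toLinearMap (linExt M.str.act w) =
      linExt N.str.act (f.toLinearMap.lTensor K w) := by
  rw [linExt_apply M.str.act ⟨w, hw⟩]
  exact f.map_act ⟨w, hw⟩

theorem lTensor_mem {M N : LeftRightSAYD.{u₁, u₂, v} k} (f : Hom M N)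
    (w : K ⊗[ℂ] M.carrier) (hw : w ∈ cotensor k.βR M.str.baseCoact) :
    f.toLinearMap.lTensor K w ∈ cotensor k.βR N.str.baseCoact := by
  have h : N.str.baseCoact ∘ₗ f.toLinearMap = f.toLinearMap.lTensor C ∘ₗ M.str.baseCoact :=
    LinearMap.ext f.map_baseCoact
  have h1 : ∀ z : K ⊗[ℂ] M.carrier, cotensorDiff k.βR N.str.baseCoact
      (f.toLinearMap.lTensor K z) =
        (f.toLinearMap.lTensor C).lTensor K (cotensorDiff k.βR M.str.baseCoact z) := by
    intro z
    induction z with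
    | zero => simp
    | add a b ha hb => simp only [map_add, ha, hb]
    | tmul x y =>
      simp only [cotensorDiff, LinearMap.sub_apply, LinearMap.comp_apply, LinearEquiv.coe_coe,
        LinearMap.rTensor_tmul, LinearMap.lTensor_tmul, map_sub, f.map_baseCoact]
      congr 1
      induction k.βR x with
      | zero => simp
      | add a b ha hb => simp only [map_add, TensorProduct.add_tmul, ha, hb]
      | tmul a b => simp
  rw [cotensor, LinearMap.mem_ker] at hw ⊢
  rw [h1, hw, map_zero]

instance : Category (LeftRightSAYD.{u₁, u₂, v} k) where
  Hom := Hom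
  id M :=
    { toLinearMap := LinearMap.id
      map_baseCoact := fun m => by simp
      map_act := fun w => by
        rw [LinearMap.lTensor_id, LinearMap.id_apply, LinearMap.id_apply, linExt_apply]
      map_coact := fun m => by simp }
  comp f g :=
    { toLinearMap := g.toLinearMap ∘ₗ f.toLinearMap
      map_baseCoact := fun m => by
        rw [LinearMap.comp_apply, g.map_baseCoact, f.map_baseCoact, LinearMap.lTensor_comp,
          LinearMap.comp_apply]
      map_act := fun w => by
        rw [LinearMap.comp_apply, f.map_act, map_act_lTensor g _ (lTensor_mem f w w.2),
          LinearMap.lTensor_comp, LinearMap.comp_apply]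
      map_coact := fun m => by
        rw [LinearMap.comp_apply, g.map_coact, f.map_coact, LinearMap.rTensor_comp,
          LinearMap.comp_apply] }

end LeftRightSAYD

end LeftRight

/-! ### Right modules and module coalgebras -/

section Right

variable {C : Type u₁} {B : Type u₂} [AddCommGroup C] [Module ℂ C] [Coalgebra ℂ C]
  [AddCommGroup B] [Module ℂ B] [Coalgebra ℂ B]

/-- A right module over a right bicoalgebroid `B`: a right `C`-comodule `M` with an associative and
unital right `C`-colinear action `M □_C B → M`. -/
structure RightModuleStr (b : RightBicoalgebroid C B) (M : Type v) [AddCommGroup M]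
    [Module ℂ M] where
  baseCoact : M →ₗ[ℂ] M ⊗[ℂ] C
  isRightCoaction_baseCoact : IsRightCoaction baseCoact
  act : cotensor baseCoact b.βL →ₗ[ℂ] M
  /-- `(m ◁ b)₀ ⊗ (m ◁ b)₁ = m ◁ b₁ ⊗ α(b₂)` -/
  act_colinear : ∀ w, baseCoact (act w) =
    (linExt act).rTensor C
      ((TensorProduct.assoc ℂ M B C).symm (b.αR.lTensor M (w : M ⊗[ℂ] B)))
  act_assoc : ∀ w ∈ cotensor₃ baseCoact b.βL b.αR b.βL,
    linExt act ((linExt act).rTensor B w) =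
      linExt act ((linExt b.μ).lTensor M (TensorProduct.assoc ℂ M B B w))
  act_unit : ∀ m, linExt act (b.η.lTensor M (baseCoact m)) = m

/-- The canonical left `C`-coaction `m ↦ α(η(m₁)₁) ⊗ m₀ ◁ η(m₁)₂` of a right module over a right
bicoalgebroid, which makes it a `C`-bicomodule. -/
def RightModuleStr.canonicalCoact {b : RightBicoalgebroid C B} {M : Type v} [AddCommGroup M]
    [Module ℂ M] (s : RightModuleStr b M) : M →ₗ[ℂ] C ⊗[ℂ] M :=
  TensorProduct.map b.α (linExt s.act) ∘ₗ (TensorProduct.leftComm ℂ M B B).toLinearMap ∘ₗ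
    (Coalgebra.comul ∘ₗ b.η).lTensor M ∘ₗ s.baseCoact

/-- A right module coalgebra over a right bicoalgebroid `B`. The `C`-bicomodule structure of `T` is
that of a right `B`-module. -/
structure RightModuleCoalgebra (b : RightBicoalgebroid C B) (T : Type u₃) [AddCommGroup T]
    [Module ℂ T] [Coalgebra ℂ T] extends RightModuleStr b T where
  /-- `(t₁)₀ ⊗ (t₁)₁ ⊗ t₂ = t₁ ⊗ (t₂)₋₁ ⊗ (t₂)₀` -/
  cobalanced : ∀ t, TensorProduct.assoc ℂ T C T
      (baseCoact.rTensor T (Coalgebra.comul (R := ℂ) t)) =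
    toRightModuleStr.canonicalCoact.lTensor T (Coalgebra.comul (R := ℂ) t)
  /-- `ε(t ◁ b) = ε(t) ε(b)` -/
  counit_act : ∀ w, Coalgebra.counit (R := ℂ) (act w) =
    TensorProduct.lid ℂ ℂ (TensorProduct.map (Coalgebra.counit (R := ℂ) (A := T))
      (Coalgebra.counit (R := ℂ) (A := B)) (w : T ⊗[ℂ] B))
  /-- `Δ(t ◁ b) = t₁ ◁ b₁ ⊗ t₂ ◁ b₂` -/
  comul_act : ∀ w, Coalgebra.comul (R := ℂ) (act w) =
    TensorProduct.map (linExt act) (linExt act) (TensorProduct.tensorTensorTensorComm ℂ T T B B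
      (TensorProduct.map (Coalgebra.comul (R := ℂ) (A := T)) (Coalgebra.comul (R := ℂ) (A := B))
        (w : T ⊗[ℂ] B)))

/-- The subspace `I = {t ◁ b - ε(b) t}` of a right module coalgebra `T`. -/
def RightModuleCoalgebra.orbitCoideal {b : RightBicoalgebroid C B} {T : Type u₃} [AddCommGroup T]
    [Module ℂ T] [Coalgebra ℂ T] (A : RightModuleCoalgebra b T) : Submodule ℂ T :=
  LinearMap.range (A.act - (TensorProduct.rid ℂ T).toLinearMap ∘ₗ
    (Coalgebra.counit (R := ℂ) (A := B)).lTensor T ∘ₗ (cotensor A.baseCoact b.βL).subtype)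

/-! ### The subspace `I` is a coideal

The facts in this part only serve to prove that `T / I` is a coalgebra. -/

/-- A linear map that vanishes on `ker D` factors through `D`. -/
theorem exists_factor_of_ker_le {V W U : Type*} [AddCommGroup V] [Module ℂ V] [AddCommGroup W]
    [Module ℂ W] [AddCommGroup U] [Module ℂ U] (D : V →ₗ[ℂ] W) (g : V →ₗ[ℂ] U)
    (h : ∀ x, D x = 0 → g x = 0) : ∃ f : W →ₗ[ℂ] U, g = f ∘ₗ D := by
  obtain ⟨s, hs⟩ := D.rangeRestrict.exists_rightInverse_of_surjective
    (LinearMap.range_rangeRestrict D)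
  refine ⟨linExt (g ∘ₗ s), ?_⟩
  ext x
  have h1 := linExt_apply (g ∘ₗ s) (D.rangeRestrict x)
  have h2 : D (s (D.rangeRestrict x)) = D x :=
    congrArg Subtype.val (LinearMap.congr_fun hs (D.rangeRestrict x))
  have h3 : g (s (D.rangeRestrict x) - x) = 0 := h _ (by rw [map_sub, h2, sub_self])
  rw [map_sub, sub_eq_zero] at h3
  exact h3.symm.trans h1.symm

theorem SourceTarget.βL_coassoc (s : SourceTarget C B) (x : B) :
    TensorProduct.assoc ℂ C C B ((Coalgebra.comul (R := ℂ) (A := C)).rTensor B (s.βL x)) =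
      s.βL.lTensor C (s.βL x) := by
  -- `b ⊗ (b' ⊗ b'') ↦ β(b'') ⊗ (β(b') ⊗ b)`
  let G : B ⊗[ℂ] (B ⊗[ℂ] B) →ₗ[ℂ] C ⊗[ℂ] (C ⊗[ℂ] B) :=
    TensorProduct.map s.β (s.β.rTensor B) ∘ₗ (TensorProduct.assoc ℂ B B B).toLinearMap ∘ₗ
      (TensorProduct.comm ℂ B B).toLinearMap.rTensor B ∘ₗ
        (TensorProduct.comm ℂ B (B ⊗[ℂ] B)).toLinearMap
  have h1 : ∀ z : B ⊗[ℂ] B, TensorProduct.assoc ℂ C C B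
      ((Coalgebra.comul (R := ℂ) (A := C)).rTensor B
        (s.β.rTensor B (TensorProduct.comm ℂ B B z))) =
      G ((Coalgebra.comul (R := ℂ) (A := B)).lTensor B z) := by
    intro z
    induction z with
    | zero => simp
    | add a b ha hb => simp only [map_add, ha, hb]
    | tmul a b =>
      simp only [TensorProduct.comm_tmul, LinearMap.rTensor_tmul, LinearMap.lTensor_tmul, s.comul_β]
      induction (Coalgebra.comul (R := ℂ) b) with
      | zero => simp
      | add p q hp hq => simp only [map_add, TensorProduct.add_tmul, TensorProduct.tmul_add, hp, hq]
      | tmul p q => simp [G]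
  have h2 : ∀ z : B ⊗[ℂ] B, s.βL.lTensor C (s.β.rTensor B (TensorProduct.comm ℂ B B z)) =
      G (TensorProduct.assoc ℂ B B B ((Coalgebra.comul (R := ℂ) (A := B)).rTensor B z)) := by
    intro z
    induction z with
    | zero => simp
    | add a b ha hb => simp only [map_add, ha, hb]
    | tmul a b =>
      simp only [TensorProduct.comm_tmul, LinearMap.rTensor_tmul, LinearMap.lTensor_tmul,
        SourceTarget.βL, LinearMap.comp_apply, LinearEquiv.coe_coe]
      induction (Coalgebra.comul (R := ℂ) a) with
      | zero => simp
      | add p q hp hq => simp only [map_add, TensorProduct.add_tmul, TensorProduct.tmul_add, hp, hq]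
      | tmul p q => simp [G]
  refine (h1 (Coalgebra.comul x)).trans (Eq.trans ?_ (h2 (Coalgebra.comul x)).symm)
  rw [Coalgebra.coassoc_apply]

theorem SourceTarget.βL_comul (s : SourceTarget C B) (x : B) :
    s.βL.lTensor B (Coalgebra.comul x) = TensorProduct.leftComm ℂ C B B
      ((Coalgebra.comul (R := ℂ) (A := B)).lTensor C (s.βL x)) := by
  -- `b ⊗ (b' ⊗ b'') ↦ b ⊗ (β(b'') ⊗ b')`
  let G : B ⊗[ℂ] (B ⊗[ℂ] B) →ₗ[ℂ] B ⊗[ℂ] (C ⊗[ℂ] B) :=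
    (s.β.rTensor B ∘ₗ (TensorProduct.comm ℂ B B).toLinearMap).lTensor B
  have h1 : ∀ z : B ⊗[ℂ] B, s.βL.lTensor B z =
      G ((Coalgebra.comul (R := ℂ) (A := B)).lTensor B z) := by
    intro z
    rw [← LinearMap.comp_apply, ← LinearMap.lTensor_comp]
    rfl
  have h2 : ∀ z : B ⊗[ℂ] B, TensorProduct.leftComm ℂ C B B
      ((Coalgebra.comul (R := ℂ) (A := B)).lTensor C
        (s.β.rTensor B (TensorProduct.comm ℂ B B z))) =
      G (TensorProduct.assoc ℂ B B B ((Coalgebra.comul (R := ℂ) (A := B)).rTensor B z)) := by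
    intro z
    induction z with
    | zero => simp
    | add a b ha hb => simp only [map_add, ha, hb]
    | tmul a b =>
      simp only [TensorProduct.comm_tmul, LinearMap.rTensor_tmul, LinearMap.lTensor_tmul]
      induction (Coalgebra.comul (R := ℂ) a) with
      | zero => simp
      | add p q hp hq => simp only [map_add, TensorProduct.add_tmul, TensorProduct.tmul_add, hp, hq]
      | tmul p q => simp [G]
  rw [h1, ← Coalgebra.coassoc_apply, ← h2]
  rfl

theorem SourceTarget.αR_comul (s : SourceTarget C B) (x : B) :
    s.αR.lTensor B (Coalgebra.comul x) = TensorProduct.assoc ℂ B B C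
      ((Coalgebra.comul (R := ℂ) (A := B)).rTensor C (s.αR x)) := by
  have h2 : ∀ z : B ⊗[ℂ] B, TensorProduct.assoc ℂ B B C
      ((Coalgebra.comul (R := ℂ) (A := B)).rTensor C (s.α.lTensor B z)) =
      (s.α.lTensor B).lTensor B (TensorProduct.assoc ℂ B B B
        ((Coalgebra.comul (R := ℂ) (A := B)).rTensor B z)) := by
    intro z
    induction z with
    | zero => simp
    | add a b ha hb => simp only [map_add, ha, hb]
    | tmul a b =>
      simp only [LinearMap.rTensor_tmul, LinearMap.lTensor_tmul]
      induction (Coalgebra.comul (R := ℂ) a) with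
      | zero => simp
      | add p q hp hq => simp only [map_add, TensorProduct.add_tmul, hp, hq]
      | tmul p q => simp
  have h1 : ∀ z : B ⊗[ℂ] B, s.αR.lTensor B z =
      (s.α.lTensor B).lTensor B ((Coalgebra.comul (R := ℂ) (A := B)).lTensor B z) := by
    intro z
    rw [← LinearMap.comp_apply, ← LinearMap.lTensor_comp]
    rfl
  rw [h1, ← Coalgebra.coassoc_apply, ← h2]
  rfl

theorem RightBicoalgebroid.η_βL_mem (b : RightBicoalgebroid C B) (x : B) :
    b.η.rTensor B (b.βL x) ∈ cotensor b.αR b.βL := by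
  have h1 : ∀ z : C ⊗[ℂ] B, TensorProduct.assoc ℂ B C B (b.αR.rTensor B (b.η.rTensor B z)) =
      b.η.rTensor (C ⊗[ℂ] B) (TensorProduct.assoc ℂ C C B
        ((Coalgebra.comul (R := ℂ) (A := C)).rTensor B z)) := by
    intro z
    induction z with
    | zero => simp
    | add a b ha hb => simp only [map_add, ha, hb]
    | tmul c y =>
      simp only [LinearMap.rTensor_tmul, b.η_colinear_right]
      induction (Coalgebra.comul (R := ℂ) c) with
      | zero => simp
      | add p q hp hq => simp only [map_add, TensorProduct.add_tmul, hp, hq]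
      | tmul p q => simp
  have h2 : ∀ z : C ⊗[ℂ] B, b.βL.lTensor B (b.η.rTensor B z) =
      b.η.rTensor (C ⊗[ℂ] B) (b.βL.lTensor C z) := by
    intro z
    rw [← LinearMap.comp_apply, ← LinearMap.comp_apply, LinearMap.lTensor_comp_rTensor,
      LinearMap.rTensor_comp_lTensor]
  rw [cotensor, LinearMap.mem_ker, cotensorDiff, LinearMap.sub_apply, LinearMap.comp_apply,
    LinearEquiv.coe_coe, h1, h2, b.βL_coassoc, sub_self]

/-- `α(η(β(x₂))₁) ⊗ η(β(x₂))₂ x₁ = β(x₁) ⊗ x₂` -/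
theorem RightBicoalgebroid.α_η_β (b : RightBicoalgebroid C B) (x : B) :
    TensorProduct.map b.α (linExt b.μ) (TensorProduct.assoc ℂ B B B
      ((Coalgebra.comul ∘ₗ b.η).rTensor B (b.βL x))) = b.copL x := by
  have ht := congrArg (TensorProduct.comm ℂ B C) (b.takeuchi ⟨_, b.η_βL_mem x⟩)
  have h1 : ∀ z : C ⊗[ℂ] B, TensorProduct.comm ℂ B C
      (TensorProduct.map (linExt b.μ) b.α (TensorProduct.rightComm ℂ B B B
        (((TensorProduct.comm ℂ B B).toLinearMap ∘ₗ Coalgebra.comul).rTensor B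
          (b.η.rTensor B z)))) =
      TensorProduct.map b.α (linExt b.μ) (TensorProduct.assoc ℂ B B B
        ((Coalgebra.comul ∘ₗ b.η).rTensor B z)) := by
    intro z
    induction z with
    | zero => simp
    | add a b ha hb => simp only [map_add, ha, hb]
    | tmul c y =>
      simp only [LinearMap.rTensor_tmul, LinearMap.comp_apply, LinearEquiv.coe_coe]
      induction (Coalgebra.comul (R := ℂ) (b.η c)) with
      | zero => simp
      | add p q hp hq => simp only [map_add, TensorProduct.add_tmul, hp, hq]
      | tmul p q => simp
  let G : B ⊗[ℂ] (B ⊗[ℂ] B) →ₗ[ℂ] C ⊗[ℂ] B :=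
    TensorProduct.map b.β (linExt b.μ ∘ₗ b.η.rTensor B ∘ₗ b.β.rTensor B ∘ₗ
      (TensorProduct.comm ℂ B B).toLinearMap)
  have h2 : ∀ z : B ⊗[ℂ] B, TensorProduct.comm ℂ B C
      (TensorProduct.map (linExt b.μ) b.β ((TensorProduct.assoc ℂ B B B).symm
        (((TensorProduct.comm ℂ B B).toLinearMap ∘ₗ Coalgebra.comul).lTensor B
          (b.η.rTensor B (b.β.rTensor B (TensorProduct.comm ℂ B B z)))))) =
      G (TensorProduct.assoc ℂ B B B ((Coalgebra.comul (R := ℂ) (A := B)).rTensor B z)) := by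
    intro z
    induction z with
    | zero => simp
    | add a b ha hb => simp only [map_add, ha, hb]
    | tmul c y =>
      simp only [LinearMap.rTensor_tmul, LinearMap.lTensor_tmul, LinearMap.comp_apply,
        LinearEquiv.coe_coe, TensorProduct.comm_tmul]
      induction (Coalgebra.comul (R := ℂ) c) with
      | zero => simp
      | add p q hp hq => simp only [map_add, TensorProduct.add_tmul, TensorProduct.tmul_add, hp, hq]
      | tmul p q => simp [G]
  have h3 : ∀ z : B ⊗[ℂ] B, G ((Coalgebra.comul (R := ℂ) (A := B)).lTensor B z) =
      b.β.rTensor B z := by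
    intro z
    induction z with
    | zero => simp
    | add a b ha hb => simp only [map_add, ha, hb]
    | tmul c y =>
      have := b.η_μ y
      simp only [SourceTarget.βL, LinearMap.comp_apply, LinearEquiv.coe_coe] at this
      simp only [G, LinearMap.lTensor_tmul, LinearMap.rTensor_tmul, TensorProduct.map_tmul,
        LinearMap.comp_apply, LinearEquiv.coe_coe]
      exact congrArg (fun q => b.β c ⊗ₜ[ℂ] q) this
  have h4 := h2 (Coalgebra.comul x)
  rw [Coalgebra.coassoc_apply, h3] at h4
  exact ((h1 _).symm.trans ht.symm).trans h4

variable {M : Type v} [AddCommGroup M] [Module ℂ M]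

set_option maxHeartbeats 1000000 in
/-- `m₋₁ ⊗ m₀ ◁ b = β(b₁) ⊗ m ◁ b₂` on `M □_C B`. -/
theorem RightModuleStr.canonicalCoact_act {b : RightBicoalgebroid C B} (s : RightModuleStr b M)
    (w : M ⊗[ℂ] B) (hw : w ∈ cotensor s.baseCoact b.βL) :
    (linExt s.act).lTensor C (TensorProduct.assoc ℂ C M B (s.canonicalCoact.rTensor B w)) =
      (linExt s.act).lTensor C (TensorProduct.leftComm ℂ M C B (b.copL.lTensor M w)) := by
  let A := linExt s.act
  let E : C →ₗ[ℂ] B ⊗[ℂ] B := Coalgebra.comul ∘ₗ b.η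
  -- `m ⊗ (c ⊗ y) ↦ α(η(c)₁) ⊗ ((m ⊗ η(c)₂) ⊗ y)`
  let Z : M ⊗[ℂ] (C ⊗[ℂ] B) →ₗ[ℂ] C ⊗[ℂ] ((M ⊗[ℂ] B) ⊗[ℂ] B) :=
    (TensorProduct.assoc ℂ C (M ⊗[ℂ] B) B).toLinearMap ∘ₗ
      (b.α.rTensor (M ⊗[ℂ] B) ∘ₗ (TensorProduct.leftComm ℂ M B B).toLinearMap ∘ₗ
        E.lTensor M).rTensor B ∘ₗ (TensorProduct.assoc ℂ M C B).symm.toLinearMap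
  let D₁ := (cotensorDiff s.baseCoact b.βL).rTensor B
  let D₂ := (cotensorDiff b.αR b.βL).lTensor M ∘ₗ (TensorProduct.assoc ℂ M B B).toLinearMap
  let F : (M ⊗[ℂ] B) ⊗[ℂ] B →ₗ[ℂ] M := A ∘ₗ A.rTensor B
  let F' : (M ⊗[ℂ] B) ⊗[ℂ] B →ₗ[ℂ] M :=
    A ∘ₗ (linExt b.μ).lTensor M ∘ₗ (TensorProduct.assoc ℂ M B B).toLinearMap
  obtain ⟨f, hf⟩ := exists_factor_of_ker_le (D₁.prod D₂) (F - F') (by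
    intro x hx
    rw [LinearMap.prod_apply] at hx
    replace hx := Prod.mk_eq_zero.1 hx
    rw [LinearMap.sub_apply, sub_eq_zero]
    exact s.act_assoc x ⟨hx.1, hx.2⟩)
  have hww : TensorProduct.assoc ℂ M C B (s.baseCoact.rTensor B w) = b.βL.lTensor M w := by
    rw [cotensor, LinearMap.mem_ker, cotensorDiff, LinearMap.sub_apply, sub_eq_zero] at hw
    exact hw
  set v := b.βL.lTensor M w with hv
  have hL : (linExt s.act).lTensor C (TensorProduct.assoc ℂ C M B (s.canonicalCoact.rTensor B w)) =
      F.lTensor C (Z v) := by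
    rw [← hww]
    have : ∀ z : (M ⊗[ℂ] C) ⊗[ℂ] B, A.lTensor C (TensorProduct.assoc ℂ C M B
        ((TensorProduct.map b.α A ∘ₗ (TensorProduct.leftComm ℂ M B B).toLinearMap ∘ₗ
          E.lTensor M).rTensor B z)) =
        F.lTensor C (Z (TensorProduct.assoc ℂ M C B z)) := by
      intro z
      induction z with
      | zero => simp
      | add a b ha hb => simp only [map_add, ha, hb]
      | tmul u y =>
        induction u with
        | zero => simp
        | add a b ha hb => simp only [map_add, TensorProduct.add_tmul, ha, hb]
        | tmul m c =>
          simp only [Z, F, LinearMap.rTensor_tmul, LinearMap.lTensor_tmul, LinearMap.comp_apply,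
            LinearEquiv.coe_coe, LinearEquiv.symm_apply_apply]
          induction E c with
          | zero => simp
          | add p q hp hq =>
            simp only [map_add, TensorProduct.add_tmul, TensorProduct.tmul_add, hp, hq]
          | tmul p q => simp
    rw [← this]
    congr 2
    rw [← LinearMap.comp_apply, ← LinearMap.rTensor_comp]
    rfl
  have hR : (linExt s.act).lTensor C (TensorProduct.leftComm ℂ M C B (b.copL.lTensor M w)) =
      F'.lTensor C (Z v) := by
    have : ∀ z : M ⊗[ℂ] (C ⊗[ℂ] B), F'.lTensor C (Z z) =
        A.lTensor C (TensorProduct.leftComm ℂ M C B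
          ((TensorProduct.map b.α (linExt b.μ) ∘ₗ (TensorProduct.assoc ℂ B B B).toLinearMap ∘ₗ
            E.rTensor B).lTensor M z)) := by
      intro z
      induction z with
      | zero => simp
      | add a b ha hb => simp only [map_add, ha, hb]
      | tmul m u =>
        induction u with
        | zero => simp
        | add a b ha hb => simp only [map_add, TensorProduct.tmul_add, ha, hb]
        | tmul c y =>
          simp only [Z, F', LinearMap.rTensor_tmul, LinearMap.lTensor_tmul, LinearMap.comp_apply,
            LinearEquiv.coe_coe, TensorProduct.assoc_symm_tmul]
          induction E c with
          | zero => simp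
          | add p q hp hq =>
            simp only [map_add, TensorProduct.add_tmul, TensorProduct.tmul_add, hp, hq]
          | tmul p q => simp
    have hcop : b.copL = (TensorProduct.map b.α (linExt b.μ) ∘ₗ
        (TensorProduct.assoc ℂ B B B).toLinearMap ∘ₗ E.rTensor B) ∘ₗ b.βL :=
      LinearMap.ext fun x => (b.α_η_β x).symm
    rw [this, hv, hcop, LinearMap.lTensor_comp, LinearMap.comp_apply]
  rw [hL, hR, ← sub_eq_zero, ← LinearMap.sub_apply, ← LinearMap.lTensor_sub, hf,
    LinearMap.lTensor_comp, LinearMap.comp_apply]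
  have hD : D₁.prod D₂ = LinearMap.inl ℂ _ _ ∘ₗ D₁ + LinearMap.inr ℂ _ _ ∘ₗ D₂ := by
    ext x <;> simp
  suffices h : D₁.lTensor C (Z v) = 0 ∧ D₂.lTensor C (Z v) = 0 by
    have h' : (D₁.prod D₂).lTensor C (Z v) =
        (LinearMap.inl ℂ _ _).lTensor C (D₁.lTensor C (Z v)) +
          (LinearMap.inr ℂ _ _).lTensor C (D₂.lTensor C (Z v)) := by
      rw [hD, LinearMap.lTensor_add, LinearMap.lTensor_comp, LinearMap.lTensor_comp]
      rfl
    rw [h', h.1, h.2, map_zero, map_zero, add_zero, map_zero]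
  constructor
  · -- `m ⊗ (c ⊗ (d ⊗ y)) ↦ α(η(d)₁) ⊗ ((m ⊗ (c ⊗ η(d)₂)) ⊗ y)`
    let H : M ⊗[ℂ] (C ⊗[ℂ] (C ⊗[ℂ] B)) →ₗ[ℂ] C ⊗[ℂ] ((M ⊗[ℂ] (C ⊗[ℂ] B)) ⊗[ℂ] B) :=
      (TensorProduct.assoc ℂ C (M ⊗[ℂ] (C ⊗[ℂ] B)) B).toLinearMap ∘ₗ
        ((TensorProduct.assoc ℂ M C B).toLinearMap.lTensor C ∘ₗ b.α.rTensor ((M ⊗[ℂ] C) ⊗[ℂ] B) ∘ₗ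
          (TensorProduct.leftComm ℂ (M ⊗[ℂ] C) B B).toLinearMap ∘ₗ
            E.lTensor (M ⊗[ℂ] C)).rTensor B ∘ₗ
          (TensorProduct.assoc ℂ (M ⊗[ℂ] C) C B).symm.toLinearMap ∘ₗ
            (TensorProduct.assoc ℂ M C (C ⊗[ℂ] B)).symm.toLinearMap
    let J : M ⊗[ℂ] (C ⊗[ℂ] B) →ₗ[ℂ] M ⊗[ℂ] (C ⊗[ℂ] (C ⊗[ℂ] B)) :=
      ((TensorProduct.assoc ℂ C C B).toLinearMap ∘ₗ
        (Coalgebra.comul (R := ℂ) (A := C)).rTensor B).lTensor M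
    have hP2 : ∀ z, ((b.βL.lTensor M).rTensor B).lTensor C (Z z) = H (J z) := by
      intro z
      induction z with
      | zero => simp
      | add a b ha hb => simp only [map_add, ha, hb]
      | tmul m u =>
        induction u with
        | zero => simp
        | add a b ha hb => simp only [map_add, TensorProduct.tmul_add, ha, hb]
        | tmul c y =>
          have e1 : ((b.βL.lTensor M).rTensor B).lTensor C (Z (m ⊗ₜ (c ⊗ₜ y))) =
              TensorProduct.assoc ℂ C (M ⊗[ℂ] (C ⊗[ℂ] B)) B
                (TensorProduct.map b.α (TensorProduct.mk ℂ M (C ⊗[ℂ] B) m)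
                  (b.βL.lTensor B (E c)) ⊗ₜ y) := by
            simp only [Z, LinearMap.rTensor_tmul, LinearMap.lTensor_tmul, LinearMap.comp_apply,
              LinearEquiv.coe_coe, TensorProduct.assoc_symm_tmul]
            induction E c with
            | zero => simp
            | add p q hp hq =>
              simp only [map_add, TensorProduct.add_tmul, TensorProduct.tmul_add, hp, hq]
            | tmul p q => simp
          have e2 : b.βL.lTensor B (E c) = TensorProduct.leftComm ℂ C B B
              (E.lTensor C (Coalgebra.comul (R := ℂ) c)) := by
            show b.βL.lTensor B (Coalgebra.comul (b.η c)) = _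
            rw [b.βL_comul, b.η_colinear_left, ← LinearMap.comp_apply (LinearMap.lTensor C _),
              ← LinearMap.lTensor_comp]
          rw [e1, e2]
          simp only [H, J, LinearMap.rTensor_tmul, LinearMap.lTensor_tmul, LinearMap.comp_apply,
            LinearEquiv.coe_coe]
          induction (Coalgebra.comul (R := ℂ) c) with
          | zero => simp
          | add p q hp hq =>
            simp only [map_add, TensorProduct.add_tmul, TensorProduct.tmul_add, hp, hq]
          | tmul p q =>
            simp only [LinearMap.rTensor_tmul, LinearMap.lTensor_tmul, LinearMap.comp_apply,
              LinearEquiv.coe_coe, TensorProduct.assoc_symm_tmul, TensorProduct.assoc_tmul]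
            induction E q with
            | zero => simp
            | add p q hp hq =>
              simp only [map_add, TensorProduct.add_tmul, TensorProduct.tmul_add, hp, hq]
            | tmul p q => simp
    have hP1 : ((((TensorProduct.assoc ℂ M C B).toLinearMap ∘ₗ
        s.baseCoact.rTensor B)).rTensor B).lTensor C (Z v) = H (J v) := by
      have e1 : ∀ z : (M ⊗[ℂ] C) ⊗[ℂ] B, ((((TensorProduct.assoc ℂ M C B).toLinearMap ∘ₗ
          s.baseCoact.rTensor B)).rTensor B).lTensor C (Z (TensorProduct.assoc ℂ M C B z)) =
          H (TensorProduct.assoc ℂ M C (C ⊗[ℂ] B) (TensorProduct.assoc ℂ (M ⊗[ℂ] C) C B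
            ((s.baseCoact.rTensor C).rTensor B z))) := by
        intro z
        induction z with
        | zero => simp
        | add a b ha hb => simp only [map_add, ha, hb]
        | tmul u y =>
          induction u with
          | zero => simp
          | add a b ha hb => simp only [map_add, TensorProduct.add_tmul, ha, hb]
          | tmul m c =>
            simp only [H, Z, LinearMap.rTensor_tmul, LinearMap.lTensor_tmul, LinearMap.comp_apply,
              LinearEquiv.coe_coe, LinearEquiv.symm_apply_apply]
            induction E c with
            | zero => simp
            | add p q hp hq =>
              simp only [map_add, TensorProduct.add_tmul, TensorProduct.tmul_add, hp, hq]
            | tmul p q => simp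
      have e2 : ∀ z : M ⊗[ℂ] B, TensorProduct.assoc ℂ M C (C ⊗[ℂ] B)
          (TensorProduct.assoc ℂ (M ⊗[ℂ] C) C B ((s.baseCoact.rTensor C).rTensor B
            (s.baseCoact.rTensor B z))) =
          J (TensorProduct.assoc ℂ M C B (s.baseCoact.rTensor B z)) := by
        intro z
        induction z with
        | zero => simp
        | add a b ha hb => simp only [map_add, ha, hb]
        | tmul m y =>
          have h := congrArg (fun q => (TensorProduct.assoc ℂ C C B).toLinearMap.lTensor M
            (TensorProduct.assoc ℂ M (C ⊗[ℂ] C) B (q ⊗ₜ[ℂ] y)))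
              (s.isRightCoaction_baseCoact.coassoc m)
          simp only [LinearMap.rTensor_tmul]
          refine Eq.trans ?_ (h.trans ?_)
          · induction s.baseCoact.rTensor C (s.baseCoact m) with
            | zero => simp
            | add p q hp hq => simp only [map_add, TensorProduct.add_tmul, hp, hq]
            | tmul p q =>
              induction p with
              | zero => simp
              | add p q hp hq => simp only [map_add, TensorProduct.add_tmul, hp, hq]
              | tmul p q => simp
          · induction s.baseCoact m with
            | zero => simp
            | add p q hp hq => simp only [map_add, TensorProduct.add_tmul, hp, hq]
            | tmul p q => simp [J]
      rw [← hww, e1, e2]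
    simp only [D₁, cotensorDiff]
    rw [LinearMap.rTensor_sub, LinearMap.lTensor_sub, LinearMap.sub_apply, hP1, hP2, sub_self]
  · -- `c ⊗ (d ⊗ y) ↦ α(η(c)₁) ⊗ (η(c)₂ ⊗ (d ⊗ y))`
    let H : C ⊗[ℂ] (C ⊗[ℂ] B) →ₗ[ℂ] C ⊗[ℂ] (B ⊗[ℂ] (C ⊗[ℂ] B)) :=
      (TensorProduct.assoc ℂ C B (C ⊗[ℂ] B)).toLinearMap ∘ₗ
        (b.α.rTensor B ∘ₗ E).rTensor (C ⊗[ℂ] B)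
    have e1 : ∀ z : C ⊗[ℂ] B, ((TensorProduct.assoc ℂ B C B).toLinearMap ∘ₗ
        b.αR.rTensor B).lTensor C (TensorProduct.assoc ℂ C B B
          ((b.α.rTensor B ∘ₗ E).rTensor B z)) =
        H (TensorProduct.assoc ℂ C C B ((Coalgebra.comul (R := ℂ) (A := C)).rTensor B z)) := by
      intro z
      induction z with
      | zero => simp
      | add a b ha hb => simp only [map_add, ha, hb]
      | tmul c y =>
        have e2 : b.αR.lTensor B (E c) = TensorProduct.assoc ℂ B B C
            (E.rTensor C (Coalgebra.comul (R := ℂ) c)) := by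
          show b.αR.lTensor B (Coalgebra.comul (b.η c)) = _
          rw [b.αR_comul, b.η_colinear_right, ← LinearMap.comp_apply (LinearMap.rTensor C _),
            ← LinearMap.rTensor_comp]
        have e3 : ∀ z : B ⊗[ℂ] B, ((TensorProduct.assoc ℂ B C B).toLinearMap ∘ₗ
            b.αR.rTensor B).lTensor C (TensorProduct.assoc ℂ C B B (b.α.rTensor B z ⊗ₜ y)) =
            TensorProduct.map b.α ((TensorProduct.assoc ℂ B C B).toLinearMap ∘ₗ
              (TensorProduct.mk ℂ (B ⊗[ℂ] C) B).flip y) (b.αR.lTensor B z) := by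
          intro z
          induction z with
          | zero => simp
          | add p q hp hq => simp only [map_add, TensorProduct.add_tmul, hp, hq]
          | tmul p q => simp
        simp only [LinearMap.rTensor_tmul, LinearMap.comp_apply (g := E)]
        rw [e3, e2]
        induction (Coalgebra.comul (R := ℂ) c) with
        | zero => simp
        | add p q hp hq => simp only [map_add, TensorProduct.add_tmul, hp, hq]
        | tmul p q =>
          simp only [H, LinearMap.rTensor_tmul, LinearMap.comp_apply, LinearEquiv.coe_coe,
            TensorProduct.assoc_tmul]
          induction E p with
          | zero => simp
          | add p q hp hq => simp only [map_add, TensorProduct.add_tmul, hp, hq]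
          | tmul p q => simp
    have e4 : ∀ z : C ⊗[ℂ] B, (b.βL.lTensor B).lTensor C (TensorProduct.assoc ℂ C B B
          ((b.α.rTensor B ∘ₗ E).rTensor B z)) = H (b.βL.lTensor C z) := by
      intro z
      induction z with
      | zero => simp
      | add a b ha hb => simp only [map_add, ha, hb]
      | tmul c y =>
        simp only [H, LinearMap.rTensor_tmul, LinearMap.lTensor_tmul, LinearMap.comp_apply,
          LinearEquiv.coe_coe]
        induction E c with
        | zero => simp
        | add p q hp hq => simp only [map_add, TensorProduct.add_tmul, hp, hq]
        | tmul p q => simp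
    have e5 : ∀ x, (cotensorDiff b.αR b.βL).lTensor C (TensorProduct.assoc ℂ C B B
          ((b.α.rTensor B ∘ₗ E).rTensor B (b.βL x))) = 0 := by
      intro x
      rw [cotensorDiff, LinearMap.lTensor_sub, LinearMap.sub_apply, e1, e4, b.βL_coassoc, sub_self]
    -- `m ⊗ (c ⊗ (y ⊗ z)) ↦ c ⊗ (m ⊗ (y ⊗ z))`
    have e6 : ∀ z : M ⊗[ℂ] (C ⊗[ℂ] B), D₂.lTensor C (Z z) =
        TensorProduct.leftComm ℂ M C (B ⊗[ℂ] (C ⊗[ℂ] B))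
          (((cotensorDiff b.αR b.βL).lTensor C ∘ₗ (TensorProduct.assoc ℂ C B B).toLinearMap ∘ₗ
            (b.α.rTensor B ∘ₗ E).rTensor B).lTensor M z) := by
      intro z
      induction z with
      | zero => simp
      | add a b ha hb => simp only [map_add, ha, hb]
      | tmul m u =>
        induction u with
        | zero => simp
        | add a b ha hb => simp only [map_add, TensorProduct.tmul_add, ha, hb]
        | tmul c y =>
          simp only [Z, D₂, LinearMap.rTensor_tmul, LinearMap.lTensor_tmul, LinearMap.comp_apply,
            LinearEquiv.coe_coe, TensorProduct.assoc_symm_tmul]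
          induction E c with
          | zero => simp
          | add p q hp hq =>
            simp only [map_add, TensorProduct.add_tmul, TensorProduct.tmul_add, hp, hq]
          | tmul p q => simp
    rw [e6, hv, ← LinearMap.comp_apply (f := LinearMap.lTensor M _), ← LinearMap.lTensor_comp]
    have e7 : ((cotensorDiff b.αR b.βL).lTensor C ∘ₗ (TensorProduct.assoc ℂ C B B).toLinearMap ∘ₗ
            (b.α.rTensor B ∘ₗ E).rTensor B) ∘ₗ b.βL = 0 := LinearMap.ext e5
    rw [e7, LinearMap.lTensor_zero, LinearMap.zero_apply, map_zero]

theorem tensorMap_sub_left {V W V' W' : Type*} [AddCommGroup V] [Module ℂ V] [AddCommGroup W]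
    [Module ℂ W] [AddCommGroup V'] [Module ℂ V'] [AddCommGroup W'] [Module ℂ W']
    (f f' : V →ₗ[ℂ] W) (g : V' →ₗ[ℂ] W') :
    TensorProduct.map (f - f') g = TensorProduct.map f g - TensorProduct.map f' g := by
  ext x y
  simp [TensorProduct.sub_tmul]

theorem tensorMap_sub_right {V W V' W' : Type*} [AddCommGroup V] [Module ℂ V] [AddCommGroup W]
    [Module ℂ W] [AddCommGroup V'] [Module ℂ V'] [AddCommGroup W'] [Module ℂ W']
    (f : V →ₗ[ℂ] W) (g g' : V' →ₗ[ℂ] W') :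
    TensorProduct.map f (g - g') = TensorProduct.map f g - TensorProduct.map f g' := by
  ext x y
  simp [TensorProduct.tmul_sub]

theorem SourceTarget.copL_comul (s : SourceTarget C B) (x : B) :
    TensorProduct.assoc ℂ C B B (s.βL.rTensor B (Coalgebra.comul x)) =
      TensorProduct.leftComm ℂ B C B (s.copL.lTensor B (Coalgebra.comul x)) := by
  have h2 : ∀ z : B ⊗[ℂ] B, TensorProduct.assoc ℂ C B B (s.βL.rTensor B z) =
      TensorProduct.leftComm ℂ B C B ((s.β.rTensor B).lTensor B (TensorProduct.assoc ℂ B B B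
        ((Coalgebra.comul (R := ℂ) (A := B)).rTensor B z))) := by
    intro z
    induction z with
    | zero => simp
    | add a b ha hb => simp only [map_add, ha, hb]
    | tmul a b =>
      simp only [LinearMap.rTensor_tmul, SourceTarget.βL, LinearMap.comp_apply, LinearEquiv.coe_coe]
      induction (Coalgebra.comul (R := ℂ) a) with
      | zero => simp
      | add p q hp hq => simp only [map_add, TensorProduct.add_tmul, hp, hq]
      | tmul p q => simp
  rw [h2, Coalgebra.coassoc_apply, SourceTarget.copL, LinearMap.lTensor_comp, LinearMap.comp_apply]

namespace RightModuleCoalgebra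

variable {b : RightBicoalgebroid C B} {T : Type u₃} [AddCommGroup T] [Module ℂ T]
  [Coalgebra ℂ T] (A : RightModuleCoalgebra b T)

/-- The right `C`-coaction of a module coalgebra is left `T`-colinear. -/
theorem baseCoact_comul (t : T) :
    A.baseCoact.lTensor T (Coalgebra.comul t) = TensorProduct.assoc ℂ T T C
      ((Coalgebra.comul (R := ℂ) (A := T)).rTensor C (A.baseCoact t)) := by
  let g : C ⊗[ℂ] T →ₗ[ℂ] C :=
    (TensorProduct.rid ℂ C).toLinearMap ∘ₗ (Coalgebra.counit (R := ℂ) (A := T)).lTensor C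
  let f : T →ₗ[ℂ] C := g ∘ₗ A.canonicalCoact
  have h1 : ∀ z : T ⊗[ℂ] T, g.lTensor T (TensorProduct.assoc ℂ T C T (A.baseCoact.rTensor T z)) =
      A.baseCoact (TensorProduct.rid ℂ T
        ((Coalgebra.counit (R := ℂ) (A := T)).lTensor T z)) := by
    intro z
    induction z with
    | zero => simp
    | add a b ha hb => simp only [map_add, ha, hb]
    | tmul x y =>
      simp only [LinearMap.rTensor_tmul, LinearMap.lTensor_tmul, TensorProduct.rid_tmul, map_smul]
      induction A.baseCoact x with
      | zero => simp
      | add p q hp hq => simp only [map_add, TensorProduct.add_tmul, smul_add, hp, hq]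
      | tmul p q => simp [g]
  have h2 : ∀ x, A.baseCoact x = f.lTensor T (Coalgebra.comul x) := by
    intro x
    have h := h1 (Coalgebra.comul x)
    rw [A.cobalanced, Coalgebra.lTensor_counit_comul, TensorProduct.rid_tmul, one_smul] at h
    rw [← h]
    exact (LinearMap.congr_fun (LinearMap.lTensor_comp T g A.canonicalCoact) _).symm
  have h3 : ∀ z : T ⊗[ℂ] T, TensorProduct.assoc ℂ T T C
      ((Coalgebra.comul (R := ℂ) (A := T)).rTensor C (f.lTensor T z)) =
      (f.lTensor T).lTensor T (TensorProduct.assoc ℂ T T T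
        ((Coalgebra.comul (R := ℂ) (A := T)).rTensor T z)) := by
    intro z
    induction z with
    | zero => simp
    | add a b ha hb => simp only [map_add, ha, hb]
    | tmul x y =>
      simp only [LinearMap.rTensor_tmul, LinearMap.lTensor_tmul]
      induction Coalgebra.comul (R := ℂ) x with
      | zero => simp
      | add p q hp hq => simp only [map_add, TensorProduct.add_tmul, hp, hq]
      | tmul p q => simp
  have h4 : A.baseCoact = f.lTensor T ∘ₗ Coalgebra.comul := LinearMap.ext h2
  rw [h2, h3, Coalgebra.coassoc_apply, h4, LinearMap.lTensor_comp, LinearMap.comp_apply]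

/-- `t₁ ⊗ (t₂ ⊗ b) ∈ T ⊗ (T □_C B)` for `t ⊗ b ∈ T □_C B`. -/
theorem lTensor_cotensorDiff_comul (w : T ⊗[ℂ] B) (hw : w ∈ cotensor A.baseCoact b.βL) :
    (cotensorDiff A.baseCoact b.βL).lTensor T (TensorProduct.assoc ℂ T T B
      ((Coalgebra.comul (R := ℂ) (A := T)).rTensor B w)) = 0 := by
  have h1 : ∀ z : T ⊗[ℂ] B, (b.βL.lTensor T).lTensor T (TensorProduct.assoc ℂ T T B
      ((Coalgebra.comul (R := ℂ) (A := T)).rTensor B z)) = TensorProduct.assoc ℂ T T (C ⊗[ℂ] B)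
        ((Coalgebra.comul (R := ℂ) (A := T)).rTensor (C ⊗[ℂ] B) (b.βL.lTensor T z)) := by
    intro z
    induction z with
    | zero => simp
    | add a b ha hb => simp only [map_add, ha, hb]
    | tmul x y =>
      simp only [LinearMap.rTensor_tmul, LinearMap.lTensor_tmul]
      induction Coalgebra.comul (R := ℂ) x with
      | zero => simp
      | add p q hp hq => simp only [map_add, TensorProduct.add_tmul, hp, hq]
      | tmul p q => simp
  have h2 : ∀ z : T ⊗[ℂ] B, ((TensorProduct.assoc ℂ T C B).toLinearMap ∘ₗ
      A.baseCoact.rTensor B).lTensor T (TensorProduct.assoc ℂ T T B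
      ((Coalgebra.comul (R := ℂ) (A := T)).rTensor B z)) = TensorProduct.assoc ℂ T T (C ⊗[ℂ] B)
        ((Coalgebra.comul (R := ℂ) (A := T)).rTensor (C ⊗[ℂ] B)
          (TensorProduct.assoc ℂ T C B (A.baseCoact.rTensor B z))) := by
    intro z
    induction z with
    | zero => simp
    | add a b ha hb => simp only [map_add, ha, hb]
    | tmul x y =>
      let G : T ⊗[ℂ] (T ⊗[ℂ] C) →ₗ[ℂ] T ⊗[ℂ] (T ⊗[ℂ] (C ⊗[ℂ] B)) :=
        ((TensorProduct.assoc ℂ T C B).toLinearMap ∘ₗ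
          (TensorProduct.mk ℂ (T ⊗[ℂ] C) B).flip y).lTensor T
      have e1 : ∀ u : T ⊗[ℂ] T, ((TensorProduct.assoc ℂ T C B).toLinearMap ∘ₗ
          A.baseCoact.rTensor B).lTensor T (TensorProduct.assoc ℂ T T B (u ⊗ₜ y)) =
          G (A.baseCoact.lTensor T u) := by
        intro u
        induction u with
        | zero => simp
        | add p q hp hq => simp only [map_add, TensorProduct.add_tmul, hp, hq]
        | tmul p q => simp [G]
      have e2 : ∀ u : T ⊗[ℂ] C, TensorProduct.assoc ℂ T T (C ⊗[ℂ] B)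
          ((Coalgebra.comul (R := ℂ) (A := T)).rTensor (C ⊗[ℂ] B)
            (TensorProduct.assoc ℂ T C B (u ⊗ₜ y))) =
          G (TensorProduct.assoc ℂ T T C ((Coalgebra.comul (R := ℂ) (A := T)).rTensor C u)) := by
        intro u
        induction u with
        | zero => simp
        | add p q hp hq => simp only [map_add, TensorProduct.add_tmul, hp, hq]
        | tmul p q =>
          simp only [LinearMap.rTensor_tmul, TensorProduct.assoc_tmul]
          induction Coalgebra.comul (R := ℂ) p with
          | zero => simp
          | add p q hp hq => simp only [map_add, TensorProduct.add_tmul, hp, hq]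
          | tmul p q => simp [G]
      rw [LinearMap.rTensor_tmul, e1, LinearMap.rTensor_tmul, e2, A.baseCoact_comul]
  rw [cotensor, LinearMap.mem_ker, cotensorDiff, LinearMap.sub_apply, sub_eq_zero] at hw
  rw [cotensorDiff, LinearMap.lTensor_sub, LinearMap.sub_apply, h1, h2, sub_eq_zero, ← hw]
  rfl

/-- `t ⊗ b ↦ b₁ ⊗ (t ⊗ b₂)` -/
def split (_ : RightBicoalgebroid C B) (T : Type u₃) [AddCommGroup T] [Module ℂ T] :
    T ⊗[ℂ] B →ₗ[ℂ] B ⊗[ℂ] (T ⊗[ℂ] B) :=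
  (TensorProduct.leftComm ℂ T B B).toLinearMap ∘ₗ (Coalgebra.comul (R := ℂ) (A := B)).lTensor T

/-- `(t₁ ⊗ b₁) ⊗ (t₂ ◁ b₂) ∈ (T □_C B) ⊗ T` for `t ⊗ b ∈ T □_C B`. -/
theorem map_cotensorDiff_comul (w : T ⊗[ℂ] B) (hw : w ∈ cotensor A.baseCoact b.βL) :
    TensorProduct.map (cotensorDiff A.baseCoact b.βL) (linExt A.act)
      ((TensorProduct.assoc ℂ T B (T ⊗[ℂ] B)).symm ((split b T).lTensor T
        (TensorProduct.assoc ℂ T T B ((Coalgebra.comul (R := ℂ) (A := T)).rTensor B w)))) = 0 := by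
  let D := cotensorDiff A.baseCoact b.βL
  let N₁ : T ⊗[ℂ] B →ₗ[ℂ] C ⊗[ℂ] T := (linExt A.act).lTensor C ∘ₗ
    (TensorProduct.assoc ℂ C T B).toLinearMap ∘ₗ A.canonicalCoact.rTensor B
  let N₂ : T ⊗[ℂ] B →ₗ[ℂ] C ⊗[ℂ] T := (linExt A.act).lTensor C ∘ₗ
    (TensorProduct.leftComm ℂ T C B).toLinearMap ∘ₗ b.copL.lTensor T
  obtain ⟨g, hg⟩ := exists_factor_of_ker_le D (N₁ - N₂) (by
    intro x hx
    rw [LinearMap.sub_apply, sub_eq_zero]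
    exact A.canonicalCoact_act x hx)
  let S' : T ⊗[ℂ] (C ⊗[ℂ] B) →ₗ[ℂ] B ⊗[ℂ] (T ⊗[ℂ] (C ⊗[ℂ] B)) :=
    (TensorProduct.leftComm ℂ T B (C ⊗[ℂ] B)).toLinearMap ∘ₗ
      ((TensorProduct.leftComm ℂ C B B).toLinearMap ∘ₗ
        (Coalgebra.comul (R := ℂ) (A := B)).lTensor C).lTensor T
  have hS₁ : ∀ z : T ⊗[ℂ] B, ((TensorProduct.assoc ℂ T C B).toLinearMap ∘ₗ
      A.baseCoact.rTensor B).lTensor B (split b T z) =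
        S' (TensorProduct.assoc ℂ T C B (A.baseCoact.rTensor B z)) := by
    intro z
    induction z with
    | zero => simp
    | add a b ha hb => simp only [map_add, ha, hb]
    | tmul x y =>
      have e1 : ∀ u : B ⊗[ℂ] B, ((TensorProduct.assoc ℂ T C B).toLinearMap ∘ₗ
          A.baseCoact.rTensor B).lTensor B (TensorProduct.leftComm ℂ T B B (x ⊗ₜ u)) =
          TensorProduct.leftComm ℂ T B (C ⊗[ℂ] B)
            ((TensorProduct.leftComm ℂ C B B).toLinearMap.lTensor T
              (TensorProduct.assoc ℂ T C (B ⊗[ℂ] B) (A.baseCoact x ⊗ₜ u))) := by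
        intro u
        induction u with
        | zero => simp
        | add p q hp hq => simp only [map_add, TensorProduct.tmul_add, hp, hq]
        | tmul p q =>
          simp only [LinearMap.lTensor_tmul, TensorProduct.leftComm_tmul, LinearMap.comp_apply,
            LinearMap.rTensor_tmul, LinearEquiv.coe_coe]
          induction A.baseCoact x with
          | zero => simp
          | add p q hp hq =>
            simp only [map_add, TensorProduct.add_tmul, TensorProduct.tmul_add, hp, hq]
          | tmul p q => simp
      simp only [split, LinearMap.comp_apply, LinearEquiv.coe_coe, LinearMap.lTensor_tmul] at e1 ⊢
      rw [e1, LinearMap.rTensor_tmul]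
      induction A.baseCoact x with
      | zero => simp
      | add p q hp hq => simp only [map_add, TensorProduct.add_tmul, hp, hq]
      | tmul p q => simp [S']
  have hS₂ : ∀ z : T ⊗[ℂ] B, (b.βL.lTensor T).lTensor B (split b T z) =
      S' (b.βL.lTensor T z) := by
    intro z
    induction z with
    | zero => simp
    | add a b ha hb => simp only [map_add, ha, hb]
    | tmul x y =>
      have e1 : ∀ u : B ⊗[ℂ] B, (b.βL.lTensor T).lTensor B
          (TensorProduct.leftComm ℂ T B B (x ⊗ₜ u)) =
          TensorProduct.leftComm ℂ T B (C ⊗[ℂ] B) (x ⊗ₜ b.βL.lTensor B u) := by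
        intro u
        induction u with
        | zero => simp
        | add p q hp hq => simp only [map_add, TensorProduct.tmul_add, hp, hq]
        | tmul p q => simp
      simp only [split, S', LinearMap.comp_apply, LinearEquiv.coe_coe, LinearMap.lTensor_tmul,
        e1, b.βL_comul]
  have hS : ∀ z, (N₁ - N₂).lTensor B (split b T z) = g.lTensor B (S' (D z)) := by
    intro z
    have : D.lTensor B (split b T z) = S' (D z) := by
      simp only [D, cotensorDiff]
      rw [LinearMap.lTensor_sub, LinearMap.sub_apply, hS₁, hS₂, LinearMap.sub_apply, map_sub]
      rfl
    rw [hg, LinearMap.lTensor_comp, LinearMap.comp_apply, this]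
  have hS' : (N₁ - N₂).lTensor B ∘ₗ split b T = (g.lTensor B ∘ₗ S') ∘ₗ D := LinearMap.ext hS
  have hzero : ((N₁ - N₂).lTensor B ∘ₗ split b T).lTensor T
      (TensorProduct.assoc ℂ T T B ((Coalgebra.comul (R := ℂ) (A := T)).rTensor B w)) = 0 := by
    rw [hS', LinearMap.lTensor_comp, LinearMap.comp_apply, A.lTensor_cotensorDiff_comul w hw,
      map_zero]
  let R : T ⊗[ℂ] (B ⊗[ℂ] (C ⊗[ℂ] T)) →ₗ[ℂ] (T ⊗[ℂ] (C ⊗[ℂ] B)) ⊗[ℂ] T :=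
    (TensorProduct.assoc ℂ T (C ⊗[ℂ] B) T).symm.toLinearMap ∘ₗ
      ((TensorProduct.assoc ℂ C B T).symm.toLinearMap ∘ₗ
        (TensorProduct.leftComm ℂ B C T).toLinearMap).lTensor T
  have hR₁ : ∀ z : T ⊗[ℂ] B, TensorProduct.map ((TensorProduct.assoc ℂ T C B).toLinearMap ∘ₗ
      A.baseCoact.rTensor B) (linExt A.act) ((TensorProduct.assoc ℂ T B (T ⊗[ℂ] B)).symm
        ((split b T).lTensor T (TensorProduct.assoc ℂ T T B
          ((Coalgebra.comul (R := ℂ) (A := T)).rTensor B z)))) =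
      R ((N₁.lTensor B ∘ₗ split b T).lTensor T (TensorProduct.assoc ℂ T T B
          ((Coalgebra.comul (R := ℂ) (A := T)).rTensor B z))) := by
    intro z
    induction z with
    | zero => simp
    | add a b ha hb => simp only [map_add, ha, hb]
    | tmul x y =>
      -- `t ⊗ (c ⊗ t') ↦ (t ⊗ (c ⊗ p)) ⊗ t' ◁ q`
      let L : B → B → T ⊗[ℂ] (C ⊗[ℂ] T) →ₗ[ℂ] (T ⊗[ℂ] (C ⊗[ℂ] B)) ⊗[ℂ] T := fun p q =>
        (TensorProduct.assoc ℂ T (C ⊗[ℂ] B) T).symm.toLinearMap ∘ₗ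
          (TensorProduct.map ((TensorProduct.mk ℂ C B).flip p)
            (linExt A.act ∘ₗ (TensorProduct.mk ℂ T B).flip q)).lTensor T
      have e1 : ∀ (u : T ⊗[ℂ] T) (p q : B),
          TensorProduct.map ((TensorProduct.assoc ℂ T C B).toLinearMap ∘ₗ
            A.baseCoact.rTensor B) (linExt A.act) ((TensorProduct.assoc ℂ T B (T ⊗[ℂ] B)).symm
              ((TensorProduct.leftComm ℂ T B B).toLinearMap.lTensor T
                (TensorProduct.assoc ℂ T T (B ⊗[ℂ] B) (u ⊗ₜ (p ⊗ₜ q))))) =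
          L p q (TensorProduct.assoc ℂ T C T (A.baseCoact.rTensor T u)) := by
        intro u p q
        induction u with
        | zero => simp
        | add p q hp hq => simp only [map_add, TensorProduct.add_tmul, hp, hq]
        | tmul t t' =>
          simp only [LinearMap.rTensor_tmul, TensorProduct.assoc_tmul, LinearMap.lTensor_tmul,
            LinearEquiv.coe_coe, TensorProduct.leftComm_tmul, TensorProduct.assoc_symm_tmul,
            TensorProduct.map_tmul, LinearMap.comp_apply]
          induction A.baseCoact t with
          | zero => simp
          | add p q hp hq => simp only [map_add, TensorProduct.add_tmul, hp, hq]
          | tmul p q => simp [L]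
      have e2 : ∀ (u : T ⊗[ℂ] T) (p q : B), R ((N₁.lTensor B).lTensor T
          ((TensorProduct.leftComm ℂ T B B).toLinearMap.lTensor T
            (TensorProduct.assoc ℂ T T (B ⊗[ℂ] B) (u ⊗ₜ (p ⊗ₜ q))))) =
          L p q (A.canonicalCoact.lTensor T u) := by
        intro u p q
        induction u with
        | zero => simp
        | add p q hp hq => simp only [map_add, TensorProduct.add_tmul, hp, hq]
        | tmul t t' =>
          simp only [N₁, TensorProduct.assoc_tmul, LinearMap.lTensor_tmul,
            LinearEquiv.coe_coe, TensorProduct.leftComm_tmul, LinearMap.rTensor_tmul,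
            LinearMap.comp_apply]
          induction A.canonicalCoact t' with
          | zero => simp
          | add p q hp hq =>
            simp only [map_add, TensorProduct.add_tmul, TensorProduct.tmul_add, hp, hq]
          | tmul p q => simp [R, L]
      have e3 : ∀ u : T ⊗[ℂ] T, (split b T).lTensor T (TensorProduct.assoc ℂ T T B (u ⊗ₜ y)) =
          (TensorProduct.leftComm ℂ T B B).toLinearMap.lTensor T
            (TensorProduct.assoc ℂ T T (B ⊗[ℂ] B) (u ⊗ₜ Coalgebra.comul y)) := by
        intro u
        induction u with
        | zero => simp
        | add p q hp hq => simp only [map_add, TensorProduct.add_tmul, hp, hq]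
        | tmul p q => simp [split]
      have e4 : ∀ z, (N₁.lTensor B ∘ₗ split b T).lTensor T z =
          (N₁.lTensor B).lTensor T ((split b T).lTensor T z) := fun z => by
        rw [LinearMap.lTensor_comp]
        rfl
      rw [LinearMap.rTensor_tmul, e4, e3]
      induction (Coalgebra.comul (R := ℂ) y) with
      | zero => simp
      | add p q hp hq => simp only [map_add, TensorProduct.tmul_add, hp, hq]
      | tmul p q => rw [e1, e2, A.cobalanced]
  have hR₂ : ∀ z : T ⊗[ℂ] (T ⊗[ℂ] B), TensorProduct.map (b.βL.lTensor T) (linExt A.act)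
      ((TensorProduct.assoc ℂ T B (T ⊗[ℂ] B)).symm ((split b T).lTensor T z)) =
      R ((N₂.lTensor B ∘ₗ split b T).lTensor T z) := by
    intro z
    induction z with
    | zero => simp
    | add a b ha hb => simp only [map_add, ha, hb]
    | tmul t u =>
      induction u with
      | zero => simp
      | add a b ha hb => simp only [map_add, TensorProduct.tmul_add, ha, hb]
      | tmul t' y =>
        -- `c ⊗ (p ⊗ q) ↦ (t ⊗ (c ⊗ p)) ⊗ t' ◁ q`
        let L : C ⊗[ℂ] (B ⊗[ℂ] B) →ₗ[ℂ] (T ⊗[ℂ] (C ⊗[ℂ] B)) ⊗[ℂ] T :=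
          TensorProduct.map (TensorProduct.mk ℂ T (C ⊗[ℂ] B) t)
            (linExt A.act ∘ₗ TensorProduct.mk ℂ T B t') ∘ₗ
              (TensorProduct.assoc ℂ C B B).symm.toLinearMap
        have e1 : ∀ v : B ⊗[ℂ] B, TensorProduct.map (b.βL.lTensor T) (linExt A.act)
            ((TensorProduct.assoc ℂ T B (T ⊗[ℂ] B)).symm (t ⊗ₜ
              TensorProduct.leftComm ℂ T B B (t' ⊗ₜ v))) =
            L (TensorProduct.assoc ℂ C B B (b.βL.rTensor B v)) := by
          intro v
          induction v with
          | zero => simp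
          | add a b ha hb => simp only [map_add, TensorProduct.tmul_add, ha, hb]
          | tmul p q => simp [L]
        have e2 : ∀ v : B ⊗[ℂ] B, R (t ⊗ₜ N₂.lTensor B
              (TensorProduct.leftComm ℂ T B B (t' ⊗ₜ v))) =
            L (TensorProduct.leftComm ℂ B C B (b.copL.lTensor B v)) := by
          intro v
          induction v with
          | zero => simp
          | add a b ha hb => simp only [map_add, TensorProduct.tmul_add, ha, hb]
          | tmul p q =>
            simp only [N₂, TensorProduct.leftComm_tmul, LinearMap.lTensor_tmul,
              LinearMap.comp_apply, LinearEquiv.coe_coe]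
            induction b.copL q with
            | zero => simp
            | add a b ha hb => simp only [map_add, TensorProduct.tmul_add, ha, hb]
            | tmul c d => simp [R, L]
        have e3 : split b T (t' ⊗ₜ y) =
            TensorProduct.leftComm ℂ T B B (t' ⊗ₜ Coalgebra.comul y) := by simp [split]
        show TensorProduct.map (b.βL.lTensor T) (linExt A.act)
          ((TensorProduct.assoc ℂ T B (T ⊗[ℂ] B)).symm (t ⊗ₜ split b T (t' ⊗ₜ y))) =
            R (t ⊗ₜ N₂.lTensor B (split b T (t' ⊗ₜ y)))
        rw [e3, e1, e2, b.copL_comul]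
  rw [cotensorDiff, tensorMap_sub_left, LinearMap.sub_apply, hR₁, hR₂, ← map_sub,
    ← LinearMap.sub_apply, ← LinearMap.lTensor_sub, ← LinearMap.sub_comp, ← LinearMap.lTensor_sub,
    hzero, map_zero]

/-- The subspace `I` is a coideal, so that `S = T / I` is a coalgebra. -/
instance isCoideal : A.orbitCoideal.IsCoideal where
  counit_eq_zero := by
    rintro _ ⟨w, rfl⟩
    have h : ∀ z : T ⊗[ℂ] B, TensorProduct.lid ℂ ℂ
        (TensorProduct.map (Coalgebra.counit (R := ℂ) (A := T))
          (Coalgebra.counit (R := ℂ) (A := B)) z) = Coalgebra.counit (R := ℂ)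
        (TensorProduct.rid ℂ T ((Coalgebra.counit (R := ℂ) (A := B)).lTensor T z)) := by
      intro z
      induction z with
      | zero => simp
      | add a b ha hb => simp only [map_add, ha, hb]
      | tmul x y => simp [mul_comm]
    rw [LinearMap.sub_apply, map_sub, A.counit_act, h, sub_eq_zero]
    rfl
  map_mkQ_comul_eq_zero := by
    rintro _ ⟨w, rfl⟩
    let I := A.orbitCoideal
    let ρ : T ⊗[ℂ] B →ₗ[ℂ] T :=
      (TensorProduct.rid ℂ T).toLinearMap ∘ₗ (Coalgebra.counit (R := ℂ) (A := B)).lTensor T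
    obtain ⟨h, hh⟩ := exists_factor_of_ker_le (cotensorDiff A.baseCoact b.βL)
      (I.mkQ ∘ₗ linExt A.act - I.mkQ ∘ₗ ρ) (by
        intro x hx
        rw [LinearMap.sub_apply, LinearMap.comp_apply, LinearMap.comp_apply, ← map_sub,
          Submodule.mkQ_apply, Submodule.Quotient.mk_eq_zero, linExt_apply A.act ⟨x, hx⟩]
        exact ⟨⟨x, hx⟩, rfl⟩)
    let Z := TensorProduct.assoc ℂ T T B
      ((Coalgebra.comul (R := ℂ) (A := T)).rTensor B (w : T ⊗[ℂ] B))
    let U := (TensorProduct.assoc ℂ T B (T ⊗[ℂ] B)).symm ((split b T).lTensor T Z)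
    have hU : TensorProduct.tensorTensorTensorComm ℂ T T B B
        (TensorProduct.map (Coalgebra.comul (R := ℂ) (A := T)) (Coalgebra.comul (R := ℂ) (A := B))
          (w : T ⊗[ℂ] B)) = U := by
      simp only [U, Z]
      induction (w : T ⊗[ℂ] B) with
      | zero => simp
      | add a b ha hb => simp only [map_add, ha, hb]
      | tmul x y =>
        simp only [TensorProduct.map_tmul, LinearMap.rTensor_tmul]
        induction Coalgebra.comul (R := ℂ) x with
        | zero => simp
        | add a b ha hb => simp only [map_add, TensorProduct.add_tmul, ha, hb]
        | tmul t t' =>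
          simp only [split, TensorProduct.assoc_tmul, LinearMap.lTensor_tmul, LinearMap.comp_apply,
            LinearEquiv.coe_coe]
          induction Coalgebra.comul (R := ℂ) y with
          | zero => simp
          | add a b ha hb => simp only [map_add, TensorProduct.tmul_add, ha, hb]
          | tmul p q => simp
    have h1 : TensorProduct.map (I.mkQ ∘ₗ linExt A.act) (I.mkQ ∘ₗ linExt A.act) U =
        TensorProduct.map (I.mkQ ∘ₗ ρ) (I.mkQ ∘ₗ linExt A.act) U := by
      rw [← sub_eq_zero, ← LinearMap.sub_apply, ← tensorMap_sub_left, hh,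
        TensorProduct.map_comp, LinearMap.comp_apply, A.map_cotensorDiff_comul w w.2, map_zero]
    have h2 : ∀ z : T ⊗[ℂ] (T ⊗[ℂ] B), TensorProduct.map (I.mkQ ∘ₗ ρ) (I.mkQ ∘ₗ linExt A.act)
        ((TensorProduct.assoc ℂ T B (T ⊗[ℂ] B)).symm ((split b T).lTensor T z)) =
        TensorProduct.map I.mkQ (I.mkQ ∘ₗ linExt A.act) z := by
      intro z
      induction z with
      | zero => simp
      | add a b ha hb => simp only [map_add, ha, hb]
      | tmul t u =>
        induction u with
        | zero => simp
        | add a b ha hb => simp only [map_add, TensorProduct.tmul_add, ha, hb]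
        | tmul t' y =>
          have e1 : ∀ v : B ⊗[ℂ] B, TensorProduct.map (I.mkQ ∘ₗ ρ) (I.mkQ ∘ₗ linExt A.act)
              ((TensorProduct.assoc ℂ T B (T ⊗[ℂ] B)).symm
                (t ⊗ₜ TensorProduct.leftComm ℂ T B B (t' ⊗ₜ v))) =
              I.mkQ t ⊗ₜ (I.mkQ (linExt A.act (t' ⊗ₜ TensorProduct.lid ℂ B
                ((Coalgebra.counit (R := ℂ) (A := B)).rTensor B v)))) := by
            intro v
            induction v with
            | zero => simp
            | add a b ha hb => simp only [map_add, TensorProduct.tmul_add, ha, hb]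
            | tmul p q => simp [ρ, TensorProduct.smul_tmul]
          simp only [split, LinearMap.lTensor_tmul, LinearMap.comp_apply, LinearEquiv.coe_coe]
          rw [e1, Coalgebra.rTensor_counit_comul]
          simp
    have h3 : TensorProduct.map I.mkQ (I.mkQ ∘ₗ linExt A.act) Z =
        TensorProduct.map I.mkQ (I.mkQ ∘ₗ ρ) Z := by
      rw [← sub_eq_zero, ← LinearMap.sub_apply, ← tensorMap_sub_right, hh,
        ← LinearMap.comp_id I.mkQ, TensorProduct.map_comp, LinearMap.comp_apply]
      refine (congrArg _ (A.lTensor_cotensorDiff_comul w w.2)).trans (map_zero _)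
    have h4 : TensorProduct.map I.mkQ (I.mkQ ∘ₗ ρ) Z =
        TensorProduct.map I.mkQ I.mkQ (Coalgebra.comul (ρ w)) := by
      simp only [Z]
      induction (w : T ⊗[ℂ] B) with
      | zero => simp
      | add a b ha hb => simp only [map_add, ha, hb]
      | tmul x y =>
        simp only [ρ, LinearMap.comp_apply, LinearMap.lTensor_tmul, LinearMap.rTensor_tmul,
          LinearEquiv.coe_coe, TensorProduct.rid_tmul, map_smul]
        induction Coalgebra.comul (R := ℂ) x with
        | zero => simp
        | add a b ha hb => simp only [map_add, TensorProduct.add_tmul, smul_add, ha, hb]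
        | tmul t t' => simp
    rw [LinearMap.sub_apply, map_sub, map_sub, A.comul_act, hU, ← LinearMap.comp_apply,
      ← TensorProduct.map_comp]
    exact sub_eq_zero.2 ((h1.trans (h2 Z)).trans (h3.trans h4))

end RightModuleCoalgebra

/-! ### Right-left stable anti-Yetter-Drinfeld modules -/

/-- A right-left stable anti-Yetter-Drinfeld structure over a right `×_C`-Hopf coalgebra on the
vector space `M`: a right `B`-module and left `B`-comodule structure such that the two underlying
`C`-bicomodule structures agree, with the anti-Yetter-Drinfeld and the stability condition. -/
structure RightLeftSAYDStr (b : RightHopfCoalgebra C B) (M : Type v) [AddCommGroup M]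
    [Module ℂ M] extends RightModuleStr b.toRightBicoalgebroid M where
  coact : M →ₗ[ℂ] B ⊗[ℂ] M
  isLeftCoaction_coact : IsLeftCoaction coact
  /-- the right `C`-coaction is `m ↦ m₀ ⊗ β(m₋₁)` -/
  baseCoact_eq : ∀ m, baseCoact m = b.β.lTensor M (TensorProduct.comm ℂ B M (coact m))
  /-- the left `C`-coaction `m ↦ α(m₋₁) ⊗ m₀` is the canonical one -/
  canonicalCoact_eq : ∀ m, b.α.rTensor M (coact m) = toRightModuleStr.canonicalCoact m
  /-- `(m ◁ b)₋₁ ⊗ (m ◁ b)₀ = ν⁺(b₂, m₋₁) b₁ ⊗ m₀ ◁ ν⁻(b₂, m₋₁)`. The permutations turn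
  `(m₋₁ ⊗ m₀) ⊗ (b₂ ⊗ b₁)` into `(b₂ ⊗ m₋₁) ⊗ (b₁ ⊗ m₀)`, and then `(ν⁻ ⊗ ν⁺) ⊗ (b₁ ⊗ m₀)` into
  `(ν⁺ ⊗ b₁) ⊗ (ν⁻ ⊗ m₀)`. -/
  ayd : ∀ w, coact (act w) =
    TensorProduct.map (linExt b.μ) (linExt act ∘ₗ (TensorProduct.comm ℂ B M).toLinearMap)
      (TensorProduct.tensorTensorTensorComm ℂ B B B M
        (((TensorProduct.comm ℂ B B).toLinearMap ∘ₗ b.νInv).rTensor (B ⊗[ℂ] M)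
          (TensorProduct.map (TensorProduct.comm ℂ B B).toLinearMap
              (TensorProduct.comm ℂ M B).toLinearMap
            (TensorProduct.tensorTensorTensorComm ℂ B M B B
              (TensorProduct.map coact
                ((TensorProduct.comm ℂ B B).toLinearMap ∘ₗ Coalgebra.comul) (w : M ⊗[ℂ] B))))))
  /-- `m₀ ◁ m₋₁ = m` -/
  stable : ∀ m, linExt act (TensorProduct.comm ℂ B M (coact m)) = m

/-- A right-left stable anti-Yetter-Drinfeld module. -/
structure RightLeftSAYD (b : RightHopfCoalgebra C B) where
  carrier : Type v
  [addCommGroup : AddCommGroup carrier]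
  [module : Module ℂ carrier]
  str : RightLeftSAYDStr b carrier

namespace RightLeftSAYD

attribute [instance] RightLeftSAYD.addCommGroup RightLeftSAYD.module

variable {b : RightHopfCoalgebra C B}

/-- A `B`-linear and `B`-colinear map. -/
@[ext]
structure Hom (M N : RightLeftSAYD.{u₁, u₂, v} b) where
  toLinearMap : M.carrier →ₗ[ℂ] N.carrier
  map_baseCoact : ∀ m, N.str.baseCoact (toLinearMap m) = toLinearMap.rTensor C (M.str.baseCoact m)
  map_act : ∀ w, toLinearMap (M.str.act w) =
    linExt N.str.act (toLinearMap.rTensor B (w : M.carrier ⊗[ℂ] B))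
  map_coact : ∀ m, N.str.coact (toLinearMap m) = toLinearMap.lTensor B (M.str.coact m)

theorem map_act_rTensor {M N : RightLeftSAYD.{u₁, u₂, v} b} (f : Hom M N)
    (w : M.carrier ⊗[ℂ] B) (hw : w ∈ cotensor M.str.baseCoact b.βL) :
    f.toLinearMap (linExt M.str.act w) =
      linExt N.str.act (f.toLinearMap.rTensor B w) := by
  rw [linExt_apply M.str.act ⟨w, hw⟩]
  exact f.map_act ⟨w, hw⟩

theorem rTensor_mem {M N : RightLeftSAYD.{u₁, u₂, v} b} (f : Hom M N)
    (w : M.carrier ⊗[ℂ] B) (hw : w ∈ cotensor M.str.baseCoact b.βL) :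
    f.toLinearMap.rTensor B w ∈ cotensor N.str.baseCoact b.βL := by
  have h1 : ∀ z : M.carrier ⊗[ℂ] B, cotensorDiff N.str.baseCoact b.βL
      (f.toLinearMap.rTensor B z) =
        f.toLinearMap.rTensor (C ⊗[ℂ] B) (cotensorDiff M.str.baseCoact b.βL z) := by
    intro z
    induction z with
    | zero => simp
    | add a b ha hb => simp only [map_add, ha, hb]
    | tmul x y =>
      simp only [cotensorDiff, LinearMap.sub_apply, LinearMap.comp_apply, LinearEquiv.coe_coe,
        LinearMap.rTensor_tmul, LinearMap.lTensor_tmul, map_sub, f.map_baseCoact]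
      congr 1
      induction M.str.baseCoact x with
      | zero => simp
      | add a b ha hb => simp only [map_add, TensorProduct.add_tmul, ha, hb]
      | tmul a b => simp
  rw [cotensor, LinearMap.mem_ker] at hw ⊢
  rw [h1, hw, map_zero]

instance : Category (RightLeftSAYD.{u₁, u₂, v} b) where
  Hom := Hom
  id M :=
    { toLinearMap := LinearMap.id
      map_baseCoact := fun m => by simp
      map_act := fun w => by
        rw [LinearMap.rTensor_id, LinearMap.id_apply, LinearMap.id_apply, linExt_apply]
      map_coact := fun m => by simp }
  comp f g :=
    { toLinearMap := g.toLinearMap ∘ₗ f.toLinearMap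
      map_baseCoact := fun m => by
        rw [LinearMap.comp_apply, g.map_baseCoact, f.map_baseCoact, LinearMap.rTensor_comp,
          LinearMap.comp_apply]
      map_act := fun w => by
        rw [LinearMap.comp_apply, f.map_act, map_act_rTensor g _ (rTensor_mem f w w.2),
          LinearMap.rTensor_comp, LinearMap.comp_apply]
      map_coact := fun m => by
        rw [LinearMap.comp_apply, g.map_coact, f.map_coact, LinearMap.lTensor_comp,
          LinearMap.comp_apply] }

end RightLeftSAYD

end Right

/-! ### Comodule coalgebras and equivariant Galois coextensions -/

section Coextension

/-- A left comodule coalgebra over a left `×_C`-Hopf coalgebra. The `C`-bicomodule structure of `T`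
is `t ↦ α(t₋₁) ⊗ t₀` and `t ↦ t₀ ⊗ β(t₋₁)`. -/
structure LeftComoduleCoalgebra {C : Type u₁} {K : Type u₂} [AddCommGroup C] [Module ℂ C]
    [Coalgebra ℂ C] [AddCommGroup K] [Module ℂ K] [Coalgebra ℂ K] (k : LeftHopfCoalgebra C K)
    (T : Type u₃) [AddCommGroup T] [Module ℂ T] [Coalgebra ℂ T] where
  coact : T →ₗ[ℂ] K ⊗[ℂ] T
  isLeftCoaction_coact : IsLeftCoaction coact
  /-- `t₋₁ ε(t₀) = η(α(t₋₁)) ε(t₀)` -/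
  counit_coact : ∀ t,
    TensorProduct.rid ℂ K ((Coalgebra.counit (R := ℂ) (A := T)).lTensor K (coact t)) =
      k.η (k.α (TensorProduct.rid ℂ K
        ((Coalgebra.counit (R := ℂ) (A := T)).lTensor K (coact t))))
  /-- `t₋₁ ⊗ (t₀)₁ ⊗ (t₀)₂ = (t₁)₋₁ (t₂)₋₁ ⊗ (t₁)₀ ⊗ (t₂)₀` -/
  comul_coact : ∀ t, (Coalgebra.comul (R := ℂ) (A := T)).lTensor K (coact t) =
    (linExt k.μ).rTensor (T ⊗[ℂ] T) (TensorProduct.tensorTensorTensorComm ℂ K T K T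
      (TensorProduct.map coact coact (Coalgebra.comul (R := ℂ) t)))
  /-- `β((t₁)₋₁) ⊗ (t₁)₀ ⊗ t₂ = α((t₂)₋₁) ⊗ t₁ ⊗ (t₂)₀` -/
  cobalanced : ∀ t, TensorProduct.assoc ℂ C T T
      ((k.β.rTensor T ∘ₗ coact).rTensor T (Coalgebra.comul (R := ℂ) t)) =
    TensorProduct.leftComm ℂ T C T
      ((k.α.rTensor T ∘ₗ coact).lTensor T (Coalgebra.comul (R := ℂ) t))

variable {C : Type u₁} {B : Type u₂} {T : Type u₃} {K : Type u₄}
  [AddCommGroup C] [Module ℂ C] [Coalgebra ℂ C] [AddCommGroup B] [Module ℂ B] [Coalgebra ℂ B]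
  [AddCommGroup T] [Module ℂ T] [Coalgebra ℂ T] [AddCommGroup K] [Module ℂ K] [Coalgebra ℂ K]

namespace RightModuleCoalgebra

variable {b : RightBicoalgebroid C B} (A : RightModuleCoalgebra b T)

/-- The coalgebra `S = T / I`. -/
abbrev Orbit : Type u₃ := T ⧸ A.orbitCoideal

/-- The left `S`-coaction `t ↦ π(t₁) ⊗ t₂`. -/
def orbitL : T →ₗ[ℂ] A.Orbit ⊗[ℂ] T := A.orbitCoideal.mkQ.rTensor T ∘ₗ Coalgebra.comul

/-- The right `S`-coaction `t ↦ t₁ ⊗ π(t₂)`. -/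
def orbitR : T →ₗ[ℂ] T ⊗[ℂ] A.Orbit := A.orbitCoideal.mkQ.lTensor T ∘ₗ Coalgebra.comul

/-- The canonical map `t ⊗ b ↦ t₁ ⊗ t₂ ◁ b`. -/
def can : T ⊗[ℂ] B →ₗ[ℂ] T ⊗[ℂ] T :=
  (linExt A.act).lTensor T ∘ₗ (TensorProduct.assoc ℂ T T B).toLinearMap ∘ₗ
    (Coalgebra.comul (R := ℂ) (A := T)).rTensor B

end RightModuleCoalgebra

/-- A right `B`-module coalgebra `T` is a `K`-equivariant `B`-Galois coextension of `S = T / I` if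
it is a left `K`-comodule coalgebra over the left `×_S`-Hopf coalgebra `K` such that the map `can`
is a bijection and the action of `B` is `K`-equivariant. -/
structure EquivariantGaloisCoextension {b : RightHopfCoalgebra C B}
    (A : RightModuleCoalgebra b.toRightBicoalgebroid T) (k : LeftHopfCoalgebra A.Orbit K)
    extends LeftComoduleCoalgebra k T where
  /-- the `S`-bicomodule structure of the `K`-comodule `T` is the one given by `π : T → S` -/
  α_coact : ∀ t, k.α.rTensor T (coact t) = A.orbitL t
  β_coact : ∀ t, TensorProduct.comm ℂ A.Orbit T (k.β.rTensor T (coact t)) = A.orbitR t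
  /-- the `K`-coaction is right `C`-colinear, so that `K` coacts on `T □_C B` -/
  baseCoact_coact : ∀ t, A.baseCoact.lTensor K (coact t) =
    TensorProduct.assoc ℂ K T C (coact.rTensor C (A.baseCoact t))
  /-- `(t ◁ b)₋₁ ⊗ (t ◁ b)₀ = t₋₁ ⊗ t₀ ◁ b` -/
  equivariant : ∀ w, coact (A.act w) =
    (linExt A.act).lTensor K (TensorProduct.assoc ℂ K T B (coact.rTensor B (w : T ⊗[ℂ] B)))
  /-- `can : T □_C B → T □_S T` is bijective -/
  can_bijOn : Set.BijOn A.can (cotensor A.baseCoact b.βL) (cotensor A.orbitR A.orbitL)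

namespace EquivariantGaloisCoextension

variable {b : RightHopfCoalgebra C B} {A : RightModuleCoalgebra b.toRightBicoalgebroid T}
  {k : LeftHopfCoalgebra A.Orbit K} (E : EquivariantGaloisCoextension A k)

/-- `κ = (ε ⊗ id) ∘ can⁻¹`, a map `T □_S T → B`. -/
def κ : T ⊗[ℂ] T →ₗ[ℂ] B :=
  (TensorProduct.lid ℂ B).toLinearMap ∘ₗ (Coalgebra.counit (R := ℂ) (A := T)).rTensor B ∘ₗ
    invOn A.can E.can_bijOn

/-- The vector space `M □_K T`. -/
abbrev tilde (M : LeftRightSAYD k) : Submodule ℂ (M.carrier ⊗[ℂ] T) :=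
  cotensor M.str.coact E.coact

/-- `m ⊗ t ↦ t₋₁ ▷ m ⊗ t₀` -/
def twist (M : LeftRightSAYD k) : M.carrier ⊗[ℂ] T →ₗ[ℂ] M.carrier ⊗[ℂ] T :=
  (linExt M.str.act ∘ₗ (TensorProduct.comm ℂ M.carrier K).toLinearMap).rTensor T ∘ₗ
    (TensorProduct.assoc ℂ M.carrier K T).symm.toLinearMap ∘ₗ E.coact.lTensor M.carrier

/-- `m ⊗ t ↦ κ(((t₂)₀)₂ ⊗ t₁) ⊗ ((t₂)₋₁ ▷ m ⊗ ((t₂)₀)₁)`. The elements are rearranged as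
`m ⊗ t ↦ (m ⊗ t₂) ⊗ t₁ ↦ (m' ⊗ (u₁ ⊗ u₂)) ⊗ t₁ ↦ (m' ⊗ u₁) ⊗ (u₂ ⊗ t₁)`, where
`m' ⊗ u = (t₂)₋₁ ▷ m ⊗ (t₂)₀`. -/
def tildeCoact (M : LeftRightSAYD k) :
    M.carrier ⊗[ℂ] T →ₗ[ℂ] B ⊗[ℂ] (M.carrier ⊗[ℂ] T) :=
  (TensorProduct.comm ℂ (M.carrier ⊗[ℂ] T) B).toLinearMap ∘ₗ
    E.κ.lTensor (M.carrier ⊗[ℂ] T) ∘ₗ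
    (TensorProduct.assoc ℂ (M.carrier ⊗[ℂ] T) T T).toLinearMap ∘ₗ
    ((TensorProduct.assoc ℂ M.carrier T T).symm.toLinearMap ∘ₗ
      (Coalgebra.comul (R := ℂ) (A := T)).lTensor M.carrier ∘ₗ E.twist M).rTensor T ∘ₗ
    (TensorProduct.assoc ℂ M.carrier T T).symm.toLinearMap ∘ₗ
    ((TensorProduct.comm ℂ T T).toLinearMap ∘ₗ Coalgebra.comul).lTensor M.carrier

end EquivariantGaloisCoextension

end Coextension

end

/-!
Let `x = m ⊗ t` be an element of `M □_K T`. The proof rests on the *rotation*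
`θ(x) = (t₂)₋₁ ▷ m ⊗ ((t₂)₀ ⊗ t₁)`. The two `S`-coactions of `M` are determined by its
`K`-coaction, hence on `M □_K T` they are given by `π : T → S`; therefore `θ` takes its values in
`M ⊗ (T □_S T)` (`LeftRightSAYDStr.rotate_mem`), where the canonical map can be inverted. The left
`B`-coaction of `M □_K T` is `can⁻¹ ∘ θ` up to the order of the tensor factors
(`cotensorCoact`); since `can⁻¹(u ⊗ v) = u₁ ⊗ κ(u₂ ⊗ v)` (`sw_comul_κ`), this is the coaction
written with `κ`.

The coaction has values in `B ⊗ (M □_K T)` because `θ` and `can⁻¹` are `K`-colinear. For `θ` this is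
the anti-Yetter-Drinfeld condition of `M`: the inverse Galois map in it cancels against the product
of `K` in the diagonal coaction of `T □_S T` (`LeftRightSAYDStr.sw_coact_rotate`).

Coassociativity comes from the composition law of rotations
(`LeftRightSAYDStr.sw_rotate_rotate`): turning three tensor factors by one place, twice, amounts to
turning them by two places, because a full turn is `m₁ ▷ m₀ = m`. Together with the colinearity of
`can⁻¹` for the left and the right coactions of `T` it gives `cotensorCoact_coassoc`. Counitality
is the stability of `M`, and the stability of `M □_K T` is the unitality of the `K`-action.

The anti-Yetter-Drinfeld condition of `M □_K T` is checked after applying `can`. The canonical map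
is intertwined by the action with the Galois map of `B` (`RightModuleCoalgebra.can_act`), which
cancels the `ν⁻¹` of the condition, and what remains is the rotation of `x ◁ e` (`rotate_act`). The
domains of the products involved, triple cotensor products, are controlled by
`RightModuleStr.act_νInv_mem`.

All computations are done in a Sweedler calculus: `sw z fun a b => f a b` is the value of the
bilinear function `f` on the tensor `z = ∑ a ⊗ b`. Partially defined operations are only applied to
elements of `R ⊗ p` (`withParam R p`), where `p` is the domain and `R` collects the tensor factors
that do not take part; `sw_congr_of_mem_withParam` transfers an equation valid on `p` to such
elements.
-/

noncomputable section

local notation "Δ" => Coalgebra.comul (R := ℂ)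
local notation "ε" => Coalgebra.counit (R := ℂ)

/-! ### Sweedler calculus -/

section Sweedler

variable {V W U X Y Z R : Type*}
  [AddCommGroup V] [Module ℂ V] [AddCommGroup W] [Module ℂ W] [AddCommGroup U] [Module ℂ U]
  [AddCommGroup X] [Module ℂ X] [AddCommGroup Y] [Module ℂ Y] [AddCommGroup Z] [Module ℂ Z]
  [AddCommGroup R] [Module ℂ R]

/-- Linearity of an unbundled function. As a `fun_prop` predicate it lets the side conditions of
the Sweedler calculus be checked automatically. -/
@[fun_prop]
structure Lin (f : V → W) : Prop where
  add : ∀ x y, f (x + y) = f x + f y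
  smul : ∀ (c : ℂ) x, f (c • x) = c • f x

namespace Lin

/-- The bundled version of a linear function. -/
def bundle {f : V → W} (h : Lin f) : V →ₗ[ℂ] W where
  toFun := f
  map_add' := h.add
  map_smul' := h.smul

@[simp] theorem bundle_apply {f : V → W} (h : Lin f) (x : V) : h.bundle x = f x := rfl

theorem map_zero {f : V → W} (h : Lin f) : f 0 = 0 := h.bundle.map_zero

@[fun_prop] theorem id : Lin (fun x : V => x) := ⟨fun _ _ => rfl, fun _ _ => rfl⟩

@[fun_prop] theorem comp {f : W → U} {g : V → W} (hf : Lin f) (hg : Lin g) :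
    Lin (fun x => f (g x)) :=
  ⟨fun x y => by rw [hg.add, hf.add], fun c x => by rw [hg.smul, hf.smul]⟩

@[fun_prop] theorem linearMap (φ : V →ₗ[ℂ] W) : Lin (fun x => φ x) :=
  ⟨map_add φ, map_smul φ⟩

@[fun_prop] theorem linearEquiv (φ : V ≃ₗ[ℂ] W) : Lin (fun x => φ x) :=
  ⟨map_add φ, map_smul φ⟩

@[fun_prop] theorem coe (p : Submodule ℂ V) : Lin fun x : p => (x : V) := linearMap p.subtype

@[fun_prop] theorem tmul_left (y : Y) {f : V → X} (hf : Lin f) : Lin (fun x => f x ⊗ₜ[ℂ] y) :=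
  ⟨fun a b => by rw [hf.add, TensorProduct.add_tmul],
    fun c a => by rw [hf.smul, TensorProduct.smul_tmul']⟩

@[fun_prop] theorem tmul_right (x : X) {f : V → Y} (hf : Lin f) : Lin (fun y => x ⊗ₜ[ℂ] f y) :=
  ⟨fun a b => by rw [hf.add, TensorProduct.tmul_add],
    fun c a => by rw [hf.smul, TensorProduct.tmul_smul]⟩

@[fun_prop] theorem smul_left (y : Y) {f : V → ℂ} (hf : Lin f) : Lin (fun x => f x • y) :=
  ⟨fun a b => by rw [hf.add, add_smul], fun c a => by rw [hf.smul, smul_assoc]⟩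

@[fun_prop] theorem smul_right (c : ℂ) {f : V → Y} (hf : Lin f) : Lin (fun x => c • f x) :=
  ⟨fun a b => by rw [hf.add, smul_add], fun d a => by rw [hf.smul, smul_comm]⟩

end Lin

theorem exists_sum_range_tmul (z : X ⊗[ℂ] Y) : ∃ (n : ℕ) (l : ℕ → X) (r : ℕ → Y),
    z = ∑ i ∈ Finset.range n, l i ⊗ₜ[ℂ] r i := by
  obtain ⟨k, l, r, h⟩ := TensorProduct.exists_sum_tmul_eq z
  refine ⟨k, fun i => if h : i < k then l ⟨i, h⟩ else 0,
    fun i => if h : i < k then r ⟨i, h⟩ else 0, ?_⟩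
  rw [h, Finset.sum_range]
  simp

/-- Sweedler notation: if `z = ∑ aᵢ ⊗ bᵢ`, then `sw z fun a b => f a b` is `∑ f aᵢ bᵢ`. The sum
runs over a chosen representation of `z`, on which it does not depend when `f` is bilinear. -/
def sw (z : X ⊗[ℂ] Y) (f : X → Y → V) : V :=
  ∑ i ∈ Finset.range (exists_sum_range_tmul z).choose,
    f ((exists_sum_range_tmul z).choose_spec.choose i)
      ((exists_sum_range_tmul z).choose_spec.choose_spec.choose i)

theorem sw_tmul_self (z : X ⊗[ℂ] Y) : sw z (fun a b => a ⊗ₜ[ℂ] b) = z :=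
  (exists_sum_range_tmul z).choose_spec.choose_spec.choose_spec.symm

theorem sw_congr (z : X ⊗[ℂ] Y) {f g : X → Y → V} (h : ∀ a b, f a b = g a b) : sw z f = sw z g :=
  congrArg _ (funext fun a => funext fun b => h a b)

theorem map_sw (φ : V →ₗ[ℂ] W) (z : X ⊗[ℂ] Y) (f : X → Y → V) :
    φ (sw z f) = sw z fun a b => φ (f a b) := map_sum φ _ _

theorem equiv_sw (φ : V ≃ₗ[ℂ] W) (z : X ⊗[ℂ] Y) (f : X → Y → V) :
    φ (sw z f) = sw z fun a b => φ (f a b) := map_sum φ _ _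

theorem smul_sw (c : ℂ) (z : X ⊗[ℂ] Y) (f : X → Y → V) :
    c • sw z f = sw z fun a b => c • f a b := Finset.smul_sum

theorem sw_tmul (z : X ⊗[ℂ] Y) (f : X → Y → V) (w : W) :
    sw z f ⊗ₜ[ℂ] w = sw z fun a b => f a b ⊗ₜ[ℂ] w := TensorProduct.sum_tmul _ _ _

theorem tmul_sw (z : X ⊗[ℂ] Y) (f : X → Y → V) (w : W) :
    w ⊗ₜ[ℂ] sw z f = sw z fun a b => w ⊗ₜ[ℂ] f a b := TensorProduct.tmul_sum _ _ _

theorem sw_comm {X' Y' : Type*} [AddCommGroup X'] [Module ℂ X'] [AddCommGroup Y'] [Module ℂ Y']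
    (z : X ⊗[ℂ] Y) (w : X' ⊗[ℂ] Y') (f : X → Y → X' → Y' → V) :
    sw z (fun a b => sw w fun c d => f a b c d) = sw w fun c d => sw z fun a b => f a b c d :=
  Finset.sum_comm

theorem sw_eq_lift (z : X ⊗[ℂ] Y) (f : X →ₗ[ℂ] Y →ₗ[ℂ] V) :
    sw z (fun a b => f a b) = TensorProduct.lift f z := by
  conv_rhs => rw [← sw_tmul_self z, map_sw]
  rfl

/-- The bundled version of a bilinear function. -/
def bilin {f : X → Y → V} (h₁ : ∀ y, Lin fun x => f x y) (h₂ : ∀ x, Lin fun y => f x y) :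
    X →ₗ[ℂ] Y →ₗ[ℂ] V :=
  LinearMap.mk₂ ℂ f (fun a b y => (h₁ y).add a b) (fun c a y => (h₁ y).smul c a)
    (fun x a b => (h₂ x).add a b) (fun c x a => (h₂ x).smul c a)

theorem sw_eq_bilin {f : X → Y → V} (h₁ : ∀ y, Lin fun x => f x y) (h₂ : ∀ x, Lin fun y => f x y)
    (z : X ⊗[ℂ] Y) : sw z f = TensorProduct.lift (bilin h₁ h₂) z :=
  sw_eq_lift z (bilin h₁ h₂)

theorem sw_apply (x : X) (y : Y) (f : X → Y → V) (h₁ : ∀ y, Lin fun x => f x y)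
    (h₂ : ∀ x, Lin fun y => f x y) : sw (x ⊗ₜ[ℂ] y) f = f x y := by
  rw [sw_eq_bilin h₁ h₂, TensorProduct.lift.tmul]
  rfl

@[fun_prop] theorem Lin.sw_left {z : W → X ⊗[ℂ] Y} {f : X → Y → V} (h₁ : ∀ y, Lin fun x => f x y)
    (h₂ : ∀ x, Lin fun y => f x y) (hz : Lin z) : Lin fun w => sw (z w) f := by
  simp only [sw_eq_bilin h₁ h₂]
  fun_prop

@[fun_prop] theorem Lin.sw_right (z : X ⊗[ℂ] Y) {f : W → X → Y → V}
    (h : ∀ x y, Lin fun w => f w x y) : Lin fun w => sw z (f w) := by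
  constructor
  · intro a b
    simp only [sw, (h _ _).add, Finset.sum_add_distrib]
  · intro c a
    simp only [sw, (h _ _).smul, Finset.smul_sum]

/-- Substitution of a sum of pure tensors. -/
theorem sw_sw (z : X ⊗[ℂ] Y) {V' W' : Type*} [AddCommGroup V'] [Module ℂ V'] [AddCommGroup W']
    [Module ℂ W'] (f : X → Y → V' ⊗[ℂ] W') (g : V' → W' → V)
    (h₁ : ∀ y, Lin fun x => g x y) (h₂ : ∀ x, Lin fun y => g x y) :
    sw (sw z f) g = sw z fun a b => sw (f a b) g := by
  simp only [sw_eq_bilin h₁ h₂, map_sw]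

theorem rTensor_eq_sw (φ : X →ₗ[ℂ] W) (z : X ⊗[ℂ] Y) :
    φ.rTensor Y z = sw z fun a b => φ a ⊗ₜ[ℂ] b := by
  conv_lhs => rw [← sw_tmul_self z, map_sw]
  rfl

theorem lTensor_eq_sw (φ : Y →ₗ[ℂ] W) (z : X ⊗[ℂ] Y) :
    φ.lTensor X z = sw z fun a b => a ⊗ₜ[ℂ] φ b := by
  conv_lhs => rw [← sw_tmul_self z, map_sw]
  rfl

theorem map_eq_sw (φ : X →ₗ[ℂ] V) (ψ : Y →ₗ[ℂ] W) (z : X ⊗[ℂ] Y) :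
    TensorProduct.map φ ψ z = sw z fun a b => φ a ⊗ₜ[ℂ] ψ b := by
  conv_lhs => rw [← sw_tmul_self z, map_sw]
  rfl

theorem comm_eq_sw (z : X ⊗[ℂ] Y) :
    TensorProduct.comm ℂ X Y z = sw z fun a b => b ⊗ₜ[ℂ] a := by
  conv_lhs => rw [← sw_tmul_self z, equiv_sw]
  rfl

theorem lid_eq_sw (z : ℂ ⊗[ℂ] Y) : TensorProduct.lid ℂ Y z = sw z fun a b => a • b := by
  conv_lhs => rw [← sw_tmul_self z, equiv_sw]
  rfl

theorem rid_eq_sw (z : Y ⊗[ℂ] ℂ) : TensorProduct.rid ℂ Y z = sw z fun a b => b • a := by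
  conv_lhs => rw [← sw_tmul_self z, equiv_sw]
  rfl

theorem assoc_eq_sw (z : (X ⊗[ℂ] Y) ⊗[ℂ] Z) :
    TensorProduct.assoc ℂ X Y Z z =
      sw z fun a c => sw a fun a b => a ⊗ₜ[ℂ] (b ⊗ₜ[ℂ] c) := by
  conv_lhs => rw [← sw_tmul_self z, equiv_sw]
  refine sw_congr _ fun a c => ?_
  conv_lhs => rw [← sw_tmul_self a, sw_tmul, equiv_sw]
  rfl

theorem assoc_symm_eq_sw (z : X ⊗[ℂ] (Y ⊗[ℂ] Z)) :
    (TensorProduct.assoc ℂ X Y Z).symm z =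
      sw z fun a c => sw c fun b c => (a ⊗ₜ[ℂ] b) ⊗ₜ[ℂ] c := by
  conv_lhs => rw [← sw_tmul_self z, equiv_sw]
  refine sw_congr _ fun a c => ?_
  conv_lhs => rw [← sw_tmul_self c, tmul_sw, equiv_sw]
  rfl

theorem leftComm_eq_sw (z : X ⊗[ℂ] (Y ⊗[ℂ] Z)) :
    TensorProduct.leftComm ℂ X Y Z z =
      sw z fun a c => sw c fun b c => b ⊗ₜ[ℂ] (a ⊗ₜ[ℂ] c) := by
  conv_lhs => rw [← sw_tmul_self z, equiv_sw]
  refine sw_congr _ fun a c => ?_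
  conv_lhs => rw [← sw_tmul_self c, tmul_sw, equiv_sw]
  rfl

theorem rightComm_eq_sw (z : (X ⊗[ℂ] Y) ⊗[ℂ] Z) :
    TensorProduct.rightComm ℂ X Y Z z =
      sw z fun a c => sw a fun a b => (a ⊗ₜ[ℂ] c) ⊗ₜ[ℂ] b := by
  conv_lhs => rw [← sw_tmul_self z, equiv_sw]
  refine sw_congr _ fun a c => ?_
  conv_lhs => rw [← sw_tmul_self a, sw_tmul, equiv_sw]
  rfl

theorem tttComm_eq_sw (z : (X ⊗[ℂ] Y) ⊗[ℂ] (Z ⊗[ℂ] W)) :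
    TensorProduct.tensorTensorTensorComm ℂ X Y Z W z =
      sw z fun p q => sw p fun a b => sw q fun c d => (a ⊗ₜ[ℂ] c) ⊗ₜ[ℂ] (b ⊗ₜ[ℂ] d) := by
  conv_lhs => rw [← sw_tmul_self z, equiv_sw]
  refine sw_congr _ fun p q => ?_
  conv_lhs => rw [← sw_tmul_self p, sw_tmul, equiv_sw]
  refine sw_congr _ fun a b => ?_
  conv_lhs => rw [← sw_tmul_self q, tmul_sw, equiv_sw]
  rfl

end Sweedler

/-! ### Equations on subspaces with parameters -/

section Extension

variable {V W U X Y R C : Type*}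
  [AddCommGroup V] [Module ℂ V] [AddCommGroup W] [Module ℂ W] [AddCommGroup U] [Module ℂ U]
  [AddCommGroup X] [Module ℂ X] [AddCommGroup Y] [Module ℂ Y]
  [AddCommGroup R] [Module ℂ R] [AddCommGroup C] [Module ℂ C]

/-- The subspace `R ⊗ p` of `R ⊗ V` for a subspace `p` of `V`. -/
def withParam (R : Type*) [AddCommGroup R] [Module ℂ R] (p : Submodule ℂ V) :
    Submodule ℂ (R ⊗[ℂ] V) :=
  LinearMap.range (p.subtype.lTensor R)

/-- Since vector spaces are flat, `R ⊗ ker D` is the kernel of `R ⊗ D`. -/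
theorem mem_withParam_ker (D : V →ₗ[ℂ] W) (w : R ⊗[ℂ] V) :
    w ∈ withParam R (LinearMap.ker D) ↔ D.lTensor R w = 0 :=
  (Module.Flat.lTensor_exact R (LinearMap.exact_subtype_ker_map D) w).symm

/-- Two functions that agree on `R × p` have the same value on the elements of `R ⊗ p`. -/
theorem sw_congr_of_mem_withParam {p : Submodule ℂ V} {w : R ⊗[ℂ] V} (hw : w ∈ withParam R p)
    {F G : R → V → U} (h : ∀ r, ∀ v ∈ p, F r v = G r v)
    (hF₁ : ∀ v, Lin fun r => F r v) (hF₂ : ∀ r, Lin fun v => F r v)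
    (hG₁ : ∀ v, Lin fun r => G r v) (hG₂ : ∀ r, Lin fun v => G r v) :
    sw w F = sw w G := by
  obtain ⟨w, rfl⟩ := hw
  rw [lTensor_eq_sw, sw_sw _ _ _ hF₁ hF₂, sw_sw _ _ _ hG₁ hG₂]
  refine sw_congr _ fun r v => ?_
  rw [sw_apply _ _ _ hF₁ hF₂, sw_apply _ _ _ hG₁ hG₂]
  exact h r v v.2

theorem sw_mem {p : Submodule ℂ V} (z : X ⊗[ℂ] Y) {f : X → Y → V} (h : ∀ a b, f a b ∈ p) :
    sw z f ∈ p :=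
  Submodule.sum_mem p fun _ _ => h _ _

theorem sw_mem_withParam_of_forall {p : Submodule ℂ V} (z : X ⊗[ℂ] Y) {f : X → Y → R ⊗[ℂ] V}
    (h : ∀ a b, f a b ∈ withParam R p) : sw z f ∈ withParam R p :=
  sw_mem z h

/-- The elements of `R ⊗ p` are preserved by maps of the parameter space `R`. -/
theorem sw_mem_withParam {R' : Type*} [AddCommGroup R'] [Module ℂ R'] {p : Submodule ℂ V}
    {w : R ⊗[ℂ] V} (hw : w ∈ withParam R p) (φ : R → R') (hφ : Lin φ) :
    (sw w fun r v => φ r ⊗ₜ[ℂ] v) ∈ withParam R' p := by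
  obtain ⟨w, rfl⟩ := hw
  refine ⟨hφ.bundle.rTensor _ w, ?_⟩
  simp (disch := fun_prop) only [rTensor_eq_sw, lTensor_eq_sw, sw_sw, sw_apply, Lin.bundle_apply]

theorem tmul_mem_withParam {p : Submodule ℂ V} {v : V} (hv : v ∈ p) (r : R) :
    r ⊗ₜ[ℂ] v ∈ withParam R p :=
  ⟨r ⊗ₜ ⟨v, hv⟩, rfl⟩

/-- A map that sends `r ⊗ v` with `v ∈ p` into `q` sends `R ⊗ p` into `q`. -/
theorem sw_mem_of_mem_withParam {p : Submodule ℂ V} {q : Submodule ℂ W} {w : R ⊗[ℂ] V}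
    (hw : w ∈ withParam R p) {F : R → V → W} (h : ∀ r, ∀ v ∈ p, F r v ∈ q)
    (h₁ : ∀ v, Lin fun r => F r v) (h₂ : ∀ r, Lin fun v => F r v) : sw w F ∈ q := by
  obtain ⟨w, rfl⟩ := hw
  rw [lTensor_eq_sw, sw_sw _ _ _ h₁ h₂]
  refine sw_mem _ fun r v => ?_
  rw [sw_apply _ _ _ h₁ h₂]
  exact h r v v.2

theorem mem_cotensor_iff {r : X →ₗ[ℂ] X ⊗[ℂ] C} {l : Y →ₗ[ℂ] C ⊗[ℂ] Y} {w : X ⊗[ℂ] Y} :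
    w ∈ cotensor r l ↔
      (sw w fun x y => sw (r x) fun x c => x ⊗ₜ[ℂ] (c ⊗ₜ[ℂ] y)) =
        sw w fun x y => sw (l y) fun c y => x ⊗ₜ[ℂ] (c ⊗ₜ[ℂ] y) := by
  rw [cotensor, LinearMap.mem_ker, cotensorDiff, LinearMap.sub_apply, sub_eq_zero,
    LinearMap.comp_apply, LinearEquiv.coe_coe, rTensor_eq_sw, lTensor_eq_sw, equiv_sw]
  simp (disch := fun_prop) only [assoc_eq_sw, sw_apply]
  rw [iff_iff_eq]
  congr 2
  funext x y
  conv_lhs => rw [← sw_tmul_self (l y), tmul_sw]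

/-- The defining property of the elements of a cotensor product. -/
theorem sw_cotensor {r : X →ₗ[ℂ] X ⊗[ℂ] C} {l : Y →ₗ[ℂ] C ⊗[ℂ] Y} {w : X ⊗[ℂ] Y}
    (hw : w ∈ cotensor r l) (F : X → C → Y → U) (h₁ : ∀ c y, Lin fun x => F x c y)
    (h₂ : ∀ x y, Lin fun c => F x c y) (h₃ : ∀ x c, Lin fun y => F x c y) :
    (sw w fun x y => sw (r x) fun x c => F x c y) =
      sw w fun x y => sw (l y) fun c y => F x c y := by
  have := congrArg (fun z => sw z fun a b => sw b fun b c => F a b c) (mem_cotensor_iff.1 hw)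
  simpa (disch := fun_prop) only [sw_sw, sw_apply] using this

theorem mem_withParam_cotensor_iff {r : X →ₗ[ℂ] X ⊗[ℂ] C} {l : Y →ₗ[ℂ] C ⊗[ℂ] Y}
    {w : R ⊗[ℂ] (X ⊗[ℂ] Y)} :
    w ∈ withParam R (cotensor r l) ↔
      (sw w fun s w => sw w fun x y => sw (r x) fun x c => s ⊗ₜ[ℂ] (x ⊗ₜ[ℂ] (c ⊗ₜ[ℂ] y))) =
        sw w fun s w => sw w fun x y => sw (l y) fun c y =>
          s ⊗ₜ[ℂ] (x ⊗ₜ[ℂ] (c ⊗ₜ[ℂ] y)) := by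
  rw [cotensor, mem_withParam_ker, cotensorDiff, LinearMap.lTensor_sub, LinearMap.sub_apply,
    sub_eq_zero, lTensor_eq_sw, lTensor_eq_sw, iff_iff_eq]
  congr 2
  · funext s w
    rw [LinearMap.comp_apply, LinearEquiv.coe_coe, rTensor_eq_sw, equiv_sw, tmul_sw]
    simp (disch := fun_prop) only [assoc_eq_sw, sw_apply, tmul_sw]
  · funext s w
    rw [lTensor_eq_sw, tmul_sw]
    refine sw_congr _ fun x y => ?_
    conv_lhs => rw [← sw_tmul_self (l y), tmul_sw, tmul_sw]

end Extension

/-! ### Coalgebras, coactions and triple cotensor products -/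

section Coalgebra

variable {C V : Type*} [AddCommGroup C] [Module ℂ C] [Coalgebra ℂ C] [AddCommGroup V] [Module ℂ V]

theorem sw_coassoc (t : C) (F : C → C → C → V)
    (h₁ : ∀ b c, Lin fun a => F a b c) (h₂ : ∀ a c, Lin fun b => F a b c)
    (h₃ : ∀ a b, Lin fun c => F a b c) :
    (sw (Δ t) fun a c => sw (Δ a) fun a b => F a b c) =
      sw (Δ t) fun a b => sw (Δ b) fun b c => F a b c := by
  have := congrArg (fun z => sw z fun a b => sw b fun b c => F a b c)
    (Coalgebra.coassoc_apply (R := ℂ) t)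
  simpa (disch := fun_prop) only [assoc_eq_sw, rTensor_eq_sw, lTensor_eq_sw, sw_sw, sw_apply]
    using this

theorem sw_counit_left (t : C) (F : C → V) (h : Lin F) :
    (sw (Δ t) fun a b => (ε a : ℂ) • F b) = F t := by
  have := congrArg (fun z => sw z fun a b => a • F b)
    (Coalgebra.rTensor_counit_comul (R := ℂ) t)
  simpa (disch := fun_prop) only [rTensor_eq_sw, sw_sw, sw_apply, one_smul] using this

theorem sw_counit_right (t : C) (F : C → V) (h : Lin F) :
    (sw (Δ t) fun a b => (ε b : ℂ) • F a) = F t := by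
  have := congrArg (fun z => sw z fun a b => b • F a)
    (Coalgebra.lTensor_counit_comul (R := ℂ) t)
  simpa (disch := fun_prop) only [lTensor_eq_sw, sw_sw, sw_apply, one_smul] using this

variable {X : Type*} [AddCommGroup X] [Module ℂ X]

theorem IsRightCoaction.sw_coassoc {r : X →ₗ[ℂ] X ⊗[ℂ] C} (h : IsRightCoaction r) (x : X)
    (F : X → C → C → V) (h₁ : ∀ b c, Lin fun a => F a b c) (h₂ : ∀ a c, Lin fun b => F a b c)
    (h₃ : ∀ a b, Lin fun c => F a b c) :
    (sw (r x) fun x c => sw (r x) fun x b => F x b c) =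
      sw (r x) fun x b => sw (Δ b) fun b c => F x b c := by
  have := congrArg (fun z => sw z fun a b => sw b fun b c => F a b c) (h.coassoc x)
  simpa (disch := fun_prop) only [assoc_eq_sw, rTensor_eq_sw, lTensor_eq_sw, sw_sw, sw_apply]
    using this

theorem IsLeftCoaction.sw_coassoc {l : X →ₗ[ℂ] C ⊗[ℂ] X} (h : IsLeftCoaction l) (x : X)
    (F : C → C → X → V) (h₁ : ∀ b c, Lin fun a => F a b c) (h₂ : ∀ a c, Lin fun b => F a b c)
    (h₃ : ∀ a b, Lin fun c => F a b c) :
    (sw (l x) fun c x => sw (Δ c) fun c d => F c d x) =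
      sw (l x) fun c x => sw (l x) fun d x => F c d x := by
  have := congrArg (fun z => sw z fun a b => sw b fun b c => F a b c) (h.coassoc x)
  simpa (disch := fun_prop) only [assoc_eq_sw, rTensor_eq_sw, lTensor_eq_sw, sw_sw, sw_apply]
    using this

theorem IsRightCoaction.sw_counit {r : X →ₗ[ℂ] X ⊗[ℂ] C} (h : IsRightCoaction r) (x : X)
    (F : X → V) (hF : Lin F) : (sw (r x) fun x c => (ε c : ℂ) • F x) = F x := by
  have := congrArg (fun z => sw z fun a b => b • F a) (h.counit x)
  simpa (disch := fun_prop) only [lTensor_eq_sw, sw_sw, sw_apply, one_smul] using this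

end Coalgebra

namespace SourceTarget

variable {C B V : Type*} [AddCommGroup C] [Module ℂ C] [Coalgebra ℂ C]
  [AddCommGroup B] [Module ℂ B] [Coalgebra ℂ B] [AddCommGroup V] [Module ℂ V]
  (s : SourceTarget C B) (x : B)

theorem sw_αL (F : C → B → V) (h₁ : ∀ b, Lin fun a => F a b) (h₂ : ∀ a, Lin fun b => F a b) :
    sw (s.αL x) F = sw (Δ x) fun a b => F (s.α a) b := by
  simp (disch := fun_prop) only [αL, LinearMap.comp_apply, rTensor_eq_sw, sw_sw, sw_apply]

theorem sw_αR (F : B → C → V) (h₁ : ∀ b, Lin fun a => F a b) (h₂ : ∀ a, Lin fun b => F a b) :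
    sw (s.αR x) F = sw (Δ x) fun a b => F a (s.α b) := by
  simp (disch := fun_prop) only [αR, LinearMap.comp_apply, lTensor_eq_sw, sw_sw, sw_apply]

theorem sw_βL (F : C → B → V) (h₁ : ∀ b, Lin fun a => F a b) (h₂ : ∀ a, Lin fun b => F a b) :
    sw (s.βL x) F = sw (Δ x) fun a b => F (s.β b) a := by
  simp (disch := fun_prop) only [βL, LinearMap.comp_apply, LinearEquiv.coe_coe, comm_eq_sw,
    rTensor_eq_sw, sw_sw, sw_apply]

theorem sw_βR (F : B → C → V) (h₁ : ∀ b, Lin fun a => F a b) (h₂ : ∀ a, Lin fun b => F a b) :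
    sw (s.βR x) F = sw (Δ x) fun a b => F b (s.β a) := by
  simp (disch := fun_prop) only [βR, LinearMap.comp_apply, LinearEquiv.coe_coe, comm_eq_sw,
    lTensor_eq_sw, sw_sw, sw_apply]

theorem sw_copL (F : C → B → V) (h₁ : ∀ b, Lin fun a => F a b) (h₂ : ∀ a, Lin fun b => F a b) :
    sw (s.copL x) F = sw (Δ x) fun a b => F (s.β a) b := by
  simp (disch := fun_prop) only [copL, LinearMap.comp_apply, rTensor_eq_sw, sw_sw, sw_apply]

theorem sw_copR (F : B → C → V) (h₁ : ∀ b, Lin fun a => F a b) (h₂ : ∀ a, Lin fun b => F a b) :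
    sw (s.copR x) F = sw (Δ x) fun a b => F a (s.β b) := by
  simp (disch := fun_prop) only [copR, LinearMap.comp_apply, lTensor_eq_sw, sw_sw, sw_apply]

end SourceTarget

section Cotensor₃

variable {C D X Y Z R U : Type*}
  [AddCommGroup C] [Module ℂ C] [AddCommGroup D] [Module ℂ D] [AddCommGroup X] [Module ℂ X]
  [AddCommGroup Y] [Module ℂ Y] [AddCommGroup Z] [Module ℂ Z] [AddCommGroup R] [Module ℂ R]
  [AddCommGroup U] [Module ℂ U]

theorem mem_cotensor₃_iff {rX : X →ₗ[ℂ] X ⊗[ℂ] C} {lY : Y →ₗ[ℂ] C ⊗[ℂ] Y}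
    {rY : Y →ₗ[ℂ] Y ⊗[ℂ] D} {lZ : Z →ₗ[ℂ] D ⊗[ℂ] Z} {w : (X ⊗[ℂ] Y) ⊗[ℂ] Z} :
    w ∈ cotensor₃ rX lY rY lZ ↔
      (sw w fun w z => sw w fun x y => z ⊗ₜ[ℂ] (x ⊗ₜ[ℂ] y)) ∈ withParam Z (cotensor rX lY) ∧
      (sw w fun w z => sw w fun x y => x ⊗ₜ[ℂ] (y ⊗ₜ[ℂ] z)) ∈ withParam X (cotensor rY lZ) := by
  rw [cotensor₃, Submodule.mem_inf, cotensor, cotensor, mem_withParam_ker, mem_withParam_ker,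
    LinearMap.mem_ker, LinearMap.mem_ker, LinearMap.comp_apply, LinearEquiv.coe_coe, assoc_eq_sw]
  refine and_congr ?_ Iff.rfl
  rw [← (TensorProduct.comm ℂ _ _).map_eq_zero_iff (x := LinearMap.rTensor Z _ w)]
  refine iff_of_eq (congrArg (· = 0) ?_)
  simp (disch := fun_prop) only [rTensor_eq_sw, lTensor_eq_sw, comm_eq_sw, sw_sw, sw_apply]
  refine sw_congr _ fun w z => ?_
  conv_lhs => rw [← sw_tmul_self w, map_sw, tmul_sw]

/-- Elements of `R ⊗ (X □ Y □ Z)`. -/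
theorem mem_withParam_cotensor₃ {rX : X →ₗ[ℂ] X ⊗[ℂ] C} {lY : Y →ₗ[ℂ] C ⊗[ℂ] Y}
    {rY : Y →ₗ[ℂ] Y ⊗[ℂ] D} {lZ : Z →ₗ[ℂ] D ⊗[ℂ] Z} {w : R ⊗[ℂ] ((X ⊗[ℂ] Y) ⊗[ℂ] Z)}
    (h₁ : (sw w fun r w => sw w fun w z => sw w fun x y =>
      (r ⊗ₜ[ℂ] z) ⊗ₜ[ℂ] (x ⊗ₜ[ℂ] y)) ∈ withParam (R ⊗[ℂ] Z) (cotensor rX lY))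
    (h₂ : (sw w fun r w => sw w fun w z => sw w fun x y =>
      (r ⊗ₜ[ℂ] x) ⊗ₜ[ℂ] (y ⊗ₜ[ℂ] z)) ∈ withParam (R ⊗[ℂ] X) (cotensor rY lZ)) :
    w ∈ withParam R (cotensor₃ rX lY rY lZ) := by
  let D₁ := (cotensorDiff rX lY).rTensor Z
  let D₂ := (cotensorDiff rY lZ).lTensor X ∘ₗ (TensorProduct.assoc ℂ X Y Z).toLinearMap
  have h : cotensor₃ rX lY rY lZ = LinearMap.ker (D₁.prod D₂) := (LinearMap.ker_prod D₁ D₂).symm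
  have hD : D₁.prod D₂ = LinearMap.inl ℂ _ _ ∘ₗ D₁ + LinearMap.inr ℂ _ _ ∘ₗ D₂ := by
    ext x <;> simp
  suffices h : D₁.lTensor R w = 0 ∧ D₂.lTensor R w = 0 by
    rw [‹cotensor₃ rX lY rY lZ = _›, mem_withParam_ker, hD, LinearMap.lTensor_add,
      LinearMap.lTensor_comp, LinearMap.lTensor_comp, LinearMap.add_apply, LinearMap.comp_apply,
      LinearMap.comp_apply, h.1, h.2, map_zero, map_zero, add_zero]
  rw [cotensor, mem_withParam_ker] at h₁ h₂
  constructor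
  · refine Eq.trans ?_ ((congrArg (fun z => sw z fun p q => sw p fun r z => r ⊗ₜ[ℂ] (q ⊗ₜ[ℂ] z))
      h₁).trans (Lin.map_zero (f := fun z => sw z fun p q => sw p fun r z => r ⊗ₜ[ℂ] (q ⊗ₜ[ℂ] z))
        (by fun_prop)))
    simp (disch := fun_prop) only [D₁, lTensor_eq_sw, rTensor_eq_sw, sw_sw, sw_apply, tmul_sw]
    refine sw_congr _ fun r w => sw_congr _ fun w z => ?_
    conv_lhs => rw [← sw_tmul_self w, map_sw, sw_tmul, tmul_sw]
  · refine Eq.trans ?_ ((congrArg (fun z => sw z fun p q => sw p fun r z => r ⊗ₜ[ℂ] (z ⊗ₜ[ℂ] q))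
      h₂).trans (Lin.map_zero (f := fun z => sw z fun p q => sw p fun r z => r ⊗ₜ[ℂ] (z ⊗ₜ[ℂ] q))
        (by fun_prop)))
    simp (disch := fun_prop) only [D₂, lTensor_eq_sw, LinearMap.comp_apply, LinearEquiv.coe_coe,
      assoc_eq_sw, sw_sw, sw_apply, tmul_sw]

end Cotensor₃

/-! ### Left bicoalgebroids and their modules -/

section LeftBicoalgebroid

variable {C K V : Type*} [AddCommGroup C] [Module ℂ C] [Coalgebra ℂ C]
  [AddCommGroup K] [Module ℂ K] [Coalgebra ℂ K] [AddCommGroup V] [Module ℂ V]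

namespace LeftBicoalgebroid

variable (k : LeftBicoalgebroid C K)

theorem sw_takeuchi {w : K ⊗[ℂ] K} (hw : w ∈ cotensor k.βR k.αL) (F : K → C → V)
    (h₁ : ∀ c, Lin fun x => F x c) (h₂ : ∀ x, Lin fun c => F x c) :
    (sw w fun g h => sw (Δ h) fun h₁ h₂ => F (linExt k.μ (g ⊗ₜ h₁)) (k.α h₂)) =
      sw w fun g h => sw (Δ g) fun g₁ g₂ => F (linExt k.μ (g₁ ⊗ₜ h)) (k.β g₂) := by
  have := congrArg (fun z => sw z F) (k.takeuchi ⟨w, hw⟩)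
  simpa (disch := fun_prop) only [map_eq_sw, assoc_symm_eq_sw, rightComm_eq_sw, lTensor_eq_sw,
    rTensor_eq_sw, sw_sw, sw_apply] using this

theorem sw_η_right (x : K) (F : K → V) (h : Lin F) :
    (sw (Δ x) fun a b => F (linExt k.μ (b ⊗ₜ k.η (k.β a)))) = F x := by
  have := congrArg F (k.μ_η x)
  rw [← this, lTensor_eq_sw, map_sw, k.sw_βR _ _ (by fun_prop) (by fun_prop)]
  change _ = h.bundle _
  rw [map_sw]
  rfl

theorem sw_η_βR (c : C) (F : K → C → V) (h₁ : ∀ c, Lin fun x => F x c)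
    (h₂ : ∀ x, Lin fun c => F x c) :
    (sw (Δ (k.η c)) fun a b => F b (k.β a)) = sw (Δ c) fun c d => F (k.η c) d := by
  have := congrArg (fun z => sw z F) (k.η_colinear_right c)
  simpa (disch := fun_prop) only [k.sw_βR, rTensor_eq_sw, sw_sw, sw_apply] using this

theorem sw_η_αL (c : C) (F : C → K → V) (h₁ : ∀ c, Lin fun x => F x c)
    (h₂ : ∀ x, Lin fun c => F x c) :
    (sw (Δ (k.η c)) fun a b => F (k.α a) b) = sw (Δ c) fun c d => F c (k.η d) := by
  have := congrArg (fun z => sw z F) (k.η_colinear_left c)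
  simpa (disch := fun_prop) only [k.sw_αL, lTensor_eq_sw, sw_sw, sw_apply] using this

end LeftBicoalgebroid

namespace LeftModuleStr

variable {k : LeftBicoalgebroid C K} {M : Type*} [AddCommGroup M] [Module ℂ M]
  (s : LeftModuleStr k M)

theorem sw_canonicalCoact (m : M) (F : M → C → V) (h₁ : ∀ c, Lin fun x => F x c)
    (h₂ : ∀ x, Lin fun c => F x c) :
    sw (s.canonicalCoact m) F = sw (s.baseCoact m) fun c m => sw (Δ (k.η c)) fun h₁ h₂ =>
      F (linExt s.act (h₁ ⊗ₜ m)) (k.α h₂) := by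
  simp (disch := fun_prop) only [canonicalCoact, LinearMap.comp_apply, LinearEquiv.coe_coe,
    map_eq_sw, rightComm_eq_sw, rTensor_eq_sw, sw_sw, sw_apply]

theorem sw_act_assoc {w : (K ⊗[ℂ] K) ⊗[ℂ] M} (hw : w ∈ cotensor₃ k.βR k.αL k.βR s.baseCoact)
    (F : M → V) (hF : Lin F) :
    (sw w fun p m => F (linExt s.act (linExt k.μ p ⊗ₜ m))) =
      sw w fun p m => sw p fun g h => F (linExt s.act (g ⊗ₜ linExt s.act (h ⊗ₜ m))) := by
  have := congrArg hF.bundle (s.act_assoc w hw)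
  simpa (disch := fun_prop) only [map_sw, equiv_sw, assoc_eq_sw, lTensor_eq_sw,
    rTensor_eq_sw, sw_sw, sw_apply, Lin.bundle_apply] using this

/-- `k ▷ m₀ ⊗ m₁ = k₁ ▷ m ⊗ β(k₂)` on `K □ M`, for the canonical right coaction of `M`. -/
theorem sw_canonicalCoact_act {w : K ⊗[ℂ] M} (hw : w ∈ cotensor k.βR s.baseCoact)
    (F : M → C → V) (h₁ : ∀ c, Lin fun x => F x c) (h₂ : ∀ x, Lin fun c => F x c) :
    (sw w fun x m => sw (s.canonicalCoact m) fun m c => F (linExt s.act (x ⊗ₜ m)) c) =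
      sw w fun x m => sw (Δ x) fun x₁ x₂ => F (linExt s.act (x₁ ⊗ₜ m)) (k.β x₂) := by
  -- `α(h₂) ⊗ ((x ⊗ h₁) ⊗ m₀)` with `h = η(m₋₁)`: the products `x ▷ (h₁ ▷ m₀)` can be reassociated
  have hW : (sw w fun x m => sw (s.baseCoact m) fun c m => sw (Δ (k.η c)) fun h₁ h₂ =>
      k.α h₂ ⊗ₜ[ℂ] ((x ⊗ₜ[ℂ] h₁) ⊗ₜ[ℂ] m)) ∈
        withParam C (cotensor₃ k.βR k.αL k.βR s.baseCoact) := by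
    refine mem_withParam_cotensor₃ ?_ ?_
    · rw [mem_withParam_cotensor_iff]
      simp (disch := fun_prop) only [sw_sw, sw_apply, k.sw_βR, k.sw_αL, sw_coassoc]
      refine Eq.trans ?_ (sw_congr _ fun x m => sw_congr _ fun c m => (k.sw_η_αL c (fun c h =>
        sw (Δ h) fun h₁ h₂ => (k.α h₂ ⊗ₜ m) ⊗ₜ (x ⊗ₜ (c ⊗ₜ h₁))) (by fun_prop)
          (by fun_prop)).symm)
      simp (disch := fun_prop) only [s.isLeftCoaction_baseCoact.sw_coassoc]
      refine Eq.trans ?_ (sw_cotensor hw (fun x c m => sw (s.baseCoact m) fun d m =>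
        sw (Δ (k.η d)) fun h₁ h₂ => (k.α h₂ ⊗ₜ m) ⊗ₜ (x ⊗ₜ (c ⊗ₜ h₁))) (by fun_prop)
          (by fun_prop) (by fun_prop))
      simp (disch := fun_prop) only [k.sw_βR]
      refine sw_congr _ fun x m => ?_
      simp only [sw_comm (Δ x)]
    · rw [mem_withParam_cotensor_iff]
      simp (disch := fun_prop) only [sw_sw, sw_apply, k.sw_βR, sw_coassoc]
      refine sw_congr _ fun x m => ?_
      refine (sw_congr _ fun c m => k.sw_η_βR c (fun h d => sw (Δ h) fun h₁ h₂ =>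
        (k.α h₂ ⊗ₜ[ℂ] x) ⊗ₜ[ℂ] (h₁ ⊗ₜ[ℂ] (d ⊗ₜ[ℂ] m))) (by fun_prop) (by fun_prop)).trans ?_
      simp (disch := fun_prop) only [s.isLeftCoaction_baseCoact.sw_coassoc]
      exact sw_congr _ fun c m => sw_comm _ _ _
  -- `x ⊗ η(m₋₁)` lies in `K □ K`, where the Takeuchi condition applies
  have hW' : (sw w fun x m => sw (s.baseCoact m) fun c m => m ⊗ₜ[ℂ] (x ⊗ₜ[ℂ] k.η c)) ∈
        withParam M (cotensor k.βR k.αL) := by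
    rw [mem_withParam_cotensor_iff]
    simp (disch := fun_prop) only [sw_sw, sw_apply, k.sw_βR, k.sw_αL]
    refine Eq.trans ?_ (sw_congr _ fun x m => sw_congr _ fun c m => (k.sw_η_αL c (fun c h =>
      m ⊗ₜ (x ⊗ₜ (c ⊗ₜ h))) (by fun_prop) (by fun_prop)).symm)
    simp (disch := fun_prop) only [s.isLeftCoaction_baseCoact.sw_coassoc]
    refine Eq.trans ?_ (sw_cotensor hw (fun x c m => sw (s.baseCoact m) fun d m =>
      m ⊗ₜ (x ⊗ₜ (c ⊗ₜ k.η d))) (by fun_prop) (by fun_prop) (by fun_prop))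
    simp (disch := fun_prop) only [k.sw_βR]
    refine sw_congr _ fun x m => ?_
    simp only [sw_comm (Δ x)]
  have e₁ := sw_congr_of_mem_withParam hW
    (F := fun c p => sw p fun p m => F (linExt s.act (linExt k.μ p ⊗ₜ m)) c)
    (G := fun c p => sw p fun p m => sw p fun g h =>
      F (linExt s.act (g ⊗ₜ linExt s.act (h ⊗ₜ m))) c)
    (fun c v hv => s.sw_act_assoc hv (fun m => F m c) (by fun_prop))
    (by fun_prop) (by fun_prop) (by fun_prop) (by fun_prop)
  simp (disch := fun_prop) only [sw_sw, sw_apply] at e₁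
  have e₂ := sw_congr_of_mem_withParam hW'
    (F := fun m p => sw p fun g h => sw (Δ h) fun h₁ h₂ =>
      F (linExt s.act (linExt k.μ (g ⊗ₜ h₁) ⊗ₜ m)) (k.α h₂))
    (G := fun m p => sw p fun g h => sw (Δ g) fun g₁ g₂ =>
      F (linExt s.act (linExt k.μ (g₁ ⊗ₜ h) ⊗ₜ m)) (k.β g₂))
    (fun m v hv => k.sw_takeuchi hv (fun x c => F (linExt s.act (x ⊗ₜ m)) c) (by fun_prop)
      (by fun_prop)) (by fun_prop) (by fun_prop) (by fun_prop) (by fun_prop)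
  simp (disch := fun_prop) only [sw_sw, sw_apply] at e₂
  simp (disch := fun_prop) only [s.sw_canonicalCoact]
  rw [← e₁, e₂]
  refine (sw_cotensor hw (fun x c m => sw (Δ x) fun x₁ x₂ =>
    F (linExt s.act (linExt k.μ (x₁ ⊗ₜ k.η c) ⊗ₜ m)) (k.β x₂)) (by fun_prop)
      (by fun_prop) (by fun_prop)).symm.trans ?_
  simp (disch := fun_prop) only [k.sw_βR, ← sw_coassoc]
  refine sw_congr _ fun x m => sw_congr _ fun x₁ x₂ => ?_
  exact k.sw_η_right x₁ (fun x => F (linExt s.act (x ⊗ₜ m)) (k.β x₂)) (by fun_prop)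

end LeftModuleStr

end LeftBicoalgebroid

/-! ### Comodule coalgebras -/

namespace LeftComoduleCoalgebra

variable {S K T M V : Type*} [AddCommGroup S] [Module ℂ S] [Coalgebra ℂ S]
  [AddCommGroup K] [Module ℂ K] [Coalgebra ℂ K] [AddCommGroup T] [Module ℂ T] [Coalgebra ℂ T]
  [AddCommGroup M] [Module ℂ M] [AddCommGroup V] [Module ℂ V]
  {k : LeftHopfCoalgebra S K} (c : LeftComoduleCoalgebra k T)

theorem sw_comul_coact (t : T) (F : K → T → T → V) (h₁ : ∀ b c, Lin fun a => F a b c)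
    (h₂ : ∀ a c, Lin fun b => F a b c) (h₃ : ∀ a b, Lin fun c => F a b c) :
    (sw (c.coact t) fun g t => sw (Δ t) fun a b => F g a b) =
      sw (Δ t) fun a b => sw (c.coact a) fun g a => sw (c.coact b) fun h b =>
        F (linExt k.μ (g ⊗ₜ h)) a b := by
  have := congrArg (fun z => sw z fun a b => sw b fun b c => F a b c) (c.comul_coact t)
  simpa (disch := fun_prop) only [lTensor_eq_sw, rTensor_eq_sw, tttComm_eq_sw, map_eq_sw, sw_sw,
    sw_apply] using this

variable {π : T →ₗ[ℂ] S} (hα : ∀ t, k.α.rTensor T (c.coact t) = π.rTensor T (Δ t))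
  (hβ : ∀ t, TensorProduct.comm ℂ S T (k.β.rTensor T (c.coact t)) = π.lTensor T (Δ t))

include hα in
theorem sw_α_coact (t : T) (F : S → T → V) (h₁ : ∀ b, Lin fun a => F a b)
    (h₂ : ∀ a, Lin fun b => F a b) :
    (sw (c.coact t) fun g t => F (k.α g) t) = sw (Δ t) fun a b => F (π a) b := by
  have := congrArg (fun z => sw z F) (hα t)
  simpa (disch := fun_prop) only [rTensor_eq_sw, sw_sw, sw_apply] using this

include hβ in
theorem sw_β_coact (t : T) (F : S → T → V) (h₁ : ∀ b, Lin fun a => F a b)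
    (h₂ : ∀ a, Lin fun b => F a b) :
    (sw (c.coact t) fun g t => F (k.β g) t) = sw (Δ t) fun a b => F (π b) a := by
  have := congrArg (fun z => sw z fun t s => F s t) (hβ t)
  simpa (disch := fun_prop) only [rTensor_eq_sw, lTensor_eq_sw, comm_eq_sw, sw_sw, sw_apply]
    using this

/-- The cotensor product `T □_S T` for the coactions `t ↦ t₁ ⊗ π(t₂)` and `t ↦ π(t₁) ⊗ t₂`. -/
abbrev selfCotensor (π : T →ₗ[ℂ] S) : Submodule ℂ (T ⊗[ℂ] T) :=
  cotensor (π.lTensor T ∘ₗ Δ) (π.rTensor T ∘ₗ Δ)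

omit [Coalgebra ℂ S] in
theorem sw_selfCotensor {p : T ⊗[ℂ] T} (hp : p ∈ selfCotensor π) (F : T → S → T → V)
    (h₁ : ∀ b c, Lin fun a => F a b c) (h₂ : ∀ a c, Lin fun b => F a b c)
    (h₃ : ∀ a b, Lin fun c => F a b c) :
    (sw p fun u v => sw (Δ u) fun a b => F a (π b) v) =
      sw p fun u v => sw (Δ v) fun a b => F u (π a) b := by
  have := sw_cotensor hp F h₁ h₂ h₃
  simpa (disch := fun_prop) only [LinearMap.comp_apply, lTensor_eq_sw, rTensor_eq_sw, sw_sw,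
    sw_apply] using this

omit [Coalgebra ℂ S] in
theorem comul_mem_selfCotensor (t : T) : Δ t ∈ selfCotensor π := by
  rw [mem_cotensor_iff]
  simp (disch := fun_prop) only [LinearMap.comp_apply, lTensor_eq_sw, rTensor_eq_sw, sw_sw,
    sw_apply, sw_coassoc]

include hα hβ in
/-- `(u₀ ⊗ v₀) ⊗ (u₋₁ ⊗ v₋₁) ∈ (T ⊗ T) ⊗ (K □ K)` for `u ⊗ v ∈ T □ T`. -/
theorem coact_coact_mem {p : T ⊗[ℂ] T} (hp : p ∈ selfCotensor π) :
    (sw p fun u v => sw (c.coact u) fun g u => sw (c.coact v) fun h v =>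
      (u ⊗ₜ[ℂ] v) ⊗ₜ[ℂ] (g ⊗ₜ[ℂ] h)) ∈ withParam (T ⊗[ℂ] T) (cotensor k.βR k.αL) := by
  rw [mem_withParam_cotensor_iff]
  simp (disch := fun_prop) only [sw_sw, sw_apply, k.sw_βR, k.sw_αL]
  have hc := c.isLeftCoaction_coact
  have h₁ : ∀ v, Lin fun u => sw (c.coact u) fun g u => sw (Δ g) fun a b =>
      sw (c.coact v) fun h v => (u ⊗ₜ[ℂ] v) ⊗ₜ[ℂ] (b ⊗ₜ[ℂ] (k.β a ⊗ₜ[ℂ] h)) := by fun_prop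
  calc
    _ = sw p fun u v => sw (c.coact u) fun g u => sw (Δ g) fun a b => sw (c.coact v) fun h v =>
        (u ⊗ₜ[ℂ] v) ⊗ₜ[ℂ] (b ⊗ₜ[ℂ] (k.β a ⊗ₜ[ℂ] h)) :=
      sw_congr _ fun u v => sw_congr _ fun g u => sw_comm _ _ _
    _ = sw p fun u v => sw (Δ u) fun a b => sw (c.coact a) fun g u => sw (c.coact v) fun h v =>
        (u ⊗ₜ[ℂ] v) ⊗ₜ[ℂ] (g ⊗ₜ[ℂ] (π b ⊗ₜ[ℂ] h)) := by
      refine sw_congr _ fun u v => ?_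
      rw [hc.sw_coassoc _ _ (by fun_prop) (by fun_prop) (by fun_prop)]
      exact c.sw_β_coact hβ u (fun b a => sw (c.coact a) fun g u => sw (c.coact v) fun h v =>
        (u ⊗ₜ[ℂ] v) ⊗ₜ[ℂ] (g ⊗ₜ[ℂ] (b ⊗ₜ[ℂ] h))) (by fun_prop) (by fun_prop)
    _ = sw p fun u v => sw (Δ v) fun a b => sw (c.coact u) fun g u => sw (c.coact b) fun h v =>
        (u ⊗ₜ[ℂ] v) ⊗ₜ[ℂ] (g ⊗ₜ[ℂ] (π a ⊗ₜ[ℂ] h)) :=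
      sw_selfCotensor hp (fun u a v => sw (c.coact u) fun g u => sw (c.coact v) fun h v =>
        (u ⊗ₜ[ℂ] v) ⊗ₜ[ℂ] (g ⊗ₜ[ℂ] (a ⊗ₜ[ℂ] h))) (by fun_prop) (by fun_prop) (by fun_prop)
    _ = _ := by
      refine sw_congr _ fun u v => ?_
      rw [sw_comm]
      refine sw_congr _ fun g u => ?_
      rw [hc.sw_coassoc _ _ (by fun_prop) (by fun_prop) (by fun_prop)]
      exact (c.sw_α_coact hα v (fun a b => sw (c.coact b) fun h v =>
        (u ⊗ₜ[ℂ] v) ⊗ₜ[ℂ] (g ⊗ₜ[ℂ] (a ⊗ₜ[ℂ] h))) (by fun_prop) (by fun_prop)).symm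

end LeftComoduleCoalgebra

/-! ### The rotation of `M □_K T` -/

section Rotation

variable {S K T M V : Type*} [AddCommGroup S] [Module ℂ S] [Coalgebra ℂ S]
  [AddCommGroup K] [Module ℂ K] [Coalgebra ℂ K] [AddCommGroup T] [Module ℂ T] [Coalgebra ℂ T]
  [AddCommGroup M] [Module ℂ M] [AddCommGroup V] [Module ℂ V]
  {k : LeftHopfCoalgebra S K} (c : LeftComoduleCoalgebra k T) (s : LeftRightSAYDStr k M)
  {π : T →ₗ[ℂ] S} (hα : ∀ t, k.α.rTensor T (c.coact t) = π.rTensor T (Δ t))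
  (hβ : ∀ t, TensorProduct.comm ℂ S T (k.β.rTensor T (c.coact t)) = π.lTensor T (Δ t))

namespace LeftRightSAYDStr

/-- The rotation `m ⊗ t ↦ (t₂)₋₁ ▷ m ⊗ ((t₂)₀ ⊗ t₁)`: the second tensor factor of `Δ t` is carried
around `m` at the price of an action of `K`. -/
def rotate : M ⊗[ℂ] T →ₗ[ℂ] M ⊗[ℂ] (T ⊗[ℂ] T) :=
  (show Lin fun x : M ⊗[ℂ] T => sw x fun m t => sw (Δ t) fun a b => sw (c.coact b) fun h b =>
    linExt s.act (h ⊗ₜ m) ⊗ₜ[ℂ] (b ⊗ₜ[ℂ] a) by fun_prop).bundle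

theorem sw_rotate (x : M ⊗[ℂ] T) (F : M → T ⊗[ℂ] T → V) (h₁ : ∀ p, Lin fun m => F m p)
    (h₂ : ∀ m, Lin fun p => F m p) :
    sw (s.rotate c x) F = sw x fun m t => sw (Δ t) fun a b => sw (c.coact b) fun h b =>
      F (linExt s.act (h ⊗ₜ m)) (b ⊗ₜ[ℂ] a) := by
  simp (disch := fun_prop) only [rotate, Lin.bundle_apply, sw_sw, sw_apply]

variable {c s}
variable {x : M ⊗[ℂ] T} (hx : x ∈ cotensor s.coact c.coact)

include hx hβ in
/-- On `M □_K T` the left `S`-coaction of `M` is `m ⊗ t ↦ m ⊗ π(t₂) ⊗ t₁`. -/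
theorem sw_baseCoact (F : M → S → T → V) (h₁ : ∀ b c, Lin fun a => F a b c)
    (h₂ : ∀ a c, Lin fun b => F a b c) (h₃ : ∀ a b, Lin fun c => F a b c) :
    (sw x fun m t => sw (s.baseCoact m) fun c m => F m c t) =
      sw x fun m t => sw (Δ t) fun a b => F m (π b) a := by
  simp (disch := fun_prop) only [s.baseCoact_eq, comm_eq_sw, rTensor_eq_sw, sw_sw, sw_apply]
  refine (sw_cotensor hx (fun m h t => F m (k.β h) t) (by fun_prop) (by fun_prop)
    (by fun_prop)).trans ?_
  exact sw_congr _ fun m t => c.sw_β_coact hβ t (fun a b => F m a b) (by fun_prop) (by fun_prop)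

include hx hα in
/-- On `M □_K T` the canonical right `S`-coaction of `M` is `m ⊗ t ↦ m ⊗ π(t₁) ⊗ t₂`. -/
theorem sw_canonicalCoact (F : M → S → T → V) (h₁ : ∀ b c, Lin fun a => F a b c)
    (h₂ : ∀ a c, Lin fun b => F a b c) (h₃ : ∀ a b, Lin fun c => F a b c) :
    (sw x fun m t => sw (s.canonicalCoact m) fun m c => F m c t) =
      sw x fun m t => sw (Δ t) fun a b => F m (π a) b := by
  simp (disch := fun_prop) only [← s.canonicalCoact_eq, lTensor_eq_sw, sw_sw, sw_apply]
  refine (sw_cotensor hx (fun m h t => F m (k.α h) t) (by fun_prop) (by fun_prop)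
    (by fun_prop)).trans ?_
  exact sw_congr _ fun m t => c.sw_α_coact hα t (fun a b => F m a b) (by fun_prop) (by fun_prop)

include hx hβ in
/-- The element `(t₂)₋₁ ⊗ m` that the rotation multiplies out belongs to `K □ M`. -/
theorem coact_comul_mem :
    (sw x fun m t => sw (Δ t) fun a b => sw (c.coact b) fun h b => (b ⊗ₜ[ℂ] a) ⊗ₜ[ℂ] (h ⊗ₜ[ℂ] m)) ∈
      withParam (T ⊗[ℂ] T) (cotensor k.βR s.baseCoact) := by
  rw [mem_withParam_cotensor_iff]
  simp (disch := fun_prop) only [sw_sw, sw_apply, k.sw_βR]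
  have hc := c.isLeftCoaction_coact
  calc
    _ = sw x fun m t => sw (Δ t) fun a b => sw (Δ b) fun b d => sw (c.coact b) fun h b =>
        (b ⊗ₜ[ℂ] a) ⊗ₜ[ℂ] (h ⊗ₜ[ℂ] (π d ⊗ₜ[ℂ] m)) := by
      refine sw_congr _ fun m t => sw_congr _ fun a b => ?_
      rw [hc.sw_coassoc _ _ (by fun_prop) (by fun_prop) (by fun_prop)]
      exact c.sw_β_coact hβ b (fun d b => sw (c.coact b) fun h b =>
        (b ⊗ₜ[ℂ] a) ⊗ₜ[ℂ] (h ⊗ₜ[ℂ] (d ⊗ₜ[ℂ] m))) (by fun_prop) (by fun_prop)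
    _ = sw x fun m t => sw (Δ t) fun b d => sw (Δ b) fun a b => sw (c.coact b) fun h b =>
        (b ⊗ₜ[ℂ] a) ⊗ₜ[ℂ] (h ⊗ₜ[ℂ] (π d ⊗ₜ[ℂ] m)) := by
      refine sw_congr _ fun m t => ?_
      rw [sw_coassoc _ _ (by fun_prop) (by fun_prop) (by fun_prop)]
    _ = _ := by
      refine (sw_baseCoact hβ hx (fun m d t => sw (Δ t) fun a b => sw (c.coact b) fun h b =>
        (b ⊗ₜ[ℂ] a) ⊗ₜ[ℂ] (h ⊗ₜ[ℂ] (d ⊗ₜ[ℂ] m))) (by fun_prop) (by fun_prop)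
          (by fun_prop)).symm.trans ?_
      refine sw_congr _ fun m t => ?_
      simp only [sw_comm (s.baseCoact m)]

include hx hα hβ in
/-- The rotation takes `M □_K T` to `M ⊗ (T □_S T)`. -/
theorem rotate_mem : s.rotate c x ∈ withParam M (LeftComoduleCoalgebra.selfCotensor π) := by
  rw [mem_withParam_cotensor_iff]
  simp (disch := fun_prop) only [sw_rotate, sw_sw, sw_apply, LinearMap.comp_apply, lTensor_eq_sw,
    rTensor_eq_sw]
  have hc := c.isLeftCoaction_coact
  have hW := sw_congr_of_mem_withParam (coact_comul_mem hβ hx)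
    (F := fun p w => sw p fun b a => sw w fun h m => sw (s.canonicalCoact m) fun m d =>
      linExt s.act (h ⊗ₜ m) ⊗ₜ[ℂ] (b ⊗ₜ[ℂ] (d ⊗ₜ[ℂ] a)))
    (G := fun p w => sw p fun b a => sw w fun h m => sw (Δ h) fun h₁ h₂ =>
      linExt s.act (h₁ ⊗ₜ m) ⊗ₜ[ℂ] (b ⊗ₜ[ℂ] (k.β h₂ ⊗ₜ[ℂ] a)))
    (fun p w hw => sw_congr _ fun b a => s.sw_canonicalCoact_act hw
      (fun m d => m ⊗ₜ[ℂ] (b ⊗ₜ[ℂ] (d ⊗ₜ[ℂ] a))) (by fun_prop) (by fun_prop))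
    (by fun_prop) (by fun_prop) (by fun_prop) (by fun_prop)
  simp (disch := fun_prop) only [sw_sw, sw_apply] at hW
  calc
    _ = sw x fun m t => sw (Δ t) fun a b => sw (c.coact b) fun h b => sw (Δ h) fun h₁ h₂ =>
        linExt s.act (h₁ ⊗ₜ m) ⊗ₜ[ℂ] (b ⊗ₜ[ℂ] (k.β h₂ ⊗ₜ[ℂ] a)) := by
      refine sw_congr _ fun m t => sw_congr _ fun a b => ?_
      rw [hc.sw_coassoc _ _ (by fun_prop) (by fun_prop) (by fun_prop)]
      exact sw_congr _ fun h b => (c.sw_β_coact hβ b (fun d b =>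
        linExt s.act (h ⊗ₜ m) ⊗ₜ[ℂ] (b ⊗ₜ[ℂ] (d ⊗ₜ[ℂ] a))) (by fun_prop) (by fun_prop)).symm
    _ = sw x fun m t => sw (s.canonicalCoact m) fun m d => sw (Δ t) fun a b =>
        sw (c.coact b) fun h b => linExt s.act (h ⊗ₜ m) ⊗ₜ[ℂ] (b ⊗ₜ[ℂ] (d ⊗ₜ[ℂ] a)) := by
      rw [← hW]
      refine sw_congr _ fun m t => ?_
      simp only [sw_comm (s.canonicalCoact m)]
    _ = sw x fun m t => sw (Δ t) fun d t => sw (Δ t) fun a b =>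
        sw (c.coact b) fun h b => linExt s.act (h ⊗ₜ m) ⊗ₜ[ℂ] (b ⊗ₜ[ℂ] (π d ⊗ₜ[ℂ] a)) :=
      sw_canonicalCoact hα hx (fun m d t => sw (Δ t) fun a b => sw (c.coact b) fun h b =>
        linExt s.act (h ⊗ₜ m) ⊗ₜ[ℂ] (b ⊗ₜ[ℂ] (d ⊗ₜ[ℂ] a))) (by fun_prop) (by fun_prop)
          (by fun_prop)
    _ = _ := by
      refine sw_congr _ fun m t => ?_
      rw [← sw_coassoc _ _ (by fun_prop) (by fun_prop) (by fun_prop)]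
      refine sw_congr _ fun a b => sw_comm _ _ _

end LeftRightSAYDStr

end Rotation

/-! ### Colinearity of the rotation -/

section RotationColinear

variable {S K T M V : Type*} [AddCommGroup S] [Module ℂ S] [Coalgebra ℂ S]
  [AddCommGroup K] [Module ℂ K] [Coalgebra ℂ K] [AddCommGroup T] [Module ℂ T] [Coalgebra ℂ T]
  [AddCommGroup M] [Module ℂ M] [AddCommGroup V] [Module ℂ V]
  {k : LeftHopfCoalgebra S K}

/-- The identity `ν⁻¹ ∘ ν = id` in Sweedler notation. -/
theorem LeftHopfCoalgebra.sw_νInv {w : K ⊗[ℂ] K} (hw : w ∈ cotensor k.βR k.αL) (F : K → K → V)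
    (h₁ : ∀ b, Lin fun a => F a b) (h₂ : ∀ a, Lin fun b => F a b) :
    (sw w fun g h => sw (Δ h) fun a b => sw (k.νInv (linExt k.μ (g ⊗ₜ a) ⊗ₜ b)) F) = sw w F := by
  have hg : k.galois w = sw w fun g h => sw (Δ h) fun a b => linExt k.μ (g ⊗ₜ a) ⊗ₜ[ℂ] b := by
    simp (disch := fun_prop) only [LeftBicoalgebroid.galois, LinearMap.comp_apply,
      LinearEquiv.coe_coe, lTensor_eq_sw, rTensor_eq_sw, assoc_symm_eq_sw, sw_sw, sw_apply]
  have h : k.νInv (k.galois w) = w := invOn_apply k.galois k.galois_bijOn hw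
  conv_rhs => rw [← h, hg]
  simp (disch := fun_prop) only [map_sw, sw_sw]

namespace LeftRightSAYDStr

variable (s : LeftRightSAYDStr k M)

/-- The anti-Yetter-Drinfeld condition in Sweedler notation. -/
theorem sw_coact_act {w : K ⊗[ℂ] M} (hw : w ∈ cotensor k.βR s.baseCoact) (F : M → K → V)
    (h₁ : ∀ b, Lin fun a => F a b) (h₂ : ∀ a, Lin fun b => F a b) :
    (sw w fun h m => sw (s.coact (linExt s.act (h ⊗ₜ m))) F) =
      sw w fun h m => sw (Δ h) fun a b => sw (s.coact m) fun m g =>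
        sw (k.νInv (g ⊗ₜ a)) fun p q => F (linExt s.act (q ⊗ₜ m)) (linExt k.μ (b ⊗ₜ p)) := by
  have := congrArg (fun z => sw z F) (s.ayd ⟨w, hw⟩)
  rw [← linExt_apply] at this
  simp (disch := fun_prop) only [map_eq_sw, comm_eq_sw, rTensor_eq_sw, tttComm_eq_sw, sw_sw,
    sw_apply, LinearMap.comp_apply, LinearEquiv.coe_coe] at this
  rw [← this]
  conv_rhs => rw [← sw_tmul_self w]
  simp (disch := fun_prop) only [map_sw, sw_sw]

theorem sw_stable (m : M) : (sw (s.coact m) fun m g => linExt s.act (g ⊗ₜ m)) = m := by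
  have := s.stable m
  simpa (disch := fun_prop) only [comm_eq_sw, map_sw] using this

variable {c : LeftComoduleCoalgebra k T} {s} {π : T →ₗ[ℂ] S}
  (hα : ∀ t, k.α.rTensor T (c.coact t) = π.rTensor T (Δ t))
  (hβ : ∀ t, TensorProduct.comm ℂ S T (k.β.rTensor T (c.coact t)) = π.lTensor T (Δ t))
  {x : M ⊗[ℂ] T} (hx : x ∈ cotensor s.coact c.coact)

include hx hα hβ in
/-- The rotation of an element of `M □_K T` lies in `M □_K (T □_S T)`, for the diagonal coaction of
`K` on `T □_S T`. The anti-Yetter-Drinfeld condition produces `ν⁻¹`, which cancels against the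
product in the diagonal coaction. -/
theorem sw_coact_rotate (F : M → K → T → T → V) (h₁ : ∀ b c d, Lin fun a => F a b c d)
    (h₂ : ∀ a c d, Lin fun b => F a b c d) (h₃ : ∀ a b d, Lin fun c => F a b c d)
    (h₄ : ∀ a b c, Lin fun d => F a b c d) :
    (sw (s.rotate c x) fun m p => sw (s.coact m) fun m h => sw p fun u v => F m h u v) =
      sw (s.rotate c x) fun m p => sw p fun u v => sw (c.coact u) fun g u =>
        sw (c.coact v) fun h v => F m (linExt k.μ (g ⊗ₜ h)) u v := by
  simp (disch := fun_prop) only [sw_rotate, sw_apply]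
  have hc := c.isLeftCoaction_coact
  -- the coaction of `h ▷ m`, by the anti-Yetter-Drinfeld condition
  have hW := sw_congr_of_mem_withParam (coact_comul_mem hβ hx)
    (F := fun p w => sw p fun b a => sw w fun h m => sw (s.coact (linExt s.act (h ⊗ₜ m)))
      fun m h => F m h b a)
    (G := fun p w => sw p fun b a => sw w fun h m => sw (Δ h) fun h₁ h₂ =>
      sw (s.coact m) fun m g => sw (k.νInv (g ⊗ₜ h₁)) fun p q =>
        F (linExt s.act (q ⊗ₜ m)) (linExt k.μ (h₂ ⊗ₜ p)) b a)
    (fun p w hw => sw_congr _ fun b a => s.sw_coact_act hw (fun m h => F m h b a) (by fun_prop)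
      (by fun_prop)) (by fun_prop) (by fun_prop) (by fun_prop) (by fun_prop)
  simp (disch := fun_prop) only [sw_sw, sw_apply] at hW
  rw [hW]
  calc
    _ = sw x fun m t => sw (s.coact m) fun m g => sw (Δ t) fun a b => sw (c.coact b) fun h b =>
        sw (Δ h) fun h₁ h₂ => sw (k.νInv (g ⊗ₜ h₁)) fun p q =>
          F (linExt s.act (q ⊗ₜ m)) (linExt k.μ (h₂ ⊗ₜ p)) b a := by
      refine sw_congr _ fun m t => ?_
      simp only [sw_comm (s.coact m)]
    -- `m₀ ⊗ m₁ ⊗ t = m ⊗ t₋₁ ⊗ t₀`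
    _ = sw x fun m t => sw (c.coact t) fun g t => sw (Δ t) fun a b => sw (c.coact b) fun h b =>
        sw (Δ h) fun h₁ h₂ => sw (k.νInv (g ⊗ₜ h₁)) fun p q =>
          F (linExt s.act (q ⊗ₜ m)) (linExt k.μ (h₂ ⊗ₜ p)) b a :=
      sw_cotensor hx (fun m g t => sw (Δ t) fun a b => sw (c.coact b) fun h b =>
        sw (Δ h) fun h₁ h₂ => sw (k.νInv (g ⊗ₜ h₁)) fun p q =>
          F (linExt s.act (q ⊗ₜ m)) (linExt k.μ (h₂ ⊗ₜ p)) b a) (by fun_prop) (by fun_prop)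
            (by fun_prop)
    _ = sw x fun m t => sw (Δ t) fun a b => sw (c.coact a) fun g a => sw (c.coact b) fun h b =>
        sw (c.coact b) fun h' b => sw (Δ h') fun h₁ h₂ =>
          sw (k.νInv (linExt k.μ (g ⊗ₜ h) ⊗ₜ h₁)) fun p q =>
            F (linExt s.act (q ⊗ₜ m)) (linExt k.μ (h₂ ⊗ₜ p)) b a := by
      refine sw_congr _ fun m t => ?_
      rw [c.sw_comul_coact _ _ (by fun_prop) (by fun_prop) (by fun_prop)]
    _ = sw x fun m t => sw (Δ t) fun a b => sw (c.coact a) fun g a => sw (c.coact b) fun h b =>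
        sw (c.coact b) fun h' b => sw (Δ h) fun h₁ h₂ =>
          sw (k.νInv (linExt k.μ (g ⊗ₜ h₁) ⊗ₜ h₂)) fun p q =>
            F (linExt s.act (q ⊗ₜ m)) (linExt k.μ (h' ⊗ₜ p)) b a := by
      refine sw_congr _ fun m t => sw_congr _ fun a b => sw_congr _ fun g a => ?_
      refine (sw_congr _ fun h b => hc.sw_coassoc b (fun h₁ h₂ b =>
        sw (k.νInv (linExt k.μ (g ⊗ₜ h) ⊗ₜ h₁)) fun p q =>
            F (linExt s.act (q ⊗ₜ m)) (linExt k.μ (h₂ ⊗ₜ p)) b a) (by fun_prop) (by fun_prop)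
              (by fun_prop)).trans ?_
      rw [← hc.sw_coassoc _ _ (by fun_prop) (by fun_prop) (by fun_prop)]
      exact sw_congr _ fun h b => sw_comm _ _ _
    -- `g h₁ ⊗ h₂ = ν(g ⊗ h)`
    _ = sw x fun m t => sw (Δ t) fun a b => sw (c.coact a) fun g a => sw (c.coact b) fun h b =>
        sw (c.coact b) fun h' b => F (linExt s.act (h ⊗ₜ m)) (linExt k.μ (h' ⊗ₜ g)) b a := by
      refine sw_congr _ fun m t => ?_
      have hW := sw_congr_of_mem_withParam
        (c.coact_coact_mem hα hβ (LeftComoduleCoalgebra.comul_mem_selfCotensor t))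
        (F := fun p w => sw p fun a b => sw (c.coact b) fun h' b => sw w fun g h =>
          sw (Δ h) fun h₁ h₂ => sw (k.νInv (linExt k.μ (g ⊗ₜ h₁) ⊗ₜ h₂)) fun p q =>
            F (linExt s.act (q ⊗ₜ m)) (linExt k.μ (h' ⊗ₜ p)) b a)
        (G := fun p w => sw p fun a b => sw (c.coact b) fun h' b => sw w fun g h =>
          F (linExt s.act (h ⊗ₜ m)) (linExt k.μ (h' ⊗ₜ g)) b a)
        (fun p w hw => sw_congr _ fun a b => sw_congr _ fun h' b => LeftHopfCoalgebra.sw_νInv hw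
          (fun p q => F (linExt s.act (q ⊗ₜ m)) (linExt k.μ (h' ⊗ₜ p)) b a) (by fun_prop)
            (by fun_prop)) (by fun_prop) (by fun_prop) (by fun_prop) (by fun_prop)
      simpa (disch := fun_prop) only [sw_sw, sw_apply] using hW
    _ = _ := by
      refine sw_congr _ fun m t => sw_congr _ fun a b => ?_
      simp only [sw_comm (c.coact a)]

end LeftRightSAYDStr

end RotationColinear

/-! ### Domains of the iterated products -/

section IteratedCoaction

variable {S K T M V : Type*} [AddCommGroup S] [Module ℂ S] [Coalgebra ℂ S]
  [AddCommGroup K] [Module ℂ K] [Coalgebra ℂ K] [AddCommGroup T] [Module ℂ T] [Coalgebra ℂ T]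
  [AddCommGroup M] [Module ℂ M] [AddCommGroup V] [Module ℂ V]

namespace LeftBicoalgebroid

variable {k : LeftBicoalgebroid S K}

theorem sw_μ_assoc {w : (K ⊗[ℂ] K) ⊗[ℂ] K} (hw : w ∈ cotensor₃ k.βR k.αL k.βR k.αL)
    (F : K → V) (hF : Lin F) :
    (sw w fun p e => F (linExt k.μ (linExt k.μ p ⊗ₜ e))) =
      sw w fun p e => sw p fun g h => F (linExt k.μ (g ⊗ₜ linExt k.μ (h ⊗ₜ e))) := by
  have := congrArg hF.bundle (k.μ_assoc w hw)
  simpa (disch := fun_prop) only [map_sw, equiv_sw, assoc_eq_sw, lTensor_eq_sw,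
    rTensor_eq_sw, sw_sw, sw_apply, Lin.bundle_apply] using this

theorem sw_comul_β_μ {w : K ⊗[ℂ] K} (hw : w ∈ cotensor k.βR k.αL) (F : K → S → V)
    (h₁ : ∀ b, Lin fun a => F a b) (h₂ : ∀ a, Lin fun b => F a b) :
    (sw (Δ (linExt k.μ w)) fun a b => F b (k.β a)) =
      sw w fun g h => sw (Δ h) fun a b => F (linExt k.μ (g ⊗ₜ b)) (k.β a) := by
  have := congrArg (fun z => sw z F) (k.μ_colinear_right ⟨w, hw⟩)
  rw [← linExt_apply] at this
  simpa (disch := fun_prop) only [k.sw_βR, lTensor_eq_sw, rTensor_eq_sw, assoc_symm_eq_sw, sw_sw,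
    sw_apply] using this

theorem sw_μ_mem {w : (K ⊗[ℂ] K) ⊗[ℂ] K} (hw : w ∈ cotensor₃ k.βR k.αL k.βR k.αL) :
    (sw w fun p e => linExt k.μ p ⊗ₜ[ℂ] e) ∈ cotensor k.βR k.αL := by
  obtain ⟨hw₁, hw₂⟩ := mem_cotensor₃_iff.1 hw
  rw [mem_cotensor_iff]
  have h₁ := sw_congr_of_mem_withParam hw₁
    (F := fun e p => sw (Δ (linExt k.μ p)) fun a b => b ⊗ₜ[ℂ] (k.β a ⊗ₜ[ℂ] e))
    (G := fun e p => sw p fun g h => sw (Δ h) fun a b =>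
      linExt k.μ (g ⊗ₜ b) ⊗ₜ[ℂ] (k.β a ⊗ₜ[ℂ] e))
    (fun e p hp => sw_comul_β_μ hp (fun a b => a ⊗ₜ[ℂ] (b ⊗ₜ[ℂ] e)) (by fun_prop) (by fun_prop))
    (by fun_prop) (by fun_prop) (by fun_prop) (by fun_prop)
  have h₂ := sw_congr_of_mem_withParam hw₂
    (F := fun g p => sw p fun h e => sw (k.βR h) fun b a =>
      linExt k.μ (g ⊗ₜ b) ⊗ₜ[ℂ] (a ⊗ₜ[ℂ] e))
    (G := fun g p => sw p fun h e => sw (k.αL e) fun a b =>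
      linExt k.μ (g ⊗ₜ h) ⊗ₜ[ℂ] (a ⊗ₜ[ℂ] b))
    (fun e p hp => sw_cotensor hp _ (by fun_prop) (by fun_prop) (by fun_prop))
    (by fun_prop) (by fun_prop) (by fun_prop) (by fun_prop)
  have h₀ : ∀ (w : K ⊗[ℂ] K) (e : K), sw (Δ (linExt k.μ w)) (fun a b => b ⊗ₜ[ℂ] (k.β a ⊗ₜ[ℂ] e)) =
      sw w fun g h => sw (Δ (linExt k.μ (g ⊗ₜ h))) fun a b => b ⊗ₜ[ℂ] (k.β a ⊗ₜ[ℂ] e) := by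
    intro w e
    conv_lhs => rw [← sw_tmul_self w]
    simp (disch := fun_prop) only [map_sw, sw_sw]
  have h₀' : ∀ (w : K ⊗[ℂ] K) (a : S) (b : K), linExt k.μ w ⊗ₜ[ℂ] (a ⊗ₜ[ℂ] b) =
      sw w fun g h => linExt k.μ (g ⊗ₜ h) ⊗ₜ[ℂ] (a ⊗ₜ[ℂ] b) := by
    intro w a b
    conv_lhs => rw [← sw_tmul_self w]
    simp (disch := fun_prop) only [map_sw, sw_tmul]
  simp (disch := fun_prop) only [sw_sw, sw_apply, k.sw_βR, k.sw_αL] at h₁ h₂ ⊢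
  refine (sw_congr _ fun p e => h₀ p e).trans (h₁.trans (h₂.trans ?_))
  refine sw_congr _ fun p e => Eq.trans ?_ (sw_congr _ fun a b => (h₀' p (k.α a) b).symm)
  exact sw_comm _ _ _

end LeftBicoalgebroid

variable {k : LeftHopfCoalgebra S K}

namespace LeftComoduleCoalgebra

variable {c : LeftComoduleCoalgebra k T} {π : T →ₗ[ℂ] S}
  (hα : ∀ t, k.α.rTensor T (c.coact t) = π.rTensor T (Δ t))
  (hβ : ∀ t, TensorProduct.comm ℂ S T (k.β.rTensor T (c.coact t)) = π.lTensor T (Δ t))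

omit [Coalgebra ℂ S] in
theorem comul_right_mem {p : T ⊗[ℂ] T} (hp : p ∈ selfCotensor π) :
    (sw p fun u v => sw (Δ v) fun a b => b ⊗ₜ[ℂ] (u ⊗ₜ[ℂ] a)) ∈ withParam T (selfCotensor π) := by
  rw [mem_withParam_cotensor_iff]
  simp (disch := fun_prop) only [sw_sw, sw_apply, LinearMap.comp_apply, lTensor_eq_sw,
    rTensor_eq_sw]
  have := sw_selfCotensor hp (fun u s v => sw (Δ v) fun a b => b ⊗ₜ[ℂ] (u ⊗ₜ[ℂ] (s ⊗ₜ[ℂ] a)))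
    (by fun_prop) (by fun_prop) (by fun_prop)
  simp (disch := fun_prop) only [sw_coassoc]
  rw [← this]
  exact sw_congr _ fun u v => sw_comm _ _ _

include hα hβ in
/-- `(u₀ ⊗ v₀ ⊗ w₀) ⊗ (u₋₁ ⊗ v₋₁ ⊗ w₋₁)` has its `K`-part in `K □ K □ K`, on `T □_S T □_S T`. -/
theorem coact₃_mem {p : T ⊗[ℂ] T} (hp : p ∈ selfCotensor π) :
    (sw p fun u v => sw (Δ v) fun a b => sw (c.coact u) fun g u => sw (c.coact a) fun h a =>
      sw (c.coact b) fun e b => (u ⊗ₜ[ℂ] (a ⊗ₜ[ℂ] b)) ⊗ₜ[ℂ] ((g ⊗ₜ[ℂ] h) ⊗ₜ[ℂ] e)) ∈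
        withParam (T ⊗[ℂ] (T ⊗[ℂ] T)) (cotensor₃ k.βR k.αL k.βR k.αL) := by
  refine mem_withParam_cotensor₃ ?_ ?_
  · simp (disch := fun_prop) only [sw_sw, sw_apply]
    have := sw_mem_of_mem_withParam (W := ((T ⊗[ℂ] (T ⊗[ℂ] T)) ⊗[ℂ] K) ⊗[ℂ] (K ⊗[ℂ] K))
      (comul_right_mem hp)
      (q := withParam ((T ⊗[ℂ] (T ⊗[ℂ] T)) ⊗[ℂ] K) (cotensor k.βR k.αL))
      (F := fun b p => sw p fun u a => sw (c.coact u) fun g u => sw (c.coact a) fun h a =>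
      sw (c.coact b) fun e b => ((u ⊗ₜ[ℂ] (a ⊗ₜ[ℂ] b)) ⊗ₜ[ℂ] e) ⊗ₜ[ℂ] (g ⊗ₜ[ℂ] h))
      (fun b p hp => by
        have := sw_mem_withParam (R' := (T ⊗[ℂ] (T ⊗[ℂ] T)) ⊗[ℂ] K) (c.coact_coact_mem hα hβ hp)
          (fun q => sw q fun u a => sw (c.coact b) fun e b => (u ⊗ₜ[ℂ] (a ⊗ₜ[ℂ] b)) ⊗ₜ[ℂ] e)
          (by fun_prop)
        simpa (disch := fun_prop) only [sw_sw, sw_apply, sw_tmul] using this)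
      (by fun_prop) (by fun_prop)
    simpa (disch := fun_prop) only [sw_sw, sw_apply] using this
  · simp (disch := fun_prop) only [sw_sw, sw_apply]
    refine sw_mem_withParam_of_forall p fun u v => ?_
    have := sw_mem_withParam (R' := (T ⊗[ℂ] (T ⊗[ℂ] T)) ⊗[ℂ] K)
      (c.coact_coact_mem hα hβ (comul_mem_selfCotensor v))
      (fun q => sw q fun a b => sw (c.coact u) fun g u => (u ⊗ₜ[ℂ] (a ⊗ₜ[ℂ] b)) ⊗ₜ[ℂ] g)
      (by fun_prop)
    simp (disch := fun_prop) only [sw_sw, sw_apply, sw_tmul] at this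
    simpa only [sw_comm (c.coact u)] using this

end LeftComoduleCoalgebra

namespace LeftRightSAYDStr

variable {s : LeftRightSAYDStr k M} {c : LeftComoduleCoalgebra k T} {π : T →ₗ[ℂ] S}
  (hα : ∀ t, k.α.rTensor T (c.coact t) = π.rTensor T (Δ t))
  (hβ : ∀ t, TensorProduct.comm ℂ S T (k.β.rTensor T (c.coact t)) = π.lTensor T (Δ t))
  {x : M ⊗[ℂ] T} (hx : x ∈ cotensor s.coact c.coact)

theorem sw_baseCoact_act {w : K ⊗[ℂ] M} (hw : w ∈ cotensor k.βR s.baseCoact) (F : S → M → V)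
    (h₁ : ∀ b, Lin fun a => F a b) (h₂ : ∀ a, Lin fun b => F a b) :
    (sw w fun h m => sw (s.baseCoact (linExt s.act (h ⊗ₜ m))) F) =
      sw w fun h m => sw (Δ h) fun a b => F (k.α a) (linExt s.act (b ⊗ₜ m)) := by
  have := congrArg (fun z => sw z F) (s.act_colinear ⟨w, hw⟩)
  rw [← linExt_apply] at this
  simp (disch := fun_prop) only [lTensor_eq_sw, rTensor_eq_sw, assoc_eq_sw, k.sw_αL, sw_sw,
    sw_apply] at this
  rw [← this]
  conv_rhs => rw [← sw_tmul_self w]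
  simp (disch := fun_prop) only [map_sw, sw_sw]

include hx hα hβ in
/-- On a rotated element `m ⊗ (u ⊗ v)` the left `S`-coaction of `m` is given by `v₁ ⊗ π(v₂)`. -/
theorem sw_baseCoact_rotate (F : S → M → T → T → V) (h₁ : ∀ b c d, Lin fun a => F a b c d)
    (h₂ : ∀ a c d, Lin fun b => F a b c d) (h₃ : ∀ a b d, Lin fun c => F a b c d)
    (h₄ : ∀ a b c, Lin fun d => F a b c d) :
    (sw (s.rotate c x) fun m p => sw (s.baseCoact m) fun d m => sw p fun u v => F d m u v) =
      sw (s.rotate c x) fun m p => sw p fun u v => sw (Δ v) fun a b => F (π b) m u a := by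
  have hc := c.isLeftCoaction_coact
  simp (disch := fun_prop) only [sw_rotate, sw_apply]
  have hW := sw_congr_of_mem_withParam (coact_comul_mem hβ hx)
    (F := fun p w => sw p fun b a => sw w fun h m => sw (s.baseCoact (linExt s.act (h ⊗ₜ m)))
      fun d m => F d m b a)
    (G := fun p w => sw p fun b a => sw w fun h m => sw (Δ h) fun h₁ h₂ =>
      F (k.α h₁) (linExt s.act (h₂ ⊗ₜ m)) b a)
    (fun p w hw => sw_congr _ fun b a => s.sw_baseCoact_act hw (fun d m => F d m b a)
      (by fun_prop) (by fun_prop)) (by fun_prop) (by fun_prop) (by fun_prop) (by fun_prop)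
  simp (disch := fun_prop) only [sw_sw, sw_apply] at hW
  rw [hW]
  refine sw_congr _ fun m t => ?_
  calc
    _ = sw (Δ t) fun a b => sw (Δ b) fun d b => sw (c.coact b) fun h b =>
        F (π d) (linExt s.act (h ⊗ₜ m)) b a := by
      refine sw_congr _ fun a b => ?_
      rw [hc.sw_coassoc _ _ (by fun_prop) (by fun_prop) (by fun_prop)]
      exact c.sw_α_coact hα b (fun d b => sw (c.coact b) fun h b =>
        F d (linExt s.act (h ⊗ₜ m)) b a) (by fun_prop) (by fun_prop)
    _ = _ := by
      rw [← sw_coassoc _ _ (by fun_prop) (by fun_prop) (by fun_prop)]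
      exact sw_congr _ fun a b => sw_comm _ _ _

include hx hα hβ in
/-- For a rotated element `m ⊗ (u ⊗ v)` the element `(v₂)₋₁ ⊗ m` belongs to `K □ M`. -/
theorem coact_rotate_mem :
    (sw (s.rotate c x) fun m p => sw p fun u v => sw (Δ v) fun a b => sw (c.coact b) fun e b =>
      (u ⊗ₜ[ℂ] (a ⊗ₜ[ℂ] b)) ⊗ₜ[ℂ] (e ⊗ₜ[ℂ] m)) ∈
        withParam (T ⊗[ℂ] (T ⊗[ℂ] T)) (cotensor k.βR s.baseCoact) := by
  have hc := c.isLeftCoaction_coact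
  rw [mem_withParam_cotensor_iff]
  simp (disch := fun_prop) only [sw_sw, sw_apply, k.sw_βR]
  have := sw_baseCoact_rotate hα hβ hx (fun d m u v => sw (Δ v) fun a b =>
    sw (c.coact b) fun e b => (u ⊗ₜ[ℂ] (a ⊗ₜ[ℂ] b)) ⊗ₜ[ℂ] (e ⊗ₜ[ℂ] (d ⊗ₜ[ℂ] m)))
      (by fun_prop) (by fun_prop) (by fun_prop) (by fun_prop)
  simp only [sw_comm _ (s.baseCoact _)] at this ⊢
  rw [this]
  refine sw_congr _ fun m p => sw_congr _ fun u v => ?_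
  rw [sw_coassoc _ _ (by fun_prop) (by fun_prop) (by fun_prop)]
  refine sw_congr _ fun a b => ?_
  rw [hc.sw_coassoc _ _ (by fun_prop) (by fun_prop) (by fun_prop)]
  exact c.sw_β_coact hβ b (fun d b => sw (c.coact b) fun e b =>
    (u ⊗ₜ[ℂ] (a ⊗ₜ[ℂ] b)) ⊗ₜ[ℂ] (e ⊗ₜ[ℂ] (d ⊗ₜ[ℂ] m))) (by fun_prop) (by fun_prop)

end LeftRightSAYDStr

end IteratedCoaction

/-! ### Composition of rotations -/

section IteratedRotation

variable {S K T M V : Type*} [AddCommGroup S] [Module ℂ S] [Coalgebra ℂ S]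
  [AddCommGroup K] [Module ℂ K] [Coalgebra ℂ K] [AddCommGroup T] [Module ℂ T] [Coalgebra ℂ T]
  [AddCommGroup M] [Module ℂ M] [AddCommGroup V] [Module ℂ V]
  {k : LeftHopfCoalgebra S K}

namespace LeftRightSAYDStr

variable {s : LeftRightSAYDStr k M} {c : LeftComoduleCoalgebra k T} {π : T →ₗ[ℂ] S}
  (hα : ∀ t, k.α.rTensor T (c.coact t) = π.rTensor T (Δ t))
  (hβ : ∀ t, TensorProduct.comm ℂ S T (k.β.rTensor T (c.coact t)) = π.lTensor T (Δ t))
  {x : M ⊗[ℂ] T} (hx : x ∈ cotensor s.coact c.coact)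

include hx hα hβ in
/-- Associativity of the action for `(t₂)₋₁ ⊗ (t₃)₋₁ ⊗ m`, where `m ⊗ t` is in `M □_K T`. -/
theorem sw_act_act_comul (F : M → T → T → T → V) (h₁ : ∀ b c d, Lin fun a => F a b c d)
    (h₂ : ∀ a c d, Lin fun b => F a b c d) (h₃ : ∀ a b d, Lin fun c => F a b c d)
    (h₄ : ∀ a b c, Lin fun d => F a b c d) :
    (sw x fun m t => sw (Δ t) fun a b => sw (Δ b) fun b d => sw (c.coact b) fun g b =>
      sw (c.coact d) fun h d => F (linExt s.act (linExt k.μ (g ⊗ₜ h) ⊗ₜ m)) a b d) =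
    sw x fun m t => sw (Δ t) fun a b => sw (Δ b) fun b d => sw (c.coact b) fun g b =>
      sw (c.coact d) fun h d => F (linExt s.act (g ⊗ₜ linExt s.act (h ⊗ₜ m))) a b d := by
  have hW : (sw x fun m t => sw (Δ t) fun a b => sw (Δ b) fun b d => sw (c.coact b) fun g b =>
      sw (c.coact d) fun h d => (a ⊗ₜ[ℂ] (b ⊗ₜ[ℂ] d)) ⊗ₜ[ℂ] ((g ⊗ₜ[ℂ] h) ⊗ₜ[ℂ] m)) ∈
        withParam (T ⊗[ℂ] (T ⊗[ℂ] T)) (cotensor₃ k.βR k.αL k.βR s.baseCoact) := by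
    refine mem_withParam_cotensor₃ ?_ ?_
    · simp (disch := fun_prop) only [sw_sw, sw_apply]
      refine sw_mem_withParam_of_forall x fun m t =>
        sw_mem_withParam_of_forall (Δ t) fun a b => ?_
      have := sw_mem_withParam (R' := (T ⊗[ℂ] (T ⊗[ℂ] T)) ⊗[ℂ] M)
        (c.coact_coact_mem hα hβ (LeftComoduleCoalgebra.comul_mem_selfCotensor b))
        (fun q => (a ⊗ₜ[ℂ] q) ⊗ₜ[ℂ] m) (by fun_prop)
      simpa (disch := fun_prop) only [sw_sw, sw_apply] using this
    · simp (disch := fun_prop) only [sw_sw, sw_apply]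
      have := sw_mem_withParam (R' := (T ⊗[ℂ] (T ⊗[ℂ] T)) ⊗[ℂ] K) (coact_comul_mem hβ hx)
        (fun q => sw q fun d a => sw (Δ a) fun a b => sw (c.coact b) fun g b =>
          (a ⊗ₜ[ℂ] (b ⊗ₜ[ℂ] d)) ⊗ₜ[ℂ] g) (by fun_prop)
      simp (disch := fun_prop) only [sw_sw, sw_apply, sw_tmul] at this
      convert this using 1
      refine sw_congr _ fun m t => ?_
      rw [← sw_coassoc _ _ (by fun_prop) (by fun_prop) (by fun_prop)]
      refine sw_congr _ fun a d => ?_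
      simp only [sw_comm (c.coact d)]
  have := sw_congr_of_mem_withParam hW
    (F := fun q w => sw q fun a q => sw q fun b d => sw w fun p m =>
      F (linExt s.act (linExt k.μ p ⊗ₜ m)) a b d)
    (G := fun q w => sw q fun a q => sw q fun b d => sw w fun p m => sw p fun g h =>
      F (linExt s.act (g ⊗ₜ linExt s.act (h ⊗ₜ m))) a b d)
    (fun q w hw => sw_congr _ fun a q => sw_congr _ fun b d =>
      s.sw_act_assoc hw (fun m => F m a b d) (by fun_prop))
    (by fun_prop) (by fun_prop) (by fun_prop) (by fun_prop)
  simpa (disch := fun_prop) only [sw_sw, sw_apply] using this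

include hx hα hβ in
/-- Associativity of the action for `u₋₁ (v₁)₋₁ ⊗ (v₂)₋₁ ⊗ m`, and of the product, where
`m ⊗ (u ⊗ v)` is a rotated element. -/
theorem sw_act_act_rotate (F : M → T → T → T → V) (h₁ : ∀ b c d, Lin fun a => F a b c d)
    (h₂ : ∀ a c d, Lin fun b => F a b c d) (h₃ : ∀ a b d, Lin fun c => F a b c d)
    (h₄ : ∀ a b c, Lin fun d => F a b c d) :
    (sw (s.rotate c x) fun m p => sw p fun u v => sw (Δ v) fun a b => sw (c.coact u) fun g u =>
      sw (c.coact a) fun h a => sw (c.coact b) fun e b =>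
        F (linExt s.act (linExt k.μ (g ⊗ₜ h) ⊗ₜ linExt s.act (e ⊗ₜ m))) u a b) =
    sw (s.rotate c x) fun m p => sw p fun u v => sw (Δ v) fun a b => sw (c.coact u) fun g u =>
      sw (c.coact a) fun h a => sw (c.coact b) fun e b =>
        F (linExt s.act (linExt k.μ (g ⊗ₜ linExt k.μ (h ⊗ₜ e)) ⊗ₜ m)) u a b := by
  have hT := sw_mem_of_mem_withParam (rotate_mem hα hβ hx)
    (q := withParam (M ⊗[ℂ] (T ⊗[ℂ] (T ⊗[ℂ] T))) (cotensor₃ k.βR k.αL k.βR k.αL))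
    (F := fun m p => sw p fun u v => sw (Δ v) fun a b => sw (c.coact u) fun g u =>
      sw (c.coact a) fun h a => sw (c.coact b) fun e b =>
        (m ⊗ₜ[ℂ] (u ⊗ₜ[ℂ] (a ⊗ₜ[ℂ] b))) ⊗ₜ[ℂ] ((g ⊗ₜ[ℂ] h) ⊗ₜ[ℂ] e))
    (fun m p hp => by
      have := sw_mem_withParam (LeftComoduleCoalgebra.coact₃_mem hα hβ hp) (fun q => m ⊗ₜ[ℂ] q)
        (by fun_prop)
      simpa (disch := fun_prop) only [sw_sw, sw_apply] using this) (by fun_prop) (by fun_prop)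
  have hW : (sw (s.rotate c x) fun m p => sw p fun u v => sw (Δ v) fun a b =>
      sw (c.coact u) fun g u => sw (c.coact a) fun h a => sw (c.coact b) fun e b =>
        (u ⊗ₜ[ℂ] (a ⊗ₜ[ℂ] b)) ⊗ₜ[ℂ] ((linExt k.μ (g ⊗ₜ h) ⊗ₜ[ℂ] e) ⊗ₜ[ℂ] m)) ∈
        withParam (T ⊗[ℂ] (T ⊗[ℂ] T)) (cotensor₃ k.βR k.αL k.βR s.baseCoact) := by
    refine mem_withParam_cotensor₃ ?_ ?_
    · simp (disch := fun_prop) only [sw_sw, sw_apply]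
      have := sw_mem_of_mem_withParam hT
        (q := withParam ((T ⊗[ℂ] (T ⊗[ℂ] T)) ⊗[ℂ] M) (cotensor k.βR k.αL))
        (F := fun q w => sw q fun m q => (q ⊗ₜ[ℂ] m) ⊗ₜ[ℂ] sw w fun p e => linExt k.μ p ⊗ₜ[ℂ] e)
        (fun q w hw => sw_mem_withParam_of_forall q fun m q =>
          tmul_mem_withParam (LeftBicoalgebroid.sw_μ_mem hw) (q ⊗ₜ[ℂ] m))
        (by fun_prop) (by fun_prop)
      simpa (disch := fun_prop) only [sw_sw, sw_apply] using this
    · simp (disch := fun_prop) only [sw_sw, sw_apply]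
      have := sw_mem_withParam (R' := (T ⊗[ℂ] (T ⊗[ℂ] T)) ⊗[ℂ] K) (coact_rotate_mem hα hβ hx)
        (fun q => sw q fun u q => sw q fun a b => sw (c.coact u) fun g u =>
          sw (c.coact a) fun h a => (u ⊗ₜ[ℂ] (a ⊗ₜ[ℂ] b)) ⊗ₜ[ℂ] linExt k.μ (g ⊗ₜ h)) (by fun_prop)
      simp (disch := fun_prop) only [sw_sw, sw_apply, sw_tmul] at this
      convert this using 1
      refine sw_congr _ fun m p => sw_congr _ fun u v => sw_congr _ fun a b => ?_
      simp only [sw_comm (c.coact b)]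
  have e₁ := sw_congr_of_mem_withParam hW
    (F := fun q w => sw q fun u q => sw q fun a b => sw w fun p m =>
      F (linExt s.act (linExt k.μ p ⊗ₜ m)) u a b)
    (G := fun q w => sw q fun u q => sw q fun a b => sw w fun p m => sw p fun g h =>
      F (linExt s.act (g ⊗ₜ linExt s.act (h ⊗ₜ m))) u a b)
    (fun q w hw => sw_congr _ fun a q => sw_congr _ fun b d =>
      s.sw_act_assoc hw (fun m => F m a b d) (by fun_prop))
    (by fun_prop) (by fun_prop) (by fun_prop) (by fun_prop)
  have e₂ := sw_congr_of_mem_withParam hT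
    (F := fun q w => sw q fun m q => sw q fun u q => sw q fun a b => sw w fun p e =>
      F (linExt s.act (linExt k.μ (linExt k.μ p ⊗ₜ e) ⊗ₜ m)) u a b)
    (G := fun q w => sw q fun m q => sw q fun u q => sw q fun a b => sw w fun p e =>
      sw p fun g h => F (linExt s.act (linExt k.μ (g ⊗ₜ linExt k.μ (h ⊗ₜ e)) ⊗ₜ m)) u a b)
    (fun q w hw => sw_congr _ fun m q => sw_congr _ fun u q => sw_congr _ fun a b =>
      LeftBicoalgebroid.sw_μ_assoc hw (fun g => F (linExt s.act (g ⊗ₜ m)) u a b) (by fun_prop))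
    (by fun_prop) (by fun_prop) (by fun_prop) (by fun_prop)
  simp (disch := fun_prop) only [sw_sw, sw_apply] at e₁ e₂
  rw [← e₂, e₁]

include hx hα hβ in
/-- Rotating twice in `M □_K (T □_S T □_S T)`, by two places each time, is rotating by one place:
the full turn is the identity by stability. -/
theorem sw_rotate_rotate (F : M → T → T → T → V) (h₁ : ∀ b c d, Lin fun a => F a b c d)
    (h₂ : ∀ a c d, Lin fun b => F a b c d) (h₃ : ∀ a b d, Lin fun c => F a b c d)
    (h₄ : ∀ a b c, Lin fun d => F a b c d) :
    (sw (s.rotate c x) fun m p => sw p fun u v => sw (Δ u) fun a b => sw (c.coact b) fun g b =>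
      sw (c.coact v) fun h v => F (linExt s.act (linExt k.μ (g ⊗ₜ h) ⊗ₜ m)) b v a) =
    sw (s.rotate c x) fun m p => sw p fun u v => sw (Δ v) fun a b => F m u a b := by
  calc
    _ = sw x fun m t => sw (Δ t) fun v b => sw (Δ b) fun a d => sw (c.coact a) fun e a =>
        sw (c.coact d) fun f d => sw (c.coact d) fun g d => sw (c.coact v) fun h v =>
          F (linExt s.act (linExt k.μ (g ⊗ₜ h) ⊗ₜ
            linExt s.act (linExt k.μ (e ⊗ₜ f) ⊗ₜ m))) d v a := by
      simp (disch := fun_prop) only [sw_rotate, sw_apply]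
      refine sw_congr _ fun m t => sw_congr _ fun v b => ?_
      exact c.sw_comul_coact b (fun e a d => sw (c.coact d) fun g d => sw (c.coact v) fun h v =>
        F (linExt s.act (linExt k.μ (g ⊗ₜ h) ⊗ₜ linExt s.act (e ⊗ₜ m))) d v a) (by fun_prop)
          (by fun_prop) (by fun_prop)
    _ = sw x fun m t => sw (Δ t) fun v b => sw (Δ b) fun a d => sw (c.coact a) fun e a =>
        sw (c.coact d) fun f d => sw (c.coact d) fun g d => sw (c.coact v) fun h v =>
          F (linExt s.act (linExt k.μ (g ⊗ₜ h) ⊗ₜ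
            linExt s.act (e ⊗ₜ linExt s.act (f ⊗ₜ m)))) d v a :=
      sw_act_act_comul hα hβ hx (fun m v a d => sw (c.coact d) fun g d =>
        sw (c.coact v) fun h v => F (linExt s.act (linExt k.μ (g ⊗ₜ h) ⊗ₜ m)) d v a)
        (by fun_prop) (by fun_prop) (by fun_prop) (by fun_prop)
    _ = sw (s.rotate c x) fun m p => sw p fun u v => sw (Δ v) fun a b => sw (c.coact u) fun g u =>
      sw (c.coact a) fun h a => sw (c.coact b) fun e b =>
        F (linExt s.act (linExt k.μ (g ⊗ₜ h) ⊗ₜ linExt s.act (e ⊗ₜ m))) u a b := by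
      simp (disch := fun_prop) only [sw_rotate, sw_apply]
      refine sw_congr _ fun m t => ?_
      rw [← sw_coassoc _ _ (by fun_prop) (by fun_prop) (by fun_prop)]
      refine sw_congr _ fun v d => ?_
      refine Eq.trans ?_ (sw_comm (Δ v) (c.coact d) _)
      refine sw_congr _ fun v a => ?_
      simp only [sw_comm (c.coact a)]
    _ = sw (s.rotate c x) fun m p => sw p fun u v => sw (Δ v) fun a b => sw (c.coact u) fun g u =>
      sw (c.coact a) fun h a => sw (c.coact b) fun e b =>
        F (linExt s.act (linExt k.μ (g ⊗ₜ linExt k.μ (h ⊗ₜ e)) ⊗ₜ m)) u a b :=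
      sw_act_act_rotate hα hβ hx F h₁ h₂ h₃ h₄
    _ = sw (s.rotate c x) fun m p => sw p fun u v => sw (c.coact u) fun g u =>
        sw (c.coact v) fun h v => sw (Δ v) fun a b =>
        F (linExt s.act (linExt k.μ (g ⊗ₜ h) ⊗ₜ m)) u a b := by
      refine sw_congr _ fun m p => sw_congr _ fun u v => ?_
      rw [sw_comm]
      refine sw_congr _ fun g u => ?_
      rw [c.sw_comul_coact _ _ (by fun_prop) (by fun_prop) (by fun_prop)]
    -- colinearity of the rotation turns the product into the coaction of `m`
    _ = sw (s.rotate c x) fun m p => sw (s.coact m) fun m h => sw p fun u v => sw (Δ v) fun a b =>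
        F (linExt s.act (h ⊗ₜ m)) u a b :=
      (sw_coact_rotate hα hβ hx (fun m h u v => sw (Δ v) fun a b =>
        F (linExt s.act (h ⊗ₜ m)) u a b) (by fun_prop) (by fun_prop) (by fun_prop)
          (by fun_prop)).symm
    -- stability
    _ = _ := by
      refine sw_congr _ fun m p => ?_
      have h : Lin fun m => sw p fun u v => sw (Δ v) fun a b => F m u a b := by fun_prop
      exact (map_sw h.bundle (s.coact m) fun m g => linExt s.act (g ⊗ₜ m)).symm.trans
        (congrArg h.bundle (s.sw_stable m))

end LeftRightSAYDStr

end IteratedRotation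

/-! ### The canonical map and its inverse -/

section Can

variable {C : Type u₁} {B : Type u₂} {T : Type u₃} {K : Type u₄}
  [AddCommGroup C] [Module ℂ C] [Coalgebra ℂ C] [AddCommGroup B] [Module ℂ B] [Coalgebra ℂ B]
  [AddCommGroup T] [Module ℂ T] [Coalgebra ℂ T] [AddCommGroup K] [Module ℂ K] [Coalgebra ℂ K]
  {V : Type*} [AddCommGroup V] [Module ℂ V]

namespace RightModuleCoalgebra

variable {b : RightBicoalgebroid C B} (A : RightModuleCoalgebra b T)

theorem sw_comul_act {w : T ⊗[ℂ] B} (hw : w ∈ cotensor A.baseCoact b.βL) (F : T → T → V)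
    (h₁ : ∀ b, Lin fun a => F a b) (h₂ : ∀ a, Lin fun b => F a b) :
    (sw w fun t b => sw (Δ (linExt A.act (t ⊗ₜ b))) F) =
      sw w fun t b => sw (Δ t) fun t₁ t₂ => sw (Δ b) fun b₁ b₂ =>
        F (linExt A.act (t₁ ⊗ₜ b₁)) (linExt A.act (t₂ ⊗ₜ b₂)) := by
  have := congrArg (fun z => sw z F) (A.comul_act ⟨w, hw⟩)
  rw [← linExt_apply] at this
  simp (disch := fun_prop) only [map_eq_sw, tttComm_eq_sw, sw_sw, sw_apply] at this
  rw [← this]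
  conv_rhs => rw [← sw_tmul_self w]
  simp (disch := fun_prop) only [map_sw, sw_sw]

theorem sw_counit_act {w : T ⊗[ℂ] B} (hw : w ∈ cotensor A.baseCoact b.βL) :
    (sw w fun t b => ε (linExt A.act (t ⊗ₜ b))) = sw w fun t b => ε t • ε b := by
  have := A.counit_act ⟨w, hw⟩
  rw [← linExt_apply] at this
  simp (disch := fun_prop) only [map_eq_sw, lid_eq_sw, sw_sw, sw_apply] at this
  rw [← this]
  conv_rhs => rw [← sw_tmul_self w]
  simp (disch := fun_prop) only [map_sw]

theorem can_eq_sw (w : T ⊗[ℂ] B) : A.can w =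
    sw w fun t b => sw (Δ t) fun t₁ t₂ => t₁ ⊗ₜ[ℂ] linExt A.act (t₂ ⊗ₜ b) := by
  simp (disch := fun_prop) only [can, LinearMap.comp_apply, LinearEquiv.coe_coe, lTensor_eq_sw,
    rTensor_eq_sw, assoc_eq_sw, sw_sw, sw_apply]

/-- `t₁ ⊗ (t₂ ⊗ b) ∈ T ⊗ (T □_C B)` for `t ⊗ b ∈ T □_C B`. -/
theorem comul_left_mem {w : T ⊗[ℂ] B} (hw : w ∈ cotensor A.baseCoact b.βL) :
    (sw w fun t b => sw (Δ t) fun t₁ t₂ => t₁ ⊗ₜ[ℂ] (t₂ ⊗ₜ[ℂ] b)) ∈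
      withParam T (cotensor A.baseCoact b.βL) := by
  refine (mem_withParam_ker (cotensorDiff A.baseCoact b.βL) _).2 ?_
  rw [← A.lTensor_cotensorDiff_comul w hw]
  simp (disch := fun_prop) only [rTensor_eq_sw, assoc_eq_sw, sw_sw, sw_apply]

/-- `t₂ ◁ b₂ ⊗ (t₁ ⊗ b₁) ∈ T ⊗ (T □_C B)` for `t ⊗ b ∈ T □_C B`. -/
theorem comul_act_mem {w : T ⊗[ℂ] B} (hw : w ∈ cotensor A.baseCoact b.βL) :
    (sw w fun t b => sw (Δ t) fun t₁ t₂ => sw (Δ b) fun b₁ b₂ =>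
      linExt A.act (t₂ ⊗ₜ b₂) ⊗ₜ[ℂ] (t₁ ⊗ₜ[ℂ] b₁)) ∈
        withParam T (cotensor A.baseCoact b.βL) := by
  refine (mem_withParam_ker (cotensorDiff A.baseCoact b.βL) _).2 ?_
  have := congrArg (TensorProduct.comm ℂ _ _) (A.map_cotensorDiff_comul w hw)
  rw [map_zero] at this
  rw [← this]
  simp (disch := fun_prop) only [split, LinearMap.comp_apply, LinearEquiv.coe_coe, lTensor_eq_sw,
    rTensor_eq_sw, assoc_eq_sw, assoc_symm_eq_sw, leftComm_eq_sw, map_eq_sw, comm_eq_sw, sw_sw,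
    sw_apply]

end RightModuleCoalgebra

namespace EquivariantGaloisCoextension

variable {b : RightHopfCoalgebra C B} {A : RightModuleCoalgebra b.toRightBicoalgebroid T}
  {k : LeftHopfCoalgebra A.Orbit K} (E : EquivariantGaloisCoextension A k)

/-- The inverse of `can`, extended to `T ⊗ T`. -/
def canInv : T ⊗[ℂ] T →ₗ[ℂ] T ⊗[ℂ] B := invOn A.can E.can_bijOn

theorem canInv_can {q : T ⊗[ℂ] B} (hq : q ∈ cotensor A.baseCoact b.βL) :
    E.canInv (A.can q) = q := invOn_apply _ _ hq

theorem can_canInv {p : T ⊗[ℂ] T} (hp : p ∈ cotensor A.orbitR A.orbitL) :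
    A.can (E.canInv p) = p := by
  obtain ⟨q, hq, rfl⟩ := E.can_bijOn.surjOn hp
  rw [E.canInv_can hq]

theorem canInv_mem {p : T ⊗[ℂ] T} (hp : p ∈ cotensor A.orbitR A.orbitL) :
    E.canInv p ∈ cotensor A.baseCoact b.βL := by
  obtain ⟨q, hq, rfl⟩ := E.can_bijOn.surjOn hp
  rwa [E.canInv_can hq]

theorem sw_canInv_can {q : T ⊗[ℂ] B} (hq : q ∈ cotensor A.baseCoact b.βL) (F : T → B → V)
    (h₁ : ∀ b, Lin fun a => F a b) (h₂ : ∀ a, Lin fun b => F a b) :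
    (sw q fun t b => sw (Δ t) fun t₁ t₂ =>
      sw (E.canInv (t₁ ⊗ₜ linExt A.act (t₂ ⊗ₜ b))) F) = sw q F := by
  have := congrArg (fun z => sw z F) (E.canInv_can hq)
  rw [A.can_eq_sw] at this
  simpa (disch := fun_prop) only [map_sw, sw_sw] using this

/-- The inverse of `can` is left `T`-colinear. -/
theorem sw_comul_canInv {p : T ⊗[ℂ] T} (hp : p ∈ cotensor A.orbitR A.orbitL) (F : T → T → B → V)
    (h₁ : ∀ b c, Lin fun a => F a b c) (h₂ : ∀ a c, Lin fun b => F a b c)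
    (h₃ : ∀ a b, Lin fun c => F a b c) :
    (sw p fun u v => sw (Δ u) fun u₁ u₂ => sw (E.canInv (u₂ ⊗ₜ v)) fun t b => F u₁ t b) =
      sw (E.canInv p) fun t b => sw (Δ t) fun t₁ t₂ => F t₁ t₂ b := by
  obtain ⟨q, hq, rfl⟩ := E.can_bijOn.surjOn hp
  rw [E.canInv_can hq, A.can_eq_sw]
  have := sw_congr_of_mem_withParam (A.comul_left_mem hq)
    (F := fun a q => sw q fun t b => sw (Δ t) fun t₁ t₂ =>
      sw (E.canInv (t₁ ⊗ₜ linExt A.act (t₂ ⊗ₜ b))) fun t b => F a t b)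
    (G := fun a q => sw q fun t b => F a t b)
    (fun a q hq => E.sw_canInv_can hq (F a) (by fun_prop) (by fun_prop))
    (by fun_prop) (by fun_prop) (by fun_prop) (by fun_prop)
  simp (disch := fun_prop) only [sw_sw, sw_apply] at this ⊢
  rw [← this]
  exact sw_congr _ fun t b => sw_coassoc t (fun a t₁ t₂ =>
    sw (E.canInv (t₁ ⊗ₜ linExt A.act (t₂ ⊗ₜ b))) fun t b => F a t b)
    (by fun_prop) (by fun_prop) (by fun_prop)

theorem sw_coact_act {w : T ⊗[ℂ] B} (hw : w ∈ cotensor A.baseCoact b.βL) (F : K → T → V)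
    (h₁ : ∀ b, Lin fun a => F a b) (h₂ : ∀ a, Lin fun b => F a b) :
    (sw w fun t b => sw (E.coact (linExt A.act (t ⊗ₜ b))) F) =
      sw w fun t b => sw (E.coact t) fun g t => F g (linExt A.act (t ⊗ₜ b)) := by
  have := congrArg (fun z => sw z F) (E.equivariant ⟨w, hw⟩)
  rw [← linExt_apply] at this
  simp (disch := fun_prop) only [lTensor_eq_sw, rTensor_eq_sw, assoc_eq_sw, sw_sw, sw_apply]
    at this
  rw [← this]
  conv_rhs => rw [← sw_tmul_self w]
  simp (disch := fun_prop) only [map_sw, sw_sw]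

theorem sw_baseCoact_coact (t : T) (F : K → T → C → V) (h₁ : ∀ b c, Lin fun a => F a b c)
    (h₂ : ∀ a c, Lin fun b => F a b c) (h₃ : ∀ a b, Lin fun c => F a b c) :
    (sw (E.coact t) fun g t => sw (A.baseCoact t) fun t c => F g t c) =
      sw (A.baseCoact t) fun t c => sw (E.coact t) fun g t => F g t c := by
  have := congrArg (fun z => sw z fun g z => sw z fun t c => F g t c) (E.baseCoact_coact t)
  simpa (disch := fun_prop) only [lTensor_eq_sw, rTensor_eq_sw, assoc_eq_sw, sw_sw, sw_apply]
    using this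

theorem coact_left_mem {w : T ⊗[ℂ] B} (hw : w ∈ cotensor A.baseCoact b.βL) :
    (sw w fun t b => sw (E.coact t) fun g t => g ⊗ₜ[ℂ] (t ⊗ₜ[ℂ] b)) ∈
      withParam K (cotensor A.baseCoact b.βL) := by
  rw [mem_withParam_cotensor_iff]
  simp (disch := fun_prop) only [sw_sw, sw_apply]
  have := sw_cotensor hw (fun t c b => sw (E.coact t) fun g t => g ⊗ₜ[ℂ] (t ⊗ₜ[ℂ] (c ⊗ₜ[ℂ] b)))
    (by fun_prop) (by fun_prop) (by fun_prop)
  refine (sw_congr _ fun t b => E.sw_baseCoact_coact t (fun g t c =>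
    g ⊗ₜ[ℂ] (t ⊗ₜ[ℂ] (c ⊗ₜ[ℂ] b))) (by fun_prop) (by fun_prop) (by fun_prop)).trans
    (this.trans ?_)
  exact sw_congr _ fun t b => sw_comm _ _ _

/-- The inverse of `can` is left `K`-colinear. -/
theorem sw_coact_canInv {p : T ⊗[ℂ] T} (hp : p ∈ cotensor A.orbitR A.orbitL) (F : K → T → B → V)
    (h₁ : ∀ b c, Lin fun a => F a b c) (h₂ : ∀ a c, Lin fun b => F a b c)
    (h₃ : ∀ a b, Lin fun c => F a b c) :
    (sw p fun u v => sw (E.coact u) fun g u => sw (E.coact v) fun h v =>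
      sw (E.canInv (u ⊗ₜ v)) fun t b => F (linExt k.μ (g ⊗ₜ h)) t b) =
      sw (E.canInv p) fun t b => sw (E.coact t) fun g t => F g t b := by
  obtain ⟨q, hq, rfl⟩ := E.can_bijOn.surjOn hp
  rw [E.canInv_can hq, A.can_eq_sw]
  have h₁ := sw_congr_of_mem_withParam (A.comul_left_mem hq)
    (F := fun a q => sw q fun t b => sw (E.coact (linExt A.act (t ⊗ₜ b))) fun h v =>
      sw (E.coact a) fun g u => sw (E.canInv (u ⊗ₜ v)) fun t b => F (linExt k.μ (g ⊗ₜ h)) t b)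
    (G := fun a q => sw q fun t b => sw (E.coact t) fun h t =>
      sw (E.coact a) fun g u => sw (E.canInv (u ⊗ₜ linExt A.act (t ⊗ₜ b))) fun t b =>
        F (linExt k.μ (g ⊗ₜ h)) t b)
    (fun a q hq => E.sw_coact_act hq (fun h v => sw (E.coact a) fun g u =>
      sw (E.canInv (u ⊗ₜ v)) fun t b => F (linExt k.μ (g ⊗ₜ h)) t b) (by fun_prop) (by fun_prop))
    (by fun_prop) (by fun_prop) (by fun_prop) (by fun_prop)
  have h₂ := sw_congr_of_mem_withParam (E.coact_left_mem hq)
    (F := fun g q => sw q fun t b => sw (Δ t) fun t₁ t₂ =>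
      sw (E.canInv (t₁ ⊗ₜ linExt A.act (t₂ ⊗ₜ b))) fun t b => F g t b)
    (G := fun g q => sw q fun t b => F g t b)
    (fun g q hq => E.sw_canInv_can hq (F g) (by fun_prop) (by fun_prop))
    (by fun_prop) (by fun_prop) (by fun_prop) (by fun_prop)
  simp (disch := fun_prop) only [sw_sw, sw_apply] at h₁ h₂ ⊢
  rw [← h₂]
  simp only [sw_comm (E.coact _) (E.coact (linExt A.act _))]
  rw [h₁]
  refine sw_congr _ fun t b => ?_
  rw [E.sw_comul_coact t (fun g t₁ t₂ => sw (E.canInv (t₁ ⊗ₜ linExt A.act (t₂ ⊗ₜ b))) fun t b =>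
    F g t b) (by fun_prop) (by fun_prop) (by fun_prop)]
  exact sw_congr _ fun t₁ t₂ => sw_comm _ _ _

/-- The inverse of `can` turns the right `T`-coaction of `T □_S T` into
`t ⊗ b ↦ t₁ ⊗ b₁ ⊗ t₂ ◁ b₂`. -/
theorem sw_canInv_comul {p : T ⊗[ℂ] T} (hp : p ∈ cotensor A.orbitR A.orbitL) (F : T → B → T → V)
    (h₁ : ∀ b c, Lin fun a => F a b c) (h₂ : ∀ a c, Lin fun b => F a b c)
    (h₃ : ∀ a b, Lin fun c => F a b c) :
    (sw p fun u v => sw (Δ v) fun v₁ v₂ => sw (E.canInv (u ⊗ₜ v₁)) fun t b => F t b v₂) =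
      sw (E.canInv p) fun t b => sw (Δ t) fun t₁ t₂ => sw (Δ b) fun b₁ b₂ =>
        F t₁ b₁ (linExt A.act (t₂ ⊗ₜ b₂)) := by
  obtain ⟨q, hq, rfl⟩ := E.can_bijOn.surjOn hp
  rw [E.canInv_can hq, A.can_eq_sw]
  have h₁ := sw_congr_of_mem_withParam (A.comul_left_mem hq)
    (F := fun u q => sw q fun t b => sw (Δ (linExt A.act (t ⊗ₜ b))) fun v₁ v₂ =>
      sw (E.canInv (u ⊗ₜ v₁)) fun t b => F t b v₂)
    (G := fun u q => sw q fun t b => sw (Δ t) fun t₁ t₂ => sw (Δ b) fun b₁ b₂ =>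
      sw (E.canInv (u ⊗ₜ linExt A.act (t₁ ⊗ₜ b₁))) fun t b => F t b (linExt A.act (t₂ ⊗ₜ b₂)))
    (fun u q hq => A.sw_comul_act hq (fun v₁ v₂ => sw (E.canInv (u ⊗ₜ v₁)) fun t b => F t b v₂)
      (by fun_prop) (by fun_prop))
    (by fun_prop) (by fun_prop) (by fun_prop) (by fun_prop)
  have h₂ := sw_congr_of_mem_withParam (A.comul_act_mem hq)
    (F := fun v q => sw q fun t b => sw (Δ t) fun t₁ t₂ =>
      sw (E.canInv (t₁ ⊗ₜ linExt A.act (t₂ ⊗ₜ b))) fun t b => F t b v)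
    (G := fun v q => sw q fun t b => F t b v)
    (fun v q hq => E.sw_canInv_can hq (fun t b => F t b v) (by fun_prop) (by fun_prop))
    (by fun_prop) (by fun_prop) (by fun_prop) (by fun_prop)
  simp (disch := fun_prop) only [sw_sw, sw_apply] at h₁ h₂ ⊢
  rw [← h₂, h₁]
  refine sw_congr _ fun t b => ?_
  rw [← sw_coassoc t (fun u t₁ t₂ => sw (Δ b) fun b₁ b₂ =>
      sw (E.canInv (u ⊗ₜ linExt A.act (t₁ ⊗ₜ b₁))) fun t b => F t b (linExt A.act (t₂ ⊗ₜ b₂)))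
      (by fun_prop) (by fun_prop) (by fun_prop)]
  exact sw_congr _ fun t₁ t₂ => sw_comm _ _ _

/-- If `can⁻¹(u ⊗ v) = t ⊗ b`, then `t ◁ b = ε(u) v`. -/
theorem act_canInv {p : T ⊗[ℂ] T} (hp : p ∈ cotensor A.orbitR A.orbitL) :
    linExt A.act (E.canInv p) = sw p fun u v => ε u • v := by
  obtain ⟨q, hq, rfl⟩ := E.can_bijOn.surjOn hp
  rw [E.canInv_can hq, A.can_eq_sw]
  simp (disch := fun_prop) only [sw_sw, sw_apply]
  conv_lhs => rw [← sw_tmul_self q, map_sw]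
  refine sw_congr _ fun t b => ?_
  exact (sw_counit_left t (fun t => linExt A.act (t ⊗ₜ b)) (by fun_prop)).symm

/-- If `can⁻¹(u ⊗ v) = t ⊗ b`, then `ε(b) t = ε(v) u`. -/
theorem counit_canInv {p : T ⊗[ℂ] T} (hp : p ∈ cotensor A.orbitR A.orbitL) :
    (sw (E.canInv p) fun t b => ε b • t) = sw p fun u v => ε v • u := by
  obtain ⟨q, hq, rfl⟩ := E.can_bijOn.surjOn hp
  rw [E.canInv_can hq, A.can_eq_sw]
  have h₁ := sw_congr_of_mem_withParam (A.comul_left_mem hq)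
    (F := fun u q => (sw q fun t b => ε (linExt A.act (t ⊗ₜ b))) • u)
    (G := fun u q => (sw q fun t b => ε t • ε b) • u)
    (fun u q hq => congrArg (· • u) (A.sw_counit_act hq))
    (by fun_prop) (by fun_prop) (by fun_prop) (by fun_prop)
  simp (disch := fun_prop) only [sw_sw, sw_apply] at h₁ ⊢
  rw [h₁]
  refine sw_congr _ fun t b => ?_
  simp only [smul_assoc]
  exact (sw_counit_right t (fun t => ε b • t) (by fun_prop)).symm

theorem κ_eq_sw (z : T ⊗[ℂ] T) : E.κ z = sw (E.canInv z) fun t b => ε t • b := by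
  simp (disch := fun_prop) only [κ, canInv, LinearMap.comp_apply, LinearEquiv.coe_coe,
    rTensor_eq_sw, lid_eq_sw, sw_sw, sw_apply]

/-- The inverse of `can` is recovered from `κ` as `u ⊗ v ↦ u₁ ⊗ κ(u₂ ⊗ v)`. -/
theorem sw_comul_κ {p : T ⊗[ℂ] T} (hp : p ∈ cotensor A.orbitR A.orbitL) (F : T → B → V)
    (h₁ : ∀ b, Lin fun a => F a b) (h₂ : ∀ a, Lin fun b => F a b) :
    (sw p fun u v => sw (Δ u) fun u₁ u₂ => F u₁ (E.κ (u₂ ⊗ₜ v))) = sw (E.canInv p) F := by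
  have := E.sw_comul_canInv hp (fun u t b => F u (ε t • b))
    (by fun_prop) (by fun_prop) (by fun_prop)
  have h : ∀ u z, F u (E.κ z) = sw (E.canInv z) fun t b => F u (ε t • b) := by
    intro u z
    rw [E.κ_eq_sw]
    exact map_sw (h₂ u).bundle _ _
  simp only [h]
  rw [this]
  refine sw_congr _ fun t b => ?_
  simp only [(h₂ _).smul]
  exact sw_counit_right t (fun t => F t b) (by fun_prop)

end EquivariantGaloisCoextension

end Can

/-! ### Right bicoalgebroids and their modules -/

section RightBicoalgebroid

variable {C B X V : Type*} [AddCommGroup C] [Module ℂ C] [Coalgebra ℂ C]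
  [AddCommGroup B] [Module ℂ B] [Coalgebra ℂ B] [AddCommGroup X] [Module ℂ X]
  [AddCommGroup V] [Module ℂ V]

theorem SourceTarget.sw_cocommute (s : SourceTarget C B) (x : B) (F : C → C → V)
    (h₁ : ∀ c, Lin fun x => F x c) (h₂ : ∀ x, Lin fun c => F x c) :
    (sw (Δ x) fun a c => F (s.α a) (s.β c)) = sw (Δ x) fun a c => F (s.α c) (s.β a) := by
  have := congrArg (fun z => sw z F) (s.cocommute x)
  simpa (disch := fun_prop) only [map_eq_sw, comm_eq_sw, sw_sw, sw_apply] using this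

namespace RightBicoalgebroid

variable (b : RightBicoalgebroid C B)

theorem sw_η_βL (c : C) (F : C → B → V) (h₁ : ∀ c, Lin fun x => F x c)
    (h₂ : ∀ x, Lin fun c => F x c) :
    (sw (Δ (b.η c)) fun a y => F (b.β y) a) = sw (Δ c) fun c d => F c (b.η d) := by
  have := congrArg (fun z => sw z F) (b.η_colinear_left c)
  simpa (disch := fun_prop) only [b.sw_βL, lTensor_eq_sw, sw_sw, sw_apply] using this

theorem sw_βL_μ {w : B ⊗[ℂ] B} (hw : w ∈ cotensor b.αR b.βL) (F : C → B → V)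
    (h₁ : ∀ b, Lin fun a => F a b) (h₂ : ∀ a, Lin fun b => F a b) :
    (sw w fun g h => sw (Δ (linExt b.μ (g ⊗ₜ h))) fun x y => F (b.β y) x) =
      sw w fun g h => sw (Δ g) fun x y => F (b.β y) (linExt b.μ (x ⊗ₜ h)) := by
  have := congrArg (fun z => sw z F) (b.μ_colinear_left ⟨w, hw⟩)
  rw [← linExt_apply] at this
  simp (disch := fun_prop) only [b.sw_βL, lTensor_eq_sw, rTensor_eq_sw, assoc_eq_sw, sw_sw,
    sw_apply] at this
  rw [← this]
  conv_rhs => rw [← sw_tmul_self w]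
  simp (disch := fun_prop) only [map_sw, sw_sw]

variable {b} {r : X →ₗ[ℂ] X ⊗[ℂ] C}

/-- The product maps `X □ B □ B` to `X □ B`. -/
theorem sw_μ_mem {w : (X ⊗[ℂ] B) ⊗[ℂ] B} (hw : w ∈ cotensor₃ r b.βL b.αR b.βL) :
    (sw w fun p e => sw p fun x g => x ⊗ₜ[ℂ] linExt b.μ (g ⊗ₜ e)) ∈ cotensor r b.βL := by
  obtain ⟨hw₁, hw₂⟩ := mem_cotensor₃_iff.1 hw
  rw [mem_cotensor_iff]
  have h₁ := sw_congr_of_mem_withParam hw₁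
    (F := fun e p => sw p fun x g => sw (r x) fun x c => x ⊗ₜ[ℂ] (c ⊗ₜ[ℂ] linExt b.μ (g ⊗ₜ e)))
    (G := fun e p => sw p fun x g => sw (b.βL g) fun c g =>
      x ⊗ₜ[ℂ] (c ⊗ₜ[ℂ] linExt b.μ (g ⊗ₜ e)))
    (fun e p hp => sw_cotensor hp (fun x c g => x ⊗ₜ[ℂ] (c ⊗ₜ[ℂ] linExt b.μ (g ⊗ₜ e)))
      (by fun_prop) (by fun_prop) (by fun_prop))
    (by fun_prop) (by fun_prop) (by fun_prop) (by fun_prop)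
  have h₂ := sw_congr_of_mem_withParam hw₂
    (F := fun x p => sw p fun g h => sw (Δ (linExt b.μ (g ⊗ₜ h))) fun a y =>
      x ⊗ₜ[ℂ] (b.β y ⊗ₜ[ℂ] a))
    (G := fun x p => sw p fun g h => sw (Δ g) fun a y =>
      x ⊗ₜ[ℂ] (b.β y ⊗ₜ[ℂ] linExt b.μ (a ⊗ₜ h)))
    (fun x p hp => b.sw_βL_μ hp (fun c y => x ⊗ₜ[ℂ] (c ⊗ₜ[ℂ] y)) (by fun_prop) (by fun_prop))
    (by fun_prop) (by fun_prop) (by fun_prop) (by fun_prop)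
  simp (disch := fun_prop) only [sw_sw, sw_apply, b.sw_βL] at h₁ h₂ ⊢
  rw [h₁, h₂]

/-- A right `C`-colinear action maps `X □ B □ B` to `X □ B`. -/
theorem sw_act_mem {act : cotensor r b.βL →ₗ[ℂ] X}
    (hact : ∀ w, r (act w) = (linExt act).rTensor C
      ((TensorProduct.assoc ℂ X B C).symm (b.αR.lTensor X (w : X ⊗[ℂ] B))))
    {w : (X ⊗[ℂ] B) ⊗[ℂ] B} (hw : w ∈ cotensor₃ r b.βL b.αR b.βL) :
    (sw w fun p e => linExt act p ⊗ₜ[ℂ] e) ∈ cotensor r b.βL := by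
  obtain ⟨hw₁, hw₂⟩ := mem_cotensor₃_iff.1 hw
  rw [mem_cotensor_iff]
  have h₁ := sw_congr_of_mem_withParam hw₁
    (F := fun e p => sw (r (linExt act p)) fun x c => x ⊗ₜ[ℂ] (c ⊗ₜ[ℂ] e))
    (G := fun e p => sw p fun x g => sw (Δ g) fun g y =>
      linExt act (x ⊗ₜ g) ⊗ₜ[ℂ] (b.α y ⊗ₜ[ℂ] e))
    (fun e p hp => by
      have := congrArg (fun z => sw z fun x c => x ⊗ₜ[ℂ] (c ⊗ₜ[ℂ] e)) (hact ⟨p, hp⟩)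
      rw [← linExt_apply] at this
      simpa (disch := fun_prop) only [b.sw_αR, lTensor_eq_sw, rTensor_eq_sw, assoc_symm_eq_sw,
        sw_sw, sw_apply] using this)
    (by fun_prop) (by fun_prop) (by fun_prop) (by fun_prop)
  have h₂ := sw_congr_of_mem_withParam hw₂
    (F := fun x p => sw p fun g e => sw (b.αR g) fun g c =>
      linExt act (x ⊗ₜ g) ⊗ₜ[ℂ] (c ⊗ₜ[ℂ] e))
    (G := fun x p => sw p fun g e => sw (b.βL e) fun c e =>
      linExt act (x ⊗ₜ g) ⊗ₜ[ℂ] (c ⊗ₜ[ℂ] e))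
    (fun x p hp => sw_cotensor hp (fun g c e => linExt act (x ⊗ₜ g) ⊗ₜ[ℂ] (c ⊗ₜ[ℂ] e))
      (by fun_prop) (by fun_prop) (by fun_prop))
    (by fun_prop) (by fun_prop) (by fun_prop) (by fun_prop)
  have h₀ : ∀ (p : X ⊗[ℂ] B) (e : B), sw (r (linExt act p)) (fun x c => x ⊗ₜ[ℂ] (c ⊗ₜ[ℂ] e)) =
      sw p fun x g => sw (r (linExt act (x ⊗ₜ g))) fun x c => x ⊗ₜ[ℂ] (c ⊗ₜ[ℂ] e) := by
    intro p e
    conv_lhs => rw [← sw_tmul_self p]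
    simp (disch := fun_prop) only [map_sw, sw_sw]
  have h₀' : ∀ (p : X ⊗[ℂ] B) (c : C) (e : B), linExt act p ⊗ₜ[ℂ] (c ⊗ₜ[ℂ] e) =
      sw p fun x g => linExt act (x ⊗ₜ g) ⊗ₜ[ℂ] (c ⊗ₜ[ℂ] e) := by
    intro p c e
    conv_lhs => rw [← sw_tmul_self p]
    simp (disch := fun_prop) only [map_sw, sw_tmul]
  simp (disch := fun_prop) only [sw_sw, sw_apply, b.sw_βL, b.sw_αR] at h₁ h₂ ⊢
  refine (sw_congr _ fun p e => h₀ p e).trans (h₁.trans (h₂.trans ?_))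
  refine sw_congr _ fun p e => Eq.trans ?_ (sw_congr _ fun x y => (h₀' p (b.β y) x).symm)
  exact sw_comm _ _ _

/-- `α(b₂) ⊗ (x ⊗ b₁) ∈ C ⊗ (X □ B)` for `x ⊗ b ∈ X □ B`, since `α` and `β` cocommute. -/
theorem comul_α_mem {w : X ⊗[ℂ] B} (hw : w ∈ cotensor r b.βL) :
    (sw w fun x e => sw (Δ e) fun e f => b.α f ⊗ₜ[ℂ] (x ⊗ₜ[ℂ] e)) ∈
      withParam C (cotensor r b.βL) := by
  rw [mem_withParam_cotensor_iff]
  have := sw_cotensor hw (fun x c e => sw (Δ e) fun e f =>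
    b.α f ⊗ₜ[ℂ] (x ⊗ₜ[ℂ] (c ⊗ₜ[ℂ] e))) (by fun_prop) (by fun_prop) (by fun_prop)
  simp (disch := fun_prop) only [sw_sw, sw_apply, b.sw_βL] at this ⊢
  refine (sw_congr _ fun x e => sw_comm _ _ _).trans (this.trans ?_)
  refine sw_congr _ fun x e => ?_
  rw [sw_coassoc e (fun e y f => b.α f ⊗ₜ[ℂ] (x ⊗ₜ[ℂ] (b.β y ⊗ₜ[ℂ] e))) (by fun_prop)
    (by fun_prop) (by fun_prop), sw_coassoc e (fun e f y => b.α f ⊗ₜ[ℂ] (x ⊗ₜ[ℂ] (b.β y ⊗ₜ[ℂ] e)))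
    (by fun_prop) (by fun_prop) (by fun_prop)]
  exact sw_congr _ fun e f => (b.sw_cocommute f (fun c d => c ⊗ₜ[ℂ] (x ⊗ₜ[ℂ] (d ⊗ₜ[ℂ] e)))
    (by fun_prop) (by fun_prop))

theorem η_mem (hr : IsRightCoaction r) (x : X) :
    (sw (r x) fun x c => x ⊗ₜ[ℂ] b.η c) ∈ cotensor r b.βL := by
  rw [mem_cotensor_iff]
  simp (disch := fun_prop) only [sw_sw, sw_apply, b.sw_βL]
  rw [hr.sw_coassoc x (fun x c d => x ⊗ₜ[ℂ] (c ⊗ₜ[ℂ] b.η d)) (by fun_prop) (by fun_prop)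
    (by fun_prop)]
  exact sw_congr _ fun x c => (b.sw_η_βL c (fun c d => x ⊗ₜ[ℂ] (c ⊗ₜ[ℂ] d)) (by fun_prop)
    (by fun_prop)).symm

/-- The element `η(x₁)₁ ⊗ (x₀ ⊗ η(x₁)₂)` of the canonical coaction lies in `B ⊗ (X □ B)`. -/
theorem comul_η_mem (hr : IsRightCoaction r) (x : X) :
    (sw (r x) fun x c => sw (Δ (b.η c)) fun h₁ h₂ => h₁ ⊗ₜ[ℂ] (x ⊗ₜ[ℂ] h₂)) ∈
      withParam B (cotensor r b.βL) := by
  rw [mem_withParam_cotensor_iff]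
  simp (disch := fun_prop) only [sw_sw, sw_apply, b.sw_βL]
  have h₁ := hr.sw_coassoc x (fun x c d => sw (Δ (b.η d)) fun h₁ h₂ =>
    h₁ ⊗ₜ[ℂ] (x ⊗ₜ[ℂ] (c ⊗ₜ[ℂ] h₂))) (by fun_prop) (by fun_prop) (by fun_prop)
  simp only [sw_comm (r _) (Δ (b.η _))] at h₁ ⊢
  simp only [← sw_comm (r _) (Δ (b.η _))] at h₁ ⊢
  have h₂ : ∀ (x : X) (c : C), (sw (Δ (b.η c)) fun h₁ h₂ => sw (Δ h₂) fun h₂ h₃ =>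
      h₁ ⊗ₜ[ℂ] (x ⊗ₜ[ℂ] (b.β h₃ ⊗ₜ[ℂ] h₂))) = sw (Δ c) fun c d => sw (Δ (b.η d)) fun h₁ h₂ =>
        h₁ ⊗ₜ[ℂ] (x ⊗ₜ[ℂ] (c ⊗ₜ[ℂ] h₂)) := by
    intro x c
    rw [← b.sw_η_βL c (fun c h => sw (Δ h) fun h₁ h₂ => h₁ ⊗ₜ[ℂ] (x ⊗ₜ[ℂ] (c ⊗ₜ[ℂ] h₂)))
      (by fun_prop) (by fun_prop)]
    exact (sw_coassoc _ (fun h₁ h₂ h₃ => h₁ ⊗ₜ[ℂ] (x ⊗ₜ[ℂ] (b.β h₃ ⊗ₜ[ℂ] h₂))) (by fun_prop)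
      (by fun_prop) (by fun_prop)).symm
  simp only [h₂]
  exact h₁

end RightBicoalgebroid

namespace RightModuleStr

variable {b : RightBicoalgebroid C B} (s : RightModuleStr b X)

theorem sw_baseCoact_act {w : X ⊗[ℂ] B} (hw : w ∈ cotensor s.baseCoact b.βL) (F : X → C → V)
    (h₁ : ∀ b, Lin fun a => F a b) (h₂ : ∀ a, Lin fun b => F a b) :
    (sw w fun x e => sw (s.baseCoact (linExt s.act (x ⊗ₜ e))) F) =
      sw w fun x e => sw (Δ e) fun e f => F (linExt s.act (x ⊗ₜ e)) (b.α f) := by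
  have := congrArg (fun z => sw z F) (s.act_colinear ⟨w, hw⟩)
  rw [← linExt_apply] at this
  simp (disch := fun_prop) only [lTensor_eq_sw, rTensor_eq_sw, assoc_symm_eq_sw, b.sw_αR, sw_sw,
    sw_apply] at this
  rw [← this]
  conv_rhs => rw [← sw_tmul_self w]
  simp (disch := fun_prop) only [map_sw, sw_sw]

theorem sw_act_assoc {w : (X ⊗[ℂ] B) ⊗[ℂ] B} (hw : w ∈ cotensor₃ s.baseCoact b.βL b.αR b.βL)
    (F : X → V) (hF : Lin F) :
    (sw w fun p e => F (linExt s.act (linExt s.act p ⊗ₜ e))) =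
      sw w fun p e => sw p fun x g => F (linExt s.act (x ⊗ₜ linExt b.μ (g ⊗ₜ e))) := by
  have := congrArg hF.bundle (s.act_assoc w hw)
  simpa (disch := fun_prop) only [map_sw, equiv_sw, assoc_eq_sw, lTensor_eq_sw,
    rTensor_eq_sw, sw_sw, sw_apply, Lin.bundle_apply] using this

theorem sw_act_unit (x : X) :
    (sw (s.baseCoact x) fun x c => linExt s.act (x ⊗ₜ b.η c)) = x := by
  have := s.act_unit x
  simpa (disch := fun_prop) only [lTensor_eq_sw, map_sw] using this

theorem sw_canonicalCoact (x : X) (F : C → X → V) (h₁ : ∀ c, Lin fun x => F x c)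
    (h₂ : ∀ x, Lin fun c => F x c) :
    sw (s.canonicalCoact x) F = sw (s.baseCoact x) fun x c => sw (Δ (b.η c)) fun h₁ h₂ =>
      F (b.α h₁) (linExt s.act (x ⊗ₜ h₂)) := by
  simp (disch := fun_prop) only [canonicalCoact, LinearMap.comp_apply, LinearEquiv.coe_coe,
    map_eq_sw, leftComm_eq_sw, lTensor_eq_sw, sw_sw, sw_apply]

/-- `x₋₁ ⊗ x₀ ◁ b = β(b₁) ⊗ x ◁ b₂` on `X □ B`, for the canonical left coaction of `X`. -/
theorem sw_canonicalCoact_act {w : X ⊗[ℂ] B} (hw : w ∈ cotensor s.baseCoact b.βL)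
    (F : C → X → V) (h₁ : ∀ c, Lin fun x => F x c) (h₂ : ∀ x, Lin fun c => F x c) :
    (sw w fun x e => sw (s.canonicalCoact x) fun c x => F c (linExt s.act (x ⊗ₜ e))) =
      sw w fun x e => sw (Δ e) fun e f => F (b.β e) (linExt s.act (x ⊗ₜ f)) := by
  have := congrArg (fun z => sw z F) (s.canonicalCoact_act w hw)
  simpa (disch := fun_prop) only [lTensor_eq_sw, rTensor_eq_sw, assoc_eq_sw, leftComm_eq_sw,
    b.sw_copL, sw_sw, sw_apply] using this

end RightModuleStr

end RightBicoalgebroid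

/-! ### Cotensor products up to isomorphism -/

section Lift

variable {V W U X R : Type*}
  [AddCommGroup V] [Module ℂ V] [AddCommGroup W] [Module ℂ W] [AddCommGroup U] [Module ℂ U]
  [AddCommGroup X] [Module ℂ X] [AddCommGroup R] [Module ℂ R]

variable {ι : X →ₗ[ℂ] V} (hι : Function.Injective ι)

include hι in
theorem ext_tmul_of_injective {z z' : R ⊗[ℂ] X}
    (h : (sw z fun r x => r ⊗ₜ[ℂ] ι x) = sw z' fun r x => r ⊗ₜ[ℂ] ι x) : z = z' :=
  Module.Flat.lTensor_preserves_injective_linearMap (M := R) ι hι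
    (by simpa only [lTensor_eq_sw] using h)

include hι in
theorem ext_of_injective_tmul {z z' : X ⊗[ℂ] R}
    (h : (sw z fun x r => ι x ⊗ₜ[ℂ] r) = sw z' fun x r => ι x ⊗ₜ[ℂ] r) : z = z' :=
  Module.Flat.rTensor_preserves_injective_linearMap (M := R) ι hι
    (by simpa only [rTensor_eq_sw] using h)

/-- The lift of a linear function with values in the image of `R ⊗ X` in `R ⊗ V`, for an injective
map `X → V`. -/
def liftParam (f : W → R ⊗[ℂ] V) (hf : Lin f) (h : ∀ w, f w ∈ LinearMap.range (ι.lTensor R)) :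
    W →ₗ[ℂ] R ⊗[ℂ] X :=
  (LinearEquiv.ofInjective (ι.lTensor R)
    (Module.Flat.lTensor_preserves_injective_linearMap ι hι)).symm.toLinearMap ∘ₗ
      hf.bundle.codRestrict _ h

theorem sw_liftParam {f : W → R ⊗[ℂ] V} (hf : Lin f)
    (h : ∀ w, f w ∈ LinearMap.range (ι.lTensor R)) (w : W) (F : R → V → U)
    (h₁ : ∀ v, Lin fun r => F r v) (h₂ : ∀ r, Lin fun v => F r v) :
    (sw (liftParam hι f hf h w) fun r y => F r (ι y)) = sw (f w) F := by
  have : ι.lTensor R (liftParam hι f hf h w) = f w :=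
    congrArg Subtype.val ((LinearEquiv.ofInjective (ι.lTensor R)
      (Module.Flat.lTensor_preserves_injective_linearMap ι hι)).apply_symm_apply
        (hf.bundle.codRestrict _ h w))
  rw [← this]
  simp (disch := fun_prop) only [lTensor_eq_sw, sw_sw, sw_apply]

/-- The injective map `ι` identifies `X` with the cotensor product of `r` and `l`. The structure of
`M □_K T` is transported along such a map, so that elements of tensor products over `M □_K T` need
not be written with a subtype. -/
structure IsCotensor {C Y Z : Type*} [AddCommGroup C] [Module ℂ C] [AddCommGroup Y] [Module ℂ Y]
    [AddCommGroup Z] [Module ℂ Z] (r : Y →ₗ[ℂ] Y ⊗[ℂ] C) (l : Z →ₗ[ℂ] C ⊗[ℂ] Z)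
    (ι : X →ₗ[ℂ] Y ⊗[ℂ] Z) : Prop where
  injective : Function.Injective ι
  range_eq : LinearMap.range ι = cotensor r l

namespace IsCotensor

variable {C Y Z : Type*} [AddCommGroup C] [Module ℂ C] [AddCommGroup Y] [Module ℂ Y]
  [AddCommGroup Z] [Module ℂ Z] {r : Y →ₗ[ℂ] Y ⊗[ℂ] C} {l : Z →ₗ[ℂ] C ⊗[ℂ] Z}

theorem subtype : IsCotensor r l (cotensor r l).subtype :=
  ⟨Submodule.subtype_injective _, Submodule.range_subtype _⟩

variable {ι : X →ₗ[ℂ] Y ⊗[ℂ] Z} (h : IsCotensor r l ι)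

include h

theorem mem (x : X) : ι x ∈ cotensor r l := h.range_eq ▸ LinearMap.mem_range_self ι x

theorem exists_eq {z : Y ⊗[ℂ] Z} (hz : z ∈ cotensor r l) : ∃ x, ι x = z :=
  LinearMap.mem_range.1 (h.range_eq.symm ▸ hz)

theorem mem_range_lTensor {z : R ⊗[ℂ] (Y ⊗[ℂ] Z)} (hz : z ∈ withParam R (cotensor r l)) :
    z ∈ LinearMap.range (ι.lTensor R) := by
  obtain ⟨z, rfl⟩ := hz
  choose g hg using fun x : cotensor r l => h.exists_eq x.2
  rw [lTensor_eq_sw]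
  exact sw_mem (p := LinearMap.range (ι.lTensor R)) z fun a x => ⟨a ⊗ₜ g x, by
    rw [LinearMap.lTensor_tmul, hg, Submodule.subtype_apply]⟩

end IsCotensor

end Lift

/-! ### The right `B`-module `M □_K T` -/

section Tilde

variable {C : Type u₁} {B : Type u₂} {T : Type u₃} {K : Type u₄} {M : Type v}
  [AddCommGroup C] [Module ℂ C] [Coalgebra ℂ C] [AddCommGroup B] [Module ℂ B] [Coalgebra ℂ B]
  [AddCommGroup T] [Module ℂ T] [Coalgebra ℂ T] [AddCommGroup K] [Module ℂ K] [Coalgebra ℂ K]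
  [AddCommGroup M] [Module ℂ M]
  {X V : Type*} [AddCommGroup X] [Module ℂ X] [AddCommGroup V] [Module ℂ V]

namespace EquivariantGaloisCoextension

variable {b : RightHopfCoalgebra C B} {A : RightModuleCoalgebra b.toRightBicoalgebroid T}
  {k : LeftHopfCoalgebra A.Orbit K} (E : EquivariantGaloisCoextension A k)
  {r : M →ₗ[ℂ] M ⊗[ℂ] K} {ι : X →ₗ[ℂ] M ⊗[ℂ] T} (h : IsCotensor r E.coact ι)

include h in
theorem baseCoact_mem (x : X) :
    (sw (ι x) fun m t => sw (A.baseCoact t) fun t c => c ⊗ₜ[ℂ] (m ⊗ₜ[ℂ] t)) ∈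
      withParam C (cotensor r E.coact) := by
  rw [mem_withParam_cotensor_iff]
  simp (disch := fun_prop) only [sw_sw, sw_apply]
  have := sw_cotensor (h.mem x) (fun m g t => sw (A.baseCoact t) fun t c =>
    c ⊗ₜ[ℂ] (m ⊗ₜ[ℂ] (g ⊗ₜ[ℂ] t))) (by fun_prop) (by fun_prop) (by fun_prop)
  refine (sw_congr _ fun m t => sw_comm _ _ _).trans (this.trans ?_)
  exact sw_congr _ fun m t => E.sw_baseCoact_coact t (fun g t c => c ⊗ₜ[ℂ] (m ⊗ₜ[ℂ] (g ⊗ₜ[ℂ] t)))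
    (by fun_prop) (by fun_prop) (by fun_prop)

/-- The right `C`-coaction `m ⊗ t ↦ m ⊗ t₀ ⊗ t₁` of `M □_K T`. -/
def cotensorBaseCoact : X →ₗ[ℂ] X ⊗[ℂ] C :=
  (TensorProduct.comm ℂ _ _).toLinearMap ∘ₗ
    liftParam h.injective (fun x : X =>
      sw (ι x) fun m t => sw (A.baseCoact t) fun t c => c ⊗ₜ[ℂ] (m ⊗ₜ[ℂ] t))
        (by fun_prop) fun x => h.mem_range_lTensor (E.baseCoact_mem h x)

theorem sw_cotensorBaseCoact (x : X) (F : M ⊗[ℂ] T → C → V)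
    (h₁ : ∀ c, Lin fun x => F x c) (h₂ : ∀ x, Lin fun c => F x c) :
    (sw (E.cotensorBaseCoact h x) fun y c => F (ι y) c) =
      sw (ι x) fun m t => sw (A.baseCoact t) fun t c => F (m ⊗ₜ t) c := by
  have := sw_liftParam h.injective (f := fun x : X =>
      sw (ι x) fun m t => sw (A.baseCoact t) fun t c => c ⊗ₜ[ℂ] (m ⊗ₜ[ℂ] t)) (by fun_prop)
      (fun x => h.mem_range_lTensor (E.baseCoact_mem h x)) x (fun c y => F y c) h₂ h₁
  simp (disch := fun_prop) only [sw_sw, sw_apply] at this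
  rw [← this]
  simp (disch := fun_prop) only [cotensorBaseCoact, LinearMap.comp_apply, LinearEquiv.coe_coe,
    comm_eq_sw, sw_sw, sw_apply]

theorem isRightCoaction_cotensorBaseCoact : IsRightCoaction (E.cotensorBaseCoact h) where
  coassoc x := by
    have hA := A.isRightCoaction_baseCoact
    refine ext_of_injective_tmul h.injective ?_
    simp (disch := fun_prop) only [assoc_eq_sw, rTensor_eq_sw, lTensor_eq_sw, sw_sw, sw_apply]
    have h₁ : ∀ (x : X) (c : C),
        (sw (E.cotensorBaseCoact h x) fun y d => (ι y) ⊗ₜ[ℂ] (d ⊗ₜ[ℂ] c)) =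
          sw (ι x) fun m t => sw (A.baseCoact t) fun t d =>
            (m ⊗ₜ[ℂ] t) ⊗ₜ[ℂ] (d ⊗ₜ[ℂ] c) := fun x c =>
      E.sw_cotensorBaseCoact h x (fun y d => y ⊗ₜ[ℂ] (d ⊗ₜ[ℂ] c)) (by fun_prop) (by fun_prop)
    simp only [h₁]
    rw [E.sw_cotensorBaseCoact h x (fun y c => sw y fun m t => sw (A.baseCoact t) fun t d =>
      (m ⊗ₜ[ℂ] t) ⊗ₜ[ℂ] (d ⊗ₜ[ℂ] c)) (by fun_prop) (by fun_prop),
      E.sw_cotensorBaseCoact h x (fun y c => y ⊗ₜ[ℂ] Δ c) (by fun_prop) (by fun_prop)]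
    simp (disch := fun_prop) only [sw_apply]
    refine sw_congr _ fun m t => ?_
    rw [hA.sw_coassoc t (fun t c d => (m ⊗ₜ[ℂ] t) ⊗ₜ[ℂ] (c ⊗ₜ[ℂ] d)) (by fun_prop)
      (by fun_prop) (by fun_prop)]
    exact sw_congr _ fun t c => by rw [← tmul_sw, sw_tmul_self]
  counit x := by
    refine ext_of_injective_tmul h.injective ?_
    simp (disch := fun_prop) only [lTensor_eq_sw, sw_sw, sw_apply]
    rw [E.sw_cotensorBaseCoact h x (fun y c => y ⊗ₜ[ℂ] ε c) (by fun_prop) (by fun_prop)]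
    have : ∀ (m : M) (t : T), (sw (A.baseCoact t) fun t c => (m ⊗ₜ[ℂ] t) ⊗ₜ[ℂ] (ε c : ℂ)) =
        (m ⊗ₜ[ℂ] t) ⊗ₜ[ℂ] (1 : ℂ) := by
      intro m t
      rw [← A.isRightCoaction_baseCoact.sw_counit t (fun t => (m ⊗ₜ[ℂ] t) ⊗ₜ[ℂ] (1 : ℂ))
        (by fun_prop)]
      refine sw_congr _ fun t c => ?_
      rw [← TensorProduct.tmul_smul, smul_eq_mul, mul_one]
    simp only [this]
    rw [← sw_tmul, sw_tmul_self]

/-- An element `(m ⊗ t) ⊗ e` of `(M □_K T) □_C B` lies in `M ⊗ (T □_C B)`. -/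
theorem assoc_ι_mem {w : X ⊗[ℂ] B}
    (hw : w ∈ cotensor (E.cotensorBaseCoact h) b.βL) :
    (sw w fun x e => sw (ι x) fun m t => m ⊗ₜ[ℂ] (t ⊗ₜ[ℂ] e)) ∈
      withParam M (cotensor A.baseCoact b.βL) := by
  rw [mem_withParam_cotensor_iff]
  simp (disch := fun_prop) only [sw_sw, sw_apply]
  have := sw_cotensor hw (fun x c e => sw (ι x) fun m t =>
    m ⊗ₜ[ℂ] (t ⊗ₜ[ℂ] (c ⊗ₜ[ℂ] e))) (by fun_prop) (by fun_prop) (by fun_prop)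
  have h : ∀ (x : X) (e : B), (sw (E.cotensorBaseCoact h x) fun x c =>
      sw (ι x) fun m t => m ⊗ₜ[ℂ] (t ⊗ₜ[ℂ] (c ⊗ₜ[ℂ] e))) =
        sw (ι x) fun m t => sw (A.baseCoact t) fun t c =>
          m ⊗ₜ[ℂ] (t ⊗ₜ[ℂ] (c ⊗ₜ[ℂ] e)) := by
    intro x e
    rw [E.sw_cotensorBaseCoact h x (fun y c => sw y fun m t => m ⊗ₜ[ℂ] (t ⊗ₜ[ℂ] (c ⊗ₜ[ℂ] e)))
      (by fun_prop) (by fun_prop)]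
    simp (disch := fun_prop) only [sw_apply]
  simp only [h] at this
  rw [this]
  exact sw_congr _ fun x e => sw_comm _ _ _

theorem act_mem {w : X ⊗[ℂ] B}
    (hw : w ∈ cotensor (E.cotensorBaseCoact h) b.βL) :
    (sw w fun x e => sw (ι x) fun m t => m ⊗ₜ[ℂ] linExt A.act (t ⊗ₜ e)) ∈
      cotensor r E.coact := by
  rw [mem_cotensor_iff]
  simp (disch := fun_prop) only [sw_sw, sw_apply]
  have h₁ := sw_congr_of_mem_withParam (E.assoc_ι_mem h hw)
    (F := fun m p => sw p fun t e => sw (E.coact (linExt A.act (t ⊗ₜ e))) fun g t =>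
      m ⊗ₜ[ℂ] (g ⊗ₜ[ℂ] t))
    (G := fun m p => sw p fun t e => sw (E.coact t) fun g t =>
      m ⊗ₜ[ℂ] (g ⊗ₜ[ℂ] linExt A.act (t ⊗ₜ e)))
    (fun m p hp => E.sw_coact_act hp (fun g t => m ⊗ₜ[ℂ] (g ⊗ₜ[ℂ] t)) (by fun_prop) (by fun_prop))
    (by fun_prop) (by fun_prop) (by fun_prop) (by fun_prop)
  simp (disch := fun_prop) only [sw_sw, sw_apply] at h₁
  rw [h₁]
  exact sw_congr _ fun x e => sw_cotensor (h.mem x)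
    (fun m g t => m ⊗ₜ[ℂ] (g ⊗ₜ[ℂ] linExt A.act (t ⊗ₜ e))) (by fun_prop) (by fun_prop) (by fun_prop)

/-- The right action `(m ⊗ t) ◁ b = m ⊗ t ◁ b` of `B` on `M □_K T`. -/
def cotensorAct : cotensor (E.cotensorBaseCoact h) b.βL →ₗ[ℂ] X :=
  (LinearEquiv.ofInjective ι h.injective).symm.toLinearMap ∘ₗ
    (Lin.bundle (f := fun w : cotensor (E.cotensorBaseCoact h) b.βL =>
      sw (w : X ⊗[ℂ] B) fun x e => sw (ι x) fun m t => m ⊗ₜ[ℂ] linExt A.act (t ⊗ₜ e))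
      (by fun_prop)).codRestrict (LinearMap.range ι) fun w =>
        h.range_eq.symm ▸ E.act_mem h w.2

theorem ι_cotensorAct {w : X ⊗[ℂ] B} (hw : w ∈ cotensor (E.cotensorBaseCoact h) b.βL) :
    ι (linExt (E.cotensorAct h) w) =
      sw w fun x e => sw (ι x) fun m t => m ⊗ₜ[ℂ] linExt A.act (t ⊗ₜ e) :=
  (congrArg ι (linExt_apply (E.cotensorAct h) ⟨w, hw⟩)).trans
    (congrArg Subtype.val ((LinearEquiv.ofInjective ι h.injective).apply_symm_apply _))

theorem sw_cotensorAct {w : X ⊗[ℂ] B}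
    (hw : w ∈ cotensor (E.cotensorBaseCoact h) b.βL) (F : M ⊗[ℂ] T → V) (hF : Lin F) :
    (sw w fun x e => F (ι (linExt (E.cotensorAct h) (x ⊗ₜ e)))) =
      sw w fun x e => sw (ι x) fun m t => F (m ⊗ₜ linExt A.act (t ⊗ₜ e)) := by
  have h₁ : (sw w fun x e => F (ι (linExt (E.cotensorAct h) (x ⊗ₜ e)))) =
      F (ι (linExt (E.cotensorAct h) w)) := by
    conv_rhs => rw [← sw_tmul_self w]
    exact (map_sw (hF.bundle ∘ₗ ι ∘ₗ linExt (E.cotensorAct h)) w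
      _).symm
  rw [h₁, E.ι_cotensorAct h hw]
  exact (map_sw hF.bundle w _).trans (sw_congr _ fun x e => map_sw hF.bundle _ _)

/-- An element `((m ⊗ t) ⊗ e) ⊗ f` of `(M □_K T) □_C B □_C B` lies in `M ⊗ (T □_C B □_C B)`. -/
theorem assoc_ι_mem₃ {w : (X ⊗[ℂ] B) ⊗[ℂ] B}
    (hw : w ∈ cotensor₃ (E.cotensorBaseCoact h) b.βL b.αR b.βL) :
    (sw w fun p f => sw p fun x e => sw (ι x) fun m t =>
      m ⊗ₜ[ℂ] ((t ⊗ₜ[ℂ] e) ⊗ₜ[ℂ] f)) ∈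
      withParam M (cotensor₃ A.baseCoact b.βL b.αR b.βL) := by
  obtain ⟨hw₁, hw₂⟩ := mem_cotensor₃_iff.1 hw
  refine mem_withParam_cotensor₃ ?_ ?_
  · have := sw_mem_of_mem_withParam hw₁ (q := withParam (M ⊗[ℂ] B) (cotensor A.baseCoact b.βL))
      (F := fun f p => sw p fun x e => sw (ι x) fun m t =>
        (m ⊗ₜ[ℂ] f) ⊗ₜ[ℂ] (t ⊗ₜ[ℂ] e))
      (fun f p hp => by
        have := sw_mem_withParam (R' := M ⊗[ℂ] B) (E.assoc_ι_mem h hp) (fun m => m ⊗ₜ[ℂ] f)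
          (by fun_prop)
        simpa (disch := fun_prop) only [sw_sw, sw_apply] using this) (by fun_prop) (by fun_prop)
    simpa (disch := fun_prop) only [sw_sw, sw_apply] using this
  · have := sw_mem_of_mem_withParam hw₂ (q := withParam (M ⊗[ℂ] T) (cotensor b.αR b.βL))
      (F := fun x p => (ι x) ⊗ₜ[ℂ] p)
      (fun x p hp => tmul_mem_withParam hp _) (by fun_prop) (by fun_prop)
    simp (disch := fun_prop) only [sw_sw, sw_apply] at this ⊢
    convert this using 1
    refine sw_congr _ fun p f => sw_congr _ fun x e => ?_
    rw [← sw_tmul, sw_tmul_self]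

theorem cotensorAct_colinear (w : cotensor (E.cotensorBaseCoact h) b.βL) :
    E.cotensorBaseCoact h (E.cotensorAct h w) = (linExt (E.cotensorAct h)).rTensor C
      ((TensorProduct.assoc ℂ X B C).symm
        (b.αR.lTensor X (w : X ⊗[ℂ] B))) := by
  obtain ⟨w, hw⟩ := w
  refine ext_of_injective_tmul h.injective ?_
  rw [E.sw_cotensorBaseCoact h _ (fun y c => y ⊗ₜ[ℂ] c) (by fun_prop) (by fun_prop),
    ← linExt_apply, E.ι_cotensorAct h hw]
  simp (disch := fun_prop) only [assoc_symm_eq_sw, rTensor_eq_sw, lTensor_eq_sw, b.sw_αR, sw_sw,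
    sw_apply]
  have h₁ := sw_congr_of_mem_withParam (RightBicoalgebroid.comul_α_mem hw)
    (F := fun c p => sw p fun x e => (ι (linExt (E.cotensorAct h) (x ⊗ₜ e))) ⊗ₜ[ℂ] c)
    (G := fun c p => sw p fun x e => sw (ι x) fun m t =>
      (m ⊗ₜ linExt A.act (t ⊗ₜ e)) ⊗ₜ[ℂ] c)
    (fun c p hp => E.sw_cotensorAct h hp (fun y => y ⊗ₜ[ℂ] c) (by fun_prop))
    (by fun_prop) (by fun_prop) (by fun_prop) (by fun_prop)
  have h₂ := sw_congr_of_mem_withParam (E.assoc_ι_mem h hw)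
    (F := fun m p => sw p fun t e => sw (A.baseCoact (linExt A.act (t ⊗ₜ e))) fun t c =>
      (m ⊗ₜ[ℂ] t) ⊗ₜ[ℂ] c)
    (G := fun m p => sw p fun t e => sw (Δ e) fun e f =>
      (m ⊗ₜ linExt A.act (t ⊗ₜ e)) ⊗ₜ[ℂ] b.α f)
    (fun m p hp => A.sw_baseCoact_act hp (fun t c => (m ⊗ₜ[ℂ] t) ⊗ₜ[ℂ] c)
      (by fun_prop) (by fun_prop))
    (by fun_prop) (by fun_prop) (by fun_prop) (by fun_prop)
  simp (disch := fun_prop) only [sw_sw, sw_apply] at h₁ h₂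
  rw [h₁, h₂]
  exact sw_congr _ fun x e => sw_comm _ _ _

/-- The right module `M □_K T` over `B`. -/
def cotensorModule : RightModuleStr b.toRightBicoalgebroid X where
  baseCoact := E.cotensorBaseCoact h
  isRightCoaction_baseCoact := E.isRightCoaction_cotensorBaseCoact h
  act := E.cotensorAct h
  act_colinear := E.cotensorAct_colinear h
  act_assoc w hw := by
    refine h.injective ?_
    have m₁ := RightBicoalgebroid.sw_act_mem (E.cotensorAct_colinear h) hw
    have m₂ := RightBicoalgebroid.sw_μ_mem hw
    rw [rTensor_eq_sw, lTensor_eq_sw, assoc_eq_sw]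
    simp (disch := fun_prop) only [sw_sw, sw_apply]
    rw [E.ι_cotensorAct h m₁, E.ι_cotensorAct h m₂]
    simp (disch := fun_prop) only [sw_sw, sw_apply]
    have h₁ := sw_congr_of_mem_withParam (mem_cotensor₃_iff.1 hw).1
      (F := fun f p => sw (ι (linExt (E.cotensorAct h) p)) fun m t =>
        m ⊗ₜ[ℂ] linExt A.act (t ⊗ₜ f))
      (G := fun f p => sw p fun x e => sw (ι x) fun m t =>
        m ⊗ₜ[ℂ] linExt A.act (linExt A.act (t ⊗ₜ e) ⊗ₜ f))
      (fun f p hp => by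
        rw [E.ι_cotensorAct h hp]
        simp (disch := fun_prop) only [sw_sw, sw_apply]) (by fun_prop) (by fun_prop) (by fun_prop)
      (by fun_prop)
    have h₂ := sw_congr_of_mem_withParam (E.assoc_ι_mem₃ h hw)
      (F := fun m p => sw p fun p f => m ⊗ₜ[ℂ] linExt A.act (linExt A.act p ⊗ₜ f))
      (G := fun m p => sw p fun p f => sw p fun t e =>
        m ⊗ₜ[ℂ] linExt A.act (t ⊗ₜ linExt b.μ (e ⊗ₜ f)))
      (fun m p hp => A.sw_act_assoc hp (fun t => m ⊗ₜ[ℂ] t) (by fun_prop)) (by fun_prop)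
      (by fun_prop) (by fun_prop) (by fun_prop)
    simp (disch := fun_prop) only [sw_sw, sw_apply] at h₁ h₂
    refine Eq.trans (sw_congr _ fun p f => ?_) (h₁.trans h₂)
    conv_lhs => rw [← sw_tmul_self p]
    simp (disch := fun_prop) only [map_sw, sw_sw]
  act_unit x := by
    refine h.injective ?_
    rw [lTensor_eq_sw, E.ι_cotensorAct h
      (RightBicoalgebroid.η_mem (E.isRightCoaction_cotensorBaseCoact h) x)]
    simp (disch := fun_prop) only [sw_sw, sw_apply]
    rw [E.sw_cotensorBaseCoact h x (fun y c => sw y fun m t => m ⊗ₜ[ℂ] linExt A.act (t ⊗ₜ b.η c))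
      (by fun_prop) (by fun_prop)]
    simp (disch := fun_prop) only [sw_apply]
    conv_rhs => rw [← sw_tmul_self (ι x)]
    refine sw_congr _ fun m t => ?_
    rw [← tmul_sw, A.sw_act_unit]

theorem sw_cotensorModule_canonicalCoact (x : X) (F : C → M ⊗[ℂ] T → V)
    (h₁ : ∀ c, Lin fun x => F x c) (h₂ : ∀ x, Lin fun c => F x c) :
    (sw ((E.cotensorModule h).canonicalCoact x) fun c y => F c (ι y)) =
      sw (ι x) fun m t => sw (A.canonicalCoact t) fun c t => F c (m ⊗ₜ t) := by
  rw [RightModuleStr.sw_canonicalCoact _ _ (fun c y => F c (ι y))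
    (by fun_prop) (by fun_prop)]
  have h₁ := sw_congr_of_mem_withParam
    (RightBicoalgebroid.comul_η_mem (b := b.toRightBicoalgebroid)
      (E.isRightCoaction_cotensorBaseCoact h) x)
    (F := fun g p => sw p fun x e => F (b.α g) (ι (linExt (E.cotensorAct h) (x ⊗ₜ e))))
    (G := fun g p => sw p fun x e => sw (ι x) fun m t =>
      F (b.α g) (m ⊗ₜ linExt A.act (t ⊗ₜ e)))
    (fun g p hp => E.sw_cotensorAct h hp (fun y => F (b.α g) y) (by fun_prop))
    (by fun_prop) (by fun_prop) (by fun_prop) (by fun_prop)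
  simp (disch := fun_prop) only [sw_sw, sw_apply] at h₁
  refine h₁.trans ?_
  rw [E.sw_cotensorBaseCoact h x (fun y c => sw (Δ (b.η c)) fun g e => sw y fun m t =>
    F (b.α g) (m ⊗ₜ linExt A.act (t ⊗ₜ e))) (by fun_prop) (by fun_prop)]
  refine sw_congr _ fun m t => ?_
  simp (disch := fun_prop) only [sw_apply]
  exact (A.sw_canonicalCoact t (fun c t => F c (m ⊗ₜ t)) (by fun_prop) (by fun_prop)).symm

end EquivariantGaloisCoextension

end Tilde

/-! ### The left `B`-coaction of `M □_K T` -/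

section TildeCoaction

variable {C : Type u₁} {B : Type u₂} {T : Type u₃} {K : Type u₄} {M : Type v}
  [AddCommGroup C] [Module ℂ C] [Coalgebra ℂ C] [AddCommGroup B] [Module ℂ B] [Coalgebra ℂ B]
  [AddCommGroup T] [Module ℂ T] [Coalgebra ℂ T] [AddCommGroup K] [Module ℂ K] [Coalgebra ℂ K]
  [AddCommGroup M] [Module ℂ M]
  {X V R : Type*} [AddCommGroup X] [Module ℂ X] [AddCommGroup V] [Module ℂ V]
  [AddCommGroup R] [Module ℂ R]

theorem LeftComoduleCoalgebra.comul_left_mem {S : Type*} [AddCommGroup S] [Module ℂ S]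
    {π : T →ₗ[ℂ] S} {p : T ⊗[ℂ] T} (hp : p ∈ selfCotensor π) :
    (sw p fun u v => sw (Δ u) fun a b => a ⊗ₜ[ℂ] (b ⊗ₜ[ℂ] v)) ∈ withParam T (selfCotensor π) := by
  rw [mem_withParam_cotensor_iff]
  simp (disch := fun_prop) only [sw_sw, sw_apply, LinearMap.comp_apply, lTensor_eq_sw,
    rTensor_eq_sw]
  have := sw_selfCotensor hp (fun u s v => sw (Δ u) fun a b => a ⊗ₜ[ℂ] (b ⊗ₜ[ℂ] (s ⊗ₜ[ℂ] v)))
    (by fun_prop) (by fun_prop) (by fun_prop)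
  simp (disch := fun_prop) only [sw_coassoc] at this
  rw [this]
  exact sw_congr _ fun u v => sw_comm _ _ _

namespace RightModuleCoalgebra

variable {b : RightBicoalgebroid C B} (A : RightModuleCoalgebra b T)

theorem sw_cobalanced (t : T) (F : T → C → T → V) (h₁ : ∀ b c, Lin fun a => F a b c)
    (h₂ : ∀ a c, Lin fun b => F a b c) (h₃ : ∀ a b, Lin fun c => F a b c) :
    (sw (Δ t) fun t₁ t₂ => sw (A.baseCoact t₁) fun t₁ c => F t₁ c t₂) =
      sw (Δ t) fun t₁ t₂ => sw (A.canonicalCoact t₂) fun c t₂ => F t₁ c t₂ := by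
  have := congrArg (fun z => sw z fun a z => sw z fun b c => F a b c) (A.cobalanced t)
  simpa (disch := fun_prop) only [lTensor_eq_sw, rTensor_eq_sw, assoc_eq_sw, sw_sw, sw_apply]
    using this

end RightModuleCoalgebra

namespace EquivariantGaloisCoextension

variable {b : RightHopfCoalgebra C B} {A : RightModuleCoalgebra b.toRightBicoalgebroid T}
  {k : LeftHopfCoalgebra A.Orbit K} (E : EquivariantGaloisCoextension A k)

/-- If `can⁻¹(u ⊗ v) = t ⊗ e`, then `t ⊗ α(e) = u ⊗ ε(v₀) v₁` for the right `C`-coaction of `v`. -/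
theorem sw_α_canInv {p : T ⊗[ℂ] T} (hp : p ∈ cotensor A.orbitR A.orbitL) (F : T → C → V)
    (h₁ : ∀ b, Lin fun a => F a b) (h₂ : ∀ a, Lin fun b => F a b) :
    (sw (E.canInv p) fun t e => F t (b.α e)) =
      sw p fun u v => sw (A.baseCoact v) fun v c => ε v • F u c := by
  obtain ⟨q, hq, rfl⟩ := E.can_bijOn.surjOn hp
  rw [E.canInv_can hq, A.can_eq_sw]
  have e₁ := sw_congr_of_mem_withParam (A.comul_left_mem hq)
    (F := fun u q => sw q fun t e => sw (A.baseCoact (linExt A.act (t ⊗ₜ e))) fun v c =>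
      ε v • F u c)
    (G := fun u q => sw q fun t e => sw (Δ e) fun e f =>
      ε (linExt A.act (t ⊗ₜ e)) • F u (b.α f))
    (fun u q hq => A.sw_baseCoact_act hq (fun v c => ε v • F u c) (by fun_prop) (by fun_prop))
    (by fun_prop) (by fun_prop) (by fun_prop) (by fun_prop)
  have hm : (sw q fun t e => sw (Δ t) fun t₁ t₂ => sw (Δ e) fun e f =>
      F t₁ (b.α f) ⊗ₜ[ℂ] (t₂ ⊗ₜ[ℂ] e)) ∈ withParam V (cotensor A.baseCoact b.βL) := by
    have hq' := A.comul_left_mem hq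
    have := sw_mem_of_mem_withParam hq' (q := withParam V (cotensor A.baseCoact b.βL))
      (F := fun t p => sw p fun t' e => sw (Δ e) fun e f => F t (b.α f) ⊗ₜ[ℂ] (t' ⊗ₜ[ℂ] e))
      (fun t p hp => by
        have := sw_mem_withParam (R' := V) (RightBicoalgebroid.comul_α_mem hp)
          (fun c => F t c) (by fun_prop)
        simpa (disch := fun_prop) only [sw_sw, sw_apply] using this) (by fun_prop) (by fun_prop)
    simpa (disch := fun_prop) only [sw_sw, sw_apply] using this
  have e₂ := sw_congr_of_mem_withParam hm
    (F := fun u q => (sw q fun t e => ε (linExt A.act (t ⊗ₜ e))) • u)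
    (G := fun u q => (sw q fun t e => ε t • ε e) • u)
    (fun u q hq => congrArg (· • u) (A.sw_counit_act hq))
    (by fun_prop) (by fun_prop) (by fun_prop) (by fun_prop)
  simp (disch := fun_prop) only [sw_sw, sw_apply] at e₁ e₂ ⊢
  rw [e₁, e₂]
  refine sw_congr _ fun t e => ?_
  simp only [smul_assoc, ← smul_sw]
  rw [sw_counit_right t (fun t => sw (Δ e) fun e f => (ε e : ℂ) • F t (b.α f)) (by fun_prop)]
  exact (sw_counit_left e (fun e => F t (b.α e)) (by fun_prop)).symm

/-- The `K`-coaction of `T` is also left `C`-colinear. -/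
theorem sw_canonicalCoact_coact (t : T) (F : C → K → T → V) (h₁ : ∀ b c, Lin fun a => F a b c)
    (h₂ : ∀ a c, Lin fun b => F a b c) (h₃ : ∀ a b, Lin fun c => F a b c) :
    (sw (A.canonicalCoact t) fun c t => sw (E.coact t) fun g t => F c g t) =
      sw (E.coact t) fun g t => sw (A.canonicalCoact t) fun c t => F c g t := by
  have e₁ := sw_congr_of_mem_withParam
    (RightBicoalgebroid.comul_η_mem (b := b.toRightBicoalgebroid) A.isRightCoaction_baseCoact t)
    (F := fun y q => sw q fun t e => sw (E.coact (linExt A.act (t ⊗ₜ e))) fun g t =>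
      F (b.α y) g t)
    (G := fun y q => sw q fun t e => sw (E.coact t) fun g t =>
      F (b.α y) g (linExt A.act (t ⊗ₜ e)))
    (fun y q hq => E.sw_coact_act hq (fun g t => F (b.α y) g t) (by fun_prop) (by fun_prop))
    (by fun_prop) (by fun_prop) (by fun_prop) (by fun_prop)
  simp (disch := fun_prop) only [sw_sw, sw_apply] at e₁
  simp (disch := fun_prop) only [A.sw_canonicalCoact]
  rw [e₁, E.sw_baseCoact_coact t (fun g t c => sw (Δ (b.η c)) fun y e =>
    F (b.α y) g (linExt A.act (t ⊗ₜ e))) (by fun_prop) (by fun_prop) (by fun_prop)]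
  exact sw_congr _ fun t c => sw_comm _ _ _

/-- `t₋₁ ε(t₀) = η(π(t))`. -/
theorem sw_counit_coact (t : T) (F : K → V) (hF : Lin F) :
    (sw (E.coact t) fun g t => ε t • F g) = F (k.η (A.orbitCoideal.mkQ t)) := by
  have h₁ := E.counit_coact t
  have h₂ := E.sw_α_coact E.α_coact t (fun s t => ε t • s) (by fun_prop) (by fun_prop)
  rw [sw_counit_right t (fun t => A.orbitCoideal.mkQ t) (by fun_prop)] at h₂
  simp (disch := fun_prop) only [rid_eq_sw, lTensor_eq_sw, sw_sw, sw_apply] at h₁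
  have h₃ : k.α (sw (E.coact t) fun g t => (ε t : ℂ) • g) = A.orbitCoideal.mkQ t := by
    rw [map_sw, ← h₂]
    exact sw_congr _ fun g t => map_smul _ _ _
  rw [h₃] at h₁
  rw [← h₁]
  change _ = hF.bundle _
  rw [map_sw]
  exact sw_congr _ fun g t => (map_smul hF.bundle _ _).symm

variable {s : LeftRightSAYDStr k M} {ι : X →ₗ[ℂ] M ⊗[ℂ] T} (h : IsCotensor s.coact E.coact ι)

include h

theorem rotate_mem (x : X) : s.rotate E.toLeftComoduleCoalgebra (ι x) ∈
    withParam M (cotensor A.orbitR A.orbitL) :=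
  LeftRightSAYDStr.rotate_mem E.α_coact E.β_coact (h.mem x)

/-- The left `B`-coaction has values in `B ⊗ (M □_K T)`: the rotation and the inverse of the
canonical map are `K`-colinear. -/
theorem cotensorCoact_mem (x : X) :
    (sw (s.rotate E.toLeftComoduleCoalgebra (ι x)) fun m p => sw (E.canInv p) fun t e =>
      e ⊗ₜ[ℂ] (m ⊗ₜ[ℂ] t)) ∈ withParam B (cotensor s.coact E.coact) := by
  rw [mem_withParam_cotensor_iff]
  simp (disch := fun_prop) only [sw_sw, sw_apply]
  have e₁ := LeftRightSAYDStr.sw_coact_rotate E.α_coact E.β_coact (h.mem x)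
    (fun m g u v => sw (E.canInv (u ⊗ₜ v)) fun t e => e ⊗ₜ[ℂ] (m ⊗ₜ[ℂ] (g ⊗ₜ[ℂ] t)))
    (by fun_prop) (by fun_prop) (by fun_prop) (by fun_prop)
  have e₂ := sw_congr_of_mem_withParam (E.rotate_mem h x)
    (F := fun m p => sw p fun u v => sw (E.coact u) fun g u => sw (E.coact v) fun h v =>
      sw (E.canInv (u ⊗ₜ v)) fun t e => e ⊗ₜ[ℂ] (m ⊗ₜ[ℂ] (linExt k.μ (g ⊗ₜ h) ⊗ₜ[ℂ] t)))
    (G := fun m p => sw (E.canInv p) fun t e => sw (E.coact t) fun g t =>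
      e ⊗ₜ[ℂ] (m ⊗ₜ[ℂ] (g ⊗ₜ[ℂ] t)))
    (fun m p hp => E.sw_coact_canInv hp (fun g t e => e ⊗ₜ[ℂ] (m ⊗ₜ[ℂ] (g ⊗ₜ[ℂ] t)))
      (by fun_prop) (by fun_prop) (by fun_prop))
    (by fun_prop) (by fun_prop) (by fun_prop) (by fun_prop)
  rw [← e₂, ← e₁]
  refine sw_congr _ fun m p => ?_
  conv_lhs => rw [← sw_tmul_self p]
  simp (disch := fun_prop) only [map_sw, sw_sw]
  simp only [sw_comm (s.coact m)]

/-- The left `B`-coaction of `M □_K T`: the rotation `m ⊗ t ↦ (t₂)₋₁ ▷ m ⊗ ((t₂)₀ ⊗ t₁)` with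
values in `M □_K (T □_S T)`, followed by the inverse of the canonical map. -/
def cotensorCoact : X →ₗ[ℂ] B ⊗[ℂ] X :=
  liftParam h.injective (fun x : X =>
    sw (s.rotate E.toLeftComoduleCoalgebra (ι x)) fun m p => sw (E.canInv p) fun t e =>
      e ⊗ₜ[ℂ] (m ⊗ₜ[ℂ] t)) (by fun_prop) fun x => h.mem_range_lTensor (E.cotensorCoact_mem h x)

theorem sw_cotensorCoact (x : X) (F : B → M ⊗[ℂ] T → V)
    (h₁ : ∀ c, Lin fun x => F x c) (h₂ : ∀ x, Lin fun c => F x c) :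
    (sw (E.cotensorCoact h x) fun e y => F e (ι y)) =
      sw (s.rotate E.toLeftComoduleCoalgebra (ι x)) fun m p => sw (E.canInv p) fun t e =>
        F e (m ⊗ₜ t) := by
  refine Eq.trans (sw_liftParam h.injective (f := fun x : X =>
    sw (s.rotate E.toLeftComoduleCoalgebra (ι x)) fun m p => sw (E.canInv p) fun t e =>
      e ⊗ₜ[ℂ] (m ⊗ₜ[ℂ] t)) (by fun_prop)
      (fun x => h.mem_range_lTensor (E.cotensorCoact_mem h x)) x F h₁ h₂) ?_
  simp (disch := fun_prop) only [sw_sw, sw_apply]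

/-- `x₀ ⊗ x₋₁` lies in `(M □_K T) □_C B`, which gives `x₀ ◁ x₋₁` a meaning. -/
theorem cotensorCoact_comm_mem (x : X) :
    (sw (E.cotensorCoact h x) fun e y => y ⊗ₜ[ℂ] e) ∈ cotensor (E.cotensorBaseCoact h) b.βL := by
  rw [mem_cotensor_iff]
  refine ext_of_injective_tmul h.injective ?_
  simp (disch := fun_prop) only [sw_sw, sw_apply]
  have h₁ : ∀ (y : X) (e : B), (sw (E.cotensorBaseCoact h y) fun y c => ι y ⊗ₜ[ℂ] (c ⊗ₜ[ℂ] e)) =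
      sw (ι y) fun m t => sw (A.baseCoact t) fun t c => (m ⊗ₜ[ℂ] t) ⊗ₜ[ℂ] (c ⊗ₜ[ℂ] e) :=
    fun y e => E.sw_cotensorBaseCoact h y (fun y c => y ⊗ₜ[ℂ] (c ⊗ₜ[ℂ] e)) (by fun_prop)
      (by fun_prop)
  simp only [h₁]
  rw [E.sw_cotensorCoact h x (fun e y => sw y fun m t => sw (A.baseCoact t) fun t c =>
    (m ⊗ₜ[ℂ] t) ⊗ₜ[ℂ] (c ⊗ₜ[ℂ] e)) (by fun_prop) (by fun_prop),
    E.sw_cotensorCoact h x (fun e y => sw (b.βL e) fun c e => y ⊗ₜ[ℂ] (c ⊗ₜ[ℂ] e)) (by fun_prop)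
      (by fun_prop)]
  simp (disch := fun_prop) only [sw_apply]
  exact sw_congr_of_mem_withParam (E.rotate_mem h x)
    (fun m p hp => sw_cotensor (E.canInv_mem hp) (fun t c e => (m ⊗ₜ[ℂ] t) ⊗ₜ[ℂ] (c ⊗ₜ[ℂ] e))
      (by fun_prop) (by fun_prop) (by fun_prop))
    (by fun_prop) (by fun_prop) (by fun_prop) (by fun_prop)

/-- Counitality of the left `B`-coaction, from the stability of `M`. -/
theorem sw_counit_cotensorCoact (x : X) (F : X → V) (hF : Lin F) :
    (sw (E.cotensorCoact h x) fun e y => ε e • F y) = F x := by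
  have key : (sw (E.cotensorCoact h x) fun e y => (ε e : ℂ) • y) = x := by
    refine h.injective ?_
    simp only [map_sw, map_smul]
    rw [E.sw_cotensorCoact h x (fun e y => ε e • y) (by fun_prop) (by fun_prop)]
    have e₁ := sw_congr_of_mem_withParam (E.rotate_mem h x)
      (F := fun m p => sw (E.canInv p) fun t e => ε e • m ⊗ₜ[ℂ] t)
      (G := fun m p => sw p fun u v => ε v • m ⊗ₜ[ℂ] u)
      (fun m p hp => by
        have := congrArg (fun z => m ⊗ₜ[ℂ] z) (E.counit_canInv hp)
        simpa only [tmul_sw, TensorProduct.tmul_smul] using this)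
      (by fun_prop) (by fun_prop) (by fun_prop) (by fun_prop)
    rw [e₁, s.sw_rotate _ _ _ (by fun_prop) (by fun_prop)]
    simp (disch := fun_prop) only [sw_apply]
    have e₂ : ∀ (m : M) (t : T), (sw (Δ t) fun a b => sw (E.coact b) fun g b =>
        (ε a : ℂ) • (linExt s.act (g ⊗ₜ m) ⊗ₜ[ℂ] b)) =
          sw (E.coact t) fun g b => linExt s.act (g ⊗ₜ m) ⊗ₜ[ℂ] b := by
      intro m t
      have := sw_counit_left t (fun b => sw (E.coact b) fun g b =>
        linExt s.act (g ⊗ₜ m) ⊗ₜ[ℂ] b) (by fun_prop)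
      rw [← this]
      exact sw_congr _ fun a b => (smul_sw _ _ _).symm
    simp only [e₂]
    rw [← sw_cotensor (h.mem x) (fun m g b => linExt s.act (g ⊗ₜ m) ⊗ₜ[ℂ] b) (by fun_prop)
      (by fun_prop) (by fun_prop)]
    conv_rhs => rw [← sw_tmul_self (ι x)]
    refine sw_congr _ fun m t => ?_
    rw [← sw_tmul, s.sw_stable]
  conv_rhs => rw [← key]
  change _ = hF.bundle _
  rw [map_sw]
  exact sw_congr _ fun e y => (map_smul hF.bundle _ _).symm

/-- The right `C`-coaction is `x ↦ x₀ ⊗ β(x₋₁)`: apply `ε ⊗ id` to the equation that says that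
`x₀ ⊗ x₋₁` lies in `(M □_K T) □_C B`. -/
theorem cotensorBaseCoact_eq (x : X) : E.cotensorBaseCoact h x =
    b.β.lTensor X (TensorProduct.comm ℂ B X (E.cotensorCoact h x)) := by
  have := sw_cotensor (E.cotensorCoact_comm_mem h x) (fun y c e => ε e • y ⊗ₜ[ℂ] c) (by fun_prop)
    (by fun_prop) (by fun_prop)
  simp (disch := fun_prop) only [sw_sw, sw_apply, b.sw_βL] at this
  rw [lTensor_eq_sw, comm_eq_sw]
  simp (disch := fun_prop) only [sw_sw, sw_apply]
  have h₁ : ∀ (e : B) (y : X), (sw (Δ e) fun e f => (ε e : ℂ) • y ⊗ₜ[ℂ] b.β f) = y ⊗ₜ[ℂ] b.β e :=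
    fun e y => sw_counit_left e (fun e => y ⊗ₜ[ℂ] b.β e) (by fun_prop)
  simp only [h₁] at this
  rw [← this, ← E.sw_counit_cotensorCoact h x (fun x => E.cotensorBaseCoact h x) (by fun_prop)]
  refine sw_congr _ fun e y => ?_
  conv_lhs => rw [← sw_tmul_self (E.cotensorBaseCoact h y)]
  exact smul_sw _ _ _

/-- Stability of `M □_K T`, from the unitality of the action of `K` on `M`. -/
theorem cotensorCoact_stable (x : X) :
    linExt (E.cotensorAct h) (TensorProduct.comm ℂ B X (E.cotensorCoact h x)) = x := by
  refine h.injective ?_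
  rw [comm_eq_sw, E.ι_cotensorAct h (E.cotensorCoact_comm_mem h x)]
  simp (disch := fun_prop) only [sw_sw, sw_apply]
  rw [E.sw_cotensorCoact h x (fun e y => sw y fun m t => m ⊗ₜ[ℂ] linExt A.act (t ⊗ₜ e))
    (by fun_prop) (by fun_prop)]
  simp (disch := fun_prop) only [sw_apply]
  have e₁ := sw_congr_of_mem_withParam (E.rotate_mem h x)
    (F := fun m p => sw (E.canInv p) fun t e => m ⊗ₜ[ℂ] linExt A.act (t ⊗ₜ e))
    (G := fun m p => sw p fun u v => m ⊗ₜ[ℂ] ((ε u : ℂ) • v))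
    (fun m p hp => by
      rw [← tmul_sw, ← tmul_sw, ← E.act_canInv hp]
      conv_rhs => rw [← sw_tmul_self (E.canInv p), map_sw])
    (by fun_prop) (by fun_prop) (by fun_prop) (by fun_prop)
  rw [e₁, s.sw_rotate _ _ _ (by fun_prop) (by fun_prop)]
  simp (disch := fun_prop) only [sw_apply, TensorProduct.tmul_smul]
  have e₂ : ∀ (m : M) (a t : T), (sw (E.coact t) fun g b =>
      (ε b : ℂ) • linExt s.act (g ⊗ₜ m) ⊗ₜ[ℂ] a) =
        linExt s.act (k.η (A.orbitCoideal.mkQ t) ⊗ₜ m) ⊗ₜ[ℂ] a := fun m a t =>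
    E.sw_counit_coact t (fun g => linExt s.act (g ⊗ₜ m) ⊗ₜ[ℂ] a) (by fun_prop)
  simp only [e₂]
  rw [← LeftRightSAYDStr.sw_baseCoact E.β_coact (h.mem x) (fun m c a =>
    linExt s.act (k.η c ⊗ₜ m) ⊗ₜ[ℂ] a) (by fun_prop) (by fun_prop) (by fun_prop)]
  conv_rhs => rw [← sw_tmul_self (ι x)]
  refine sw_congr _ fun m t => ?_
  have := s.act_unit m
  rw [rTensor_eq_sw, map_sw] at this
  rw [← sw_tmul, this]

theorem cotensor_canonicalCoact_eq (x : X) :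
    b.α.rTensor X (E.cotensorCoact h x) = (E.cotensorModule h).canonicalCoact x := by
  refine ext_tmul_of_injective h.injective ?_
  rw [E.sw_cotensorModule_canonicalCoact h x (fun c y => c ⊗ₜ[ℂ] y) (by fun_prop) (by fun_prop),
    rTensor_eq_sw]
  simp (disch := fun_prop) only [sw_sw, sw_apply]
  rw [E.sw_cotensorCoact h x (fun e y => b.α e ⊗ₜ[ℂ] y) (by fun_prop) (by fun_prop)]
  have e₁ := sw_congr_of_mem_withParam (E.rotate_mem h x)
    (F := fun m p => sw (E.canInv p) fun t e => b.α e ⊗ₜ[ℂ] (m ⊗ₜ[ℂ] t))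
    (G := fun m p => sw p fun u v => sw (A.baseCoact v) fun v c => ε v • c ⊗ₜ[ℂ] (m ⊗ₜ[ℂ] u))
    (fun m p hp => E.sw_α_canInv hp (fun t c => c ⊗ₜ[ℂ] (m ⊗ₜ[ℂ] t)) (by fun_prop) (by fun_prop))
    (by fun_prop) (by fun_prop) (by fun_prop) (by fun_prop)
  rw [e₁, s.sw_rotate _ _ _ (by fun_prop) (by fun_prop)]
  simp (disch := fun_prop) only [sw_apply]
  have e₂ : ∀ (m : M) (t : T), (sw (Δ t) fun a b => sw (E.coact b) fun g b =>
      sw (A.baseCoact a) fun a c => (ε a : ℂ) • c ⊗ₜ[ℂ] (linExt s.act (g ⊗ₜ m) ⊗ₜ[ℂ] b)) =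
        sw (E.coact t) fun g t => sw (A.canonicalCoact t) fun c t =>
          c ⊗ₜ[ℂ] (linExt s.act (g ⊗ₜ m) ⊗ₜ[ℂ] t) := by
    intro m t
    calc
      _ = sw (Δ t) fun a b => sw (A.canonicalCoact b) fun c b => sw (E.coact b) fun g b =>
          (ε a : ℂ) • c ⊗ₜ[ℂ] (linExt s.act (g ⊗ₜ m) ⊗ₜ[ℂ] b) := by
        refine Eq.trans (sw_congr _ fun a b => sw_comm _ _ _) ?_
        exact A.sw_cobalanced t (fun a c b => sw (E.coact b) fun g b =>
          (ε a : ℂ) • c ⊗ₜ[ℂ] (linExt s.act (g ⊗ₜ m) ⊗ₜ[ℂ] b)) (by fun_prop) (by fun_prop)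
            (by fun_prop)
      _ = sw (Δ t) fun a b => (ε a : ℂ) • sw (E.coact b) fun g b => sw (A.canonicalCoact b)
          fun c b => c ⊗ₜ[ℂ] (linExt s.act (g ⊗ₜ m) ⊗ₜ[ℂ] b) := by
        refine sw_congr _ fun a b => ?_
        rw [E.sw_canonicalCoact_coact b (fun c g b =>
          (ε a : ℂ) • c ⊗ₜ[ℂ] (linExt s.act (g ⊗ₜ m) ⊗ₜ[ℂ] b)) (by fun_prop) (by fun_prop)
            (by fun_prop)]
        simp only [smul_sw]
      _ = _ := sw_counit_left t (fun b => sw (E.coact b) fun g b => sw (A.canonicalCoact b)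
          fun c b => c ⊗ₜ[ℂ] (linExt s.act (g ⊗ₜ m) ⊗ₜ[ℂ] b)) (by fun_prop)
  simp only [e₂]
  rw [← sw_cotensor (h.mem x) (fun m g t => sw (A.canonicalCoact t) fun c t =>
    c ⊗ₜ[ℂ] (linExt s.act (g ⊗ₜ m) ⊗ₜ[ℂ] t)) (by fun_prop) (by fun_prop) (by fun_prop)]
  refine sw_congr _ fun m t => ?_
  have hl : Lin fun m : M => sw (A.canonicalCoact t) fun c t => c ⊗ₜ[ℂ] (m ⊗ₜ[ℂ] t) := by fun_prop
  exact (map_sw hl.bundle (s.coact m) fun m g => linExt s.act (g ⊗ₜ m)).symm.trans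
    (congrArg hl.bundle (s.sw_stable m))

end EquivariantGaloisCoextension

end TildeCoaction

/-! ### Coassociativity of the `B`-coaction -/

section Coassoc

variable {C : Type u₁} {B : Type u₂} {T : Type u₃} {K : Type u₄} {M : Type v}
  [AddCommGroup C] [Module ℂ C] [Coalgebra ℂ C] [AddCommGroup B] [Module ℂ B] [Coalgebra ℂ B]
  [AddCommGroup T] [Module ℂ T] [Coalgebra ℂ T] [AddCommGroup K] [Module ℂ K] [Coalgebra ℂ K]
  [AddCommGroup M] [Module ℂ M]
  {X V R : Type*} [AddCommGroup X] [Module ℂ X] [AddCommGroup V] [Module ℂ V]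
  [AddCommGroup R] [Module ℂ R]

/-- `e₁ ⊗ (x ⊗ e₂) ∈ B ⊗ (X □ B)` for `x ⊗ e ∈ X □ B`. -/
theorem RightBicoalgebroid.comul_mem {b : RightBicoalgebroid C B} {r : X →ₗ[ℂ] X ⊗[ℂ] C}
    {w : X ⊗[ℂ] B} (hw : w ∈ cotensor r b.βL) :
    (sw w fun x e => sw (Δ e) fun e f => e ⊗ₜ[ℂ] (x ⊗ₜ[ℂ] f)) ∈ withParam B (cotensor r b.βL) := by
  rw [mem_withParam_cotensor_iff]
  have := sw_cotensor hw (fun x c e => sw (Δ e) fun e f => e ⊗ₜ[ℂ] (x ⊗ₜ[ℂ] (c ⊗ₜ[ℂ] f)))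
    (by fun_prop) (by fun_prop) (by fun_prop)
  simp (disch := fun_prop) only [sw_sw, sw_apply, b.sw_βL] at this ⊢
  refine (sw_congr _ fun x e => sw_comm _ _ _).trans (this.trans ?_)
  exact sw_congr _ fun x e => sw_coassoc e (fun e f y => e ⊗ₜ[ℂ] (x ⊗ₜ[ℂ] (b.β y ⊗ₜ[ℂ] f)))
    (by fun_prop) (by fun_prop) (by fun_prop)

namespace EquivariantGaloisCoextension

variable {b : RightHopfCoalgebra C B} {A : RightModuleCoalgebra b.toRightBicoalgebroid T}
  {k : LeftHopfCoalgebra A.Orbit K} (E : EquivariantGaloisCoextension A k)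

include E in
/-- The canonical map is injective on `R ⊗ (T □_C B)`. -/
theorem eq_of_sw_can_eq {z z' : R ⊗[ℂ] (T ⊗[ℂ] B)}
    (hz : z ∈ withParam R (cotensor A.baseCoact b.βL))
    (hz' : z' ∈ withParam R (cotensor A.baseCoact b.βL))
    (h : (sw z fun r q => r ⊗ₜ[ℂ] A.can q) = sw z' fun r q => r ⊗ₜ[ℂ] A.can q) : z = z' := by
  have key : ∀ z ∈ withParam R (cotensor A.baseCoact b.βL),
      (sw (sw z fun r q => r ⊗ₜ[ℂ] A.can q) fun r p => r ⊗ₜ[ℂ] E.canInv p) = z := by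
    intro z hz
    simp (disch := fun_prop) only [sw_sw, sw_apply]
    conv_rhs => rw [← sw_tmul_self z]
    exact sw_congr_of_mem_withParam hz (F := fun r q => r ⊗ₜ[ℂ] E.canInv (A.can q))
      (G := fun r q => r ⊗ₜ[ℂ] q) (fun r q hq => by rw [E.canInv_can hq]) (by fun_prop)
      (by fun_prop) (by fun_prop) (by fun_prop)
  rw [← key z hz, ← key z' hz', h]

variable {s : LeftRightSAYDStr k M} {ι : X →ₗ[ℂ] M ⊗[ℂ] T} (h : IsCotensor s.coact E.coact ι)

include h

theorem comul_cotensorCoact_mem (x : X) :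
    (sw (s.rotate E.toLeftComoduleCoalgebra (ι x)) fun m p => sw (E.canInv p) fun t e =>
      sw (Δ e) fun e f => (e ⊗ₜ[ℂ] m) ⊗ₜ[ℂ] (t ⊗ₜ[ℂ] f)) ∈
        withParam (B ⊗[ℂ] M) (cotensor A.baseCoact b.βL) := by
  refine sw_mem_of_mem_withParam (W := (B ⊗[ℂ] M) ⊗[ℂ] (T ⊗[ℂ] B)) (E.rotate_mem h x)
    (F := fun m p => sw (E.canInv p) fun t e => sw (Δ e) fun e f =>
      (e ⊗ₜ[ℂ] m) ⊗ₜ[ℂ] (t ⊗ₜ[ℂ] f)) (fun m p hp => ?_) (by fun_prop) (by fun_prop)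
  have := sw_mem_withParam (R' := B ⊗[ℂ] M) (RightBicoalgebroid.comul_mem (E.canInv_mem hp))
    (fun e => e ⊗ₜ[ℂ] m) (by fun_prop)
  simpa (disch := fun_prop) only [sw_sw, sw_apply] using this

theorem cotensorCoact_cotensorCoact_mem (x : X) :
    (sw (s.rotate E.toLeftComoduleCoalgebra (ι x)) fun m p => sw (E.canInv p) fun t e =>
      sw (s.rotate E.toLeftComoduleCoalgebra (m ⊗ₜ t)) fun m p => sw (E.canInv p) fun t f =>
        (e ⊗ₜ[ℂ] m) ⊗ₜ[ℂ] (t ⊗ₜ[ℂ] f)) ∈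
        withParam (B ⊗[ℂ] M) (cotensor A.baseCoact b.βL) := by
  have := sw_mem_of_mem_withParam (W := (B ⊗[ℂ] M) ⊗[ℂ] (T ⊗[ℂ] B)) (E.cotensorCoact_mem h x)
    (q := withParam (B ⊗[ℂ] M) (cotensor A.baseCoact b.βL))
    (F := fun e y => sw (s.rotate E.toLeftComoduleCoalgebra y) fun m p => (e ⊗ₜ[ℂ] m) ⊗ₜ[ℂ]
      E.canInv p) (fun e y hy => by
      obtain ⟨y, rfl⟩ := h.exists_eq hy
      exact sw_mem_of_mem_withParam (W := (B ⊗[ℂ] M) ⊗[ℂ] (T ⊗[ℂ] B)) (E.rotate_mem h y)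
        (fun m p hp => tmul_mem_withParam (E.canInv_mem hp) _) (by fun_prop) (by fun_prop))
    (by fun_prop) (by fun_prop)
  simp (disch := fun_prop) only [sw_sw, sw_apply] at this
  convert this using 1
  refine sw_congr _ fun m p => sw_congr _ fun t e => sw_congr _ fun m p => ?_
  rw [← tmul_sw, sw_tmul_self]

/-- Coassociativity of the left `B`-coaction, tested with the canonical map: both sides become
`m ⊗ (can⁻¹(u ⊗ v₁) ⊗ v₂)` for the rotation `m ⊗ (u ⊗ v)` of `x`. -/
theorem cotensorCoact_coassoc (x : X) :
    (sw (s.rotate E.toLeftComoduleCoalgebra (ι x)) fun m p => sw (E.canInv p) fun t e =>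
      sw (Δ e) fun e f => (e ⊗ₜ[ℂ] m) ⊗ₜ[ℂ] (t ⊗ₜ[ℂ] f)) =
    sw (s.rotate E.toLeftComoduleCoalgebra (ι x)) fun m p => sw (E.canInv p) fun t e =>
      sw (s.rotate E.toLeftComoduleCoalgebra (m ⊗ₜ t)) fun m p => sw (E.canInv p) fun t f =>
        (e ⊗ₜ[ℂ] m) ⊗ₜ[ℂ] (t ⊗ₜ[ℂ] f) := by
  refine E.eq_of_sw_can_eq (E.comul_cotensorCoact_mem h x)
    (E.cotensorCoact_cotensorCoact_mem h x) ?_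
  simp (disch := fun_prop) only [sw_sw, sw_apply]
  calc
    _ = sw (s.rotate E.toLeftComoduleCoalgebra (ι x)) fun m p => sw p fun u v => sw (Δ v)
        fun v w => sw (E.canInv (u ⊗ₜ v)) fun t e => (e ⊗ₜ[ℂ] m) ⊗ₜ[ℂ] (t ⊗ₜ[ℂ] w) := by
      refine Eq.trans ?_ (sw_congr_of_mem_withParam (E.rotate_mem h x)
        (F := fun m p => sw p fun u v => sw (Δ v) fun v w => sw (E.canInv (u ⊗ₜ v)) fun t e =>
          (e ⊗ₜ[ℂ] m) ⊗ₜ[ℂ] (t ⊗ₜ[ℂ] w))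
        (G := fun m p => sw (E.canInv p) fun t e => sw (Δ t) fun t t' => sw (Δ e) fun e f =>
          (e ⊗ₜ[ℂ] m) ⊗ₜ[ℂ] (t ⊗ₜ[ℂ] linExt A.act (t' ⊗ₜ f)))
        (fun m p hp => E.sw_canInv_comul hp (fun t e w => (e ⊗ₜ[ℂ] m) ⊗ₜ[ℂ] (t ⊗ₜ[ℂ] w))
          (by fun_prop) (by fun_prop) (by fun_prop))
        (by fun_prop) (by fun_prop) (by fun_prop) (by fun_prop)).symm
      refine sw_congr _ fun m p => sw_congr _ fun t e => ?_
      simp (disch := fun_prop) only [A.can_eq_sw, tmul_sw, sw_apply]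
      exact sw_comm _ _ _
    -- the composition of two rotations
    _ = sw (s.rotate E.toLeftComoduleCoalgebra (ι x)) fun m p => sw p fun u v => sw (Δ u)
        fun a u => sw (E.coact u) fun g u => sw (E.coact v) fun h v =>
          sw (E.canInv (u ⊗ₜ v)) fun t e =>
            (e ⊗ₜ[ℂ] linExt s.act (linExt k.μ (g ⊗ₜ h) ⊗ₜ m)) ⊗ₜ[ℂ] (t ⊗ₜ[ℂ] a) :=
      (LeftRightSAYDStr.sw_rotate_rotate E.α_coact E.β_coact (h.mem x) (fun m u v a =>
        sw (E.canInv (u ⊗ₜ v)) fun t e => (e ⊗ₜ[ℂ] m) ⊗ₜ[ℂ] (t ⊗ₜ[ℂ] a)) (by fun_prop)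
        (by fun_prop) (by fun_prop) (by fun_prop)).symm
    -- `can⁻¹` is left `K`-colinear
    _ = sw (s.rotate E.toLeftComoduleCoalgebra (ι x)) fun m p => sw p fun u v => sw (Δ u)
        fun a u => sw (E.canInv (u ⊗ₜ v)) fun t e => sw (E.coact t) fun g t =>
            (e ⊗ₜ[ℂ] linExt s.act (g ⊗ₜ m)) ⊗ₜ[ℂ] (t ⊗ₜ[ℂ] a) := by
      refine Eq.trans ?_ ((sw_congr_of_mem_withParam (E.rotate_mem h x)
        (F := fun m p => sw p fun u v => sw (Δ u) fun a u => sw (E.coact u) fun g u =>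
          sw (E.coact v) fun h v => sw (E.canInv (u ⊗ₜ v)) fun t e =>
            (e ⊗ₜ[ℂ] linExt s.act (linExt k.μ (g ⊗ₜ h) ⊗ₜ m)) ⊗ₜ[ℂ] (t ⊗ₜ[ℂ] a))
        (G := fun m p => sw p fun u v => sw (Δ u) fun a u => sw (E.canInv (u ⊗ₜ v)) fun t e =>
          sw (E.coact t) fun g t => (e ⊗ₜ[ℂ] linExt s.act (g ⊗ₜ m)) ⊗ₜ[ℂ] (t ⊗ₜ[ℂ] a))
        (fun m p hp => ?_)
        (by fun_prop) (by fun_prop) (by fun_prop) (by fun_prop)).trans ?_)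
      · rfl
      · have := sw_congr_of_mem_withParam (LeftComoduleCoalgebra.comul_left_mem hp)
          (F := fun a p => sw p fun u v => sw (E.coact u) fun g u =>
            sw (E.coact v) fun h v => sw (E.canInv (u ⊗ₜ v)) fun t e =>
              (e ⊗ₜ[ℂ] linExt s.act (linExt k.μ (g ⊗ₜ h) ⊗ₜ m)) ⊗ₜ[ℂ] (t ⊗ₜ[ℂ] a))
          (G := fun a p => sw (E.canInv p) fun t e =>
            sw (E.coact t) fun g t => (e ⊗ₜ[ℂ] linExt s.act (g ⊗ₜ m)) ⊗ₜ[ℂ] (t ⊗ₜ[ℂ] a))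
          (fun a p hp => E.sw_coact_canInv hp (fun g t e =>
            (e ⊗ₜ[ℂ] linExt s.act (g ⊗ₜ m)) ⊗ₜ[ℂ] (t ⊗ₜ[ℂ] a)) (by fun_prop) (by fun_prop)
              (by fun_prop))
          (by fun_prop) (by fun_prop) (by fun_prop) (by fun_prop)
        simpa (disch := fun_prop) only [sw_sw, sw_apply] using this
      · rfl
    -- `can⁻¹` is left `T`-colinear
    _ = sw (s.rotate E.toLeftComoduleCoalgebra (ι x)) fun m p => sw (E.canInv p) fun t e =>
        sw (s.rotate E.toLeftComoduleCoalgebra (m ⊗ₜ t)) fun m p => (e ⊗ₜ[ℂ] m) ⊗ₜ[ℂ] p := by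
      refine (sw_congr_of_mem_withParam (E.rotate_mem h x)
        (F := fun m p => sw p fun u v => sw (Δ u) fun a u => sw (E.canInv (u ⊗ₜ v)) fun t e =>
          sw (E.coact t) fun g t => (e ⊗ₜ[ℂ] linExt s.act (g ⊗ₜ m)) ⊗ₜ[ℂ] (t ⊗ₜ[ℂ] a))
        (G := fun m p => sw (E.canInv p) fun t e => sw (Δ t) fun a t => sw (E.coact t)
          fun g t => (e ⊗ₜ[ℂ] linExt s.act (g ⊗ₜ m)) ⊗ₜ[ℂ] (t ⊗ₜ[ℂ] a))
        (fun m p hp => E.sw_comul_canInv hp (fun a t e => sw (E.coact t)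
          fun g t => (e ⊗ₜ[ℂ] linExt s.act (g ⊗ₜ m)) ⊗ₜ[ℂ] (t ⊗ₜ[ℂ] a)) (by fun_prop)
            (by fun_prop) (by fun_prop))
        (by fun_prop) (by fun_prop) (by fun_prop) (by fun_prop)).trans ?_
      refine sw_congr _ fun m p => sw_congr _ fun t e => ?_
      rw [s.sw_rotate _ _ _ (by fun_prop) (by fun_prop)]
      simp (disch := fun_prop) only [sw_apply]
    _ = sw (s.rotate E.toLeftComoduleCoalgebra (ι x)) fun m p => sw (E.canInv p) fun t e =>
        sw (s.rotate E.toLeftComoduleCoalgebra (m ⊗ₜ t)) fun m p =>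
          (e ⊗ₜ[ℂ] m) ⊗ₜ[ℂ] A.can (E.canInv p) := by
      have := sw_congr_of_mem_withParam (E.cotensorCoact_mem h x)
        (F := fun e y => sw (s.rotate E.toLeftComoduleCoalgebra y) fun m p =>
          (e ⊗ₜ[ℂ] m) ⊗ₜ[ℂ] p)
        (G := fun e y => sw (s.rotate E.toLeftComoduleCoalgebra y) fun m p =>
          (e ⊗ₜ[ℂ] m) ⊗ₜ[ℂ] A.can (E.canInv p))
        (fun e y hy => by
          obtain ⟨y, rfl⟩ := h.exists_eq hy
          exact sw_congr_of_mem_withParam (E.rotate_mem h y)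
            (fun m p hp => by rw [E.can_canInv hp]) (by fun_prop) (by fun_prop) (by fun_prop)
              (by fun_prop)) (by fun_prop) (by fun_prop) (by fun_prop) (by fun_prop)
      simpa (disch := fun_prop) only [sw_sw, sw_apply] using this
    _ = _ := by
      refine sw_congr _ fun m p => sw_congr _ fun t e => sw_congr _ fun m p => ?_
      conv_lhs => rw [← sw_tmul_self (E.canInv p), map_sw, tmul_sw]

theorem isLeftCoaction_cotensorCoact : IsLeftCoaction (E.cotensorCoact h) where
  coassoc x := by
    refine Module.Flat.lTensor_preserves_injective_linearMap (M := B) _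
      (Module.Flat.lTensor_preserves_injective_linearMap (M := B) ι h.injective) ?_
    simp (disch := fun_prop) only [assoc_eq_sw, rTensor_eq_sw, lTensor_eq_sw, sw_sw, sw_apply]
    have h₁ : ∀ (y : X) (e : B), (sw (E.cotensorCoact h y) fun f y => e ⊗ₜ[ℂ] (f ⊗ₜ[ℂ] ι y)) =
        sw (s.rotate E.toLeftComoduleCoalgebra (ι y)) fun m p => sw (E.canInv p) fun t f =>
          e ⊗ₜ[ℂ] (f ⊗ₜ[ℂ] (m ⊗ₜ[ℂ] t)) := fun y e =>
      E.sw_cotensorCoact h y (fun f y => e ⊗ₜ[ℂ] (f ⊗ₜ[ℂ] y)) (by fun_prop) (by fun_prop)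
    simp only [tmul_sw, h₁]
    rw [E.sw_cotensorCoact h x (fun e y => sw (Δ e) fun e f => e ⊗ₜ[ℂ] (f ⊗ₜ[ℂ] y))
      (by fun_prop) (by fun_prop), E.sw_cotensorCoact h x (fun e y =>
      sw (s.rotate E.toLeftComoduleCoalgebra y) fun m p => sw (E.canInv p) fun t f =>
          e ⊗ₜ[ℂ] (f ⊗ₜ[ℂ] (m ⊗ₜ[ℂ] t))) (by fun_prop) (by fun_prop)]
    have := congrArg (fun z => sw z fun p q => sw p fun e m => sw q fun t f =>
      e ⊗ₜ[ℂ] (f ⊗ₜ[ℂ] (m ⊗ₜ[ℂ] t))) (E.cotensorCoact_coassoc h x)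
    simpa (disch := fun_prop) only [sw_sw, sw_apply] using this
  counit x := by
    rw [rTensor_eq_sw, ← E.sw_counit_cotensorCoact h x (fun x => (1 : ℂ) ⊗ₜ[ℂ] x) (by fun_prop)]
    refine sw_congr _ fun e y => ?_
    rw [TensorProduct.smul_tmul', smul_eq_mul, mul_one]

end EquivariantGaloisCoextension

end Coassoc

/-! ### The inverse Galois map of `B` -/

section AntiYetterDrinfeld

variable {C B X V : Type*} [AddCommGroup C] [Module ℂ C] [Coalgebra ℂ C]
  [AddCommGroup B] [Module ℂ B] [Coalgebra ℂ B] [AddCommGroup X] [Module ℂ X]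
  [AddCommGroup V] [Module ℂ V]

namespace RightBicoalgebroid

variable {b : RightBicoalgebroid C B}

theorem sw_αR_μ {w : B ⊗[ℂ] B} (hw : w ∈ cotensor b.αR b.βL) (F : B → C → V)
    (h₁ : ∀ b, Lin fun a => F a b) (h₂ : ∀ a, Lin fun b => F a b) :
    (sw w fun g h => sw (Δ (linExt b.μ (g ⊗ₜ h))) fun x y => F x (b.α y)) =
      sw w fun g h => sw (Δ h) fun x y => F (linExt b.μ (g ⊗ₜ x)) (b.α y) := by
  have := congrArg (fun z => sw z F) (b.μ_colinear_right ⟨w, hw⟩)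
  rw [← linExt_apply] at this
  simp (disch := fun_prop) only [b.sw_αR, lTensor_eq_sw, rTensor_eq_sw, assoc_symm_eq_sw, sw_sw,
    sw_apply] at this
  rw [← this]
  conv_rhs => rw [← sw_tmul_self w]
  simp (disch := fun_prop) only [map_sw, sw_sw]

theorem comul_left_mem {w : B ⊗[ℂ] B} (hw : w ∈ cotensor b.αR b.βL) :
    (sw w fun g h => sw (Δ g) fun g₁ g₂ => g₁ ⊗ₜ[ℂ] (g₂ ⊗ₜ[ℂ] h)) ∈
      withParam B (cotensor b.αR b.βL) := by
  rw [mem_withParam_cotensor_iff]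
  have := sw_cotensor hw (fun g c h => sw (Δ g) fun g₁ g₂ => g₁ ⊗ₜ[ℂ] (g₂ ⊗ₜ[ℂ] (c ⊗ₜ[ℂ] h)))
    (by fun_prop) (by fun_prop) (by fun_prop)
  simp (disch := fun_prop) only [sw_sw, sw_apply, b.sw_αR, sw_coassoc] at this ⊢
  exact this.trans (sw_congr _ fun g h => sw_comm _ _ _)

theorem comul_β_mem {w : B ⊗[ℂ] B} (hw : w ∈ cotensor b.αR b.βL) :
    (sw w fun g h => sw (Δ g) fun g₁ g₂ => b.β g₂ ⊗ₜ[ℂ] (g₁ ⊗ₜ[ℂ] h)) ∈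
      withParam C (cotensor b.αR b.βL) := by
  rw [mem_withParam_cotensor_iff]
  have := sw_cotensor hw (fun g c h => sw (Δ g) fun g₁ g₂ =>
    b.β g₂ ⊗ₜ[ℂ] (g₁ ⊗ₜ[ℂ] (c ⊗ₜ[ℂ] h))) (by fun_prop) (by fun_prop) (by fun_prop)
  simp (disch := fun_prop) only [sw_sw, sw_apply, b.sw_αR] at this ⊢
  refine Eq.trans (sw_congr _ fun g h => ?_) (this.trans (sw_congr _ fun g h => sw_comm _ _ _))
  rw [sw_coassoc g (fun x y z => b.β z ⊗ₜ[ℂ] (x ⊗ₜ[ℂ] (b.α y ⊗ₜ[ℂ] h))) (by fun_prop)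
    (by fun_prop) (by fun_prop), sw_coassoc g (fun x y z => b.β y ⊗ₜ[ℂ] (x ⊗ₜ[ℂ] (b.α z ⊗ₜ[ℂ] h)))
    (by fun_prop) (by fun_prop) (by fun_prop)]
  exact sw_congr _ fun x y => b.sw_cocommute y (fun c d => d ⊗ₜ[ℂ] (x ⊗ₜ[ℂ] (c ⊗ₜ[ℂ] h)))
    (by fun_prop) (by fun_prop)

theorem galois_eq_sw (w : B ⊗[ℂ] B) : b.galois w =
    sw w fun g h => sw (Δ g) fun g₁ g₂ => g₁ ⊗ₜ[ℂ] linExt b.μ (g₂ ⊗ₜ h) := by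
  simp (disch := fun_prop) only [galois, LinearMap.comp_apply, LinearEquiv.coe_coe,
    lTensor_eq_sw, rTensor_eq_sw, assoc_eq_sw, sw_sw, sw_apply]

end RightBicoalgebroid

namespace RightHopfCoalgebra

variable {b : RightHopfCoalgebra C B}

theorem νInv_galois {q : B ⊗[ℂ] B} (hq : q ∈ cotensor b.αR b.βL) : b.νInv (b.galois q) = q :=
  invOn_apply _ b.galois_bijOn hq

theorem νInv_mem {p : B ⊗[ℂ] B} (hp : p ∈ b.copCotensor) : b.νInv p ∈ cotensor b.αR b.βL := by
  obtain ⟨q, hq, rfl⟩ := b.galois_bijOn.surjOn hp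
  rw [νInv_galois hq]
  exact hq

theorem galois_νInv {p : B ⊗[ℂ] B} (hp : p ∈ b.copCotensor) : b.galois (b.νInv p) = p := by
  obtain ⟨q, hq, rfl⟩ := b.galois_bijOn.surjOn hp
  rw [νInv_galois hq]

theorem sw_νInv_galois {q : B ⊗[ℂ] B} (hq : q ∈ cotensor b.αR b.βL) (F : B → B → V)
    (h₁ : ∀ b, Lin fun a => F a b) (h₂ : ∀ a, Lin fun b => F a b) :
    (sw q fun g h => sw (Δ g) fun g₁ g₂ => sw (b.νInv (g₁ ⊗ₜ linExt b.μ (g₂ ⊗ₜ h))) F) =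
      sw q F := by
  have := congrArg (fun z => sw z F) (νInv_galois hq)
  rw [b.galois_eq_sw] at this
  simpa (disch := fun_prop) only [map_sw, sw_sw] using this

/-- `ν⁻(x, y)₁ ⊗ β(ν⁻(x, y)₂) ⊗ ν⁺(x, y) = ν⁻(x, y₁) ⊗ β(y₂) ⊗ ν⁺(x, y₁)`. -/
theorem sw_νInv_β_comul {p : B ⊗[ℂ] B} (hp : p ∈ b.copCotensor) (F : C → B → B → V)
    (h₁ : ∀ b c, Lin fun a => F a b c) (h₂ : ∀ a c, Lin fun b => F a b c)
    (h₃ : ∀ a b, Lin fun c => F a b c) :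
    (sw (b.νInv p) fun g h => sw (Δ g) fun g₁ g₂ => F (b.β g₂) g₁ h) =
      sw p fun x y => sw (Δ y) fun y₁ y₂ => sw (b.νInv (x ⊗ₜ y₁)) fun g h =>
        F (b.β y₂) g h := by
  obtain ⟨q, hq, rfl⟩ := b.galois_bijOn.surjOn hp
  rw [νInv_galois hq, b.galois_eq_sw]
  have e₁ := sw_congr_of_mem_withParam (RightBicoalgebroid.comul_left_mem hq)
    (F := fun x q => sw q fun g h => sw (Δ (linExt b.μ (g ⊗ₜ h))) fun y₁ y₂ =>
      sw (b.νInv (x ⊗ₜ y₁)) fun g h => F (b.β y₂) g h)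
    (G := fun x q => sw q fun g h => sw (Δ g) fun y₁ y₂ =>
      sw (b.νInv (x ⊗ₜ linExt b.μ (y₁ ⊗ₜ h))) fun g h => F (b.β y₂) g h)
    (fun x q hq => b.sw_βL_μ hq (fun c y => sw (b.νInv (x ⊗ₜ y)) fun g h => F c g h)
      (by fun_prop) (by fun_prop))
    (by fun_prop) (by fun_prop) (by fun_prop) (by fun_prop)
  have e₂ := sw_congr_of_mem_withParam (RightBicoalgebroid.comul_β_mem hq)
    (F := fun c q => sw q fun g h => sw (Δ g) fun g₁ g₂ =>
      sw (b.νInv (g₁ ⊗ₜ linExt b.μ (g₂ ⊗ₜ h))) fun g h => F c g h)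
    (G := fun c q => sw q fun g h => F c g h)
    (fun c q hq => sw_νInv_galois hq (F c) (by fun_prop) (by fun_prop))
    (by fun_prop) (by fun_prop) (by fun_prop) (by fun_prop)
  simp (disch := fun_prop) only [sw_sw, sw_apply] at e₁ e₂ ⊢
  rw [e₁, ← e₂]
  exact sw_congr _ fun g h => sw_coassoc g (fun x y z =>
    sw (b.νInv (x ⊗ₜ linExt b.μ (y ⊗ₜ h))) fun g h => F (b.β z) g h) (by fun_prop)
      (by fun_prop) (by fun_prop)

/-- `ν⁻(x, y) ⊗ ν⁺(x, y)₁ ⊗ α(ν⁺(x, y)₂) = ν⁻(x, y₁) ⊗ ν⁺(x, y₁) ⊗ α(y₂)`. -/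
theorem sw_νInv_α_comul {p : B ⊗[ℂ] B} (hp : p ∈ b.copCotensor) (F : B → B → C → V)
    (h₁ : ∀ b c, Lin fun a => F a b c) (h₂ : ∀ a c, Lin fun b => F a b c)
    (h₃ : ∀ a b, Lin fun c => F a b c) :
    (sw (b.νInv p) fun g h => sw (Δ h) fun h₁ h₂ => F g h₁ (b.α h₂)) =
      sw p fun x y => sw (Δ y) fun y₁ y₂ => sw (b.νInv (x ⊗ₜ y₁)) fun g h =>
        F g h (b.α y₂) := by
  obtain ⟨q, hq, rfl⟩ := b.galois_bijOn.surjOn hp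
  rw [νInv_galois hq, b.galois_eq_sw]
  have e₁ := sw_congr_of_mem_withParam (RightBicoalgebroid.comul_left_mem hq)
    (F := fun x q => sw q fun g h => sw (Δ (linExt b.μ (g ⊗ₜ h))) fun y₁ y₂ =>
      sw (b.νInv (x ⊗ₜ y₁)) fun g h => F g h (b.α y₂))
    (G := fun x q => sw q fun g h => sw (Δ h) fun y₁ y₂ =>
      sw (b.νInv (x ⊗ₜ linExt b.μ (g ⊗ₜ y₁))) fun g h => F g h (b.α y₂))
    (fun x q hq => RightBicoalgebroid.sw_αR_μ hq (fun y c => sw (b.νInv (x ⊗ₜ y)) fun g h =>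
      F g h c) (by fun_prop) (by fun_prop))
    (by fun_prop) (by fun_prop) (by fun_prop) (by fun_prop)
  have e₂ := sw_congr_of_mem_withParam (RightBicoalgebroid.comul_α_mem hq)
    (F := fun c q => sw q fun g h => sw (Δ g) fun g₁ g₂ =>
      sw (b.νInv (g₁ ⊗ₜ linExt b.μ (g₂ ⊗ₜ h))) fun g h => F g h c)
    (G := fun c q => sw q fun g h => F g h c)
    (fun c q hq => sw_νInv_galois hq (fun g h => F g h c) (by fun_prop) (by fun_prop))
    (by fun_prop) (by fun_prop) (by fun_prop) (by fun_prop)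
  simp (disch := fun_prop) only [sw_sw, sw_apply] at e₁ e₂ ⊢
  rw [e₁, ← e₂]
  exact sw_congr _ fun g h => sw_comm _ _ _

/-- `β(ν⁻(x, y)₁) ⊗ ν⁻(x, y)₂ ⊗ ν⁺(x, y) = β(x₁) ⊗ ν⁻(x₂, y) ⊗ ν⁺(x₂, y)`. -/
theorem sw_β_comul_νInv {p : B ⊗[ℂ] B} (hp : p ∈ b.copCotensor) (F : C → B → B → V)
    (h₁ : ∀ b c, Lin fun a => F a b c) (h₂ : ∀ a c, Lin fun b => F a b c)
    (h₃ : ∀ a b, Lin fun c => F a b c) :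
    (sw (b.νInv p) fun g h => sw (Δ g) fun g₁ g₂ => F (b.β g₁) g₂ h) =
      sw p fun x y => sw (Δ x) fun x₁ x₂ => sw (b.νInv (x₂ ⊗ₜ y)) fun g h =>
        F (b.β x₁) g h := by
  obtain ⟨q, hq, rfl⟩ := b.galois_bijOn.surjOn hp
  rw [νInv_galois hq, b.galois_eq_sw]
  have e₂ := sw_congr_of_mem_withParam (RightBicoalgebroid.comul_left_mem hq)
    (F := fun x q => sw q fun g h => sw (Δ g) fun g₁ g₂ =>
      sw (b.νInv (g₁ ⊗ₜ linExt b.μ (g₂ ⊗ₜ h))) fun g h => F (b.β x) g h)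
    (G := fun x q => sw q fun g h => F (b.β x) g h)
    (fun x q hq => sw_νInv_galois hq (F (b.β x)) (by fun_prop) (by fun_prop))
    (by fun_prop) (by fun_prop) (by fun_prop) (by fun_prop)
  simp (disch := fun_prop) only [sw_sw, sw_apply] at e₂ ⊢
  rw [← e₂]
  exact sw_congr _ fun g h => (sw_coassoc g (fun x y z =>
    sw (b.νInv (y ⊗ₜ linExt b.μ (z ⊗ₜ h))) fun g h => F (b.β x) g h) (by fun_prop)
      (by fun_prop) (by fun_prop)).symm

end RightHopfCoalgebra

namespace RightModuleStr

variable {b : RightHopfCoalgebra C B} {s : RightModuleStr b.toRightBicoalgebroid X}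
  {ρ : X →ₗ[ℂ] B ⊗[ℂ] X} (hρ : IsLeftCoaction ρ)
  (hβ : ∀ x, s.baseCoact x = b.β.lTensor X (TensorProduct.comm ℂ B X (ρ x)))
  (hα : ∀ x, b.α.rTensor X (ρ x) = s.canonicalCoact x)
  {w : X ⊗[ℂ] B} (hw : w ∈ cotensor s.baseCoact b.βL)

include hβ in
theorem sw_baseCoact_of_eq (x : X) (F : X → C → V) (h₁ : ∀ b, Lin fun a => F a b)
    (h₂ : ∀ a, Lin fun b => F a b) :
    sw (s.baseCoact x) F = sw (ρ x) fun a y => F y (b.β a) := by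
  rw [hβ]
  simp (disch := fun_prop) only [lTensor_eq_sw, comm_eq_sw, sw_sw, sw_apply]

include hρ hβ hw in
/-- The argument `e₂ ⊗ x₋₁` of `ν⁻¹` in the anti-Yetter-Drinfeld condition lies in
`B □_{C_cop} B`. -/
theorem comul_coact_mem_copCotensor :
    (sw w fun x e => sw (Δ e) fun e₁ e₂ => sw (ρ x) fun a y =>
      (y ⊗ₜ[ℂ] e₁) ⊗ₜ[ℂ] (e₂ ⊗ₜ[ℂ] a)) ∈ withParam (X ⊗[ℂ] B) b.copCotensor := by
  refine mem_withParam_cotensor_iff.2 ?_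
  have := sw_cotensor hw (fun x c e => sw (Δ e) fun e₁ e₂ => sw (ρ x) fun a y =>
    (y ⊗ₜ[ℂ] e₁) ⊗ₜ[ℂ] (e₂ ⊗ₜ[ℂ] (c ⊗ₜ[ℂ] a))) (by fun_prop) (by fun_prop) (by fun_prop)
  simp (disch := fun_prop) only [sw_sw, sw_apply, b.sw_βL, b.sw_copR, b.sw_copL,
    sw_baseCoact_of_eq hβ] at this ⊢
  refine Eq.trans (sw_congr _ fun x e => ?_) (this.symm.trans (sw_congr _ fun x e => ?_))
  · rw [sw_coassoc e (fun e f g => sw (ρ x) fun a y =>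
      (y ⊗ₜ[ℂ] e) ⊗ₜ[ℂ] (f ⊗ₜ[ℂ] (b.β g ⊗ₜ[ℂ] a))) (by fun_prop) (by fun_prop) (by fun_prop)]
    exact sw_congr _ fun e f => sw_comm _ _ _
  · refine (sw_comm _ _ _).trans (sw_congr _ fun e f => ?_)
    exact (hρ.sw_coassoc x (fun a a' y => (y ⊗ₜ[ℂ] e) ⊗ₜ[ℂ] (f ⊗ₜ[ℂ] (b.β a ⊗ₜ[ℂ] a')))
      (by fun_prop) (by fun_prop) (by fun_prop)).symm

include hρ hβ hw in
/-- `x₀ ⊗ ν⁻(e₂, x₋₁) ⊗ ν⁺(e₂, x₋₁) ⊗ e₁ ∈ (X □_C B □_C B) ⊗ B` for `x ⊗ e ∈ X □_C B`. -/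
theorem coact_νInv_mem :
    (sw w fun x e => sw (Δ e) fun e₁ e₂ => sw (ρ x) fun a y => sw (b.νInv (e₂ ⊗ₜ a)) fun g h =>
      e₁ ⊗ₜ[ℂ] ((y ⊗ₜ[ℂ] g) ⊗ₜ[ℂ] h)) ∈
        withParam B (cotensor₃ s.baseCoact b.βL b.αR b.βL) := by
  refine mem_withParam_cotensor₃ ?_ ?_
  · rw [mem_withParam_cotensor_iff]
    have e₁ := sw_congr_of_mem_withParam (comul_coact_mem_copCotensor hρ hβ hw)
      (F := fun z p => sw z fun y e => sw (b.νInv p) fun g h => sw (Δ g) fun g₁ g₂ =>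
        (e ⊗ₜ[ℂ] h) ⊗ₜ[ℂ] (y ⊗ₜ[ℂ] (b.β g₂ ⊗ₜ[ℂ] g₁)))
      (G := fun z p => sw z fun y e => sw p fun f a => sw (Δ a) fun a₁ a₂ =>
        sw (b.νInv (f ⊗ₜ a₁)) fun g h => (e ⊗ₜ[ℂ] h) ⊗ₜ[ℂ] (y ⊗ₜ[ℂ] (b.β a₂ ⊗ₜ[ℂ] g)))
      (fun z p hp => sw_congr _ fun y e => RightHopfCoalgebra.sw_νInv_β_comul hp
        (fun c g h => (e ⊗ₜ[ℂ] h) ⊗ₜ[ℂ] (y ⊗ₜ[ℂ] (c ⊗ₜ[ℂ] g))) (by fun_prop) (by fun_prop)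
          (by fun_prop))
      (by fun_prop) (by fun_prop) (by fun_prop) (by fun_prop)
    simp (disch := fun_prop) only [sw_sw, sw_apply, b.sw_βL, sw_baseCoact_of_eq hβ] at e₁ ⊢
    rw [e₁]
    refine sw_congr _ fun x e => sw_congr _ fun e f => ?_
    rw [hρ.sw_coassoc x (fun a a' y => sw (b.νInv (f ⊗ₜ a)) fun g h =>
      (e ⊗ₜ[ℂ] h) ⊗ₜ[ℂ] (y ⊗ₜ[ℂ] (b.β a' ⊗ₜ[ℂ] g))) (by fun_prop) (by fun_prop) (by fun_prop)]
    exact sw_congr _ fun a y => sw_comm _ _ _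
  · have := sw_mem_of_mem_withParam (W := (B ⊗[ℂ] X) ⊗[ℂ] (B ⊗[ℂ] B))
      (comul_coact_mem_copCotensor hρ hβ hw)
      (q := withParam (B ⊗[ℂ] X) (cotensor b.αR b.βL))
      (F := fun z p => (TensorProduct.comm ℂ X B z) ⊗ₜ[ℂ] b.νInv p)
      (fun z p hp => tmul_mem_withParam (RightHopfCoalgebra.νInv_mem hp) _)
      (by fun_prop) (by fun_prop)
    simp (disch := fun_prop) only [sw_sw, sw_apply, TensorProduct.comm_tmul] at this ⊢
    convert this using 1
    refine sw_congr _ fun x e => sw_congr _ fun e f => sw_congr _ fun a y => ?_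
    rw [← tmul_sw, sw_tmul_self]

include hρ hβ hα hw in
/-- `x₀ ◁ ν⁻(e₂, x₋₁) ⊗ ν⁺(e₂, x₋₁) ⊗ e₁ ∈ X □_C B □_C B` for `x ⊗ e ∈ X □_C B`. -/
theorem act_νInv_mem :
    (sw w fun x e => sw (Δ e) fun e₁ e₂ => sw (ρ x) fun a y => sw (b.νInv (e₂ ⊗ₜ a)) fun g h =>
      (linExt s.act (y ⊗ₜ g) ⊗ₜ[ℂ] h) ⊗ₜ[ℂ] e₁) ∈
        cotensor₃ s.baseCoact b.βL b.αR b.βL := by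
  have hm := coact_νInv_mem hρ hβ hw
  refine mem_cotensor₃_iff.2 ⟨?_, ?_⟩
  · have := sw_mem_of_mem_withParam (W := B ⊗[ℂ] (X ⊗[ℂ] B)) hm
      (q := withParam B (cotensor s.baseCoact b.βL))
      (F := fun e p => e ⊗ₜ[ℂ] sw p fun q h => linExt s.act q ⊗ₜ[ℂ] h)
      (fun e p hp => tmul_mem_withParam (RightBicoalgebroid.sw_act_mem s.act_colinear hp) e)
      (by fun_prop) (by fun_prop)
    simpa (disch := fun_prop) only [sw_sw, sw_apply] using this
  · rw [mem_withParam_cotensor_iff]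
    have hp := comul_coact_mem_copCotensor hρ hβ hw
    have e₁ := sw_congr_of_mem_withParam hp
      (F := fun z p => sw z fun y e => sw (b.νInv p) fun g h => sw (Δ h) fun h₁ h₂ =>
        linExt s.act (y ⊗ₜ g) ⊗ₜ[ℂ] (h₁ ⊗ₜ[ℂ] (b.α h₂ ⊗ₜ[ℂ] e)))
      (G := fun z p => sw z fun y e => sw p fun f a => sw (Δ a) fun a₁ a₂ =>
        sw (b.νInv (f ⊗ₜ a₁)) fun g h =>
          linExt s.act (y ⊗ₜ g) ⊗ₜ[ℂ] (h ⊗ₜ[ℂ] (b.α a₂ ⊗ₜ[ℂ] e)))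
      (fun z p hp => sw_congr _ fun y e => RightHopfCoalgebra.sw_νInv_α_comul hp
        (fun g h c => linExt s.act (y ⊗ₜ g) ⊗ₜ[ℂ] (h ⊗ₜ[ℂ] (c ⊗ₜ[ℂ] e))) (by fun_prop)
          (by fun_prop) (by fun_prop))
      (by fun_prop) (by fun_prop) (by fun_prop) (by fun_prop)
    have e₂ := sw_congr_of_mem_withParam hp
      (F := fun z p => sw z fun y e => sw (b.νInv p) fun g h => sw (Δ g) fun g₁ g₂ =>
        linExt s.act (y ⊗ₜ g₂) ⊗ₜ[ℂ] (h ⊗ₜ[ℂ] (b.β g₁ ⊗ₜ[ℂ] e)))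
      (G := fun z p => sw z fun y e => sw p fun f a => sw (Δ f) fun f₁ f₂ =>
        sw (b.νInv (f₂ ⊗ₜ a)) fun g h =>
          linExt s.act (y ⊗ₜ g) ⊗ₜ[ℂ] (h ⊗ₜ[ℂ] (b.β f₁ ⊗ₜ[ℂ] e)))
      (fun z p hp => sw_congr _ fun y e => RightHopfCoalgebra.sw_β_comul_νInv hp
        (fun c g h => linExt s.act (y ⊗ₜ g) ⊗ₜ[ℂ] (h ⊗ₜ[ℂ] (c ⊗ₜ[ℂ] e))) (by fun_prop)
          (by fun_prop) (by fun_prop))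
      (by fun_prop) (by fun_prop) (by fun_prop) (by fun_prop)
    have e₃ := sw_congr_of_mem_withParam hm
      (F := fun e z => sw z fun q h => sw q fun y g => sw (s.canonicalCoact y) fun c y =>
        linExt s.act (y ⊗ₜ g) ⊗ₜ[ℂ] (h ⊗ₜ[ℂ] (c ⊗ₜ[ℂ] e)))
      (G := fun e z => sw z fun q h => sw q fun y g => sw (Δ g) fun g₁ g₂ =>
        linExt s.act (y ⊗ₜ g₂) ⊗ₜ[ℂ] (h ⊗ₜ[ℂ] (b.β g₁ ⊗ₜ[ℂ] e)))
      (fun e z hz => by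
        have := sw_congr_of_mem_withParam (mem_cotensor₃_iff.1 hz).1
          (F := fun h q => sw q fun y g => sw (s.canonicalCoact y) fun c y =>
            linExt s.act (y ⊗ₜ g) ⊗ₜ[ℂ] (h ⊗ₜ[ℂ] (c ⊗ₜ[ℂ] e)))
          (G := fun h q => sw q fun y g => sw (Δ g) fun g₁ g₂ =>
            linExt s.act (y ⊗ₜ g₂) ⊗ₜ[ℂ] (h ⊗ₜ[ℂ] (b.β g₁ ⊗ₜ[ℂ] e)))
          (fun h q hq => s.sw_canonicalCoact_act hq (fun c y => y ⊗ₜ[ℂ] (h ⊗ₜ[ℂ] (c ⊗ₜ[ℂ] e)))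
            (by fun_prop) (by fun_prop))
          (by fun_prop) (by fun_prop) (by fun_prop) (by fun_prop)
        simpa (disch := fun_prop) only [sw_sw, sw_apply] using this)
      (by fun_prop) (by fun_prop) (by fun_prop) (by fun_prop)
    simp (disch := fun_prop) only [← hα, rTensor_eq_sw, sw_sw, sw_apply, b.sw_βL, b.sw_αR]
      at e₁ e₂ e₃ ⊢
    rw [e₁]
    refine Eq.trans (sw_congr _ fun x e => sw_congr _ fun e f => ?_) (e₃.trans (e₂.trans
      (sw_congr _ fun x e => ?_)))
    · refine (hρ.sw_coassoc x (fun a a' y => sw (b.νInv (f ⊗ₜ a)) fun g h =>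
        linExt s.act (y ⊗ₜ g) ⊗ₜ[ℂ] (h ⊗ₜ[ℂ] (b.α a' ⊗ₜ[ℂ] e))) (by fun_prop) (by fun_prop)
          (by fun_prop)).trans (sw_congr _ fun a y => ?_)
      exact sw_comm _ _ _
    · refine Eq.trans ?_ ((sw_coassoc e (fun a c d => sw (ρ x) fun a' y =>
        sw (b.νInv (d ⊗ₜ a')) fun g h => linExt s.act (y ⊗ₜ g) ⊗ₜ[ℂ] (h ⊗ₜ[ℂ] (b.β c ⊗ₜ[ℂ] a)))
          (by fun_prop) (by fun_prop) (by fun_prop)).symm.trans (sw_congr _ fun a f => ?_))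
      · simp only [sw_comm (ρ x)]
      · refine (sw_comm _ _ _).trans (sw_congr _ fun a' y => ?_)
        exact sw_comm _ _ _

end RightModuleStr

end AntiYetterDrinfeld

/-! ### The anti-Yetter-Drinfeld condition for `M □_K T` -/

section CotensorAntiYetterDrinfeld

variable {C : Type u₁} {B : Type u₂} {T : Type u₃} {K : Type u₄} {M : Type v}
  [AddCommGroup C] [Module ℂ C] [Coalgebra ℂ C] [AddCommGroup B] [Module ℂ B] [Coalgebra ℂ B]
  [AddCommGroup T] [Module ℂ T] [Coalgebra ℂ T] [AddCommGroup K] [Module ℂ K] [Coalgebra ℂ K]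
  [AddCommGroup M] [Module ℂ M]
  {X V R : Type*} [AddCommGroup X] [Module ℂ X] [AddCommGroup V] [Module ℂ V]
  [AddCommGroup R] [Module ℂ R]

namespace RightModuleCoalgebra

variable {b : RightBicoalgebroid C B} (A : RightModuleCoalgebra b T)

theorem comul_comul_mem {w : T ⊗[ℂ] B} (hw : w ∈ cotensor A.baseCoact b.βL) :
    (sw w fun t e => sw (Δ t) fun t₁ t₂ => sw (Δ e) fun e₁ e₂ =>
      (t₁ ⊗ₜ[ℂ] e₁) ⊗ₜ[ℂ] (t₂ ⊗ₜ[ℂ] e₂)) ∈ withParam (T ⊗[ℂ] B) (cotensor A.baseCoact b.βL) := by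
  have := sw_mem_of_mem_withParam (W := (T ⊗[ℂ] B) ⊗[ℂ] (T ⊗[ℂ] B)) (A.comul_left_mem hw)
    (q := withParam (T ⊗[ℂ] B) (cotensor A.baseCoact b.βL))
    (F := fun u p => sw p fun t e => sw (Δ e) fun e₁ e₂ => (u ⊗ₜ[ℂ] e₁) ⊗ₜ[ℂ] (t ⊗ₜ[ℂ] e₂))
    (fun u p hp => by
      have := sw_mem_withParam (R' := T ⊗[ℂ] B) (RightBicoalgebroid.comul_mem hp)
        (fun e => u ⊗ₜ[ℂ] e) (by fun_prop)
      simpa (disch := fun_prop) only [sw_sw, sw_apply] using this) (by fun_prop) (by fun_prop)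
  simpa (disch := fun_prop) only [sw_sw, sw_apply] using this

variable {A} {w : (T ⊗[ℂ] B) ⊗[ℂ] B} (hw : w ∈ cotensor₃ A.baseCoact b.βL b.αR b.βL)

include hw

theorem comul_left_mem₃ : (sw w fun q f => sw q fun t e => sw (Δ t) fun t₁ t₂ =>
    t₁ ⊗ₜ[ℂ] ((t₂ ⊗ₜ[ℂ] e) ⊗ₜ[ℂ] f)) ∈
      withParam T (cotensor₃ A.baseCoact b.βL b.αR b.βL) := by
  obtain ⟨hw₁, hw₂⟩ := mem_cotensor₃_iff.1 hw
  refine mem_withParam_cotensor₃ ?_ ?_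
  · have := sw_mem_of_mem_withParam (W := (T ⊗[ℂ] B) ⊗[ℂ] (T ⊗[ℂ] B)) hw₁
      (q := withParam (T ⊗[ℂ] B) (cotensor A.baseCoact b.βL))
      (F := fun f q => sw q fun t e => sw (Δ t) fun t₁ t₂ =>
        (t₁ ⊗ₜ[ℂ] f) ⊗ₜ[ℂ] (t₂ ⊗ₜ[ℂ] e))
      (fun f q hq => by
        have := sw_mem_withParam (R' := T ⊗[ℂ] B) (A.comul_left_mem hq)
          (fun t => t ⊗ₜ[ℂ] f) (by fun_prop)
        simpa (disch := fun_prop) only [sw_sw, sw_apply] using this) (by fun_prop) (by fun_prop)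
    simpa (disch := fun_prop) only [sw_sw, sw_apply] using this
  · have := sw_mem_withParam (R' := T ⊗[ℂ] T) hw₂ (fun t => Δ t) (by fun_prop)
    simp (disch := fun_prop) only [sw_sw, sw_apply] at this ⊢
    convert this using 1
    refine sw_congr _ fun q f => sw_congr _ fun t e => ?_
    rw [← sw_tmul, sw_tmul_self]

theorem comul_comul_mem₃ : (sw w fun q f => sw q fun t e => sw (Δ t) fun t₁ t₂ =>
    sw (Δ e) fun e₁ e₂ => (t₁ ⊗ₜ[ℂ] e₁) ⊗ₜ[ℂ] ((t₂ ⊗ₜ[ℂ] e₂) ⊗ₜ[ℂ] f)) ∈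
      withParam (T ⊗[ℂ] B) (cotensor₃ A.baseCoact b.βL b.αR b.βL) := by
  obtain ⟨hw₁, hw₂⟩ := mem_cotensor₃_iff.1 hw
  refine mem_withParam_cotensor₃ ?_ ?_
  · have := sw_mem_of_mem_withParam (W := ((T ⊗[ℂ] B) ⊗[ℂ] B) ⊗[ℂ] (T ⊗[ℂ] B)) hw₁
      (q := withParam ((T ⊗[ℂ] B) ⊗[ℂ] B) (cotensor A.baseCoact b.βL))
      (F := fun f q => sw q fun t e => sw (Δ t) fun t₁ t₂ => sw (Δ e) fun e₁ e₂ =>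
        ((t₁ ⊗ₜ[ℂ] e₁) ⊗ₜ[ℂ] f) ⊗ₜ[ℂ] (t₂ ⊗ₜ[ℂ] e₂))
      (fun f q hq => by
        have := sw_mem_withParam (R' := (T ⊗[ℂ] B) ⊗[ℂ] B) (A.comul_comul_mem hq)
          (fun p => p ⊗ₜ[ℂ] f) (by fun_prop)
        simpa (disch := fun_prop) only [sw_sw, sw_apply] using this) (by fun_prop) (by fun_prop)
    simpa (disch := fun_prop) only [sw_sw, sw_apply] using this
  · have := sw_mem_of_mem_withParam (W := ((T ⊗[ℂ] B) ⊗[ℂ] T) ⊗[ℂ] (B ⊗[ℂ] B)) hw₂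
      (q := withParam ((T ⊗[ℂ] B) ⊗[ℂ] T) (cotensor b.αR b.βL))
      (F := fun t q => sw q fun e f => sw (Δ t) fun t₁ t₂ => sw (Δ e) fun e₁ e₂ =>
        ((t₁ ⊗ₜ[ℂ] e₁) ⊗ₜ[ℂ] t₂) ⊗ₜ[ℂ] (e₂ ⊗ₜ[ℂ] f))
      (fun t q hq => by
        have := sw_mem_withParam (R' := (T ⊗[ℂ] B) ⊗[ℂ] T) (RightBicoalgebroid.comul_left_mem hq)
          (fun e => sw (Δ t) fun t₁ t₂ => (t₁ ⊗ₜ[ℂ] e) ⊗ₜ[ℂ] t₂) (by fun_prop)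
        simp (disch := fun_prop) only [sw_sw, sw_apply, sw_tmul] at this
        convert this using 1
        exact sw_congr _ fun e f => sw_comm _ _ _) (by fun_prop) (by fun_prop)
    simpa (disch := fun_prop) only [sw_sw, sw_apply] using this

/-- The canonical map is right `B`-linear in its second factor. -/
theorem can_μ : A.can (sw w fun q f => sw q fun t e => t ⊗ₜ[ℂ] linExt b.μ (e ⊗ₜ f)) =
    sw w fun q f => sw (A.can q) fun u v => u ⊗ₜ[ℂ] linExt A.act (v ⊗ₜ f) := by
  have e₁ := sw_congr_of_mem_withParam (comul_left_mem₃ hw)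
    (F := fun u z => sw z fun q f => u ⊗ₜ[ℂ] linExt A.act (linExt A.act q ⊗ₜ f))
    (G := fun u z => sw z fun q f => sw q fun t e =>
      u ⊗ₜ[ℂ] linExt A.act (t ⊗ₜ linExt b.μ (e ⊗ₜ f)))
    (fun u z hz => A.sw_act_assoc hz (fun t => u ⊗ₜ[ℂ] t) (by fun_prop))
    (by fun_prop) (by fun_prop) (by fun_prop) (by fun_prop)
  simp (disch := fun_prop) only [A.can_eq_sw, sw_sw, sw_apply] at e₁ ⊢
  exact e₁.symm

/-- The action intertwines the Galois map of `B` with the canonical map of `T`: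
`(t ◁ e)₁ ⊗ (t ◁ e)₂ ◁ f = t₁ ◁ e₁ ⊗ t₂ ◁ (e₂ f)`. -/
theorem can_act : A.can (sw w fun q f => linExt A.act q ⊗ₜ[ℂ] f) =
    sw w fun q f => sw q fun t e => sw (Δ t) fun t₁ t₂ => sw (b.galois (e ⊗ₜ f)) fun g h =>
      linExt A.act (t₁ ⊗ₜ g) ⊗ₜ[ℂ] linExt A.act (t₂ ⊗ₜ h) := by
  have e₁ := sw_congr_of_mem_withParam (mem_cotensor₃_iff.1 hw).1
    (F := fun f q => sw q fun t e => sw (Δ (linExt A.act (t ⊗ₜ e))) fun u v =>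
      u ⊗ₜ[ℂ] linExt A.act (v ⊗ₜ f))
    (G := fun f q => sw q fun t e => sw (Δ t) fun t₁ t₂ => sw (Δ e) fun e₁ e₂ =>
      linExt A.act (t₁ ⊗ₜ e₁) ⊗ₜ[ℂ] linExt A.act (linExt A.act (t₂ ⊗ₜ e₂) ⊗ₜ f))
    (fun f q hq => A.sw_comul_act hq (fun u v => u ⊗ₜ[ℂ] linExt A.act (v ⊗ₜ f))
      (by fun_prop) (by fun_prop))
    (by fun_prop) (by fun_prop) (by fun_prop) (by fun_prop)
  have e₂ := sw_congr_of_mem_withParam (comul_comul_mem₃ hw)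
    (F := fun p z => sw z fun q f =>
      linExt A.act p ⊗ₜ[ℂ] linExt A.act (linExt A.act q ⊗ₜ f))
    (G := fun p z => sw z fun q f => sw q fun t e =>
      linExt A.act p ⊗ₜ[ℂ] linExt A.act (t ⊗ₜ linExt b.μ (e ⊗ₜ f)))
    (fun p z hz => A.sw_act_assoc hz (fun t => linExt A.act p ⊗ₜ[ℂ] t) (by fun_prop))
    (by fun_prop) (by fun_prop) (by fun_prop) (by fun_prop)
  simp (disch := fun_prop) only [A.can_eq_sw, b.galois_eq_sw, sw_sw, sw_apply] at e₁ e₂ ⊢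
  refine Eq.trans (sw_congr _ fun q f => ?_) (e₁.trans e₂)
  conv_lhs => rw [← sw_tmul_self q]
  simp (disch := fun_prop) only [map_sw, sw_sw]

end RightModuleCoalgebra

namespace EquivariantGaloisCoextension

variable {b : RightHopfCoalgebra C B} {A : RightModuleCoalgebra b.toRightBicoalgebroid T}
  {k : LeftHopfCoalgebra A.Orbit K} (E : EquivariantGaloisCoextension A k)
  {s : LeftRightSAYDStr k M} {ι : X →ₗ[ℂ] M ⊗[ℂ] T} (h : IsCotensor s.coact E.coact ι)
  {w : X ⊗[ℂ] B} (hw : w ∈ cotensor (E.cotensorBaseCoact h) b.βL)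

include hw in
/-- The rotation of `x ◁ e` is `m ⊗ (u ◁ e₂ ⊗ v ◁ e₁)`, where `m ⊗ (u ⊗ v)` is the rotation of
`x`. -/
theorem rotate_act : s.rotate E.toLeftComoduleCoalgebra (ι (linExt (E.cotensorAct h) w)) =
    sw w fun x e => sw (Δ e) fun e₁ e₂ => sw (s.rotate E.toLeftComoduleCoalgebra (ι x))
      fun m p => sw p fun u v =>
        m ⊗ₜ[ℂ] (linExt A.act (u ⊗ₜ e₂) ⊗ₜ[ℂ] linExt A.act (v ⊗ₜ e₁)) := by
  -- `T` is a module coalgebra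
  have e₁ := sw_congr_of_mem_withParam (E.assoc_ι_mem h hw)
    (F := fun m q => sw q fun t e => sw (Δ (linExt A.act (t ⊗ₜ e))) fun u v =>
      sw (E.coact v) fun g v => linExt s.act (g ⊗ₜ m) ⊗ₜ[ℂ] (v ⊗ₜ[ℂ] u))
    (G := fun m q => sw q fun t e => sw (Δ t) fun t₁ t₂ => sw (Δ e) fun e₁ e₂ =>
      sw (E.coact (linExt A.act (t₂ ⊗ₜ e₂))) fun g v =>
        linExt s.act (g ⊗ₜ m) ⊗ₜ[ℂ] (v ⊗ₜ[ℂ] linExt A.act (t₁ ⊗ₜ e₁)))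
    (fun m q hq => A.sw_comul_act hq (fun u v => sw (E.coact v) fun g v =>
      linExt s.act (g ⊗ₜ m) ⊗ₜ[ℂ] (v ⊗ₜ[ℂ] u)) (by fun_prop) (by fun_prop))
    (by fun_prop) (by fun_prop) (by fun_prop) (by fun_prop)
  -- the action of `B` on `T` is `K`-equivariant
  have e₂ := sw_congr_of_mem_withParam (E.assoc_ι_mem h hw)
    (F := fun m q => sw q fun t e => sw (Δ t) fun t₁ t₂ => sw (Δ e) fun e₁ e₂ =>
      sw (E.coact (linExt A.act (t₂ ⊗ₜ e₂))) fun g v =>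
        linExt s.act (g ⊗ₜ m) ⊗ₜ[ℂ] (v ⊗ₜ[ℂ] linExt A.act (t₁ ⊗ₜ e₁)))
    (G := fun m q => sw q fun t e => sw (Δ t) fun t₁ t₂ => sw (Δ e) fun e₁ e₂ =>
      sw (E.coact t₂) fun g v => linExt s.act (g ⊗ₜ m) ⊗ₜ[ℂ]
        (linExt A.act (v ⊗ₜ e₂) ⊗ₜ[ℂ] linExt A.act (t₁ ⊗ₜ e₁)))
    (fun m q hq => by
      have := sw_congr_of_mem_withParam (A.comul_comul_mem hq)
        (F := fun p q => sw q fun t e => sw (E.coact (linExt A.act (t ⊗ₜ e))) fun g v =>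
          linExt s.act (g ⊗ₜ m) ⊗ₜ[ℂ] (v ⊗ₜ[ℂ] linExt A.act p))
        (G := fun p q => sw q fun t e => sw (E.coact t) fun g v =>
          linExt s.act (g ⊗ₜ m) ⊗ₜ[ℂ] (linExt A.act (v ⊗ₜ e) ⊗ₜ[ℂ] linExt A.act p))
        (fun p q hq => E.sw_coact_act hq (fun g v =>
          linExt s.act (g ⊗ₜ m) ⊗ₜ[ℂ] (v ⊗ₜ[ℂ] linExt A.act p)) (by fun_prop) (by fun_prop))
        (by fun_prop) (by fun_prop) (by fun_prop) (by fun_prop)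
      simpa (disch := fun_prop) only [sw_sw, sw_apply] using this)
    (by fun_prop) (by fun_prop) (by fun_prop) (by fun_prop)
  conv_lhs => rw [← sw_tmul_self (s.rotate _ _)]
  rw [s.sw_rotate _ _ _ (by fun_prop) (by fun_prop), E.ι_cotensorAct h hw]
  simp (disch := fun_prop) only [s.sw_rotate, sw_sw, sw_apply] at e₁ e₂ ⊢
  rw [e₁, e₂]
  refine sw_congr _ fun x e => ?_
  simp only [sw_comm (Δ e)]

/-- The element `m ⊗ (t ⊗ ν⁺(e₂, x₋₁) e₁)`, with `m ⊗ t = x₀ ◁ ν⁻(e₂, x₋₁)`, lies in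
`M ⊗ (T □_C B)`. -/
theorem act_νInv_μ_mem (hw : w ∈ cotensor (E.cotensorBaseCoact h) b.βL) :
    (sw w fun x e => sw (Δ e) fun e₁ e₂ => sw (E.cotensorCoact h x) fun a y =>
      sw (b.νInv (e₂ ⊗ₜ a)) fun n p => sw (ι (linExt (E.cotensorAct h) (y ⊗ₜ n))) fun m t =>
        m ⊗ₜ[ℂ] (t ⊗ₜ[ℂ] linExt b.μ (p ⊗ₜ e₁))) ∈
      withParam M (cotensor A.baseCoact b.βL) := by
  have hm := E.assoc_ι_mem₃ h (RightModuleStr.act_νInv_mem (s := E.cotensorModule h)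
    (E.isLeftCoaction_cotensorCoact h) (E.cotensorBaseCoact_eq h)
    (E.cotensor_canonicalCoact_eq h) hw)
  have := sw_mem_of_mem_withParam (W := M ⊗[ℂ] (T ⊗[ℂ] B)) hm
    (q := withParam M (cotensor A.baseCoact b.βL))
    (F := fun m z => m ⊗ₜ[ℂ] sw z fun q f => sw q fun t e => t ⊗ₜ[ℂ] linExt b.μ (e ⊗ₜ f))
    (fun m z hz => tmul_mem_withParam (RightBicoalgebroid.sw_μ_mem hz) m)
    (by fun_prop) (by fun_prop)
  simp (disch := fun_prop) only [sw_sw, sw_apply, tmul_sw] at this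
  exact this

/-- The canonical map sends `m ⊗ (t ⊗ ν⁺(e₂, x₋₁) e₁)`, with `m ⊗ t = x₀ ◁ ν⁻(e₂, x₋₁)`, to the
rotation of `x ◁ e`. As `can` is injective, this is the anti-Yetter-Drinfeld condition. -/
theorem can_act_νInv_μ (hw : w ∈ cotensor (E.cotensorBaseCoact h) b.βL) :
    (sw w fun x e => sw (Δ e) fun e₁ e₂ => sw (E.cotensorCoact h x) fun a y =>
      sw (b.νInv (e₂ ⊗ₜ a)) fun n p => sw (ι (linExt (E.cotensorAct h) (y ⊗ₜ n))) fun m t =>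
        m ⊗ₜ[ℂ] A.can (t ⊗ₜ[ℂ] linExt b.μ (p ⊗ₜ e₁))) =
      s.rotate E.toLeftComoduleCoalgebra (ι (linExt (E.cotensorAct h) w)) := by
  have hρ := E.isLeftCoaction_cotensorCoact h
  have hβ := E.cotensorBaseCoact_eq h
  -- the factor `e₁` leaves the canonical map
  have e₁ := sw_congr_of_mem_withParam (E.assoc_ι_mem₃ h (RightModuleStr.act_νInv_mem
      (s := E.cotensorModule h) hρ hβ (E.cotensor_canonicalCoact_eq h) hw))
    (F := fun m z => m ⊗ₜ[ℂ] A.can (sw z fun q f => sw q fun t e =>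
      t ⊗ₜ[ℂ] linExt b.μ (e ⊗ₜ f)))
    (G := fun m z => m ⊗ₜ[ℂ] sw z fun q f => sw (A.can q) fun u v =>
      u ⊗ₜ[ℂ] linExt A.act (v ⊗ₜ f))
    (fun m z hz => congrArg _ (RightModuleCoalgebra.can_μ hz))
    (by fun_prop) (by fun_prop) (by fun_prop) (by fun_prop)
  -- the action on `M □_K T` is the action on `T`
  have e₂ := sw_congr_of_mem_withParam (RightModuleStr.coact_νInv_mem
      (s := E.cotensorModule h) hρ hβ hw)
    (F := fun f z => sw z fun q p => sw (ι (linExt (E.cotensorAct h) q)) fun m t =>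
      m ⊗ₜ[ℂ] sw (A.can (t ⊗ₜ p)) fun u v => u ⊗ₜ[ℂ] linExt A.act (v ⊗ₜ f))
    (G := fun f z => sw z fun q p => sw q fun x e => sw (ι x) fun m t =>
      m ⊗ₜ[ℂ] sw (A.can (linExt A.act (t ⊗ₜ e) ⊗ₜ p)) fun u v =>
        u ⊗ₜ[ℂ] linExt A.act (v ⊗ₜ f))
    (fun f z hz => by
      have := sw_congr_of_mem_withParam (mem_cotensor₃_iff.1 hz).1
        (F := fun p q => sw (ι (linExt (E.cotensorAct h) q)) fun m t =>
          m ⊗ₜ[ℂ] sw (A.can (t ⊗ₜ p)) fun u v => u ⊗ₜ[ℂ] linExt A.act (v ⊗ₜ f))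
        (G := fun p q => sw q fun x e => sw (ι x) fun m t =>
          m ⊗ₜ[ℂ] sw (A.can (linExt A.act (t ⊗ₜ e) ⊗ₜ p)) fun u v =>
            u ⊗ₜ[ℂ] linExt A.act (v ⊗ₜ f))
        (fun p q hq => by
          rw [E.ι_cotensorAct h hq]
          simp (disch := fun_prop) only [sw_sw, sw_apply])
        (by fun_prop) (by fun_prop) (by fun_prop) (by fun_prop)
      simp (disch := fun_prop) only [sw_sw, sw_apply] at this
      refine Eq.trans (sw_congr _ fun q p => ?_) this
      conv_lhs => rw [← sw_tmul_self q]
      simp (disch := fun_prop) only [map_sw, sw_sw])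
    (by fun_prop) (by fun_prop) (by fun_prop) (by fun_prop)
  -- `can` is expressed through the Galois map of `B`
  have e₃ := sw_congr_of_mem_withParam (RightModuleStr.coact_νInv_mem
      (s := E.cotensorModule h) hρ hβ hw)
    (F := fun f z => sw z fun q p => sw q fun x e => sw (ι x) fun m t =>
      m ⊗ₜ[ℂ] sw (A.can (linExt A.act (t ⊗ₜ e) ⊗ₜ p)) fun u v =>
        u ⊗ₜ[ℂ] linExt A.act (v ⊗ₜ f))
    (G := fun f z => sw z fun q p => sw q fun x e => sw (ι x) fun m t =>
      m ⊗ₜ[ℂ] sw (Δ t) fun t₁ t₂ => sw (b.galois (e ⊗ₜ p)) fun g h =>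
        linExt A.act (t₁ ⊗ₜ g) ⊗ₜ[ℂ] linExt A.act (linExt A.act (t₂ ⊗ₜ h) ⊗ₜ f))
    (fun f z hz => by
      have := sw_congr_of_mem_withParam (E.assoc_ι_mem₃ h hz)
        (F := fun m z => m ⊗ₜ[ℂ] sw (A.can (sw z fun q p => linExt A.act q ⊗ₜ[ℂ] p)) fun u v =>
          u ⊗ₜ[ℂ] linExt A.act (v ⊗ₜ f))
        (G := fun m z => m ⊗ₜ[ℂ] sw (sw z fun q p => sw q fun t e => sw (Δ t) fun t₁ t₂ =>
          sw (b.galois (e ⊗ₜ p)) fun g h =>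
            linExt A.act (t₁ ⊗ₜ g) ⊗ₜ[ℂ] linExt A.act (t₂ ⊗ₜ h)) fun u v =>
          u ⊗ₜ[ℂ] linExt A.act (v ⊗ₜ f))
        (fun m z hz => by rw [RightModuleCoalgebra.can_act hz])
        (by fun_prop) (by fun_prop) (by fun_prop) (by fun_prop)
      simpa (disch := fun_prop) only [sw_sw, sw_apply] using this)
    (by fun_prop) (by fun_prop) (by fun_prop) (by fun_prop)
  -- which cancels against `ν⁻¹`
  have e₄ := sw_congr_of_mem_withParam (RightModuleStr.comul_coact_mem_copCotensor
      (s := E.cotensorModule h) hρ hβ hw)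
    (F := fun z p => sw z fun x f => sw (ι x) fun m t => m ⊗ₜ[ℂ] sw (Δ t) fun t₁ t₂ =>
      sw (b.galois (b.νInv p)) fun g h =>
        linExt A.act (t₁ ⊗ₜ g) ⊗ₜ[ℂ] linExt A.act (linExt A.act (t₂ ⊗ₜ h) ⊗ₜ f))
    (G := fun z p => sw z fun x f => sw (ι x) fun m t => m ⊗ₜ[ℂ] sw (Δ t) fun t₁ t₂ =>
      sw p fun g h =>
        linExt A.act (t₁ ⊗ₜ g) ⊗ₜ[ℂ] linExt A.act (linExt A.act (t₂ ⊗ₜ h) ⊗ₜ f))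
    (fun z p hp => by rw [RightHopfCoalgebra.galois_νInv hp])
    (by fun_prop) (by fun_prop) (by fun_prop) (by fun_prop)
  rw [E.rotate_act h hw]
  simp (disch := fun_prop) only [sw_sw, sw_apply, tmul_sw, map_sw] at e₁ e₂ e₃ e₄ ⊢
  refine e₁.trans (e₂.trans (e₃.trans (Eq.trans ?_ (e₄.trans ?_))))
  · refine sw_congr _ fun x e => sw_congr _ fun e f => sw_congr _ fun a y => ?_
    refine (sw_comm _ _ _).trans (sw_congr _ fun m t => (sw_comm _ _ _).trans
      (sw_congr _ fun t₁ t₂ => Eq.symm ?_))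
    conv_lhs => rw [← sw_tmul_self (b.νInv (f ⊗ₜ a)), map_sw]
    exact sw_sw _ _ _ (by fun_prop) (by fun_prop)
  · refine sw_congr _ fun x e => sw_congr _ fun e f => ?_
    rw [E.sw_cotensorCoact h x (fun a z => sw z fun m t => sw (Δ t) fun t₁ t₂ => m ⊗ₜ[ℂ]
      (linExt A.act (t₁ ⊗ₜ f) ⊗ₜ[ℂ] linExt A.act (linExt A.act (t₂ ⊗ₜ a) ⊗ₜ e)))
      (by fun_prop) (by fun_prop)]
    simp (disch := fun_prop) only [sw_apply]
    refine sw_congr_of_mem_withParam (E.rotate_mem h x) (fun m p hp => ?_)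
      (by fun_prop) (by fun_prop) (by fun_prop) (by fun_prop)
    conv_rhs => rw [← E.can_canInv hp, A.can_eq_sw]
    simp (disch := fun_prop) only [sw_sw, sw_apply]

end EquivariantGaloisCoextension

end CotensorAntiYetterDrinfeld

/-! ### The SAYD module `M □_K T` -/

section CotensorSAYD

variable {C : Type u₁} {B : Type u₂} {T : Type u₃} {K : Type u₄} {M : Type v}
  [AddCommGroup C] [Module ℂ C] [Coalgebra ℂ C] [AddCommGroup B] [Module ℂ B] [Coalgebra ℂ B]
  [AddCommGroup T] [Module ℂ T] [Coalgebra ℂ T] [AddCommGroup K] [Module ℂ K] [Coalgebra ℂ K]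
  [AddCommGroup M] [Module ℂ M]
  {X : Type*} [AddCommGroup X] [Module ℂ X]

namespace EquivariantGaloisCoextension

variable {b : RightHopfCoalgebra C B} {A : RightModuleCoalgebra b.toRightBicoalgebroid T}
  {k : LeftHopfCoalgebra A.Orbit K} (E : EquivariantGaloisCoextension A k)

section

variable {s : LeftRightSAYDStr k M} {ι : X →ₗ[ℂ] M ⊗[ℂ] T} (h : IsCotensor s.coact E.coact ι)

theorem ι_cotensorAct_apply (w : cotensor (E.cotensorBaseCoact h) b.βL) :
    ι (E.cotensorAct h w) =
      sw (w : X ⊗[ℂ] B) fun x e => sw (ι x) fun m t => m ⊗ₜ[ℂ] linExt A.act (t ⊗ₜ e) := by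
  rw [← linExt_apply (E.cotensorAct h) w, E.ι_cotensorAct h w.2]

/-- The anti-Yetter-Drinfeld condition for `M □_K T`. -/
theorem cotensorCoact_act {w : X ⊗[ℂ] B} (hw : w ∈ cotensor (E.cotensorBaseCoact h) b.βL) :
    E.cotensorCoact h (linExt (E.cotensorAct h) w) =
      sw w fun x e => sw (Δ e) fun e₁ e₂ => sw (E.cotensorCoact h x) fun a y =>
        sw (b.νInv (e₂ ⊗ₜ a)) fun n p =>
          linExt b.μ (p ⊗ₜ e₁) ⊗ₜ[ℂ] linExt (E.cotensorAct h) (y ⊗ₜ n) := by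
  refine ext_tmul_of_injective h.injective ?_
  rw [E.sw_cotensorCoact h _ (fun e z => e ⊗ₜ[ℂ] z) (by fun_prop) (by fun_prop),
    ← E.can_act_νInv_μ h hw]
  have e₁ := sw_congr_of_mem_withParam (E.act_νInv_μ_mem h hw)
    (F := fun m q => sw (E.canInv (A.can q)) fun t e => e ⊗ₜ[ℂ] (m ⊗ₜ[ℂ] t))
    (G := fun m q => sw q fun t e => e ⊗ₜ[ℂ] (m ⊗ₜ[ℂ] t))
    (fun m q hq => by rw [E.canInv_can hq]) (by fun_prop) (by fun_prop) (by fun_prop)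
    (by fun_prop)
  simp (disch := fun_prop) only [sw_sw, sw_apply] at e₁ ⊢
  rw [e₁]
  refine sw_congr _ fun x e => sw_congr _ fun e f => sw_congr _ fun a y => sw_congr _ fun n p => ?_
  rw [← tmul_sw, sw_tmul_self]

/-- The right-left SAYD structure of `M □_K T`. -/
def cotensorSAYD : RightLeftSAYDStr b X where
  toRightModuleStr := E.cotensorModule h
  coact := E.cotensorCoact h
  isLeftCoaction_coact := E.isLeftCoaction_cotensorCoact h
  baseCoact_eq := E.cotensorBaseCoact_eq h
  canonicalCoact_eq := E.cotensor_canonicalCoact_eq h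
  ayd w := by
    have e₁ := E.cotensorCoact_act h w.2
    rw [linExt_apply (E.cotensorAct h) w] at e₁
    refine e₁.trans ?_
    simp (disch := fun_prop) only [map_eq_sw, rTensor_eq_sw, comm_eq_sw, tttComm_eq_sw,
      LinearMap.comp_apply, LinearEquiv.coe_coe, sw_sw, sw_apply]
    exact sw_congr _ fun x e => sw_comm _ _ _
  stable := E.cotensorCoact_stable h

end

variable (M : LeftRightSAYD.{u₃, u₄, v} k)

theorem tildeCoact_eq_sw (z : M.carrier ⊗[ℂ] T) : E.tildeCoact M z =
    sw (M.str.rotate E.toLeftComoduleCoalgebra z) fun m p => sw p fun u v => sw (Δ u)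
      fun u₁ u₂ => E.κ (u₂ ⊗ₜ v) ⊗ₜ[ℂ] (m ⊗ₜ[ℂ] u₁) := by
  rw [LeftRightSAYDStr.sw_rotate _ _ _ _ (by fun_prop) (by fun_prop)]
  simp (disch := fun_prop) only [tildeCoact, twist, rTensor_eq_sw, lTensor_eq_sw, comm_eq_sw,
    assoc_eq_sw, assoc_symm_eq_sw, LinearMap.comp_apply, LinearEquiv.coe_coe, sw_sw, sw_apply,
    sw_tmul, tmul_sw]

/-- The formula that defines the left `B`-coaction of `M □_K T` through `κ`. -/
theorem lTensor_cotensorCoact {ι : X →ₗ[ℂ] M.carrier ⊗[ℂ] T}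
    (h : IsCotensor M.str.coact E.coact ι) (x : X) :
    ι.lTensor B (E.cotensorCoact h x) = E.tildeCoact M (ι x) := by
  rw [lTensor_eq_sw, E.sw_cotensorCoact h x (fun e y => e ⊗ₜ[ℂ] y) (by fun_prop) (by fun_prop),
    tildeCoact_eq_sw]
  exact (sw_congr_of_mem_withParam (E.rotate_mem h x)
    (fun m p hp => E.sw_comul_κ hp (fun t e => e ⊗ₜ[ℂ] (m ⊗ₜ[ℂ] t)) (by fun_prop) (by fun_prop))
    (by fun_prop) (by fun_prop) (by fun_prop) (by fun_prop)).symm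

/-- The right-left SAYD module `M □_K T`. -/
def tildeStr : RightLeftSAYDStr b (E.tilde M) := E.cotensorSAYD IsCotensor.subtype

theorem rTensor_tildeStr_baseCoact (x : E.tilde M) :
    (E.tilde M).subtype.rTensor C ((E.tildeStr M).baseCoact x) =
      (TensorProduct.assoc ℂ M.carrier T C).symm
        (A.baseCoact.lTensor M.carrier (x : M.carrier ⊗[ℂ] T)) := by
  rw [rTensor_eq_sw]
  refine (E.sw_cotensorBaseCoact IsCotensor.subtype x (fun y c => y ⊗ₜ[ℂ] c) (by fun_prop)
    (by fun_prop)).trans ?_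
  simp (disch := fun_prop) only [lTensor_eq_sw, assoc_symm_eq_sw, sw_sw, sw_apply]
  rfl

theorem tildeStr_act (w : cotensor (E.tildeStr M).baseCoact b.βL) :
    ((E.tildeStr M).act w : M.carrier ⊗[ℂ] T) =
      (linExt A.act).lTensor M.carrier (TensorProduct.assoc ℂ M.carrier T B
        ((E.tilde M).subtype.rTensor B (w : E.tilde M ⊗[ℂ] B))) := by
  refine (E.ι_cotensorAct_apply IsCotensor.subtype w).trans ?_
  simp (disch := fun_prop) only [rTensor_eq_sw, lTensor_eq_sw, assoc_eq_sw, sw_sw, sw_apply]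

theorem lTensor_tildeStr_coact (x : E.tilde M) :
    (E.tilde M).subtype.lTensor B ((E.tildeStr M).coact x) =
      E.tildeCoact M (x : M.carrier ⊗[ℂ] T) :=
  E.lTensor_cotensorCoact M IsCotensor.subtype x

end EquivariantGaloisCoextension

end CotensorSAYD

/-! ### Functoriality -/

section Functoriality

variable {C : Type u₁} {B : Type u₂} {T : Type u₃} {K : Type u₄}
  [AddCommGroup C] [Module ℂ C] [Coalgebra ℂ C] [AddCommGroup B] [Module ℂ B] [Coalgebra ℂ B]
  [AddCommGroup T] [Module ℂ T] [Coalgebra ℂ T] [AddCommGroup K] [Module ℂ K] [Coalgebra ℂ K]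

namespace EquivariantGaloisCoextension

variable {b : RightHopfCoalgebra C B} {A : RightModuleCoalgebra b.toRightBicoalgebroid T}
  {k : LeftHopfCoalgebra A.Orbit K} (E : EquivariantGaloisCoextension A k)
  {M N : LeftRightSAYD.{u₃, u₄, v} k} (φ : LeftRightSAYD.Hom M N)

theorem rTensor_mem_tilde {z : M.carrier ⊗[ℂ] T} (hz : z ∈ E.tilde M) :
    φ.toLinearMap.rTensor T z ∈ E.tilde N := by
  rw [tilde, mem_cotensor_iff, rTensor_eq_sw]
  have := sw_cotensor hz (fun m g t => φ.toLinearMap m ⊗ₜ[ℂ] (g ⊗ₜ[ℂ] t)) (by fun_prop)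
    (by fun_prop) (by fun_prop)
  simpa (disch := fun_prop) only [sw_sw, sw_apply, φ.map_coact, rTensor_eq_sw] using this

/-- The rotation is natural, since a morphism of SAYD modules is `K`-linear. -/
theorem rotate_rTensor {z : M.carrier ⊗[ℂ] T} (hz : z ∈ E.tilde M) :
    N.str.rotate E.toLeftComoduleCoalgebra (φ.toLinearMap.rTensor T z) =
      φ.toLinearMap.rTensor (T ⊗[ℂ] T) (M.str.rotate E.toLeftComoduleCoalgebra z) := by
  have e₁ := sw_congr_of_mem_withParam (LeftRightSAYDStr.coact_comul_mem E.β_coact hz)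
    (F := fun p w => φ.toLinearMap (linExt M.str.act w) ⊗ₜ[ℂ] p)
    (G := fun p w => linExt N.str.act (φ.toLinearMap.lTensor K w) ⊗ₜ[ℂ] p)
    (fun p w hw => by rw [LeftRightSAYD.map_act_lTensor φ w hw])
    (by fun_prop) (by fun_prop) (by fun_prop) (by fun_prop)
  rw [rTensor_eq_sw, rTensor_eq_sw, LeftRightSAYDStr.sw_rotate _ _ _ _ (by fun_prop) (by fun_prop),
    ← sw_tmul_self (N.str.rotate _ _),
    LeftRightSAYDStr.sw_rotate _ _ _ _ (by fun_prop) (by fun_prop)]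
  simp (disch := fun_prop) only [sw_sw, sw_apply, LinearMap.lTensor_tmul] at e₁ ⊢
  exact e₁.symm

variable {X Y : Type*} [AddCommGroup X] [Module ℂ X] [AddCommGroup Y] [Module ℂ Y]
  {ι : X →ₗ[ℂ] M.carrier ⊗[ℂ] T} {ι' : Y →ₗ[ℂ] N.carrier ⊗[ℂ] T}
  (h : IsCotensor M.str.coact E.coact ι) (h' : IsCotensor N.str.coact E.coact ι')
  {f : X →ₗ[ℂ] Y} (hf : ∀ x, ι' (f x) = φ.toLinearMap.rTensor T (ι x))

include hf

theorem cotensorBaseCoact_map (x : X) :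
    E.cotensorBaseCoact h' (f x) = f.rTensor C (E.cotensorBaseCoact h x) := by
  refine ext_of_injective_tmul h'.injective ?_
  rw [E.sw_cotensorBaseCoact h' _ (fun y c => y ⊗ₜ[ℂ] c) (by fun_prop) (by fun_prop)]
  simp (disch := fun_prop) only [rTensor_eq_sw, sw_sw, sw_apply, hf]
  rw [E.sw_cotensorBaseCoact h x (fun y c => sw y (fun m t => φ.toLinearMap m ⊗ₜ[ℂ] t) ⊗ₜ[ℂ] c)
    (by fun_prop) (by fun_prop)]
  simp (disch := fun_prop) only [sw_apply]

theorem cotensorAct_map (w : cotensor (E.cotensorBaseCoact h) b.βL) :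
    f (E.cotensorAct h w) = linExt (E.cotensorAct h') (f.rTensor B (w : X ⊗[ℂ] B)) := by
  have hw' : f.rTensor B w ∈ cotensor (E.cotensorBaseCoact h') b.βL := by
    rw [mem_cotensor_iff, rTensor_eq_sw]
    have := sw_cotensor w.2 (fun x c e => f x ⊗ₜ[ℂ] (c ⊗ₜ[ℂ] e)) (by fun_prop)
      (by fun_prop) (by fun_prop)
    simpa (disch := fun_prop) only [sw_sw, sw_apply, E.cotensorBaseCoact_map φ h h' hf,
      rTensor_eq_sw] using this
  refine h'.injective ?_
  rw [hf, E.ι_cotensorAct_apply h w, E.ι_cotensorAct h' hw']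
  simp (disch := fun_prop) only [rTensor_eq_sw, sw_sw, sw_apply, hf]

theorem cotensorCoact_map (x : X) :
    E.cotensorCoact h' (f x) = f.lTensor B (E.cotensorCoact h x) := by
  refine ext_tmul_of_injective h'.injective ?_
  rw [E.sw_cotensorCoact h' _ (fun e y => e ⊗ₜ[ℂ] y) (by fun_prop) (by fun_prop), hf,
    E.rotate_rTensor φ (h.mem x)]
  simp (disch := fun_prop) only [rTensor_eq_sw, lTensor_eq_sw, sw_sw, sw_apply, hf]
  rw [E.sw_cotensorCoact h x (fun e y => e ⊗ₜ[ℂ] sw y (fun m t => φ.toLinearMap m ⊗ₜ[ℂ] t))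
    (by fun_prop) (by fun_prop)]
  simp (disch := fun_prop) only [sw_apply]

omit hf

/-- The morphism `φ □_K id : M □_K T → N □_K T`. -/
def tildeMap : RightLeftSAYD.Hom (RightLeftSAYD.mk (E.tilde M) (E.tildeStr M))
    (RightLeftSAYD.mk (E.tilde N) (E.tildeStr N)) where
  toLinearMap := (φ.toLinearMap.rTensor T).restrict fun _ hz => E.rTensor_mem_tilde φ hz
  map_baseCoact := E.cotensorBaseCoact_map φ IsCotensor.subtype IsCotensor.subtype fun _ => rfl
  map_act := E.cotensorAct_map φ IsCotensor.subtype IsCotensor.subtype fun _ => rfl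
  map_coact := E.cotensorCoact_map φ IsCotensor.subtype IsCotensor.subtype fun _ => rfl

/-- The functor `M ↦ M □_K T`. -/
def tildeFunctor : LeftRightSAYD.{u₃, u₄, v} k ⥤ RightLeftSAYD.{u₁, u₂, max v u₃} b where
  obj M := RightLeftSAYD.mk (E.tilde M) (E.tildeStr M)
  map φ := E.tildeMap φ
  map_id M := RightLeftSAYD.Hom.ext <| LinearMap.ext fun x => Subtype.ext <|
    LinearMap.congr_fun (LinearMap.rTensor_id T M.carrier) (x : M.carrier ⊗[ℂ] T)
  map_comp {M _ _} φ ψ := RightLeftSAYD.Hom.ext <| LinearMap.ext fun x : E.tilde M =>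
    Subtype.ext <| LinearMap.rTensor_comp_apply T ψ.toLinearMap φ.toLinearMap
      (x : M.carrier ⊗[ℂ] T)

end EquivariantGaloisCoextension

end Functoriality

end

theorem mainTheorem5 {C : Type u₁} {B : Type u₂} {T : Type u₃} {K : Type u₄}
    [AddCommGroup C] [Module ℂ C] [Coalgebra ℂ C] [AddCommGroup B] [Module ℂ B] [Coalgebra ℂ B]
    [AddCommGroup T] [Module ℂ T] [Coalgebra ℂ T] [AddCommGroup K] [Module ℂ K] [Coalgebra ℂ K]
    (b : RightHopfCoalgebra C B) (A : RightModuleCoalgebra b.toRightBicoalgebroid T)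
    (k : LeftHopfCoalgebra A.Orbit K) (E : EquivariantGaloisCoextension A k) :
    ∃ (str : ∀ M : LeftRightSAYD.{u₃, u₄, v} k, RightLeftSAYDStr b (E.tilde M))
      (map : ∀ {M N : LeftRightSAYD.{u₃, u₄, v} k} (_ : M ⟶ N),
        RightLeftSAYD.mk (E.tilde M) (str M) ⟶ RightLeftSAYD.mk (E.tilde N) (str N)),
      -- the right `C`-coaction `m ⊗ t ↦ (m ⊗ t₀) ⊗ t₁`
      (∀ M (x : E.tilde M), (E.tilde M).subtype.rTensor C ((str M).baseCoact x) =
        (TensorProduct.assoc ℂ M.carrier T C).symm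
          (A.baseCoact.lTensor M.carrier (x : M.carrier ⊗[ℂ] T))) ∧
      -- the right action `(m ⊗ t) ◁ b = m ⊗ t ◁ b`
      (∀ M (w : cotensor (str M).baseCoact b.βL), ((str M).act w : M.carrier ⊗[ℂ] T) =
        (linExt A.act).lTensor M.carrier (TensorProduct.assoc ℂ M.carrier T B
          ((E.tilde M).subtype.rTensor B (w : E.tilde M ⊗[ℂ] B)))) ∧
      -- the left `B`-coaction
      (∀ M (x : E.tilde M), (E.tilde M).subtype.lTensor B ((str M).coact x) =
        E.tildeCoact M (x : M.carrier ⊗[ℂ] T)) ∧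
      -- the map `φ □ id`
      (∀ (M N) (φ : M ⟶ N) (x : E.tilde M), ((map φ).toLinearMap x : N.carrier ⊗[ℂ] T) =
        φ.toLinearMap.rTensor T (x : M.carrier ⊗[ℂ] T)) ∧
      -- these data constitute a functor
      ∃ F : LeftRightSAYD.{u₃, u₄, v} k ⥤ RightLeftSAYD.{u₁, u₂, max v u₃} b,
        F.toPrefunctor = { obj := fun M => RightLeftSAYD.mk (E.tilde M) (str M), map := map } := by
  refine ⟨E.tildeStr, E.tildeMap, E.rTensor_tildeStr_baseCoact, E.tildeStr_act,
    E.lTensor_tildeStr_coact, fun M N φ x => rfl, E.tildeFunctor, rfl⟩
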